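/- **Setting.** Let $G$ be the group of homeomorphisms $f$ of $\mathbb R$ with $f-\mathrm{id},\,f^{-1}-\mathrm{id}\in W^{1,\infty}(\mathbb R)$ and $f_\xi-1\in L^2(\mathbb R)$ (relabeling functions). Let $\mathcal D$ be the set of triples $(u,\mu,\nu)$ with $u\in H^1(\mathbb R)$, $\mu,\nu$ finite positive measures, $\mu_{ac}=u_x^2\,dx$, $\mu=f\nu$ with $0\le f\le 1$ measurable. Let $\mathcal F$ be the set of $\Theta=(y,U,y_\xi,U_\xi,\bar h,h)$ with $y-\mathrm{id}\in L^\infty$; $U,\,y_\xi-1,\,U_\xi,\,h\in L^2\cap L^\infty$; $h\in L^1$; $y_\xi,\,h,\,\bar h\ge 0$, $\bar h\le h$, $y_\xi\bar h=U_\xi^2$ a.e.; $y(\xi)-\xi\to0$ as $\xi\to-\infty$; $1/(y_\xi+h)\in L^\infty$; $y+\int_{-\infty}^{\cdot}h\,d\eta\in G$. Let $L(u,\mu,\nu)=\Theta$ with $y(\xi)=\sup\{z:\nu((-\infty,z))+z<\xi\}$, $h=1-y_\xi$, $U=u\circ y$, $\bar h=(f\circ y)h$, and $M(\Theta)=(u,\mu,\nu)$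 with $u(y(\xi))=U(\xi)$, $\mu=y_\#(\bar h\,d\xi)$, $\nu=y_\#(h\,d\xi)$. An $\alpha$-dissipative solution in Lagrangian coordinates is a family $\Theta(t)\in\mathcal F$, $t\ge0$, such that $(y-\mathrm{id},U,y_\xi-1,U_\xi,h)$ is continuous in $t$ with values in $L^\infty\times[L^2\cap L^\infty]^4$ and, in integrated form, $$y_t=U,\quad U_t=-Q,\quad y_{\xi,t}=U_\xi,\quad U_{\xi,t}=\tfrac12\bar h+(U^2-P)y_\xi,\quad h_t=2(U^2-P)U_\xi,$$ $$P(\xi)=\tfrac14\int_{\mathbb R}e^{-|y(\xi)-y(\eta)|}(2U^2y_\xi+\bar h)(\eta)\,d\eta,\qquad Q(\xi)=-\tfrac14\int_{\mathbb R}\operatorname{sign}(\xi-\eta)e^{-|y(\xi)-y(\eta)|}(2U^2y_\xi+\bar h)(\eta)\,d\eta,$$ where for a.e. $\xi$ the difference $\bar h-h$ is constant in time between breaking times and right-continuous (indeed constant on a right neighbourhood of every time), and at each time $t>0$ of wave breaking, i.e. $y_\xi(t,\xi)=0$, one has $\bar h(t,\xi)=(1-\alpha)\bar h(t-,\xi)$.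 An $\alpha$-dissipative solution in Eulerian coordinates is a family $(u,\mu,\nu)(t)\in\mathcal D$, $t\ge 0$, of the form $M(\Theta(t))$ with such a $\Theta$ and $\Theta(0)=L((u,\mu,\nu)(0))$. **Statement.** Let $c_1>0>c_2$, $t_0>0$, $\alpha\in[0,1)$, $L=c_1-c_2$, and for $t<t_0$ $$p_1=\frac{c_1-c_2e^{L(t-t_0)}}{1-e^{L(t-t_0)}},\quad p_2=\frac{c_2-c_1e^{L(t-t_0)}}{1-e^{L(t-t_0)}},$$ $$q_1=\ln L+c_1(t-t_0)-\ln(c_1-c_2e^{L(t-t_0)}),\quad q_2=-\ln L+c_2(t-t_0)+\ln(c_1e^{L(t-t_0)}-c_2).$$ Put $d_{1,2}=\frac{c_1+c_2}2\pm\sqrt{\frac{(c_1+c_2)^2}4-(1-\alpha)c_1c_2}$, $\tilde L=d_1-d_2$, and for $t>t_0$ $$\tilde p_1=\frac{d_2-d_1e^{-\tilde L(t-t_0)}}{1-e^{-\tilde L(t-t_0)}},\quad \tilde p_2=\frac{d_1-d_2e^{-\tilde L(t-t_0)}}{1-e^{-\tilde L(t-t_0)}},$$ $$\tilde q_1=\ln\tilde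 L+d_2(t-t_0)-\ln(d_1e^{-\tilde L(t-t_0)}-d_2),\quad \tilde q_2=-\ln\tilde L+d_1(t-t_0)+\ln(d_1-d_2e^{-\tilde L(t-t_0)}).$$ Let $u_0(x)=p_1(0)e^{-|x-q_1(0)|}+p_2(0)e^{-|x-q_2(0)|}$. Then: 1. There is exactly one $\alpha$-dissipative solution (in Eulerian coordinates) with initial data $(u_0,u_{0,x}^2dx,u_{0,x}^2dx)$. For $0\le t<t_0$ it is $u=p_1e^{-|x-q_1|}+p_2e^{-|x-q_2|}$, $\mu=\nu=u_x^2dx$; at $t=t_0$ it is $u=(c_1+c_2)e^{-|x|}$, $\mu=u_x^2dx-4(1-\alpha)c_1c_2\delta_0$, $\nu=u_x^2dx-4c_1c_2\delta_0$; for $t>t_0$ it is $$u=\tilde p_1e^{-|x-\tilde q_1|}+\tilde p_2e^{-|x-\tilde q_2|},\qquad \mu=u_x^2\,dx,\qquad \nu=u_x^2\,dx+\mathbf 1_{[\tilde q_1,\tilde q_2]}\,\nu_m\,dx,$$ $$\nu_m=\frac{4\alpha(1-\alpha)c_1^2c_2^2(1-e^{-\tilde L(t-t_0)})^2e^x}{\Big(e^{x-d_1(t-t_0)}(\tilde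 L+d_2e^{d_1(t-t_0)}-d_1e^{d_2(t-t_0)})-(d_1-d_2e^{-\tilde L(t-t_0)}-\tilde Le^{d_2(t-t_0)})\Big)^{2}}.$$ 2. $d_1>0>d_2$, $d_1+d_2=c_1+c_2$, and $\tilde q_1(t)<\tilde q_2(t)$ for $t>t_0$. The energy $\int_{\mathbb R}(u^2+u_x^2)\,dx$ is $E^2=2c_1^2+2c_2^2$ for $t<t_0$ and $2d_1^2+2d_2^2=E^2+4\alpha c_1c_2$ for $t>t_0$. For $t>t_0$, away from $\tilde q_1,\tilde q_2$, $u$ is differentiable and $u_x^2$ equals $(\tilde p_1e^{-\tilde q_1}+\tilde p_2e^{-\tilde q_2})^2e^{2x}$ for $x<\tilde q_1$, $(\tilde p_2e^{x-\tilde q_2}-\tilde p_1e^{\tilde q_1-x})^2$ for $\tilde q_1<x<\tilde q_2$, and $(\tilde p_1e^{\tilde q_1}+\tilde p_2e^{\tilde q_2})^2e^{-2x}$ for $x>\tilde q_2$. Moreover $\nu_m\ge0$ on $[\tilde q_1,\tilde q_2]$ and $\int_{\tilde q_1}^{\tilde q_2}\nu_m\,dx=-4\alpha c_1c_2$. 3.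 There is an $\alpha$-dissipative solution $\Theta$ in Lagrangian coordinates with $y(0,\xi)=\xi$ and $M(\Theta(0))=(u_0,u_{0,x}^2dx,u_{0,x}^2dx)$, and every such $\Theta$ has the following properties. $M(\Theta(t))$ is the triple of item 1 for all $t\ge0$. For a.e. $\xi$ and all $t\ge 0$, $y_\xi(t,\xi)=0$ if and only if $t=t_0$ and $\xi\in[q_1(0),q_2(0)]$; and $y(t_0,\xi)=0$ if and only if $\xi\in[q_1(0),q_2(0)]$. The function $\xi\mapsto y(t_0,\xi)+\int_{-\infty}^\xi\bar h(t_0,\eta)\,d\eta$ belongs to $G$. For $t>t_0$, writing $T=t-t_0$, $$C=c_2-c_1e^{-Lt_0}+Le^{\xi+c_2t_0},\qquad D=L^2e^{-c_1t_0}-Lc_1e^\xi+Lc_2e^{\xi-Lt_0},$$ $$S=\frac{2c_1c_2L(1-e^{-Lt_0})^2-(c_1-c_2e^{-Lt_0}+Le^{c_2t_0})(LC+D)}{(-c_1+c_2e^{-Lt_0}+Le^{c_2t_0})(LC+D)},\qquad S'=-2c_1c_2\frac{L^2(1-e^{-Lt_0})^2e^\xi}{(LC+D)^2},$$ $$N_l=L\tilde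 L+\big(\tilde L(-c_1e^{c_1t_0}+c_2e^{c_2t_0})+L(d_1e^{-d_1T}-d_2e^{-d_2T})\big)e^{\xi},$$ $$N_r=L\tilde L+\big(\tilde L(-c_1e^{-c_1t_0}+c_2e^{-c_2t_0})+L(d_1e^{d_1T}-d_2e^{d_2T})\big)e^{-\xi},$$ $$A=\tilde L(S+1)+(d_2e^{d_1T}-d_1e^{d_2T})(S-1),\qquad B=(d_1-d_2e^{-\tilde LT})(S+1)-\tilde Le^{d_2T}(S-1),$$ one has (for all $\xi$ in the range for $y,U$, and for a.e. such $\xi$ for $y_\xi,\bar h,h$): * for $\xi<q_1(0)$: $y=\xi+\ln(L\tilde L)-\ln N_l$, $\;y_\xi=L\tilde L/N_l$, $\;U=(d_1^2e^{-d_1T}-d_2^2e^{-d_2T})Le^\xi/N_l$, $\;\bar h=h=(d_1^2e^{-d_1T}-d_2^2e^{-d_2T})^2L^3\tilde Le^{2\xi}/N_l^3$; * for $\xi>q_2(0)$: $y=\xi-\ln(L\tilde L)+\ln N_r$, $\;y_\xi=L\tilde L/N_r$, $\;U=(d_1^2e^{d_1T}-d_2^2e^{d_2T})Le^{-\xi}/N_r$,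 $\;\bar h=h=(d_1^2e^{d_1T}-d_2^2e^{d_2T})^2L^3\tilde Le^{-2\xi}/N_r^3$; * for $q_1(0)<\xi<q_2(0)$: $y=\ln(e^{d_1T}B/A)$, $\;y_\xi=-2d_1d_2e^{d_1T}(1-e^{-\tilde LT})^2S'/(AB)$, $$U=\frac{\tilde L}{AB}\Big((d_1^2-d_2^2e^{-\tilde LT})(S+1)^2-2(d_1^2-d_2^2)e^{d_2T}(S^2-1)+e^{d_2T}(d_1^2e^{d_2T}-d_2^2e^{d_1T})(S-1)^2\Big),$$ $$\bar h=U^2y_\xi-4\tilde p_1\tilde p_2e^{\tilde q_1-\tilde q_2}y_\xi,\qquad h=\bar h-2\alpha c_1c_2S'.$$ -/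

import Mathlib

open MeasureTheory Filter Topology Set
open scoped ENNReal

noncomputable section

namespace CamassaHolm

/-! ### Function spaces on the line -/

/-- `f` is locally absolutely continuous with (weak) derivative `g`. -/
def IsWeakDeriv (f g : ℝ → ℝ) : Prop :=
  LocallyIntegrable g volume ∧ ∀ a b : ℝ, f b - f a = ∫ x in a..b, g x

/-- The continuous function `f` belongs to `W^{1,∞}(ℝ)`. -/
def MemW1Inf (f : ℝ → ℝ) : Prop :=
  MemLp f ∞ volume ∧ ∃ g : ℝ → ℝ, IsWeakDeriv f g ∧ MemLp g ∞ volume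

/-- The group `G` of relabeling functions: homeomorphisms `f` of the line such that `f - id` and
`f⁻¹ - id` belong to `W^{1,∞}` and `f_ξ - 1` belongs to `L²`. -/
def relabelingGroup : Set (ℝ → ℝ) :=
  {f | ∃ e : ℝ ≃ₜ ℝ, (⇑e = f) ∧
    MemW1Inf (fun ξ => e ξ - ξ) ∧ MemW1Inf (fun ξ => e.symm ξ - ξ) ∧
    ∃ g : ℝ → ℝ, IsWeakDeriv f g ∧ MemLp (fun ξ => g ξ - 1) 2 volume}

/-! ### Eulerian and Lagrangian coordinates -/

/-- A triple `(u, μ, ν)`. -/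
@[ext] structure EulerianState where
  u : ℝ → ℝ
  μ : Measure ℝ
  ν : Measure ℝ

/-- Membership in the set `𝒟` of Eulerian coordinates: `u ∈ H¹`, `μ` is a finite measure with
absolutely continuous part `u_x² dx`, and `ν` is a finite measure with `μ = f ν`, `0 ≤ f ≤ 1`. -/
structure EulerianState.MemD (D : EulerianState) : Prop where
  finite_μ : IsFiniteMeasure D.μ
  finite_ν : IsFiniteMeasure D.ν
  exists_deriv : ∃ ux : ℝ → ℝ, IsWeakDeriv D.u ux ∧ MemLp D.u 2 volume ∧ MemLp ux 2 volume ∧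
    ∃ μs : Measure ℝ, μs ⟂ₘ volume ∧
      D.μ = volume.withDensity (fun x => ENNReal.ofReal (ux x ^ 2)) + μs
  exists_density : ∃ f : ℝ → ℝ, Measurable f ∧ (∀ x, 0 ≤ f x ∧ f x ≤ 1) ∧
    D.μ = D.ν.withDensity (fun x => ENNReal.ofReal (f x))

/-- A tuple `(y, U, y_ξ, U_ξ, h̄, h)`. -/
structure LagrangianState where
  y : ℝ → ℝ
  U : ℝ → ℝ
  yξ : ℝ → ℝ
  Uξ : ℝ → ℝ
  hbar : ℝ → ℝ
  h : ℝ → ℝ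

/-- Membership in the set `ℱ` of Lagrangian coordinates. -/
structure LagrangianState.MemF (Θ : LagrangianState) : Prop where
  deriv_y : IsWeakDeriv Θ.y Θ.yξ
  deriv_U : IsWeakDeriv Θ.U Θ.Uξ
  ζ_bdd : MemLp (fun ξ => Θ.y ξ - ξ) ∞ volume
  U_two : MemLp Θ.U 2 volume
  U_bdd : MemLp Θ.U ∞ volume
  ζξ_two : MemLp (fun ξ => Θ.yξ ξ - 1) 2 volume
  ζξ_bdd : MemLp (fun ξ => Θ.yξ ξ - 1) ∞ volume
  Uξ_two : MemLp Θ.Uξ 2 volume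
  Uξ_bdd : MemLp Θ.Uξ ∞ volume
  h_two : MemLp Θ.h 2 volume
  h_bdd : MemLp Θ.h ∞ volume
  h_int : Integrable Θ.h volume
  hbar_meas : AEStronglyMeasurable Θ.hbar volume
  yξ_nonneg : ∀ᵐ ξ, 0 ≤ Θ.yξ ξ
  h_nonneg : ∀ᵐ ξ, 0 ≤ Θ.h ξ
  hbar_nonneg : ∀ᵐ ξ, 0 ≤ Θ.hbar ξ
  ζ_lim : Tendsto (fun ξ => Θ.y ξ - ξ) atBot (𝓝 0)
  -- the function `1 / (y_ξ + h)` is essentially bounded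
  lower : ∃ c : ℝ, 0 < c ∧ ∀ᵐ ξ, c ≤ Θ.yξ ξ + Θ.h ξ
  energy_rel : ∀ᵐ ξ, Θ.yξ ξ * Θ.hbar ξ = Θ.Uξ ξ ^ 2
  hbar_le : ∀ᵐ ξ, Θ.hbar ξ ≤ Θ.h ξ
  relabel : (fun ξ => Θ.y ξ + ∫ η in Iic ξ, Θ.h η) ∈ relabelingGroup

/-- The relation `(u, μ, ν) = M(Θ)`: `u(y(ξ)) = U(ξ)`, `μ = y_#(h̄ dξ)`, `ν = y_#(h dξ)`. -/
structure IsEulerianImage (Θ : LagrangianState) (D : EulerianState) : Prop where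
  u_eq : ∀ ξ, D.u (Θ.y ξ) = Θ.U ξ
  μ_eq : D.μ = (volume.withDensity (fun ξ => ENNReal.ofReal (Θ.hbar ξ))).map Θ.y
  ν_eq : D.ν = (volume.withDensity (fun ξ => ENNReal.ofReal (Θ.h ξ))).map Θ.y

/-- The relation `Θ = L(u, μ, ν)`: `y(ξ) = sup {z | ν((-∞,z)) + z < ξ}`, `h = 1 - y_ξ`,
`U = u ∘ y`, `h̄ = (f ∘ y) h` where `μ = f ν`. -/
structure IsLagrangianLift (D : EulerianState) (Θ : LagrangianState) : Prop where
  y_eq : ∀ ξ, Θ.y ξ = sSup {z : ℝ | (D.ν (Iio z)).toReal + z < ξ}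
  deriv_y : IsWeakDeriv Θ.y Θ.yξ
  h_eq : ∀ᵐ ξ, Θ.h ξ = 1 - Θ.yξ ξ
  U_eq : ∀ ξ, Θ.U ξ = D.u (Θ.y ξ)
  deriv_U : IsWeakDeriv Θ.U Θ.Uξ
  hbar_eq : ∃ f : ℝ → ℝ, Measurable f ∧ (∀ x, 0 ≤ f x ∧ f x ≤ 1) ∧
    D.μ = D.ν.withDensity (fun x => ENNReal.ofReal (f x)) ∧
    ∀ᵐ ξ, Θ.hbar ξ = f (Θ.y ξ) * Θ.h ξ

/-! ### The `α`-dissipative evolution -/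

/-- `P(ξ) = 1/4 ∫ e^{-|y(ξ)-y(η)|} (2 U² y_ξ + h̄)(η) dη`. -/
def LagrangianState.P (Θ : LagrangianState) (ξ : ℝ) : ℝ :=
  1 / 4 * ∫ η, Real.exp (-|Θ.y ξ - Θ.y η|) * (2 * Θ.U η ^ 2 * Θ.yξ η + Θ.hbar η)

/-- `Q(ξ) = -1/4 ∫ sign(ξ-η) e^{-|y(ξ)-y(η)|} (2 U² y_ξ + h̄)(η) dη`. -/
def LagrangianState.Q (Θ : LagrangianState) (ξ : ℝ) : ℝ :=
  -(1 / 4) * ∫ η, Real.sign (ξ - η) * Real.exp (-|Θ.y ξ - Θ.y η|) *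
    (2 * Θ.U η ^ 2 * Θ.yξ η + Θ.hbar η)

/-- The distance of two Lagrangian states in the norm of the Banach space
`L^∞ × [L² ∩ L^∞]⁴` of the variables `(ζ, U, ζ_ξ, U_ξ, h)`. -/
def lagrangianDist (Θ Θ' : LagrangianState) : ℝ≥0∞ :=
  eLpNorm (fun ξ => Θ.y ξ - Θ'.y ξ) ∞ volume
  + eLpNorm (fun ξ => Θ.U ξ - Θ'.U ξ) 2 volume + eLpNorm (fun ξ => Θ.U ξ - Θ'.U ξ) ∞ volume
  + eLpNorm (fun ξ => Θ.yξ ξ - Θ'.yξ ξ) 2 volume + eLpNorm (fun ξ => Θ.yξ ξ - Θ'.yξ ξ) ∞ volume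
  + eLpNorm (fun ξ => Θ.Uξ ξ - Θ'.Uξ ξ) 2 volume + eLpNorm (fun ξ => Θ.Uξ ξ - Θ'.Uξ ξ) ∞ volume
  + eLpNorm (fun ξ => Θ.h ξ - Θ'.h ξ) 2 volume + eLpNorm (fun ξ => Θ.h ξ - Θ'.h ξ) ∞ volume

/-- `f(t) = f(0) + ∫_0^t g(s) ds` for all `t ≥ 0`, the integrated form of `f_t = g`. -/
def Evolves (f g : ℝ → ℝ) : Prop :=
  ∀ t : ℝ, 0 ≤ t → IntervalIntegrable g volume 0 t ∧ f t = f 0 + ∫ s in (0 : ℝ)..t, g s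

/-- The energy rule along one characteristic. As long as `y_ξ ≠ 0` one has `h̄_t = h_t`, that is,
`h̄ - h` is locally constant in time; at a time `t > 0` of wave breaking, `y_ξ(t) = 0`, the
fraction `α` of the energy is taken out of `h̄`: `h̄(t) = (1 - α) h̄(t-)`. -/
def AlphaEnergyRule (α : ℝ) (yξ h hbar : ℝ → ℝ) : Prop :=
  ∀ t : ℝ, 0 ≤ t →
    (∀ᶠ s in 𝓝[>] t, hbar s - h s = hbar t - h t) ∧
    (0 < t → yξ t ≠ 0 → ∀ᶠ s in 𝓝[<] t, hbar s - h s = hbar t - h t) ∧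
    (0 < t → yξ t = 0 → ∃ l : ℝ, Tendsto hbar (𝓝[<] t) (𝓝 l) ∧ hbar t = (1 - α) * l)

/-- A global (`t ≥ 0`) `α`-dissipative solution in Lagrangian coordinates. -/
structure IsAlphaDissipativeLagrangian (α : ℝ) (Θ : ℝ → LagrangianState) : Prop where
  memF : ∀ t, 0 ≤ t → (Θ t).MemF
  cont : ∀ t, 0 ≤ t → Tendsto (fun s => lagrangianDist (Θ s) (Θ t)) (𝓝[Ici 0] t) (𝓝 0)
  eq_y : ∀ ξ, Evolves (fun t => (Θ t).y ξ) (fun t => (Θ t).U ξ)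
  eq_U : ∀ ξ, Evolves (fun t => (Θ t).U ξ) (fun t => -(Θ t).Q ξ)
  eq_yξ : ∀ᵐ ξ, Evolves (fun t => (Θ t).yξ ξ) (fun t => (Θ t).Uξ ξ)
  eq_Uξ : ∀ᵐ ξ, Evolves (fun t => (Θ t).Uξ ξ)
    (fun t => 1 / 2 * (Θ t).hbar ξ + ((Θ t).U ξ ^ 2 - (Θ t).P ξ) * (Θ t).yξ ξ)
  eq_h : ∀ᵐ ξ, Evolves (fun t => (Θ t).h ξ)
    (fun t => 2 * ((Θ t).U ξ ^ 2 - (Θ t).P ξ) * (Θ t).Uξ ξ)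
  energy : ∀ᵐ ξ, AlphaEnergyRule α (fun t => (Θ t).yξ ξ) (fun t => (Θ t).h ξ)
    (fun t => (Θ t).hbar ξ)

/-- `D` is the Eulerian `α`-dissipative solution starting from `D 0`: one passes to Lagrangian
coordinates by `L`, evolves there, and returns by `M`. -/
def IsAlphaDissipativeSolution (α : ℝ) (D : ℝ → EulerianState) : Prop :=
  ∃ Θ : ℝ → LagrangianState, IsAlphaDissipativeLagrangian α Θ ∧ IsLagrangianLift (D 0) (Θ 0) ∧
    ∀ t, 0 ≤ t → (D t).MemD ∧ IsEulerianImage (Θ t) (D t)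

/-! ### The peakon-antipeakon before breaking -/

section before

variable (c₁ c₂ t₀ t : ℝ)

def p₁ : ℝ := (c₁ - c₂ * Real.exp ((c₁ - c₂) * (t - t₀))) / (1 - Real.exp ((c₁ - c₂) * (t - t₀)))

def p₂ : ℝ := (c₂ - c₁ * Real.exp ((c₁ - c₂) * (t - t₀))) / (1 - Real.exp ((c₁ - c₂) * (t - t₀)))

def q₁ : ℝ :=
  Real.log (c₁ - c₂) + c₁ * (t - t₀) - Real.log (c₁ - c₂ * Real.exp ((c₁ - c₂) * (t - t₀)))

def q₂ : ℝ :=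
  -Real.log (c₁ - c₂) + c₂ * (t - t₀) + Real.log (c₁ * Real.exp ((c₁ - c₂) * (t - t₀)) - c₂)

end before

/-! ### The peakon-antipeakon after breaking -/

/-- `d₁` as a function of `c₁, c₂, α`. -/
def d₁ (c₁ c₂ α : ℝ) : ℝ :=
  1 / 2 * (c₁ + c₂) + Real.sqrt (1 / 4 * (c₁ + c₂) ^ 2 - (1 - α) * c₁ * c₂)

/-- `d₂` as a function of `c₁, c₂, α`. -/
def d₂ (c₁ c₂ α : ℝ) : ℝ :=
  1 / 2 * (c₁ + c₂) - Real.sqrt (1 / 4 * (c₁ + c₂) ^ 2 - (1 - α) * c₁ * c₂)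

/-! The functions `p̃_j(t)`, `q̃_j(t)` in terms of `d₁ = a`, `d₂ = b` and `t₀`. -/
section after

variable (a b t₀ t : ℝ)

def pt₁ : ℝ := (b - a * Real.exp (-(a - b) * (t - t₀))) / (1 - Real.exp (-(a - b) * (t - t₀)))

def pt₂ : ℝ := (a - b * Real.exp (-(a - b) * (t - t₀))) / (1 - Real.exp (-(a - b) * (t - t₀)))

def qt₁ : ℝ :=
  Real.log (a - b) + b * (t - t₀) - Real.log (a * Real.exp (-(a - b) * (t - t₀)) - b)

def qt₂ : ℝ :=
  -Real.log (a - b) + a * (t - t₀) + Real.log (a - b * Real.exp (-(a - b) * (t - t₀)))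

end after

/-- `P₁ e^{-|x-Q₁|} + P₂ e^{-|x-Q₂|}`. -/
def twoPeakon (P₁ P₂ Q₁ Q₂ x : ℝ) : ℝ :=
  P₁ * Real.exp (-|x - Q₁|) + P₂ * Real.exp (-|x - Q₂|)

/-- The piecewise formula for the square of the slope of `twoPeakon`. -/
def twoPeakonSlopeSq (P₁ P₂ Q₁ Q₂ x : ℝ) : ℝ :=
  if x < Q₁ then (P₁ * Real.exp (-Q₁) + P₂ * Real.exp (-Q₂)) ^ 2 * Real.exp (2 * x)
  else if x < Q₂ then (P₂ * Real.exp (x - Q₂) - P₁ * Real.exp (Q₁ - x)) ^ 2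
  else (P₁ * Real.exp Q₁ + P₂ * Real.exp Q₂) ^ 2 * Real.exp (-2 * x)

/-- The function `u(t, ·)` of the continued solution. -/
def uSol (c₁ c₂ t₀ α t : ℝ) : ℝ → ℝ :=
  if t < t₀ then twoPeakon (p₁ c₁ c₂ t₀ t) (p₂ c₁ c₂ t₀ t) (q₁ c₁ c₂ t₀ t) (q₂ c₁ c₂ t₀ t)
  else if t = t₀ then fun x => (c₁ + c₂) * Real.exp (-|x|)
  else twoPeakon (pt₁ (d₁ c₁ c₂ α) (d₂ c₁ c₂ α) t₀ t) (pt₂ (d₁ c₁ c₂ α) (d₂ c₁ c₂ α) t₀ t)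
    (qt₁ (d₁ c₁ c₂ α) (d₂ c₁ c₂ α) t₀ t) (qt₂ (d₁ c₁ c₂ α) (d₂ c₁ c₂ α) t₀ t)

/-- The density `ν_m(t, ·)`, with `d₁ = a`, `d₂ = b`. -/
def nuMDensity (c₁ c₂ α a b t₀ t x : ℝ) : ℝ :=
  4 * α * (1 - α) * c₁ ^ 2 * c₂ ^ 2 * (1 - Real.exp (-(a - b) * (t - t₀))) ^ 2 * Real.exp x *
    ((Real.exp (x - a * (t - t₀)) *
        ((a - b) + b * Real.exp (a * (t - t₀)) - a * Real.exp (b * (t - t₀)))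
      - (a - b * Real.exp (-(a - b) * (t - t₀)) - (a - b) * Real.exp (b * (t - t₀)))) ^ 2)⁻¹

/-- The measure `v_x² dx` for a function `v` differentiable almost everywhere. -/
def slopeSqMeasure (v : ℝ → ℝ) : Measure ℝ :=
  volume.withDensity (fun x => ENNReal.ofReal (deriv v x ^ 2))

/-- The interval `[q̃₁(t), q̃₂(t)]`. -/
def midInterval (c₁ c₂ t₀ α t : ℝ) : Set ℝ :=
  Icc (qt₁ (d₁ c₁ c₂ α) (d₂ c₁ c₂ α) t₀ t) (qt₂ (d₁ c₁ c₂ α) (d₂ c₁ c₂ α) t₀ t)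

/-- The explicit triple `(u(t), μ(t), ν(t))`. -/
def explicitSolution (c₁ c₂ t₀ α t : ℝ) : EulerianState where
  u := uSol c₁ c₂ t₀ α t
  μ := slopeSqMeasure (uSol c₁ c₂ t₀ α t) +
    if t = t₀ then ENNReal.ofReal (-4 * (1 - α) * c₁ * c₂) • Measure.dirac 0 else 0
  ν := slopeSqMeasure (uSol c₁ c₂ t₀ α t) +
    if t < t₀ then 0
    else if t = t₀ then ENNReal.ofReal (-4 * c₁ * c₂) • Measure.dirac 0
    else (volume.restrict (midInterval c₁ c₂ t₀ α t)).withDensity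
      (fun x => ENNReal.ofReal (nuMDensity c₁ c₂ α (d₁ c₁ c₂ α) (d₂ c₁ c₂ α) t₀ t x))

/-- The peakon-antipeakon initial data `(u₀, u₀ₓ² dx, u₀ₓ² dx)`. -/
def initialData (c₁ c₂ t₀ : ℝ) : EulerianState :=
  let u₀ := twoPeakon (p₁ c₁ c₂ t₀ 0) (p₂ c₁ c₂ t₀ 0) (q₁ c₁ c₂ t₀ 0) (q₂ c₁ c₂ t₀ 0)
  ⟨u₀, slopeSqMeasure u₀, slopeSqMeasure u₀⟩

/-! ### The explicit Lagrangian formulas after breaking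

Here `a = d₁`, `b = d₂`. -/

section lagrangianFormulas

variable (c₁ c₂ t₀ : ℝ)

def Cfun (ξ : ℝ) : ℝ :=
  c₂ - c₁ * Real.exp (-(c₁ - c₂) * t₀) + (c₁ - c₂) * Real.exp (ξ + c₂ * t₀)

def Dfun (ξ : ℝ) : ℝ :=
  (c₁ - c₂) ^ 2 * Real.exp (-c₁ * t₀) - (c₁ - c₂) * c₁ * Real.exp ξ
    + (c₁ - c₂) * c₂ * Real.exp (ξ - (c₁ - c₂) * t₀)

def Sfun (ξ : ℝ) : ℝ :=
  (2 * c₁ * c₂ * (c₁ - c₂) * (1 - Real.exp (-(c₁ - c₂) * t₀)) ^ 2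
    - (c₁ - c₂ * Real.exp (-(c₁ - c₂) * t₀) + (c₁ - c₂) * Real.exp (c₂ * t₀))
      * ((c₁ - c₂) * Cfun c₁ c₂ t₀ ξ + Dfun c₁ c₂ t₀ ξ)) /
  ((-c₁ + c₂ * Real.exp (-(c₁ - c₂) * t₀) + (c₁ - c₂) * Real.exp (c₂ * t₀))
      * ((c₁ - c₂) * Cfun c₁ c₂ t₀ ξ + Dfun c₁ c₂ t₀ ξ))

/-- The derivative of `S`. -/
def dSfun (ξ : ℝ) : ℝ :=
  -2 * c₁ * c₂ * ((c₁ - c₂) ^ 2 * (1 - Real.exp (-(c₁ - c₂) * t₀)) ^ 2 * Real.exp ξ) /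
    ((c₁ - c₂) * Cfun c₁ c₂ t₀ ξ + Dfun c₁ c₂ t₀ ξ) ^ 2

variable (a b t ξ : ℝ)

/-- The common denominator for `ξ < q₁(0)`. -/
def denL : ℝ :=
  (c₁ - c₂) * (a - b) + ((a - b) * (-c₁ * Real.exp (c₁ * t₀) + c₂ * Real.exp (c₂ * t₀))
    + (c₁ - c₂) * (a * Real.exp (-a * (t - t₀)) - b * Real.exp (-b * (t - t₀)))) * Real.exp ξ

/-- The common denominator for `q₂(0) < ξ`. -/
def denR : ℝ :=
  (c₁ - c₂) * (a - b) + ((a - b) * (-c₁ * Real.exp (-c₁ * t₀) + c₂ * Real.exp (-c₂ * t₀))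
    + (c₁ - c₂) * (a * Real.exp (a * (t - t₀)) - b * Real.exp (b * (t - t₀)))) * Real.exp (-ξ)

/-- The first factor of the denominators for `q₁(0) < ξ < q₂(0)`. -/
def denM₁ : ℝ :=
  (a - b) * (Sfun c₁ c₂ t₀ ξ + 1)
    + (b * Real.exp (a * (t - t₀)) - a * Real.exp (b * (t - t₀))) * (Sfun c₁ c₂ t₀ ξ - 1)

/-- The second factor of the denominators for `q₁(0) < ξ < q₂(0)`. -/
def denM₂ : ℝ :=
  (a - b * Real.exp (-(a - b) * (t - t₀))) * (Sfun c₁ c₂ t₀ ξ + 1)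
    - (a - b) * Real.exp (b * (t - t₀)) * (Sfun c₁ c₂ t₀ ξ - 1)

def yL : ℝ := ξ + Real.log ((c₁ - c₂) * (a - b)) - Real.log (denL c₁ c₂ t₀ a b t ξ)

def yM : ℝ :=
  Real.log (-Real.exp (a * (t - t₀)) *
    (((a - b) * Real.exp (b * (t - t₀)) * (Sfun c₁ c₂ t₀ ξ - 1)
      + (-a + b * Real.exp (-(a - b) * (t - t₀))) * (Sfun c₁ c₂ t₀ ξ + 1))
      / denM₁ c₁ c₂ t₀ a b t ξ))

def yR : ℝ := ξ - Real.log ((c₁ - c₂) * (a - b)) + Real.log (denR c₁ c₂ t₀ a b t ξ)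

def yξL : ℝ := (c₁ - c₂) * (a - b) / denL c₁ c₂ t₀ a b t ξ

def yξM : ℝ :=
  -2 * a * b * Real.exp (a * (t - t₀)) * (1 - Real.exp (-(a - b) * (t - t₀))) ^ 2
    * dSfun c₁ c₂ t₀ ξ / (denM₁ c₁ c₂ t₀ a b t ξ * denM₂ c₁ c₂ t₀ a b t ξ)

def yξR : ℝ := (c₁ - c₂) * (a - b) / denR c₁ c₂ t₀ a b t ξ

def UL : ℝ :=
  (a ^ 2 * Real.exp (-a * (t - t₀)) - b ^ 2 * Real.exp (-b * (t - t₀))) * (c₁ - c₂) * Real.exp ξ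
    / denL c₁ c₂ t₀ a b t ξ

def UM : ℝ :=
  (a - b) * ((a ^ 2 - b ^ 2 * Real.exp (-(a - b) * (t - t₀))) * (Sfun c₁ c₂ t₀ ξ + 1) ^ 2
    - 2 * (a ^ 2 - b ^ 2) * Real.exp (b * (t - t₀)) * (Sfun c₁ c₂ t₀ ξ ^ 2 - 1)
    + Real.exp (b * (t - t₀)) * (a ^ 2 * Real.exp (b * (t - t₀)) - b ^ 2 * Real.exp (a * (t - t₀)))
      * (Sfun c₁ c₂ t₀ ξ - 1) ^ 2)
    / (denM₁ c₁ c₂ t₀ a b t ξ * denM₂ c₁ c₂ t₀ a b t ξ)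

def UR : ℝ :=
  (a ^ 2 * Real.exp (a * (t - t₀)) - b ^ 2 * Real.exp (b * (t - t₀))) * (c₁ - c₂) * Real.exp (-ξ)
    / denR c₁ c₂ t₀ a b t ξ

def hbarL : ℝ :=
  (a ^ 2 * Real.exp (-a * (t - t₀)) - b ^ 2 * Real.exp (-b * (t - t₀))) ^ 2
    * (c₁ - c₂) ^ 3 * (a - b) * Real.exp (2 * ξ) / denL c₁ c₂ t₀ a b t ξ ^ 3

def hbarM : ℝ :=
  UM c₁ c₂ t₀ a b t ξ ^ 2 * yξM c₁ c₂ t₀ a b t ξ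
    - 4 * pt₁ a b t₀ t * pt₂ a b t₀ t * Real.exp (qt₁ a b t₀ t - qt₂ a b t₀ t)
      * yξM c₁ c₂ t₀ a b t ξ

def hbarR : ℝ :=
  (a ^ 2 * Real.exp (a * (t - t₀)) - b ^ 2 * Real.exp (b * (t - t₀))) ^ 2
    * (c₁ - c₂) ^ 3 * (a - b) * Real.exp (-2 * ξ) / denR c₁ c₂ t₀ a b t ξ ^ 3

end lagrangianFormulas

/-- The Lagrangian state at time `t > t₀` of the solution with `y(0, ξ) = ξ` is given by the
explicit formulas to the left of `q₁(0)`, between `q₁(0)` and `q₂(0)`, and to the right of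
`q₂(0)`. -/
structure HasExplicitFormulas (c₁ c₂ t₀ α t : ℝ) (Θ : LagrangianState) : Prop where
  left : ∀ ξ, ξ < q₁ c₁ c₂ t₀ 0 →
    Θ.y ξ = yL c₁ c₂ t₀ (d₁ c₁ c₂ α) (d₂ c₁ c₂ α) t ξ ∧
    Θ.U ξ = UL c₁ c₂ t₀ (d₁ c₁ c₂ α) (d₂ c₁ c₂ α) t ξ
  mid : ∀ ξ, q₁ c₁ c₂ t₀ 0 < ξ → ξ < q₂ c₁ c₂ t₀ 0 →
    Θ.y ξ = yM c₁ c₂ t₀ (d₁ c₁ c₂ α) (d₂ c₁ c₂ α) t ξ ∧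
    Θ.U ξ = UM c₁ c₂ t₀ (d₁ c₁ c₂ α) (d₂ c₁ c₂ α) t ξ
  right : ∀ ξ, q₂ c₁ c₂ t₀ 0 < ξ →
    Θ.y ξ = yR c₁ c₂ t₀ (d₁ c₁ c₂ α) (d₂ c₁ c₂ α) t ξ ∧
    Θ.U ξ = UR c₁ c₂ t₀ (d₁ c₁ c₂ α) (d₂ c₁ c₂ α) t ξ
  left_ae : ∀ᵐ ξ, ξ < q₁ c₁ c₂ t₀ 0 →
    Θ.yξ ξ = yξL c₁ c₂ t₀ (d₁ c₁ c₂ α) (d₂ c₁ c₂ α) t ξ ∧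
    Θ.hbar ξ = hbarL c₁ c₂ t₀ (d₁ c₁ c₂ α) (d₂ c₁ c₂ α) t ξ ∧
    Θ.h ξ = hbarL c₁ c₂ t₀ (d₁ c₁ c₂ α) (d₂ c₁ c₂ α) t ξ
  mid_ae : ∀ᵐ ξ, q₁ c₁ c₂ t₀ 0 < ξ → ξ < q₂ c₁ c₂ t₀ 0 →
    Θ.yξ ξ = yξM c₁ c₂ t₀ (d₁ c₁ c₂ α) (d₂ c₁ c₂ α) t ξ ∧
    Θ.hbar ξ = hbarM c₁ c₂ t₀ (d₁ c₁ c₂ α) (d₂ c₁ c₂ α) t ξ ∧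
    Θ.h ξ = hbarM c₁ c₂ t₀ (d₁ c₁ c₂ α) (d₂ c₁ c₂ α) t ξ - 2 * α * c₁ * c₂ * dSfun c₁ c₂ t₀ ξ
  right_ae : ∀ᵐ ξ, q₂ c₁ c₂ t₀ 0 < ξ →
    Θ.yξ ξ = yξR c₁ c₂ t₀ (d₁ c₁ c₂ α) (d₂ c₁ c₂ α) t ξ ∧
    Θ.hbar ξ = hbarR c₁ c₂ t₀ (d₁ c₁ c₂ α) (d₂ c₁ c₂ α) t ξ ∧
    Θ.h ξ = hbarR c₁ c₂ t₀ (d₁ c₁ c₂ α) (d₂ c₁ c₂ α) t ξ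

end CamassaHolm

end

open CamassaHolm

noncomputable section

namespace CamassaHolm

/-! ### Weak derivatives -/

/-! In Lagrangian coordinates the peakon-antipeakon pair is explicit and passes regularly through
the collision. Put T = t - t₀ and choose labels X such that at T = 0 the labels in [0, 2] are
exactly those sitting at the origin. For parameters a > 0 > b, away from T = 0, the velocity on each
of the label regions X < 0, 0 ≤ X ≤ 2, X > 2 is A e^x + B e^{-x} with A, B depending on time only.
Hence P and Q come from explicit antiderivatives (`potL`, `potR`, `nonlocal_flowState`), and the
Lagrangian equations become rational identities in e^{aT} and e^{bT}. The middle coefficients A, B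
are singular at T = 0, but the Lagrangian variables are not, so in the integrated equations the
collision is a single harmless exceptional time.

At T = 0 the state depends on a + b, and on ab only through the value -2ab of h̄ on the labels [0,
2] (`flowH_zero_time`). Taking out the fraction α of that energy is therefore the same as replacing
(c₁, c₂) by the pair (d₁, d₂) with the same sum and with product (1 - α)c₁c₂, while h keeps the lost
amount -2αc₁c₂ as a constant on [0, 2]. This gives existence
(`BreakingData.isAlphaDissipativeLagrangian`).

For uniqueness, as long as two solutions have the same gap h̄ - h, their other components solve a
system that is Lipschitz in the supremum norm, and Picard iteration makes them equal
(`eqAt_of_gap_eq`). Before t₀ the explicit y_ξ has a positive lower bound, which keeps the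
competitor from breaking as well (`eqAt_of_le_yξ`). At t₀ continuity and the loss rule identify the
states (`eqAt_of_forall_lt`). Just after t₀, a label with y_ξ = 0 still carries energy h̄ ≥ c; this
pushes U_ξ, and then y_ξ, away from 0, so no label breaks again for a uniform time
(`exists_not_breaking_after`). Afterwards y_ξ is bounded below on compact time intervals.

Relabelings send solutions to solutions and do not change the Eulerian image
(`IsAlphaDissipativeLagrangian.relabel`, `IsRelabeling.isEulerianImage`). One flow thus serves both
for the labels produced by L and for those with y(0, ξ) = ξ. For T ≠ 0 the map y is itself a
relabeling, so μ and ν are computed by a change of variables; at T = 0 the labels [0, 2] collapse to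
a point mass (`map_flowH_collision`). The explicit Lagrangian formulas are the flow rewritten in the
label ξ = y(0); in the middle, S is just X - 1 (`Sfun_eq`). -/

theorem IsWeakDeriv.intervalIntegrable {f g : ℝ → ℝ} (h : IsWeakDeriv f g) (a b : ℝ) :
    IntervalIntegrable g volume a b :=
  intervalIntegrable_iff.mpr
    ((h.1.integrableOn_isCompact isCompact_uIcc).mono_set uIoc_subset_uIcc)

theorem IsWeakDeriv.continuous {f g : ℝ → ℝ} (h : IsWeakDeriv f g) : Continuous f := by
  have : f = fun x => f 0 + ∫ t in (0 : ℝ)..x, g t := by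
    ext x; rw [← h.2]; ring
  rw [this]
  exact continuous_const.add
    (intervalIntegral.continuous_primitive (fun a b => h.intervalIntegrable a b) 0)

theorem IsWeakDeriv.ae_hasDerivAt {f g : ℝ → ℝ} (h : IsWeakDeriv f g) :
    ∀ᵐ x, HasDerivAt f (g x) x := by
  filter_upwards [LocallyIntegrable.ae_hasDerivAt_integral h.1] with x hx
  have h2 := (hx 0).const_add (f 0)
  refine h2.congr_of_eventuallyEq (Eventually.of_forall fun y => ?_)
  have := h.2 0 y
  simp only; linarith

/-- Lets the derivative components of two Lagrangian states be compared as soon as y and U agree. -/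
theorem IsWeakDeriv.ae_unique {f g g' : ℝ → ℝ} (h : IsWeakDeriv f g) (h' : IsWeakDeriv f g') :
    ∀ᵐ x, g x = g' x := by
  filter_upwards [h.ae_hasDerivAt, h'.ae_hasDerivAt] with x h1 h2 using h1.unique h2

/-- The exceptional set absorbs the kinks of the piecewise formulas: the labels 0 and 2 in space,
and the collision in time. -/
theorem IsWeakDeriv.of_hasDerivAt_off_countable {f g : ℝ → ℝ} {s : Set ℝ} (hs : s.Countable)
    (hf : Continuous f) (hd : ∀ x ∉ s, HasDerivAt f (g x) x) (hg : LocallyIntegrable g volume) :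
    IsWeakDeriv f g := by
  refine ⟨hg, fun a b => ?_⟩
  symm
  refine integral_eq_of_hasDerivAt_off_countable f g hs hf.continuousOn
    (fun x hx => hd x hx.2) (intervalIntegrable_iff.mpr
    ((hg.integrableOn_isCompact isCompact_uIcc).mono_set uIoc_subset_uIcc))

theorem IsWeakDeriv.of_lipschitzWith {f : ℝ → ℝ} {K : NNReal} (hf : LipschitzWith K f) :
    IsWeakDeriv f (deriv f) := by
  have hb : ∀ x, ‖deriv f x‖ ≤ K := fun x => norm_deriv_le_of_lipschitz hf
  refine ⟨?_, fun a b => ?_⟩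
  · have : MemLp (deriv f) ∞ volume :=
      memLp_top_of_bound (measurable_deriv f).aestronglyMeasurable K (Eventually.of_forall hb)
    exact this.locallyIntegrable le_top
  · exact ((hf.lipschitzOnWith).absolutelyContinuousOnInterval.integral_deriv_eq_sub).symm

theorem IsWeakDeriv.add {f g f' g' : ℝ → ℝ} (hf : IsWeakDeriv f f') (hg : IsWeakDeriv g g') :
    IsWeakDeriv (fun x => f x + g x) (fun x => f' x + g' x) := by
  refine ⟨hf.1.add hg.1, fun a b => ?_⟩
  rw [intervalIntegral.integral_add (hf.intervalIntegrable a b) (hg.intervalIntegrable a b),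
    ← hf.2, ← hg.2]
  ring

theorem IsWeakDeriv.sub {f g f' g' : ℝ → ℝ} (hf : IsWeakDeriv f f') (hg : IsWeakDeriv g g') :
    IsWeakDeriv (fun x => f x - g x) (fun x => f' x - g' x) := by
  refine ⟨hf.1.sub hg.1, fun a b => ?_⟩
  rw [intervalIntegral.integral_sub (hf.intervalIntegrable a b) (hg.intervalIntegrable a b),
    ← hf.2, ← hg.2]
  ring

theorem isWeakDeriv_id : IsWeakDeriv (fun x => x) (fun _ => 1) :=
  .of_hasDerivAt_off_countable countable_empty continuous_id (fun x _ => hasDerivAt_id x)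
    (locallyIntegrable_const 1)

theorem isWeakDeriv_integral_Iic {h : ℝ → ℝ} (hh : Integrable h) :
    IsWeakDeriv (fun ξ => ∫ η in Iic ξ, h η) h := by
  refine ⟨hh.locallyIntegrable, fun a b => ?_⟩
  exact intervalIntegral.integral_Iic_sub_Iic hh.integrableOn hh.integrableOn

/-! ### Improper integrals of derivatives -/

theorem integral_Iic_of_hasDerivAt_off_countable {f f' : ℝ → ℝ} {s : Set ℝ} (hs : s.Countable)
    (hf : Continuous f) (hd : ∀ x ∉ s, HasDerivAt f (f' x) x) {b m : ℝ}
    (hi : IntegrableOn f' (Iic b)) (hm : Tendsto f atBot (𝓝 m)) :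
    ∫ x in Iic b, f' x = f b - m := by
  refine tendsto_nhds_unique (intervalIntegral_tendsto_integral_Iic b hi tendsto_id) ?_
  refine (tendsto_const_nhds.sub hm).congr' ?_
  filter_upwards [eventually_le_atBot b] with a hab
  symm
  refine integral_eq_of_hasDerivAt_off_countable f f' hs hf.continuousOn
    (fun x hx => hd x hx.2) ?_
  exact (intervalIntegrable_iff_integrableOn_Ioc_of_le hab).mpr
    (hi.mono_set Ioc_subset_Iic_self)

theorem integral_Ioi_of_hasDerivAt_off_countable {f f' : ℝ → ℝ} {s : Set ℝ} (hs : s.Countable)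
    (hf : Continuous f) (hd : ∀ x ∉ s, HasDerivAt f (f' x) x) {a m : ℝ}
    (hi : IntegrableOn f' (Ioi a)) (hm : Tendsto f atTop (𝓝 m)) :
    ∫ x in Ioi a, f' x = m - f a := by
  refine tendsto_nhds_unique (intervalIntegral_tendsto_integral_Ioi a hi tendsto_id) ?_
  refine (hm.sub tendsto_const_nhds).congr' ?_
  filter_upwards [eventually_ge_atTop a] with b hab
  symm
  refine integral_eq_of_hasDerivAt_off_countable f f' hs hf.continuousOn
    (fun x hx => hd x hx.2) ?_
  exact (intervalIntegrable_iff_integrableOn_Ioc_of_le hab).mpr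
    (hi.mono_set Ioc_subset_Ioi_self)

theorem integral_of_hasDerivAt_off_countable {f f' : ℝ → ℝ} {s : Set ℝ} (hs : s.Countable)
    (hf : Continuous f) (hd : ∀ x ∉ s, HasDerivAt f (f' x) x) {m n : ℝ}
    (hi : Integrable f') (hm : Tendsto f atBot (𝓝 m)) (hn : Tendsto f atTop (𝓝 n)) :
    ∫ x, f' x = n - m := by
  rw [← intervalIntegral.integral_Iic_add_Ioi (b := 0) hi.integrableOn hi.integrableOn,
    integral_Iic_of_hasDerivAt_off_countable hs hf hd hi.integrableOn hm,
    integral_Ioi_of_hasDerivAt_off_countable hs hf hd hi.integrableOn hn]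
  ring

/-! ### Increasing changes of variables -/

/-- Needed at the collision time only, where y is injective on the outer labels but not on the line.
-/
theorem map_withDensity_of_hasDerivWithinAt {y y' : ℝ → ℝ} {A : Set ℝ} (hA : MeasurableSet A)
    (hy : Measurable y) (hinj : InjOn y A) (hd : ∀ x ∈ A, HasDerivWithinAt y (y' x) A x)
    (h0 : ∀ x ∈ A, 0 ≤ y' x) (ρ : ℝ → ℝ≥0∞) :
    ((volume.restrict A).withDensity (fun x => ENNReal.ofReal (y' x) * ρ (y x))).map y
      = (volume.restrict (y '' A)).withDensity ρ := by
  ext B hB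
  rw [Measure.map_apply hy hB, withDensity_apply _ (hy hB), withDensity_apply _ hB,
    Measure.restrict_restrict (hy hB), Measure.restrict_restrict hB]
  have him : B ∩ y '' A = y '' (y ⁻¹' B ∩ A) := by
    rw [image_preimage_inter]
  rw [him, lintegral_image_eq_lintegral_abs_deriv_mul ((hy hB).inter hA)
    (fun x hx => (hd x hx.2).mono inter_subset_right) (hinj.mono inter_subset_right)]
  refine setLIntegral_congr_fun ((hy hB).inter hA) fun x hx => ?_
  simp only [abs_of_nonneg (h0 x hx.2)]

/-- Bi-Lipschitz relabelings that are differentiable off a countable set. -/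
structure IsRelabeling (g g' : ℝ → ℝ) : Prop where
  cont : Continuous g
  exists_countable : ∃ s : Set ℝ, s.Countable ∧ ∀ ξ ∉ s, HasDerivAt g (g' ξ) ξ
  meas : Measurable g'
  bounds : ∃ c C : ℝ, 0 < c ∧ ∀ ξ, c ≤ g' ξ ∧ g' ξ ≤ C
  bdd : ∃ M : ℝ, ∀ ξ, |g ξ - ξ| ≤ M
  lim : Tendsto (fun ξ => g ξ - ξ) atBot (𝓝 0)
  two : MemLp (fun ξ => g' ξ - 1) 2 volume

theorem memLp_top_of_bounds {g : ℝ → ℝ} (hm : AEStronglyMeasurable g volume) {c C : ℝ}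
    (h : ∀ᵐ ξ, c ≤ g ξ ∧ g ξ ≤ C) : MemLp g ∞ volume := by
  refine memLp_top_of_bound hm (max |c| |C|) (h.mono fun x hx => ?_)
  exact abs_le_max_abs_abs hx.1 hx.2

theorem IsWeakDeriv.mul_sub_le {f g : ℝ → ℝ} (h : IsWeakDeriv f g) {c : ℝ} (hc : ∀ᵐ ξ, c ≤ g ξ)
    {a b : ℝ} (hab : a ≤ b) : c * (b - a) ≤ f b - f a := by
  rw [h.2]
  have : ∫ _ in a..b, c = c * (b - a) := by simp; ring
  rw [← this]
  exact intervalIntegral.integral_mono_ae hab (by simp) (h.intervalIntegrable a b) hc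

theorem IsWeakDeriv.strictMono {f g : ℝ → ℝ} (h : IsWeakDeriv f g) {c : ℝ} (hc0 : 0 < c)
    (hc : ∀ᵐ ξ, c ≤ g ξ) : StrictMono f := by
  intro a b hab
  have := h.mul_sub_le hc hab.le
  nlinarith [mul_pos hc0 (sub_pos.mpr hab)]

theorem surjective_of_continuous_of_sub_id_bounded {f : ℝ → ℝ} (hf : Continuous f) {M : ℝ}
    (hM : ∀ ξ, |f ξ - ξ| ≤ M) : Function.Surjective f := by
  refine hf.surjective ?_ ?_
  · refine tendsto_atTop_mono (f := fun ξ => ξ - M) (fun ξ => ?_)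
      (tendsto_atTop_add_const_right _ (-M) tendsto_id)
    linarith [(abs_le.mp (hM ξ)).1]
  · refine tendsto_atBot_mono (f := fun ξ => ξ + M) (fun ξ => ?_)
      (tendsto_atBot_add_const_right _ M tendsto_id)
    linarith [(abs_le.mp (hM ξ)).2]

/-- The homeomorphism given by a continuous strictly monotone surjection. -/
def homeoOfStrictMono (f : ℝ → ℝ) (hf : StrictMono f) (hs : Function.Surjective f) : ℝ ≃ₜ ℝ :=
  (StrictMono.orderIsoOfSurjective f hf hs).toHomeomorph

/-- The essential bounds on g make f bi-Lipschitz. The inverse then has a bounded weak derivative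
because it is Lipschitz with constant c⁻¹, and it stays at distance at most M from the identity by
substituting e.symm ξ in the bound for f. -/
theorem mem_relabelingGroup {f g : ℝ → ℝ} (h : IsWeakDeriv f g) {c C M : ℝ} (hc0 : 0 < c)
    (hg : ∀ᵐ ξ, c ≤ g ξ ∧ g ξ ≤ C) (hM : ∀ ξ, |f ξ - ξ| ≤ M)
    (h2 : MemLp (fun ξ => g ξ - 1) 2 volume) : f ∈ relabelingGroup := by
  have hmono := h.strictMono hc0 (hg.mono fun x hx => hx.1)
  have hsurj := surjective_of_continuous_of_sub_id_bounded h.continuous hM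
  set e := homeoOfStrictMono f hmono hsurj with he
  have hef : ⇑e = f := rfl
  have hlip : LipschitzWith (Real.toNNReal c⁻¹) e.symm := by
    refine LipschitzWith.of_le_add_mul _ fun x y => ?_
    have hinv : 0 < c⁻¹ := inv_pos.mpr hc0
    rw [Real.coe_toNNReal _ hinv.le]
    rcases le_total (e.symm x) (e.symm y) with hxy | hxy
    · have : 0 ≤ c⁻¹ * dist x y := by positivity
      linarith
    · have h1 := h.mul_sub_le (hg.mono fun x hx => hx.1) hxy
      rw [← hef, e.apply_symm_apply, e.apply_symm_apply] at h1
      have h2 : x - y ≤ dist x y := le_abs_self _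
      have h3 : e.symm x - e.symm y ≤ c⁻¹ * (x - y) := by
        rw [inv_mul_eq_div, le_div_iff₀ hc0]; linarith
      have h4 := mul_le_mul_of_nonneg_left h2 hinv.le
      linarith
  have hgm : AEStronglyMeasurable g volume := h.1.aestronglyMeasurable
  refine ⟨e, hef, ⟨?_, fun ξ => g ξ - 1, ?_, ?_⟩, ⟨?_, fun ξ => deriv e.symm ξ - 1, ?_, ?_⟩,
    g, h, h2⟩
  · exact memLp_top_of_bound (h.continuous.sub continuous_id).aestronglyMeasurable M
      (Eventually.of_forall hM)
  · exact h.sub isWeakDeriv_id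
  · refine memLp_top_of_bounds (c := c - 1) (C := C - 1)
      (hgm.sub aestronglyMeasurable_const) (hg.mono fun x hx => ?_)
    exact ⟨by linarith [hx.1], by linarith [hx.2]⟩
  · refine memLp_top_of_bound (e.symm.continuous.sub continuous_id).aestronglyMeasurable M
      (Eventually.of_forall fun ξ => ?_)
    have := hM (e.symm ξ)
    rw [← hef, e.apply_symm_apply] at this
    rwa [Real.norm_eq_abs, abs_sub_comm]
  · exact (IsWeakDeriv.of_lipschitzWith hlip).sub isWeakDeriv_id
  · refine memLp_top_of_bound ((measurable_deriv _).sub_const 1).aestronglyMeasurable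
      (Real.toNNReal c⁻¹ + 1) (Eventually.of_forall fun ξ => ?_)
    refine (norm_sub_le _ _).trans ?_
    simpa using norm_deriv_le_of_lipschitz hlip (x₀ := ξ)

/-! ### Change of variables, composition and inversion for relabelings. -/

namespace IsRelabeling

variable {g g' : ℝ → ℝ}

theorem locallyIntegrable (hg : IsRelabeling g g') : LocallyIntegrable g' volume := by
  obtain ⟨c, C, _, h⟩ := hg.bounds
  exact (memLp_top_of_bounds hg.meas.aestronglyMeasurable
    (Eventually.of_forall h)).locallyIntegrable le_top

theorem isWeakDeriv (hg : IsRelabeling g g') : IsWeakDeriv g g' := by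
  obtain ⟨s, hs, hd⟩ := hg.exists_countable
  exact .of_hasDerivAt_off_countable hs hg.cont hd hg.locallyIntegrable

theorem strictMono (hg : IsRelabeling g g') : StrictMono g := by
  obtain ⟨c, C, hc, h⟩ := hg.bounds
  exact hg.isWeakDeriv.strictMono hc (Eventually.of_forall fun x => (h x).1)

theorem pos (hg : IsRelabeling g g') (ξ : ℝ) : 0 < g' ξ := by
  obtain ⟨c, C, hc, h⟩ := hg.bounds
  exact hc.trans_le (h ξ).1

theorem surjective (hg : IsRelabeling g g') : Function.Surjective g := by
  obtain ⟨M, hM⟩ := hg.bdd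
  exact surjective_of_continuous_of_sub_id_bounded hg.cont hM

theorem tendsto_atBot (hg : IsRelabeling g g') : Tendsto g atBot atBot :=
  hg.strictMono.monotone.tendsto_atBot_atBot fun b => (hg.surjective b).imp fun _ h => h.le

/-- A relabeling is a homeomorphism. -/
def homeo (hg : IsRelabeling g g') : ℝ ≃ₜ ℝ := homeoOfStrictMono g hg.strictMono hg.surjective

/-- Discards the countable set where g is not differentiable. Both that set and its image are null,
so the area formula on the remaining set computes integrals over the line. -/
theorem exists_change (hg : IsRelabeling g g') : ∃ A : Set ℝ, MeasurableSet A ∧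
    (volume.restrict A = volume) ∧ (∀ ξ ∈ A, HasDerivWithinAt g (g' ξ) A ξ) ∧
    (volume Aᶜ = 0) ∧ ∀ B, volume (g '' B \ g '' (B ∩ A)) = 0 := by
  obtain ⟨s, hs, hd⟩ := hg.exists_countable
  refine ⟨sᶜ, hs.measurableSet.compl, ?_, fun ξ hξ => (hd ξ hξ).hasDerivWithinAt, ?_, fun B => ?_⟩
  · exact Measure.restrict_eq_self_of_ae_mem (compl_mem_ae_iff.mpr (hs.measure_zero _))
  · rw [compl_compl]; exact hs.measure_zero _
  · refine measure_mono_null ?_ ((hs.image g).measure_zero volume)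
    rintro _ ⟨⟨x, hx, rfl⟩, h2⟩
    by_contra h
    exact h2 ⟨x, ⟨hx, fun h' => h ⟨x, h', rfl⟩⟩, rfl⟩

theorem setLIntegral_comp (hg : IsRelabeling g g') {B : Set ℝ} (hB : MeasurableSet B)
    (F : ℝ → ℝ≥0∞) :
    ∫⁻ ξ in B, ENNReal.ofReal (g' ξ) * F (g ξ) = ∫⁻ x in g '' B, F x := by
  obtain ⟨A, hA, hAv, hd, h0, hn⟩ := hg.exists_change
  have h1 : ∫⁻ x in g '' B, F x = ∫⁻ x in g '' (B ∩ A), F x := by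
    refine setLIntegral_congr (EventuallyEq.symm ?_)
    refine (ae_eq_set).mpr ⟨?_, hn B⟩
    rw [sdiff_eq_empty.mpr (image_mono inter_subset_left)]; simp
  rw [h1, lintegral_image_eq_lintegral_abs_deriv_mul (hB.inter hA)
    (fun x hx => (hd x hx.2).mono inter_subset_right) (hg.strictMono.injective.injOn)]
  have : (volume.restrict B) = volume.restrict (B ∩ A) := by
    rw [← Measure.restrict_restrict hB, hAv]
  rw [this]
  simp only [abs_of_pos (hg.pos _)]

theorem setIntegral_comp (hg : IsRelabeling g g') {B : Set ℝ} (hB : MeasurableSet B)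
    (F : ℝ → ℝ) :
    ∫ ξ in B, F (g ξ) * g' ξ = ∫ x in g '' B, F x := by
  obtain ⟨A, hA, hAv, hd, h0, hn⟩ := hg.exists_change
  have h1 : ∫ x in g '' B, F x = ∫ x in g '' (B ∩ A), F x := by
    refine setIntegral_congr_set (EventuallyEq.symm ?_)
    refine (ae_eq_set).mpr ⟨?_, hn B⟩
    rw [sdiff_eq_empty.mpr (image_mono inter_subset_left)]; simp
  rw [h1, integral_image_eq_integral_abs_deriv_smul (hB.inter hA)
    (fun x hx => (hd x hx.2).mono inter_subset_right) (hg.strictMono.injective.injOn)]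
  have : (volume.restrict B) = volume.restrict (B ∩ A) := by
    rw [← Measure.restrict_restrict hB, hAv]
  rw [this]
  simp only [abs_of_pos (hg.pos _), smul_eq_mul, mul_comm]

theorem integrableOn_comp (hg : IsRelabeling g g') {B : Set ℝ} (hB : MeasurableSet B)
    (F : ℝ → ℝ) :
    IntegrableOn (fun ξ => F (g ξ) * g' ξ) B ↔ IntegrableOn F (g '' B) := by
  obtain ⟨A, hA, hAv, hd, h0, hn⟩ := hg.exists_change
  have h1 : IntegrableOn F (g '' B) ↔ IntegrableOn F (g '' (B ∩ A)) := by
    refine integrableOn_congr_set_ae (EventuallyEq.symm ?_)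
    refine (ae_eq_set).mpr ⟨?_, hn B⟩
    rw [sdiff_eq_empty.mpr (image_mono inter_subset_left)]; simp
  rw [h1, integrableOn_image_iff_integrableOn_abs_deriv_smul (hB.inter hA)
    (fun x hx => (hd x hx.2).mono inter_subset_right) (hg.strictMono.injective.injOn)]
  have : (volume.restrict B) = volume.restrict (B ∩ A) := by
    rw [← Measure.restrict_restrict hB, hAv]
  rw [IntegrableOn, IntegrableOn, this]
  simp only [abs_of_pos (hg.pos _), smul_eq_mul, mul_comm]

theorem integral_comp (hg : IsRelabeling g g') (F : ℝ → ℝ) :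
    ∫ ξ, F (g ξ) * g' ξ = ∫ x, F x := by
  have := hg.setIntegral_comp MeasurableSet.univ F
  rwa [image_univ, hg.surjective.range_eq, Measure.restrict_univ] at this

theorem integrable_comp (hg : IsRelabeling g g') {F : ℝ → ℝ} (hF : Integrable F) :
    Integrable (fun ξ => F (g ξ) * g' ξ) := by
  have := hg.integrableOn_comp MeasurableSet.univ F
  rw [image_univ, hg.surjective.range_eq, integrableOn_univ, integrableOn_univ] at this
  exact this.mpr hF

/-- Because g' ≥ c > 0, the image of Lebesgue measure is at most c⁻¹ times Lebesgue measure. Null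
sets and L^p norms are therefore controlled under composition with g. -/
theorem map_volume_le (hg : IsRelabeling g g') :
    ∃ K : ℝ≥0∞, K ≠ ∞ ∧ volume.map g ≤ K • volume := by
  obtain ⟨c, C, hc, h⟩ := hg.bounds
  refine ⟨ENNReal.ofReal c⁻¹, ENNReal.ofReal_ne_top, Measure.le_iff.mpr fun B hB => ?_⟩
  have hgB := hg.cont.measurable hB
  rw [Measure.map_apply hg.cont.measurable hB, Measure.smul_apply, smul_eq_mul]
  have h1 := hg.setLIntegral_comp hgB (fun _ => 1)
  rw [image_preimage_eq B hg.surjective] at h1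
  simp only [mul_one, lintegral_const, Measure.restrict_apply MeasurableSet.univ, univ_inter,
    one_mul] at h1
  rw [← h1, ← lintegral_const_mul _ hg.meas.ennreal_ofReal]
  calc volume (g ⁻¹' B) = ∫⁻ _ in g ⁻¹' B, 1 := by simp
    _ ≤ _ := by
      refine lintegral_mono fun ξ => ?_
      rw [← ENNReal.ofReal_mul (by positivity), ← ENNReal.ofReal_one]
      refine ENNReal.ofReal_le_ofReal ?_
      rw [inv_mul_eq_div, le_div_iff₀ hc]; linarith [(h ξ).1]

theorem quasiMeasurePreserving (hg : IsRelabeling g g') :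
    Measure.QuasiMeasurePreserving g volume volume := by
  obtain ⟨K, _, h⟩ := hg.map_volume_le
  exact ⟨hg.cont.measurable, (Measure.absolutelyContinuous_of_le h).trans
    Measure.smul_absolutelyContinuous⟩

theorem ae_comp (hg : IsRelabeling g g') {p : ℝ → Prop} (h : ∀ᵐ x, p x) : ∀ᵐ ξ, p (g ξ) :=
  hg.quasiMeasurePreserving.ae h

theorem memLp_comp (hg : IsRelabeling g g') {f : ℝ → ℝ} {p : ℝ≥0∞} (hf : MemLp f p volume) :
    MemLp (fun ξ => f (g ξ)) p volume := by
  obtain ⟨K, hK, h⟩ := hg.map_volume_le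
  exact (hf.of_measure_le_smul hK h).comp_of_map hg.cont.aemeasurable

/-- The constant is independent of f, which is what continuity in time of a relabeled solution
requires. For p = ∞ only null sets matter; for finite p the measure bound enters with exponent 1/p.
-/
theorem exists_eLpNorm_comp_le (hg : IsRelabeling g g') (p : ℝ≥0∞) :
    ∃ K : ℝ≥0∞, K ≠ ∞ ∧ ∀ f : ℝ → ℝ, AEStronglyMeasurable f volume →
      eLpNorm (fun ξ => f (g ξ)) p volume ≤ K * eLpNorm f p volume := by
  obtain ⟨K, hK, h⟩ := hg.map_volume_le
  rcases eq_or_ne p ∞ with rfl | hp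
  · refine ⟨1, by simp, fun f hf => ?_⟩
    have h1 : AEStronglyMeasurable f (volume.map g) :=
      hf.mono_ac ((Measure.absolutelyContinuous_of_le h).trans Measure.smul_absolutelyContinuous)
    have := eLpNorm_map_measure (p := ∞) h1 hg.cont.aemeasurable
    rw [Function.comp_def] at this
    rw [← this, one_mul]
    simp only [eLpNorm_exponent_top]
    exact eLpNormEssSup_mono_measure _
      ((Measure.absolutelyContinuous_of_le h).trans Measure.smul_absolutelyContinuous)
  · refine ⟨K ^ (1 / p).toReal, by simp [hK], fun f hf => ?_⟩
    have h1 : AEStronglyMeasurable f (volume.map g) :=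
      hf.mono_ac ((Measure.absolutelyContinuous_of_le h).trans Measure.smul_absolutelyContinuous)
    have := eLpNorm_map_measure (p := p) h1 hg.cont.aemeasurable
    rw [Function.comp_def] at this
    rw [← this, ← smul_eq_mul, ← eLpNorm_smul_measure_of_ne_top hp]
    exact eLpNorm_mono_measure f h

/-- The chain rule is obtained by substituting in the integral over an interval, since f need not be
differentiable at any prescribed point. -/
theorem comp_isWeakDeriv (hg : IsRelabeling g g') {f f' : ℝ → ℝ} (hf : IsWeakDeriv f f') :
    IsWeakDeriv (fun ξ => f (g ξ)) (fun ξ => f' (g ξ) * g' ξ) := by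
  have key : ∀ a b, a ≤ b → IntegrableOn (fun ξ => f' (g ξ) * g' ξ) (Icc a b) ∧
      f (g b) - f (g a) = ∫ ξ in a..b, f' (g ξ) * g' ξ := by
    intro a b hab
    have hI : g '' Icc a b = Icc (g a) (g b) := by
      have := OrderIso.image_Icc
        (StrictMono.orderIsoOfSurjective g hg.strictMono hg.surjective) a b
      simpa using this
    refine ⟨?_, ?_⟩
    · rw [hg.integrableOn_comp measurableSet_Icc, hI]
      exact hf.1.integrableOn_isCompact isCompact_Icc
    · rw [hf.2, intervalIntegral.integral_of_le hab,
        intervalIntegral.integral_of_le (hg.strictMono.monotone hab),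
        ← integral_Icc_eq_integral_Ioc, ← integral_Icc_eq_integral_Ioc,
        hg.setIntegral_comp measurableSet_Icc, hI]
  refine ⟨?_, fun a b => ?_⟩
  · intro x
    exact ⟨Icc (x - 1) (x + 1),
      Icc_mem_nhds (by linarith) (by linarith), (key _ _ (by linarith)).1⟩
  · rcases le_total a b with h | h
    · exact (key a b h).2
    · rw [intervalIntegral.integral_symm, ← (key b a h).2]; ring

theorem map_withDensity (hg : IsRelabeling g g') (ρ : ℝ → ℝ≥0∞) :
    (volume.withDensity (fun ξ => ENNReal.ofReal (g' ξ) * ρ (g ξ))).map g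
      = volume.withDensity ρ := by
  ext B hB
  rw [Measure.map_apply hg.cont.measurable hB, withDensity_apply _ (hg.cont.measurable hB),
    withDensity_apply _ hB, hg.setLIntegral_comp (hg.cont.measurable hB),
    image_preimage_eq B hg.surjective]

theorem symm (hg : IsRelabeling g g') :
    IsRelabeling hg.homeo.symm (fun x => (g' (hg.homeo.symm x))⁻¹) := by
  have hsymm : ∀ x, g (hg.homeo.symm x) = x := fun x => hg.homeo.apply_symm_apply x
  obtain ⟨c, C, hc, hb⟩ := hg.bounds
  have hC : 0 < C := hc.trans_le ((hb 0).1.trans (hb 0).2)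
  obtain ⟨s, hs, hd⟩ := hg.exists_countable
  have hmeas : Measurable fun x => (g' (hg.homeo.symm x))⁻¹ :=
    (hg.meas.comp hg.homeo.symm.continuous.measurable).inv
  have hcount : ∀ x ∉ g '' s,
      HasDerivAt hg.homeo.symm ((g' (hg.homeo.symm x))⁻¹) x := by
    intro x hx
    refine HasDerivAt.of_local_left_inverse hg.homeo.symm.continuous.continuousAt
      (hd _ fun h => hx ⟨_, h, hsymm x⟩) (hg.pos _).ne' (Eventually.of_forall hsymm)
  have hbounds : ∀ x, C⁻¹ ≤ (g' (hg.homeo.symm x))⁻¹ ∧ (g' (hg.homeo.symm x))⁻¹ ≤ c⁻¹ :=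
    fun x => ⟨inv_anti₀ (hg.pos _) (hb _).2, inv_anti₀ hc (hb _).1⟩
  refine ⟨hg.homeo.symm.continuous, ⟨g '' s, hs.image g, hcount⟩, hmeas,
    ⟨C⁻¹, c⁻¹, by positivity, hbounds⟩, ?_, ?_, ?_⟩
  · obtain ⟨M, hM⟩ := hg.bdd
    refine ⟨M, fun x => ?_⟩
    have := hM (hg.homeo.symm x)
    rw [hsymm] at this
    rwa [abs_sub_comm]
  · have hbot : Tendsto hg.homeo.symm atBot atBot :=
      (StrictMono.orderIsoOfSurjective g hg.strictMono hg.surjective).symm.tendsto_atBot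
    have := (hg.lim.comp hbot).neg
    simp only [Function.comp_def, hsymm, neg_sub, neg_zero] at this
    exact this
  -- Pulled back by g, this integrand becomes (1 - g')², which is integrable. The square of the new
  -- derivative minus 1 has one further factor 1/g' ≤ c⁻¹.
  · have hint : Integrable fun x => (1 - g' (hg.homeo.symm x)) ^ 2
        * (g' (hg.homeo.symm x))⁻¹ := by
      have h1 := hg.integrableOn_comp MeasurableSet.univ
        (fun x => (1 - g' (hg.homeo.symm x)) ^ 2 * (g' (hg.homeo.symm x))⁻¹)
      rw [image_univ, hg.surjective.range_eq, integrableOn_univ, integrableOn_univ] at h1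
      rw [← h1]
      refine (hg.two.integrable_sq).congr (Eventually.of_forall fun ξ => ?_)
      have h2 : hg.homeo.symm (g ξ) = ξ := hg.homeo.symm_apply_apply ξ
      simp only [h2]
      rw [mul_assoc, inv_mul_cancel₀ (hg.pos ξ).ne']; ring
    rw [memLp_two_iff_integrable_sq (hmeas.sub_const 1).aestronglyMeasurable]
    refine (hint.const_mul c⁻¹).mono' ((hmeas.sub_const 1).pow_const 2).aestronglyMeasurable (Eventually.of_forall fun x => ?_)
    rw [Real.norm_eq_abs, abs_of_nonneg (sq_nonneg _)]
    have hp := hg.pos (hg.homeo.symm x)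
    have : ((g' (hg.homeo.symm x))⁻¹ - 1) ^ 2 =
        (g' (hg.homeo.symm x))⁻¹ * ((1 - g' (hg.homeo.symm x)) ^ 2
          * (g' (hg.homeo.symm x))⁻¹) := by
      field_simp
    rw [this]
    exact mul_le_mul_of_nonneg_right (hbounds x).2 (by positivity)

end IsRelabeling

/-! ### Relabeling of Lagrangian solutions -/

/-- A set of full measure is dense, so a closed one is everything. This turns a.e. bounds on
continuous functions into pointwise bounds. -/
theorem forall_of_ae_of_isClosed {p : ℝ → Prop} (hp : IsClosed {x | p x}) (h : ∀ᵐ x, p x) (x : ℝ) :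
    p x := by
  have hd : Dense {x | p x} := Measure.dense_of_ae h
  have := hp.closure_eq ▸ hd.closure_eq
  exact (this ▸ mem_univ x : x ∈ {x | p x})

theorem exists_ae_bound_of_memLp_top {f : ℝ → ℝ} (h : MemLp f ∞ volume) :
    ∃ M : ℝ, ∀ᵐ x, |f x| ≤ M := by
  have h2 : eLpNormEssSup f volume ≠ ∞ := by
    have := h.2.ne
    rwa [eLpNorm_exponent_top] at this
  refine ⟨(eLpNormEssSup f volume).toReal, ?_⟩
  filter_upwards [ae_le_eLpNormEssSup (f := f) (μ := volume)] with x hx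
  have := ENNReal.toReal_mono h2 hx
  simpa using this

theorem exists_bound_of_memLp_top {f : ℝ → ℝ} (hf : Continuous f) (h : MemLp f ∞ volume) :
    ∃ M, ∀ x, |f x| ≤ M := by
  obtain ⟨M, hM⟩ := exists_ae_bound_of_memLp_top h
  exact ⟨M, forall_of_ae_of_isClosed (isClosed_le hf.abs continuous_const) hM⟩

theorem memLp_mul_bdd {f k : ℝ → ℝ} {p : ℝ≥0∞} (hf : MemLp f p volume) (hk : Measurable k) {C : ℝ}
    (hC : ∀ x, |k x| ≤ C) : MemLp (fun x => f x * k x) p volume := by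
  refine hf.of_le_mul (c := C) (hf.1.mul hk.aestronglyMeasurable) (Eventually.of_forall fun x => ?_)
  rw [norm_mul, mul_comm]
  exact mul_le_mul_of_nonneg_right (hC x) (norm_nonneg _)

/-- The density k is kept general because it is used twice: with h, for membership in ℱ, and with h̄
at the breaking time. -/
theorem add_integral_mem_relabelingGroup {y yξ k : ℝ → ℝ} (hy : IsWeakDeriv y yξ)
    (hb : MemLp (fun ξ => y ξ - ξ) ∞ volume) (h2 : MemLp (fun ξ => yξ ξ - 1) 2 volume)
    (hi : MemLp (fun ξ => yξ ξ - 1) ∞ volume) (hk : Integrable k) (hk2 : MemLp k 2 volume)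
    (hki : MemLp k ∞ volume) (hk0 : ∀ᵐ ξ, 0 ≤ k ξ)
    (hlow : ∃ c : ℝ, 0 < c ∧ ∀ᵐ ξ, c ≤ yξ ξ + k ξ) :
    (fun ξ => y ξ + ∫ η in Iic ξ, k η) ∈ relabelingGroup := by
  obtain ⟨c, hc, hlow⟩ := hlow
  obtain ⟨M, hM⟩ := exists_bound_of_memLp_top (hy.continuous.sub continuous_id) hb
  obtain ⟨M₁, hM₁⟩ := exists_ae_bound_of_memLp_top hi
  obtain ⟨M₂, hM₂⟩ := exists_ae_bound_of_memLp_top hki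
  refine mem_relabelingGroup (hy.add (isWeakDeriv_integral_Iic hk)) (C := 1 + M₁ + M₂)
    (M := M + ∫ η, k η) hc ?_ (fun ξ => ?_) ?_
  · filter_upwards [hlow, hM₁, hM₂] with ξ h₀ h₁ h₂
    refine ⟨h₀, ?_⟩
    linarith [(abs_le.mp h₁).2, (abs_le.mp h₂).2]
  · have h3 : |∫ η in Iic ξ, k η| ≤ ∫ η, k η := by
      rw [abs_of_nonneg (integral_nonneg_of_ae (ae_restrict_of_ae hk0))]
      exact setIntegral_le_integral hk hk0
    calc |y ξ + (∫ η in Iic ξ, k η) - ξ| = |(y ξ - ξ) + ∫ η in Iic ξ, k η| := by congr 1; ring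
      _ ≤ _ := (abs_add_le _ _).trans (add_le_add (hM ξ) h3)
  · refine (h2.add hk2).ae_eq (Eventually.of_forall fun ξ => ?_)
    simp only [Pi.add_apply]; ring

/-- The relabeled Lagrangian state `Θ ∘ g`, where `g'` is the derivative of `g`. -/
def LagrangianState.relabel (Θ : LagrangianState) (g g' : ℝ → ℝ) : LagrangianState where
  y ξ := Θ.y (g ξ)
  U ξ := Θ.U (g ξ)
  yξ ξ := Θ.yξ (g ξ) * g' ξ
  Uξ ξ := Θ.Uξ (g ξ) * g' ξ
  hbar ξ := Θ.hbar (g ξ) * g' ξ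
  h ξ := Θ.h (g ξ) * g' ξ

namespace IsRelabeling

variable {g g' : ℝ → ℝ}

theorem exists_abs_le (hg : IsRelabeling g g') : ∃ C : ℝ, ∀ ξ, |g' ξ| ≤ C := by
  obtain ⟨c, C, hc, hb⟩ := hg.bounds
  exact ⟨C, fun ξ => by rw [abs_of_pos (hg.pos ξ)]; exact (hb ξ).2⟩

theorem memLp_comp_mul (hg : IsRelabeling g g') {f : ℝ → ℝ} {p : ℝ≥0∞} (hf : MemLp f p volume) :
    MemLp (fun ξ => f (g ξ) * g' ξ) p volume := by
  obtain ⟨C, hC⟩ := hg.exists_abs_le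
  exact memLp_mul_bdd (hg.memLp_comp hf) hg.meas hC

theorem memLp_top_sub_one (hg : IsRelabeling g g') : MemLp (fun ξ => g' ξ - 1) ∞ volume := by
  obtain ⟨c, C, hc, hb⟩ := hg.bounds
  exact memLp_top_of_bounds (c := c - 1) (C := C - 1) (hg.meas.sub_const 1).aestronglyMeasurable
    (Eventually.of_forall fun ξ => ⟨by linarith [(hb ξ).1], by linarith [(hb ξ).2]⟩)

theorem memF (hg : IsRelabeling g g') {Θ : LagrangianState} (hΘ : Θ.MemF) :
    (Θ.relabel g g').MemF := by
  obtain ⟨c, C, hc, hb⟩ := hg.bounds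
  obtain ⟨M, hM⟩ := hg.bdd
  have hgid : MemLp (fun ξ => g ξ - ξ) ∞ volume :=
    memLp_top_of_bound (hg.cont.sub continuous_id).aestronglyMeasurable M (Eventually.of_forall hM)
  have hy := hg.comp_isWeakDeriv hΘ.deriv_y
  have hζ : MemLp (fun ξ => Θ.y (g ξ) - ξ) ∞ volume := by
    refine ((hg.memLp_comp hΘ.ζ_bdd).add hgid).ae_eq (Eventually.of_forall fun ξ => ?_)
    simp
  have hd : ∀ p, MemLp (fun ξ => Θ.yξ ξ - 1) p volume → MemLp (fun ξ => g' ξ - 1) p volume →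
      MemLp (fun ξ => Θ.yξ (g ξ) * g' ξ - 1) p volume := fun p h1 h2 => by
    refine ((hg.memLp_comp_mul h1).add h2).ae_eq (Eventually.of_forall fun ξ => ?_)
    simp only [Pi.add_apply]; ring
  have hh0 : ∀ᵐ ξ, 0 ≤ Θ.h (g ξ) * g' ξ :=
    (hg.ae_comp hΘ.h_nonneg).mono fun ξ h => mul_nonneg h (hg.pos ξ).le
  have hlow : ∃ c : ℝ, 0 < c ∧ ∀ᵐ ξ, c ≤ Θ.yξ (g ξ) * g' ξ + Θ.h (g ξ) * g' ξ := by
    obtain ⟨c₁, hc₁, h⟩ := hΘ.lower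
    refine ⟨c₁ * c, by positivity, (hg.ae_comp h).mono fun ξ h => ?_⟩
    rw [← add_mul]
    exact mul_le_mul h (hb ξ).1 hc.le (hc₁.le.trans h)
  exact
  { deriv_y := hy
    deriv_U := hg.comp_isWeakDeriv hΘ.deriv_U
    ζ_bdd := hζ
    U_two := hg.memLp_comp hΘ.U_two
    U_bdd := hg.memLp_comp hΘ.U_bdd
    ζξ_two := hd 2 hΘ.ζξ_two hg.two
    ζξ_bdd := hd ∞ hΘ.ζξ_bdd hg.memLp_top_sub_one
    Uξ_two := hg.memLp_comp_mul hΘ.Uξ_two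
    Uξ_bdd := hg.memLp_comp_mul hΘ.Uξ_bdd
    h_two := hg.memLp_comp_mul hΘ.h_two
    h_bdd := hg.memLp_comp_mul hΘ.h_bdd
    h_int := hg.integrable_comp hΘ.h_int
    hbar_meas := (hΘ.hbar_meas.comp_quasiMeasurePreserving hg.quasiMeasurePreserving).mul
      hg.meas.aestronglyMeasurable
    yξ_nonneg := (hg.ae_comp hΘ.yξ_nonneg).mono fun ξ h => mul_nonneg h (hg.pos ξ).le
    h_nonneg := hh0
    hbar_nonneg := (hg.ae_comp hΘ.hbar_nonneg).mono fun ξ h => mul_nonneg h (hg.pos ξ).le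
    ζ_lim := by
      have := (hΘ.ζ_lim.comp hg.tendsto_atBot).add hg.lim
      simpa [LagrangianState.relabel, Function.comp_def] using this
    lower := hlow
    energy_rel := (hg.ae_comp hΘ.energy_rel).mono fun ξ h => by
      simp only [LagrangianState.relabel]
      rw [mul_pow, ← h]; ring
    hbar_le := (hg.ae_comp hΘ.hbar_le).mono fun ξ h =>
      mul_le_mul_of_nonneg_right h (hg.pos ξ).le
    relabel := add_integral_mem_relabelingGroup hy hζ (hd 2 hΘ.ζξ_two hg.two)
      (hd ∞ hΘ.ζξ_bdd hg.memLp_top_sub_one) (hg.integrable_comp hΘ.h_int)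
      (hg.memLp_comp_mul hΘ.h_two) (hg.memLp_comp_mul hΘ.h_bdd) hh0 hlow }

/-- The density 2U²y_ξ + h̄ is linear in (y_ξ, h̄) and so picks up exactly one factor g', the
Jacobian of the substitution. -/
theorem relabel_P (hg : IsRelabeling g g') (Θ : LagrangianState) (ξ : ℝ) :
    (Θ.relabel g g').P ξ = Θ.P (g ξ) := by
  simp only [LagrangianState.P, LagrangianState.relabel]
  rw [← hg.integral_comp
    fun η => Real.exp (-|Θ.y (g ξ) - Θ.y η|) * (2 * Θ.U η ^ 2 * Θ.yξ η + Θ.hbar η)]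
  congr 2; ext η; ring

/-- Besides the Jacobian, only the order of labels matters for the sign, and g preserves it. -/
theorem relabel_Q (hg : IsRelabeling g g') (Θ : LagrangianState) (ξ : ℝ) :
    (Θ.relabel g g').Q ξ = Θ.Q (g ξ) := by
  simp only [LagrangianState.Q, LagrangianState.relabel]
  rw [← hg.integral_comp fun x => Real.sign (g ξ - x) * Real.exp (-|Θ.y (g ξ) - Θ.y x|) *
    (2 * Θ.U x ^ 2 * Θ.yξ x + Θ.hbar x)]
  congr 2; ext η
  have : Real.sign (ξ - η) = Real.sign (g ξ - g η) := by
    rcases lt_trichotomy ξ η with h | h | h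
    · rw [Real.sign_of_neg (by linarith), Real.sign_of_neg (by linarith [hg.strictMono h])]
    · subst h; simp
    · rw [Real.sign_of_pos (by linarith), Real.sign_of_pos (by linarith [hg.strictMono h])]
  rw [this]; ring

/-- The measure k(g) g' dξ is pushed by g to k dξ, so the Eulerian state does not see the choice of
labels. -/
theorem isEulerianImage (hg : IsRelabeling g g') {Θ : LagrangianState} {D : EulerianState}
    (hy : Measurable Θ.y) (h : IsEulerianImage Θ D) : IsEulerianImage (Θ.relabel g g') D := by
  have key : ∀ k : ℝ → ℝ,
      (volume.withDensity fun ξ => ENNReal.ofReal (k (g ξ) * g' ξ)).map (fun ξ => Θ.y (g ξ)) =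
        (volume.withDensity fun ξ => ENNReal.ofReal (k ξ)).map Θ.y := fun k => by
    rw [← hg.map_withDensity (fun ξ => ENNReal.ofReal (k ξ)), Measure.map_map hy hg.cont.measurable]
    congr 2
    ext ξ
    rw [mul_comm, ENNReal.ofReal_mul (hg.pos ξ).le]
  exact ⟨fun ξ => h.u_eq (g ξ), by rw [h.μ_eq]; exact (key _).symm,
    by rw [h.ν_eq]; exact (key _).symm⟩

end IsRelabeling

theorem Evolves.mul_const {f k : ℝ → ℝ} (h : Evolves f k) (c : ℝ) :
    Evolves (fun t => f t * c) (fun t => k t * c) := by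
  intro t ht
  refine ⟨(h t ht).1.mul_const c, ?_⟩
  rw [intervalIntegral.integral_mul_const]
  change f t * c = f 0 * c + _
  rw [(h t ht).2]; ring

/-- Along one label a relabeling multiplies y_ξ, h and h̄ by the same positive number, and the rule
is homogeneous. A nonzero factor keeps the breaking times. -/
theorem AlphaEnergyRule.mul_const {α : ℝ} {yξ h hbar : ℝ → ℝ} (H : AlphaEnergyRule α yξ h hbar)
    {c : ℝ} (hc : c ≠ 0) :
    AlphaEnergyRule α (fun t => yξ t * c) (fun t => h t * c) (fun t => hbar t * c) := by
  intro t ht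
  obtain ⟨h1, h2, h3⟩ := H t ht
  refine ⟨h1.mono fun s hs => ?_, fun h0 hy => (h2 h0 (left_ne_zero_of_mul hy)).mono fun s hs => ?_,
    fun h0 hy => ?_⟩
  · simp only [← sub_mul, hs]
  · simp only [← sub_mul, hs]
  · obtain ⟨l, hl, hl'⟩ := h3 h0 ((mul_eq_zero.mp hy).resolve_right hc)
    exact ⟨l * c, hl.mul_const c, by change hbar t * c = _; rw [hl']; ring⟩

theorem IsRelabeling.exists_lagrangianDist_le {g g' : ℝ → ℝ} (hg : IsRelabeling g g') :
    ∃ K : ℝ≥0∞, K ≠ ∞ ∧ ∀ Θ Θ' : LagrangianState, Θ.MemF → Θ'.MemF →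
      lagrangianDist (Θ.relabel g g') (Θ'.relabel g g') ≤ K * lagrangianDist Θ Θ' := by
  obtain ⟨C, hC⟩ := hg.exists_abs_le
  have hC0 : 0 ≤ C := (abs_nonneg _).trans (hC 0)
  obtain ⟨K₂, hK₂, h₂⟩ := hg.exists_eLpNorm_comp_le 2
  obtain ⟨K₃, hK₃, h₃⟩ := hg.exists_eLpNorm_comp_le ∞
  have hmul : ∀ (p : ℝ≥0∞) (K' : ℝ≥0∞), (∀ f : ℝ → ℝ, AEStronglyMeasurable f volume →
      eLpNorm (fun ξ => f (g ξ)) p volume ≤ K' * eLpNorm f p volume) →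
      ∀ f k : ℝ → ℝ, AEStronglyMeasurable f volume → AEStronglyMeasurable k volume →
        eLpNorm (fun ξ => f (g ξ) * g' ξ - k (g ξ) * g' ξ) p volume
          ≤ (ENNReal.ofReal C * K') * eLpNorm (fun ξ => f ξ - k ξ) p volume := by
    intro p K' hK' f k hf hk
    calc _ ≤ ENNReal.ofReal C * eLpNorm (fun ξ => f (g ξ) - k (g ξ)) p volume := by
          refine eLpNorm_le_mul_eLpNorm_of_ae_le_mul (Eventually.of_forall fun ξ => ?_) p
          rw [← sub_mul, norm_mul, mul_comm]
          exact mul_le_mul_of_nonneg_right (hC ξ) (norm_nonneg _)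
      _ ≤ ENNReal.ofReal C * (K' * eLpNorm (fun ξ => f ξ - k ξ) p volume) :=
        mul_le_mul' le_rfl (hK' (fun ξ => f ξ - k ξ) (hf.sub hk))
      _ = _ := (mul_assoc _ _ _).symm
  -- A crude constant dominating K₂, K₃ and their products with C at once.
  set K := (1 + ENNReal.ofReal C) * (K₂ + K₃) with hK
  have e1 : K₂ ≤ K := by
    calc K₂ ≤ 1 * (K₂ + K₃) := by rw [one_mul]; exact le_self_add
      _ ≤ _ := by rw [hK]; gcongr; exact le_self_add
  have e2 : K₃ ≤ K := by
    calc K₃ ≤ 1 * (K₂ + K₃) := by rw [one_mul]; exact le_add_self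
      _ ≤ _ := by rw [hK]; gcongr; exact le_self_add
  have e3 : ENNReal.ofReal C * K₂ ≤ K := by
    rw [hK]; exact mul_le_mul' le_add_self le_self_add
  have e4 : ENNReal.ofReal C * K₃ ≤ K := by
    rw [hK]; exact mul_le_mul' le_add_self le_add_self
  refine ⟨K, ENNReal.mul_ne_top (by simp) (by simp [hK₂, hK₃]), fun Θ Θ' hΘ hΘ' => ?_⟩
  have my : AEStronglyMeasurable (fun ξ => Θ.y ξ - Θ'.y ξ) volume :=
    (hΘ.deriv_y.continuous.sub hΘ'.deriv_y.continuous).aestronglyMeasurable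
  have mU : AEStronglyMeasurable (fun ξ => Θ.U ξ - Θ'.U ξ) volume := hΘ.U_two.1.sub hΘ'.U_two.1
  have m1 := hΘ.deriv_y.1.aestronglyMeasurable
  have m1' := hΘ'.deriv_y.1.aestronglyMeasurable
  have m2 := hΘ.Uξ_two.1
  have m2' := hΘ'.Uξ_two.1
  have m3 := hΘ.h_two.1
  have m3' := hΘ'.h_two.1
  simp only [lagrangianDist, mul_add, LagrangianState.relabel]
  gcongr ?_ + ?_ + ?_ + ?_ + ?_ + ?_ + ?_ + ?_ + ?_
  · exact (h₃ _ my).trans (mul_le_mul' e2 le_rfl)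
  · exact (h₂ _ mU).trans (mul_le_mul' e1 le_rfl)
  · exact (h₃ _ mU).trans (mul_le_mul' e2 le_rfl)
  · exact (hmul 2 K₂ h₂ _ _ m1 m1').trans (mul_le_mul' e3 le_rfl)
  · exact (hmul ∞ K₃ h₃ _ _ m1 m1').trans (mul_le_mul' e4 le_rfl)
  · exact (hmul 2 K₂ h₂ _ _ m2 m2').trans (mul_le_mul' e3 le_rfl)
  · exact (hmul ∞ K₃ h₃ _ _ m2 m2').trans (mul_le_mul' e4 le_rfl)
  · exact (hmul 2 K₂ h₂ _ _ m3 m3').trans (mul_le_mul' e3 le_rfl)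
  · exact (hmul ∞ K₃ h₃ _ _ m3 m3').trans (mul_le_mul' e4 le_rfl)

theorem IsAlphaDissipativeLagrangian.relabel {α : ℝ} {Θ : ℝ → LagrangianState}
    (H : IsAlphaDissipativeLagrangian α Θ) {g g' : ℝ → ℝ} (hg : IsRelabeling g g') :
    IsAlphaDissipativeLagrangian α (fun t => (Θ t).relabel g g') where
  memF t ht := hg.memF (H.memF t ht)
  cont t ht := by
    obtain ⟨K, hK, h⟩ := hg.exists_lagrangianDist_le
    have h0 : Tendsto (fun s => K * lagrangianDist (Θ s) (Θ t)) (𝓝[Ici 0] t) (𝓝 0) := by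
      have := ENNReal.Tendsto.const_mul (H.cont t ht) (Or.inr hK)
      rwa [mul_zero] at this
    refine tendsto_of_tendsto_of_tendsto_of_le_of_le' tendsto_const_nhds h0
      (Eventually.of_forall fun _ => zero_le) ?_
    filter_upwards [self_mem_nhdsWithin] with s hs
    exact h _ _ (H.memF s hs) (H.memF t ht)
  eq_y ξ := H.eq_y (g ξ)
  eq_U ξ := by
    have := H.eq_U (g ξ)
    simp only [hg.relabel_Q]
    exact this
  eq_yξ := (hg.ae_comp H.eq_yξ).mono fun ξ h => h.mul_const (g' ξ)
  eq_Uξ := (hg.ae_comp H.eq_Uξ).mono fun ξ h => by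
    have := h.mul_const (g' ξ)
    simp only [hg.relabel_P]
    refine Eq.mp (congrArg _ (funext fun t => ?_)) this
    simp only [LagrangianState.relabel]; ring
  eq_h := (hg.ae_comp H.eq_h).mono fun ξ h => by
    have := h.mul_const (g' ξ)
    simp only [hg.relabel_P]
    refine Eq.mp (congrArg _ (funext fun t => ?_)) this
    simp only [LagrangianState.relabel]; ring
  energy := (hg.ae_comp H.energy).mono fun ξ h => h.mul_const (hg.pos ξ).ne'

/-! ### Estimates for the nonlocal terms -/

theorem integrable_exp_neg_abs : Integrable (fun x : ℝ => Real.exp (-|x|)) := by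
  rw [← integrableOn_univ, ← Iic_union_Ioi (a := (0 : ℝ))]
  refine IntegrableOn.union ?_ ?_
  · exact integrableOn_exp_Iic 0 |>.congr_fun
      (fun x hx => by rw [abs_of_nonpos hx, neg_neg]) measurableSet_Iic
  · exact (integrableOn_exp_neg_Ioi 0).congr_fun
      (fun x hx => by rw [abs_of_pos hx]) measurableSet_Ioi

/-- Take out the larger exponential and use 1 - e^{-s} ≤ s. Keeping e^{-r} on the right preserves
the decay needed for integration. -/
theorem abs_exp_neg_sub_exp_neg_le {p q r : ℝ} (hp : r ≤ p) (hq : r ≤ q) :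
    |Real.exp (-p) - Real.exp (-q)| ≤ |p - q| * Real.exp (-r) := by
  wlog h : p ≤ q generalizing p q
  · rw [abs_sub_comm, abs_sub_comm p q]
    exact this hq hp (le_of_not_ge h)
  have h1 : Real.exp (-q) ≤ Real.exp (-p) := Real.exp_le_exp.mpr (by linarith)
  rw [abs_of_nonneg (by linarith), abs_of_nonpos (by linarith)]
  have h2 : Real.exp (-q) = Real.exp (-p) * Real.exp (-(q - p)) := by
    rw [← Real.exp_add]; congr 1; ring
  have h3 := Real.add_one_le_exp (-(q - p))
  have h4 : Real.exp (-p) ≤ Real.exp (-r) := Real.exp_le_exp.mpr (by linarith)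
  have h5 := Real.exp_pos (-p)
  rw [h2]
  nlinarith

/-- The total mass of the kernel `e^{-|x|}`. -/
def kernelMass : ℝ := ∫ x : ℝ, Real.exp (-|x|)

theorem kernelMass_nonneg : 0 ≤ kernelMass := integral_nonneg fun _ => (Real.exp_pos _).le

theorem integrable_exp_neg_abs_sub (ξ : ℝ) : Integrable (fun η : ℝ => Real.exp (-|ξ - η|)) :=
  integrable_exp_neg_abs.comp_sub_left ξ

theorem integral_exp_neg_abs_sub (ξ : ℝ) : ∫ η : ℝ, Real.exp (-|ξ - η|) = kernelMass :=
  integral_sub_left_eq_self (fun x => Real.exp (-|x|)) volume ξ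

/-- Since y differs from the identity by at most M, the kernel in y is comparable to the kernel in
the labels. The latter has finite mass however flat y is. -/
theorem exp_neg_abs_sub_le {M ξ η a b : ℝ} (ha : |a - ξ| ≤ M) (hb : |b - η| ≤ M) :
    Real.exp (-|a - b|) ≤ Real.exp (2 * M) * Real.exp (-|ξ - η|) := by
  rw [← Real.exp_add]
  refine Real.exp_le_exp.mpr ?_
  have : |ξ - η| ≤ |a - b| + 2 * M := by
    rw [abs_le] at ha hb
    rw [abs_le]
    constructor <;> cases abs_cases (a - b) <;> linarith
  linarith

theorem abs_exp_neg_abs_sub_le {M β ξ η a b a' b' : ℝ} (ha : |a - ξ| ≤ M) (hb : |b - η| ≤ M)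
    (ha' : |a' - ξ| ≤ M) (hb' : |b' - η| ≤ M) (h1 : |a - a'| ≤ β) (h2 : |b - b'| ≤ β) :
    |Real.exp (-|a - b|) - Real.exp (-|a' - b'|)| ≤
      2 * β * (Real.exp (2 * M) * Real.exp (-|ξ - η|)) := by
  have key : ∀ a b : ℝ, |a - ξ| ≤ M → |b - η| ≤ M → |ξ - η| - 2 * M ≤ |a - b| := by
    intro a b ha hb
    rw [abs_le] at ha hb
    cases abs_cases (a - b) <;> cases abs_cases (ξ - η) <;> linarith
  refine (abs_exp_neg_sub_exp_neg_le (key a b ha hb) (key a' b' ha' hb')).trans ?_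
  rw [← Real.exp_add, show -(|ξ - η| - 2 * M) = 2 * M + -|ξ - η| by ring]
  refine mul_le_mul_of_nonneg_right ?_ (Real.exp_pos _).le
  refine (abs_abs_sub_abs_le_abs_sub _ _).trans ?_
  rw [abs_le] at h1 h2 ⊢
  constructor <;> linarith

/-- The weight σ allows one estimate for both nonlocal terms: σ = 1 for P and a sign for Q. -/
theorem integrable_kernel {y ρ σ : ℝ → ℝ} {M R ξ a : ℝ} (hσ : Measurable σ) (hσ1 : ∀ η, |σ η| ≤ 1)
    (hy : Continuous y) (hρ : AEStronglyMeasurable ρ volume) (hR : ∀ᵐ η, |ρ η| ≤ R)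
    (hM : ∀ η, |y η - η| ≤ M) (ha : |a - ξ| ≤ M) :
    Integrable (fun η => σ η * Real.exp (-|a - y η|) * ρ η) ∧
    |∫ η, σ η * Real.exp (-|a - y η|) * ρ η| ≤ Real.exp (2 * M) * kernelMass * R := by
  have hi : Integrable fun η : ℝ => Real.exp (2 * M) * Real.exp (-|ξ - η|) * R :=
    ((integrable_exp_neg_abs_sub ξ).const_mul _).mul_const _
  have hb : ∀ᵐ η, ‖σ η * Real.exp (-|a - y η|) * ρ η‖ ≤
      Real.exp (2 * M) * Real.exp (-|ξ - η|) * R := by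
    filter_upwards [hR] with η hη
    rw [norm_mul, norm_mul, Real.norm_eq_abs, Real.norm_eq_abs, Real.norm_eq_abs, Real.abs_exp]
    refine mul_le_mul ?_ hη (abs_nonneg _) (by positivity)
    calc |σ η| * Real.exp (-|a - y η|) ≤ 1 * Real.exp (-|a - y η|) :=
          mul_le_mul_of_nonneg_right (hσ1 η) (Real.exp_pos _).le
      _ ≤ _ := by rw [one_mul]; exact exp_neg_abs_sub_le ha (hM η)
  refine ⟨hi.mono' ((hσ.aestronglyMeasurable.mul (by fun_prop)).mul hρ) hb, ?_⟩
  refine (norm_integral_le_of_norm_le hi hb).trans_eq ?_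
  rw [integral_mul_const, integral_const_mul, integral_exp_neg_abs_sub]

/-- Both the change of the kernel and the change of the density retain the factor e^{-|ξ-η|}. So P
and Q are Lipschitz for suprema alone, and the L² norms play no part in the uniqueness argument. -/
theorem abs_integral_kernel_sub_le {y ρ y' ρ' σ : ℝ → ℝ} {M R β β₂ ξ a a' : ℝ} (hσ : Measurable σ)
    (hσ1 : ∀ η, |σ η| ≤ 1) (hβ : 0 ≤ β)
    (hy : Continuous y) (hρ : AEStronglyMeasurable ρ volume) (hR : ∀ᵐ η, |ρ η| ≤ R)
    (hM : ∀ η, |y η - η| ≤ M) (ha : |a - ξ| ≤ M)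
    (hy' : Continuous y') (hρ' : AEStronglyMeasurable ρ' volume) (hR' : ∀ᵐ η, |ρ' η| ≤ R)
    (hM' : ∀ η, |y' η - η| ≤ M) (ha' : |a' - ξ| ≤ M)
    (hd : ∀ᵐ η, |y η - y' η| ≤ β) (hdρ : ∀ᵐ η, |ρ η - ρ' η| ≤ β₂) (hda : |a - a'| ≤ β) :
    |(∫ η, σ η * Real.exp (-|a - y η|) * ρ η) - ∫ η, σ η * Real.exp (-|a' - y' η|) * ρ' η| ≤
      Real.exp (2 * M) * kernelMass * (2 * β * R + β₂) := by
  rw [← integral_sub (integrable_kernel hσ hσ1 hy hρ hR hM ha).1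
    (integrable_kernel hσ hσ1 hy' hρ' hR' hM' ha').1]
  have hi : Integrable fun η : ℝ => Real.exp (2 * M) * Real.exp (-|ξ - η|) * (2 * β * R + β₂) :=
    ((integrable_exp_neg_abs_sub ξ).const_mul _).mul_const _
  rw [← Real.norm_eq_abs]
  refine (norm_integral_le_of_norm_le hi ?_).trans_eq ?_
  · filter_upwards [hR, hR', hd, hdρ] with η h1 h2 h3 h4
    have e1 := abs_exp_neg_abs_sub_le ha (hM η) ha' (hM' η) hda h3
    have e2 := exp_neg_abs_sub_le ha' (hM' η)
    set E := Real.exp (2 * M) * Real.exp (-|ξ - η|) with hE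
    have hE0 : 0 ≤ E := by positivity
    have : σ η * Real.exp (-|a - y η|) * ρ η - σ η * Real.exp (-|a' - y' η|) * ρ' η =
      σ η * ((Real.exp (-|a - y η|) - Real.exp (-|a' - y' η|)) * ρ η
        + Real.exp (-|a' - y' η|) * (ρ η - ρ' η)) := by ring
    rw [this, norm_mul, Real.norm_eq_abs, Real.norm_eq_abs]
    calc _ ≤ 1 * |(Real.exp (-|a - y η|) - Real.exp (-|a' - y' η|)) * ρ η
        + Real.exp (-|a' - y' η|) * (ρ η - ρ' η)| :=
          mul_le_mul_of_nonneg_right (hσ1 η) (abs_nonneg _)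
      _ ≤ 2 * β * E * R + E * β₂ := by
        rw [one_mul]
        refine (abs_add_le _ _).trans (add_le_add ?_ ?_)
        · rw [abs_mul]
          exact mul_le_mul e1 h1 (abs_nonneg _) (by positivity)
        · rw [abs_mul, Real.abs_exp]
          exact mul_le_mul e2 h4 (abs_nonneg _) hE0
      _ = _ := by ring
  · rw [integral_mul_const, integral_const_mul, integral_exp_neg_abs_sub]

/-! ### Continuity in time -/

theorem Evolves.continuousOn {f g : ℝ → ℝ} (h : Evolves f g) : ContinuousOn f (Ici 0) := by
  have key : ∀ T : ℝ, 0 ≤ T → ContinuousOn f (Icc 0 T) := by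
    intro T hT
    have h1 := intervalIntegral.continuousOn_primitive_interval' (h T hT).1 left_mem_uIcc
    rw [uIcc_of_le hT] at h1
    exact (continuousOn_const.add h1).congr fun t ht => (h t ht.1).2
  intro t ht
  have h1 : ContinuousWithinAt f (Icc 0 (t + 1)) t :=
    key (t + 1) (by linarith [mem_Ici.mp ht]) t ⟨ht, by linarith⟩
  refine h1.mono_of_mem_nhdsWithin ?_
  filter_upwards [self_mem_nhdsWithin, mem_nhdsWithin_of_mem_nhds (Iic_mem_nhds (lt_add_one t))]
    with s h2 h3 using ⟨h2, h3⟩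

theorem Evolves.intervalIntegrable {f g : ℝ → ℝ} (h : Evolves f g) {s t : ℝ} (hs : 0 ≤ s)
    (ht : 0 ≤ t) : IntervalIntegrable g volume s t :=
  (h s hs).1.symm.trans (h t ht).1

theorem Evolves.sub_eq {f g : ℝ → ℝ} (h : Evolves f g) {s t : ℝ} (hs : 0 ≤ s) (ht : 0 ≤ t) :
    f t - f s = ∫ r in s..t, g r := by
  rw [(h s hs).2, (h t ht).2, ← intervalIntegral.integral_interval_sub_left (h t ht).1 (h s hs).1]
  ring

/-- Exchanges "for all t" and "for a.e. ξ": countably many times produce one null set, and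
continuity in t covers the other times. -/
theorem ae_forall_abs_le {f : ℝ → ℝ → ℝ} {a b B : ℝ}
    (hc : ∀ᵐ ξ, ContinuousOn (fun t => f t ξ) (Icc a b))
    (hB : ∀ t ∈ Icc a b, ∀ᵐ ξ, |f t ξ| ≤ B) : ∀ᵐ ξ, ∀ t ∈ Icc a b, |f t ξ| ≤ B := by
  obtain ⟨s, hs, hd⟩ := TopologicalSpace.exists_countable_dense (Icc a b)
  have h1 : ∀ᵐ ξ, ∀ t ∈ s, |f t ξ| ≤ B := by
    rw [ae_ball_iff hs]
    exact fun t _ => hB t t.2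
  filter_upwards [h1, hc] with ξ h2 h3 t ht
  have hcl : IsClosed {t : Icc a b | |f t ξ| ≤ B} :=
    isClosed_le (continuousOn_iff_continuous_domRestrict.mp h3).abs continuous_const
  have : (univ : Set (Icc a b)) ⊆ {t : Icc a b | |f t ξ| ≤ B} :=
    hd.closure_eq ▸ hcl.closure_subset_iff.mpr h2
  exact this (mem_univ ⟨t, ht⟩)

/-- One Picard step: integrating C times the n-th term of the exponential series gives the next
term. -/
theorem Evolves.abs_sub_le {f g f' g' : ℝ → ℝ} (h : Evolves f g) (h' : Evolves f' g')
    {T s B C : ℝ} {n : ℕ} (hT : 0 ≤ T) (hs : T ≤ s) (h0 : f T = f' T)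
    (hb : ∀ r ∈ Icc T s, |g r - g' r| ≤ C * (B * (C * (r - T)) ^ n / n.factorial)) :
    |f s - f' s| ≤ B * (C * (s - T)) ^ (n + 1) / (n + 1).factorial := by
  have hs0 := hT.trans hs
  have e1 : f s - f' s = ∫ r in T..s, (g r - g' r) := by
    rw [intervalIntegral.integral_sub (h.intervalIntegrable hT hs0)
      (h'.intervalIntegrable hT hs0), ← h.sub_eq hT hs0, ← h'.sub_eq hT hs0, h0]
    ring
  have hcont : Continuous fun r : ℝ => C * (B * (C * (r - T)) ^ n / n.factorial) := by fun_prop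
  rw [e1, ← Real.norm_eq_abs]
  refine (intervalIntegral.norm_integral_le_of_norm_le hs
    (Eventually.of_forall fun r hr => hb r ⟨hr.1.le, hr.2⟩)
    (hcont.intervalIntegrable _ _)).trans_eq ?_
  have hd : ∀ r ∈ uIcc T s, HasDerivAt
      (fun r : ℝ => B * (C * (r - T)) ^ (n + 1) / ((n + 1).factorial : ℝ))
      (C * (B * (C * (r - T)) ^ n / n.factorial)) r := by
    intro r _
    have h1 : HasDerivAt (fun r : ℝ => C * (r - T)) (C * 1) r :=
      ((hasDerivAt_id r).sub_const T).const_mul C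
    refine (((h1.pow (n + 1)).const_mul B).div_const _).congr_deriv ?_
    rw [Nat.factorial_succ]
    push_cast
    have : (n.factorial : ℝ) ≠ 0 := by positivity
    have : (n : ℝ) + 1 ≠ 0 := by positivity
    field_simp
  rw [intervalIntegral.integral_eq_sub_of_hasDerivAt hd (hcont.intervalIntegrable _ _)]
  simp

/-! ### The energy rule -/

/-- Let τ be the first time at which the gap differs. Absence of breaking carries the old value up
to τ, and constancy on a right neighbourhood carries it beyond τ, a contradiction. The hypothesis at
s may use that the gap has been constant on [T, s); this makes bootstrap arguments possible. -/
theorem AlphaEnergyRule.gap_const {α : ℝ} {yξ h hbar : ℝ → ℝ} (H : AlphaEnergyRule α yξ h hbar)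
    {T T' : ℝ} (hT : 0 ≤ T)
    (hy : ∀ s ∈ Ioc T T', (∀ r ∈ Ico T s, hbar r - h r = hbar T - h T) → yξ s ≠ 0) :
    ∀ s ∈ Icc T T', hbar s - h s = hbar T - h T := by
  by_contra hcon
  push Not at hcon
  obtain ⟨s₀, hs₀, hne⟩ := hcon
  set Z := {s ∈ Icc T T' | hbar s - h s ≠ hbar T - h T} with hZ
  have hbdd : BddBelow Z := ⟨T, fun s hs => hs.1.1⟩
  have hZne : Z.Nonempty := ⟨s₀, hs₀, hne⟩
  set τ := sInf Z with hτ
  have hTτ : T ≤ τ := le_csInf hZne fun s hs => hs.1.1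
  have hτT' : τ ≤ T' := (csInf_le hbdd ⟨hs₀, hne⟩).trans hs₀.2
  have hbefore : ∀ r ∈ Ico T τ, hbar r - h r = hbar T - h T := by
    intro r hr
    by_contra hr'
    exact (not_le.mpr hr.2) (csInf_le hbdd ⟨⟨hr.1, hr.2.le.trans hτT'⟩, hr'⟩)
  have hat : hbar τ - h τ = hbar T - h T := by
    rcases hTτ.eq_or_lt with h1 | h1
    · rw [← h1]
    · have h2 := (H τ (hT.trans hTτ)).2.1 (hT.trans_lt h1) (hy τ ⟨h1, hτT'⟩ hbefore)
      have h3 : ∀ᶠ s in 𝓝[<] τ, s ∈ Ico T τ := by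
        filter_upwards [Ioo_mem_nhdsLT h1] with s hs using ⟨hs.1.le, hs.2⟩
      obtain ⟨s, hs1, hs2⟩ := (h2.and h3).exists
      rw [← hs1, hbefore s hs2]
  have h4 := (H τ (hT.trans hTτ)).1
  obtain ⟨u, hu, hu'⟩ := (mem_nhdsGT_iff_exists_Ioo_subset).mp h4
  obtain ⟨s, hs, hsu⟩ := exists_lt_of_csInf_lt hZne (show sInf Z < u from hu)
  have h5 : τ ≤ s := csInf_le hbdd hs
  rcases h5.eq_or_lt with h6 | h6
  · exact hs.2 (h6 ▸ hat)
  · have : hbar s - h s = hbar τ - h τ := hu' ⟨h6, hsu⟩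
    exact hs.2 (this.trans hat)

/-! ### Bounds for Lagrangian solutions -/

/-- Pointwise bounds of all components of a Lagrangian state. -/
structure LagrangianState.BoundedBy (Θ : LagrangianState) (M ξ : ℝ) : Prop where
  y : |Θ.y ξ - ξ| ≤ M
  U : |Θ.U ξ| ≤ M
  yξ : |Θ.yξ ξ| ≤ M
  Uξ : |Θ.Uξ ξ| ≤ M
  h : |Θ.h ξ| ≤ M

theorem LagrangianState.BoundedBy.mono {Θ : LagrangianState} {M M' ξ : ℝ} (h : Θ.BoundedBy M ξ)
    (hM : M ≤ M') : Θ.BoundedBy M' ξ :=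
  ⟨h.y.trans hM, h.U.trans hM, h.yξ.trans hM, h.Uξ.trans hM, h.h.trans hM⟩

theorem LagrangianState.MemF.exists_bound {Θ : LagrangianState} (hΘ : Θ.MemF) :
    ∃ M, ∀ᵐ ξ, Θ.BoundedBy M ξ := by
  obtain ⟨M₁, h₁⟩ := exists_ae_bound_of_memLp_top hΘ.ζ_bdd
  obtain ⟨M₂, h₂⟩ := exists_ae_bound_of_memLp_top hΘ.U_bdd
  obtain ⟨M₃, h₃⟩ := exists_ae_bound_of_memLp_top hΘ.ζξ_bdd
  obtain ⟨M₄, h₄⟩ := exists_ae_bound_of_memLp_top hΘ.Uξ_bdd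
  obtain ⟨M₅, h₅⟩ := exists_ae_bound_of_memLp_top hΘ.h_bdd
  refine ⟨|M₁| + |M₂| + (|M₃| + 1) + |M₄| + |M₅|, ?_⟩
  filter_upwards [h₁, h₂, h₃, h₄, h₅] with ξ a₁ a₂ a₃ a₄ a₅
  have b₁ := le_abs_self M₁
  have b₂ := le_abs_self M₂
  have b₃ := le_abs_self M₃
  have b₄ := le_abs_self M₄
  have b₅ := le_abs_self M₅
  have c₁ := abs_nonneg M₁
  have c₂ := abs_nonneg M₂
  have c₃ := abs_nonneg M₃
  have c₄ := abs_nonneg M₄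
  have c₅ := abs_nonneg M₅
  have a₃' : |Θ.yξ ξ| ≤ M₃ + 1 := by
    calc |Θ.yξ ξ| = |(Θ.yξ ξ - 1) + 1| := by ring_nf
      _ ≤ |Θ.yξ ξ - 1| + |1| := abs_add_le _ _
      _ ≤ M₃ + 1 := by rw [abs_one]; linarith
  exact ⟨by linarith, by linarith, by linarith, by linarith, by linarith⟩

theorem ae_abs_le_one_of_eLpNorm_lt {f : ℝ → ℝ} (h : eLpNorm f ∞ volume < 1) :
    ∀ᵐ ξ, |f ξ| ≤ 1 := by
  rw [eLpNorm_exponent_top] at h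
  filter_upwards [ae_le_eLpNormEssSup (f := f) (μ := volume)] with x hx
  have := hx.trans h.le
  rw [← Real.norm_eq_abs, ← toReal_enorm]
  exact ENNReal.toReal_mono ENNReal.one_ne_top this

theorem ae_boundedBy_of_lagrangianDist_lt {Θ Θ' : LagrangianState} {M : ℝ}
    (h : ∀ᵐ ξ, Θ'.BoundedBy M ξ) (hd : lagrangianDist Θ Θ' < 1) :
    ∀ᵐ ξ, Θ.BoundedBy (M + 1) ξ := by
  unfold lagrangianDist at hd
  -- The distance is a left-nested sum of nine terms; those numbered 1, 3, 5, 7, 9 are the L^∞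
  -- norms.
  have k9 := lt_of_le_of_lt le_add_self hd
  have r8 := lt_of_le_of_lt le_self_add hd
  have r7 := lt_of_le_of_lt le_self_add r8
  have k7 := lt_of_le_of_lt le_add_self r7
  have r6 := lt_of_le_of_lt le_self_add r7
  have r5 := lt_of_le_of_lt le_self_add r6
  have k5 := lt_of_le_of_lt le_add_self r5
  have r4 := lt_of_le_of_lt le_self_add r5
  have r3 := lt_of_le_of_lt le_self_add r4
  have k3 := lt_of_le_of_lt le_add_self r3
  have r2 := lt_of_le_of_lt le_self_add r3
  have k1 := lt_of_le_of_lt le_self_add r2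
  filter_upwards [h, ae_abs_le_one_of_eLpNorm_lt k1, ae_abs_le_one_of_eLpNorm_lt k3,
    ae_abs_le_one_of_eLpNorm_lt k5, ae_abs_le_one_of_eLpNorm_lt k7,
    ae_abs_le_one_of_eLpNorm_lt k9] with ξ h a1 a3 a5 a7 a9
  obtain ⟨b1, b2, b3, b4, b5⟩ := h
  constructor <;> rw [abs_le] at * <;> constructor <;> linarith

namespace IsAlphaDissipativeLagrangian

variable {α : ℝ} {Θ Θ' : ℝ → LagrangianState}

/-- Each time has a neighbourhood with one bound, by continuity into the Banach space; compactness
of [0, T] does the rest. -/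
theorem exists_bound_Icc (H : IsAlphaDissipativeLagrangian α Θ) (T : ℝ) :
    ∃ M, ∀ s ∈ Icc 0 T, ∀ᵐ ξ, (Θ s).BoundedBy M ξ := by
  refine isCompact_Icc.induction_on (p := fun S => ∃ M, ∀ s ∈ S, ∀ᵐ ξ, (Θ s).BoundedBy M ξ)
    ⟨0, by simp⟩ (fun S S' hS h => h.imp fun M h s hs => h s (hS hs)) ?_ ?_
  · rintro S S' ⟨M, h⟩ ⟨M', h'⟩
    refine ⟨max M M', ?_⟩
    rintro s (hs | hs)
    · exact (h s hs).mono fun ξ h => h.mono (le_max_left _ _)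
    · exact (h' s hs).mono fun ξ h => h.mono (le_max_right _ _)
  · intro t ht
    obtain ⟨M, hM⟩ := (H.memF t ht.1).exists_bound
    have h1 : ∀ᶠ s in 𝓝[Ici 0] t, lagrangianDist (Θ s) (Θ t) < 1 :=
      (H.cont t ht.1).eventually (gt_mem_nhds zero_lt_one)
    have h2 := h1.filter_mono (nhdsWithin_mono t Icc_subset_Ici_self : 𝓝[Icc 0 T] t ≤ _)
    exact ⟨_, h2, M + 1, fun s hs => ae_boundedBy_of_lagrangianDist_lt hM hs⟩

theorem ae_continuousOn (H : IsAlphaDissipativeLagrangian α Θ) : ∀ᵐ ξ,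
    ContinuousOn (fun t => (Θ t).yξ ξ) (Ici 0) ∧ ContinuousOn (fun t => (Θ t).Uξ ξ) (Ici 0) ∧
      ContinuousOn (fun t => (Θ t).h ξ) (Ici 0) := by
  filter_upwards [H.eq_yξ, H.eq_Uξ, H.eq_h] with ξ h1 h2 h3
    using ⟨h1.continuousOn, h2.continuousOn, h3.continuousOn⟩

theorem exists_ae_bound_Icc (H : IsAlphaDissipativeLagrangian α Θ) (T : ℝ) :
    ∃ M, 1 ≤ M ∧ ∀ᵐ ξ, ∀ s ∈ Icc 0 T, (Θ s).BoundedBy M ξ := by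
  obtain ⟨M, hM⟩ := H.exists_bound_Icc T
  have hM' : ∀ s ∈ Icc 0 T, ∀ᵐ ξ, (Θ s).BoundedBy (max M 1) ξ := fun s hs =>
    (hM s hs).mono fun ξ h => h.mono (le_max_left _ _)
  refine ⟨max M 1, le_max_right _ _, ?_⟩
  have hsub : Icc 0 T ⊆ Ici (0 : ℝ) := Icc_subset_Ici_self
  have e1 := ae_forall_abs_le (f := fun t ξ => (Θ t).y ξ - ξ) (a := 0) (b := T)
    (Eventually.of_forall fun ξ => ((H.eq_y ξ).continuousOn.mono hsub).sub continuousOn_const)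
    (fun t ht => (hM' t ht).mono fun ξ h => h.y)
  have e2 := ae_forall_abs_le (f := fun t ξ => (Θ t).U ξ) (a := 0) (b := T)
    (Eventually.of_forall fun ξ => (H.eq_U ξ).continuousOn.mono hsub)
    (fun t ht => (hM' t ht).mono fun ξ h => h.U)
  have e3 := ae_forall_abs_le (f := fun t ξ => (Θ t).yξ ξ) (a := 0) (b := T)
    (H.ae_continuousOn.mono fun ξ h => h.1.mono hsub)
    (fun t ht => (hM' t ht).mono fun ξ h => h.yξ)
  have e4 := ae_forall_abs_le (f := fun t ξ => (Θ t).Uξ ξ) (a := 0) (b := T)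
    (H.ae_continuousOn.mono fun ξ h => h.2.1.mono hsub)
    (fun t ht => (hM' t ht).mono fun ξ h => h.Uξ)
  have e5 := ae_forall_abs_le (f := fun t ξ => (Θ t).h ξ) (a := 0) (b := T)
    (H.ae_continuousOn.mono fun ξ h => h.2.2.mono hsub)
    (fun t ht => (hM' t ht).mono fun ξ h => h.h)
  filter_upwards [e1, e2, e3, e4, e5] with ξ h1 h2 h3 h4 h5 s hs
    using ⟨h1 s hs, h2 s hs, h3 s hs, h4 s hs, h5 s hs⟩

end IsAlphaDissipativeLagrangian

/-! ### Bounds and Lipschitz estimates for `P` and `Q` -/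

/-- The density in the definition of `P` and `Q`. -/
def LagrangianState.density (Θ : LagrangianState) (η : ℝ) : ℝ :=
  2 * Θ.U η ^ 2 * Θ.yξ η + Θ.hbar η

theorem LagrangianState.P_eq (Θ : LagrangianState) (ξ : ℝ) : Θ.P ξ =
    1 / 4 * ∫ η, 1 * Real.exp (-|Θ.y ξ - Θ.y η|) * Θ.density η := by
  simp only [LagrangianState.P, one_mul, LagrangianState.density]

theorem LagrangianState.Q_eq (Θ : LagrangianState) (ξ : ℝ) : Θ.Q ξ =
    -(1 / 4) * ∫ η, Real.sign (ξ - η) * Real.exp (-|Θ.y ξ - Θ.y η|) * Θ.density η := rfl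

theorem measurable_sign_sub (ξ : ℝ) : Measurable fun η : ℝ => Real.sign (ξ - η) := by
  have : Measurable Real.sign := by
    unfold Real.sign
    exact Measurable.ite measurableSet_Iio measurable_const
      (Measurable.ite measurableSet_Ioi measurable_const measurable_const)
  exact this.comp (measurable_const.sub measurable_id)

theorem abs_sign_le (x : ℝ) : |Real.sign x| ≤ 1 := by
  rcases Real.sign_apply_eq x with h | h | h <;> simp [h]

theorem LagrangianState.MemF.density_meas {Θ : LagrangianState} (hΘ : Θ.MemF) :
    AEStronglyMeasurable Θ.density volume :=
  (((hΘ.U_two.1.pow 2).const_mul 2).mul hΘ.deriv_y.1.aestronglyMeasurable).add hΘ.hbar_meas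

theorem LagrangianState.MemF.abs_hbar_le {Θ : LagrangianState} (hΘ : Θ.MemF) {M : ℝ}
    (hM : ∀ᵐ ξ, Θ.BoundedBy M ξ) : ∀ᵐ ξ, |Θ.hbar ξ| ≤ M := by
  filter_upwards [hΘ.hbar_nonneg, hΘ.hbar_le, hM] with ξ h1 h2 h3
  rw [abs_of_nonneg h1]
  exact (h2.trans (le_abs_self _)).trans h3.h

theorem LagrangianState.MemF.abs_density_le {Θ : LagrangianState} (hΘ : Θ.MemF) {M : ℝ}
    (hM : ∀ᵐ ξ, Θ.BoundedBy M ξ) : ∀ᵐ ξ, |Θ.density ξ| ≤ 2 * M ^ 3 + M := by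
  filter_upwards [hΘ.abs_hbar_le hM, hM] with ξ h1 h2
  have hM0 : 0 ≤ M := (abs_nonneg _).trans h1
  have h3 : |2 * Θ.U ξ ^ 2 * Θ.yξ ξ| ≤ 2 * M ^ 3 := by
    rw [abs_mul, abs_mul, abs_pow, abs_two]
    calc 2 * |Θ.U ξ| ^ 2 * |Θ.yξ ξ| ≤ 2 * M ^ 2 * M := by
          gcongr
          · exact h2.U
          · exact h2.yξ
      _ = _ := by ring
  exact (abs_add_le _ _).trans (add_le_add h3 h1)

theorem LagrangianState.MemF.abs_y_sub_le {Θ : LagrangianState} (hΘ : Θ.MemF) {M : ℝ}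
    (hM : ∀ᵐ ξ, Θ.BoundedBy M ξ) (ξ : ℝ) : |Θ.y ξ - ξ| ≤ M :=
  forall_of_ae_of_isClosed
    (isClosed_le (hΘ.deriv_y.continuous.sub continuous_id).abs continuous_const)
    (hM.mono fun _ h => h.y) ξ

/-- The bound for `P` and `Q`. -/
def nonlocalBound (M : ℝ) : ℝ := Real.exp (2 * M) * kernelMass * (2 * M ^ 3 + M)

/-- The Lipschitz constant for `P` and `Q`. -/
def nonlocalLip (M : ℝ) : ℝ :=
  Real.exp (2 * M) * kernelMass * (2 * (2 * M ^ 3 + M) + (6 * M ^ 2 + 1))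

theorem nonlocalBound_nonneg {M : ℝ} (hM : 0 ≤ M) : 0 ≤ nonlocalBound M := by
  have := kernelMass_nonneg
  unfold nonlocalBound; positivity

theorem nonlocalLip_nonneg {M : ℝ} (hM : 0 ≤ M) : 0 ≤ nonlocalLip M := by
  have := kernelMass_nonneg
  unfold nonlocalLip; positivity

theorem abs_quarter_mul_le {x B : ℝ} (h : |x| ≤ B) : |1 / 4 * x| ≤ B := by
  rw [abs_mul, abs_of_pos (by norm_num : (0 : ℝ) < 1 / 4)]
  linarith [abs_nonneg x]

theorem LagrangianState.MemF.abs_P_le {Θ : LagrangianState} (hΘ : Θ.MemF) {M : ℝ}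
    (hM : ∀ᵐ ξ, Θ.BoundedBy M ξ) (ξ : ℝ) : |Θ.P ξ| ≤ nonlocalBound M := by
  rw [Θ.P_eq]
  exact abs_quarter_mul_le (integrable_kernel measurable_const (fun _ => by simp)
    hΘ.deriv_y.continuous hΘ.density_meas (hΘ.abs_density_le hM) (hΘ.abs_y_sub_le hM)
    (hΘ.abs_y_sub_le hM ξ)).2

/-- The difference of all components of two Lagrangian states is at most `β`. -/
structure LagrangianState.Close (Θ Θ' : LagrangianState) (β ξ : ℝ) : Prop where
  y : |Θ.y ξ - Θ'.y ξ| ≤ β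
  U : |Θ.U ξ - Θ'.U ξ| ≤ β
  yξ : |Θ.yξ ξ - Θ'.yξ ξ| ≤ β
  Uξ : |Θ.Uξ ξ - Θ'.Uξ ξ| ≤ β
  h : |Θ.h ξ - Θ'.h ξ| ≤ β

theorem abs_sq_sub_sq_le {x y M β : ℝ} (hx : |x| ≤ M) (hy : |y| ≤ M) (h : |x - y| ≤ β) :
    |x ^ 2 - y ^ 2| ≤ 2 * M * β := by
  rw [sq_sub_sq, abs_mul]
  refine mul_le_mul ((abs_add_le _ _).trans (by linarith)) h (abs_nonneg _) ?_
  linarith [abs_nonneg x]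

theorem abs_mul_sub_mul_le {a b a' b' A B δ ε : ℝ} (ha : |a| ≤ A) (hb' : |b'| ≤ B)
    (h1 : |a - a'| ≤ δ) (h2 : |b - b'| ≤ ε) : |a * b - a' * b'| ≤ A * ε + δ * B := by
  have : a * b - a' * b' = a * (b - b') + (a - a') * b' := by ring
  rw [this]
  refine (abs_add_le _ _).trans (add_le_add ?_ ?_) <;> rw [abs_mul]
  · exact mul_le_mul ha h2 (abs_nonneg _) ((abs_nonneg _).trans ha)
  · exact mul_le_mul h1 hb' (abs_nonneg _) ((abs_nonneg _).trans h1)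

section Lipschitz

variable {Θ Θ' : LagrangianState} {M β : ℝ}

/-- The density contains h̄, which may jump in time. Equality of the gaps replaces the difference of
the h̄ by the difference of the h, which is one of the controlled components. -/
theorem ae_abs_density_sub_le (hM : ∀ᵐ ξ, Θ.BoundedBy M ξ) (hM' : ∀ᵐ ξ, Θ'.BoundedBy M ξ)
    (hc : ∀ᵐ ξ, Θ.Close Θ' β ξ)
    (hgap : ∀ᵐ ξ, Θ.hbar ξ - Θ.h ξ = Θ'.hbar ξ - Θ'.h ξ) :
    ∀ᵐ ξ, |Θ.density ξ - Θ'.density ξ| ≤ (6 * M ^ 2 + 1) * β := by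
  filter_upwards [hM, hM', hc, hgap] with ξ h1 h2 h3 h4
  have e1 := abs_sq_sub_sq_le h1.U h2.U h3.U
  have e0 : |Θ.U ξ ^ 2| ≤ M ^ 2 := by
    rw [abs_pow]; exact pow_le_pow_left₀ (abs_nonneg _) h1.U 2
  have e2 := abs_mul_sub_mul_le e0 h2.yξ e1 h3.yξ
  have e3 : Θ.density ξ - Θ'.density ξ =
      2 * (Θ.U ξ ^ 2 * Θ.yξ ξ - Θ'.U ξ ^ 2 * Θ'.yξ ξ) + (Θ.h ξ - Θ'.h ξ) := by
    simp only [LagrangianState.density]; linarith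
  rw [e3]
  refine (abs_add_le _ _).trans ?_
  rw [abs_mul, abs_two]
  linarith [h3.h]

theorem abs_P_sub_le (hΘ : Θ.MemF) (hΘ' : Θ'.MemF) (hβ : 0 ≤ β)
    (hM : ∀ᵐ ξ, Θ.BoundedBy M ξ) (hM' : ∀ᵐ ξ, Θ'.BoundedBy M ξ) (hc : ∀ᵐ ξ, Θ.Close Θ' β ξ)
    (hgap : ∀ᵐ ξ, Θ.hbar ξ - Θ.h ξ = Θ'.hbar ξ - Θ'.h ξ) {ξ : ℝ} (hξ : |Θ.y ξ - Θ'.y ξ| ≤ β) :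
    |Θ.P ξ - Θ'.P ξ| ≤ nonlocalLip M * β := by
  rw [Θ.P_eq, Θ'.P_eq, ← mul_sub]
  refine (abs_quarter_mul_le (abs_integral_kernel_sub_le (σ := fun _ => 1) measurable_const
    (fun _ => by simp) hβ
    hΘ.deriv_y.continuous hΘ.density_meas (hΘ.abs_density_le hM) (hΘ.abs_y_sub_le hM)
    (hΘ.abs_y_sub_le hM ξ) hΘ'.deriv_y.continuous hΘ'.density_meas (hΘ'.abs_density_le hM')
    (hΘ'.abs_y_sub_le hM') (hΘ'.abs_y_sub_le hM' ξ) (hc.mono fun _ h => h.y)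
    (ae_abs_density_sub_le hM hM' hc hgap) hξ)).trans_eq ?_
  unfold nonlocalLip; ring

theorem abs_Q_sub_le (hΘ : Θ.MemF) (hΘ' : Θ'.MemF) (hβ : 0 ≤ β)
    (hM : ∀ᵐ ξ, Θ.BoundedBy M ξ) (hM' : ∀ᵐ ξ, Θ'.BoundedBy M ξ) (hc : ∀ᵐ ξ, Θ.Close Θ' β ξ)
    (hgap : ∀ᵐ ξ, Θ.hbar ξ - Θ.h ξ = Θ'.hbar ξ - Θ'.h ξ) {ξ : ℝ} (hξ : |Θ.y ξ - Θ'.y ξ| ≤ β) :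
    |Θ.Q ξ - Θ'.Q ξ| ≤ nonlocalLip M * β := by
  rw [Θ.Q_eq, Θ'.Q_eq, ← mul_sub, neg_mul, abs_neg]
  refine (abs_quarter_mul_le (abs_integral_kernel_sub_le (measurable_sign_sub ξ)
    (fun _ => abs_sign_le _) hβ
    hΘ.deriv_y.continuous hΘ.density_meas (hΘ.abs_density_le hM) (hΘ.abs_y_sub_le hM)
    (hΘ.abs_y_sub_le hM ξ) hΘ'.deriv_y.continuous hΘ'.density_meas (hΘ'.abs_density_le hM')
    (hΘ'.abs_y_sub_le hM') (hΘ'.abs_y_sub_le hM' ξ) (hc.mono fun _ h => h.y)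
    (ae_abs_density_sub_le hM hM' hc hgap) hξ)).trans_eq ?_
  unfold nonlocalLip; ring

/-- The Lipschitz constant of the right-hand side of the Lagrangian system. -/
def systemLip (M : ℝ) : ℝ :=
  1 + nonlocalLip M + 2 * ((M ^ 2 + nonlocalBound M) + (2 * M + nonlocalLip M) * M)

theorem systemLip_nonneg (hM : 0 ≤ M) : 0 ≤ systemLip M := by
  have := nonlocalLip_nonneg hM
  have := nonlocalBound_nonneg hM
  unfold systemLip; positivity

/-- P and Q at ξ depend on almost all labels, whereas the other terms depend on ξ itself. Hence the
bounds are assumed both a.e. and at the given label. -/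
theorem abs_rhs_sub_le (hM0 : 0 ≤ M) (hΘ : Θ.MemF) (hΘ' : Θ'.MemF) (hβ : 0 ≤ β)
    (hM : ∀ᵐ ξ, Θ.BoundedBy M ξ) (hM' : ∀ᵐ ξ, Θ'.BoundedBy M ξ) (hc : ∀ᵐ ξ, Θ.Close Θ' β ξ)
    (hgap : ∀ᵐ ξ, Θ.hbar ξ - Θ.h ξ = Θ'.hbar ξ - Θ'.h ξ) {ξ : ℝ} (hξ : Θ.Close Θ' β ξ)
    (hb : Θ.BoundedBy M ξ) (hb' : Θ'.BoundedBy M ξ)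
    (hg : Θ.hbar ξ - Θ.h ξ = Θ'.hbar ξ - Θ'.h ξ) :
    |Θ.U ξ - Θ'.U ξ| ≤ systemLip M * β ∧ |(-Θ.Q ξ) - (-Θ'.Q ξ)| ≤ systemLip M * β ∧
    |Θ.Uξ ξ - Θ'.Uξ ξ| ≤ systemLip M * β ∧
    |(1 / 2 * Θ.hbar ξ + (Θ.U ξ ^ 2 - Θ.P ξ) * Θ.yξ ξ) -
      (1 / 2 * Θ'.hbar ξ + (Θ'.U ξ ^ 2 - Θ'.P ξ) * Θ'.yξ ξ)| ≤ systemLip M * β ∧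
    |2 * (Θ.U ξ ^ 2 - Θ.P ξ) * Θ.Uξ ξ - 2 * (Θ'.U ξ ^ 2 - Θ'.P ξ) * Θ'.Uξ ξ|
      ≤ systemLip M * β := by
  have hP := abs_P_sub_le hΘ hΘ' hβ hM hM' hc hgap hξ.y
  have hQ := abs_Q_sub_le hΘ hΘ' hβ hM hM' hc hgap hξ.y
  have hPb := hΘ.abs_P_le hM ξ
  have e1 := abs_sq_sub_sq_le hb.U hb'.U hξ.U
  have e0 : |Θ.U ξ ^ 2| ≤ M ^ 2 := by
    rw [abs_pow]; exact pow_le_pow_left₀ (abs_nonneg _) hb.U 2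
  have e2 : |Θ.U ξ ^ 2 - Θ.P ξ| ≤ M ^ 2 + nonlocalBound M :=
    (abs_sub _ _).trans (add_le_add e0 hPb)
  have e3 : |(Θ.U ξ ^ 2 - Θ.P ξ) - (Θ'.U ξ ^ 2 - Θ'.P ξ)| ≤ 2 * M * β + nonlocalLip M * β := by
    have : (Θ.U ξ ^ 2 - Θ.P ξ) - (Θ'.U ξ ^ 2 - Θ'.P ξ) =
      (Θ.U ξ ^ 2 - Θ'.U ξ ^ 2) - (Θ.P ξ - Θ'.P ξ) := by ring
    rw [this]
    exact (abs_sub _ _).trans (add_le_add e1 hP)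
  have e4 := abs_mul_sub_mul_le e2 hb'.yξ e3 hξ.yξ
  have e5 := abs_mul_sub_mul_le e2 hb'.Uξ e3 hξ.Uξ
  have n1 : 0 ≤ nonlocalLip M * β := mul_nonneg (nonlocalLip_nonneg hM0) hβ
  have n2 : 0 ≤ (M ^ 2 + nonlocalBound M) * β :=
    mul_nonneg (add_nonneg (sq_nonneg _) (nonlocalBound_nonneg hM0)) hβ
  have n3 : 0 ≤ (2 * M * β + nonlocalLip M * β) * M :=
    mul_nonneg (add_nonneg (by positivity) n1) hM0
  have hs : systemLip M * β = β + nonlocalLip M * β + 2 * ((M ^ 2 + nonlocalBound M) * β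
      + (2 * M * β + nonlocalLip M * β) * M) := by unfold systemLip; ring
  refine ⟨?_, ?_, ?_, ?_, ?_⟩
  · linarith [hξ.U]
  · rw [neg_sub_neg, abs_sub_comm]; linarith
  · linarith [hξ.Uξ]
  · have : (1 / 2 * Θ.hbar ξ + (Θ.U ξ ^ 2 - Θ.P ξ) * Θ.yξ ξ) -
      (1 / 2 * Θ'.hbar ξ + (Θ'.U ξ ^ 2 - Θ'.P ξ) * Θ'.yξ ξ) =
      1 / 2 * (Θ.h ξ - Θ'.h ξ) + ((Θ.U ξ ^ 2 - Θ.P ξ) * Θ.yξ ξ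
        - (Θ'.U ξ ^ 2 - Θ'.P ξ) * Θ'.yξ ξ) := by linarith
    rw [this]
    refine (abs_add_le _ _).trans ?_
    rw [abs_mul, abs_of_pos (by norm_num : (0 : ℝ) < 1 / 2)]
    linarith [hξ.h]
  · have : 2 * (Θ.U ξ ^ 2 - Θ.P ξ) * Θ.Uξ ξ - 2 * (Θ'.U ξ ^ 2 - Θ'.P ξ) * Θ'.Uξ ξ =
      2 * ((Θ.U ξ ^ 2 - Θ.P ξ) * Θ.Uξ ξ - (Θ'.U ξ ^ 2 - Θ'.P ξ) * Θ'.Uξ ξ) := by ring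
    rw [this, abs_mul, abs_two]
    linarith

end Lipschitz

/-! ### Uniqueness -/

/-- All components of two Lagrangian states agree at a point. -/
structure LagrangianState.EqAt (Θ Θ' : LagrangianState) (ξ : ℝ) : Prop where
  y : Θ.y ξ = Θ'.y ξ
  U : Θ.U ξ = Θ'.U ξ
  yξ : Θ.yξ ξ = Θ'.yξ ξ
  Uξ : Θ.Uξ ξ = Θ'.Uξ ξ
  h : Θ.h ξ = Θ'.h ξ
  hbar : Θ.hbar ξ = Θ'.hbar ξ

namespace IsAlphaDissipativeLagrangian

variable {α : ℝ} {Θ Θ' : ℝ → LagrangianState}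

/-- Picard iteration on the difference. The a priori bound 2M improves at the n-th round to 2M (C(s
- T))ⁿ / n!, which tends to 0. -/
theorem eqAt_of_gap_eq (H : IsAlphaDissipativeLagrangian α Θ)
    (H' : IsAlphaDissipativeLagrangian α Θ') {T T' : ℝ} (hT : 0 ≤ T)
    (h0 : ∀ᵐ ξ, (Θ T).EqAt (Θ' T) ξ)
    (hgap : ∀ᵐ ξ, ∀ s ∈ Icc T T', (Θ s).hbar ξ - (Θ s).h ξ = (Θ' s).hbar ξ - (Θ' s).h ξ) :
    ∀ᵐ ξ, ∀ s ∈ Icc T T', (Θ s).EqAt (Θ' s) ξ := by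
  obtain ⟨M₁, hM₁, hb₁⟩ := H.exists_ae_bound_Icc T'
  obtain ⟨M₂, hM₂, hb₂⟩ := H'.exists_ae_bound_Icc T'
  set M := max M₁ M₂ with hMdef
  have hM1 : 1 ≤ M := hM₁.trans (le_max_left _ _)
  have hM0 : 0 ≤ M := zero_le_one.trans hM1
  have hsub : Icc T T' ⊆ Icc 0 T' := Icc_subset_Icc_left hT
  have hb : ∀ᵐ ξ, ∀ s ∈ Icc T T', (Θ s).BoundedBy M ξ :=
    hb₁.mono fun ξ h s hs => (h s (hsub hs)).mono (le_max_left _ _)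
  have hb' : ∀ᵐ ξ, ∀ s ∈ Icc T T', (Θ' s).BoundedBy M ξ :=
    hb₂.mono fun ξ h s hs => (h s (hsub hs)).mono (le_max_right _ _)
  have hslice : ∀ {p : ℝ → ℝ → Prop}, (∀ᵐ ξ, ∀ s ∈ Icc T T', p s ξ) →
      ∀ s ∈ Icc T T', ∀ᵐ ξ, p s ξ := fun h s hs => h.mono fun ξ h => h s hs
  set C := systemLip M with hC
  have hC0 : 0 ≤ C := systemLip_nonneg hM0
  have hclose : ∀ n : ℕ, ∀ᵐ ξ, ∀ s ∈ Icc T T',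
      (Θ s).Close (Θ' s) (2 * M * (C * (s - T)) ^ n / n.factorial) ξ := by
    intro n
    induction n with
    | zero =>
      filter_upwards [hb, hb'] with ξ h1 h2 s hs
      simp only [pow_zero, mul_one, Nat.factorial_zero, Nat.cast_one, div_one]
      have a := h1 s hs
      have b := h2 s hs
      refine ⟨?_, ?_, ?_, ?_, ?_⟩
      · have := abs_sub ((Θ s).y ξ - ξ) ((Θ' s).y ξ - ξ)
        rw [sub_sub_sub_cancel_right] at this
        linarith [a.y, b.y]
      · exact (abs_sub _ _).trans (by linarith [a.U, b.U])
      · exact (abs_sub _ _).trans (by linarith [a.yξ, b.yξ])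
      · exact (abs_sub _ _).trans (by linarith [a.Uξ, b.Uξ])
      · exact (abs_sub _ _).trans (by linarith [a.h, b.h])
    | succ n ih =>
      filter_upwards [hb, hb', ih, hgap, h0, H.eq_yξ, H.eq_Uξ, H.eq_h, H'.eq_yξ, H'.eq_Uξ,
        H'.eq_h] with ξ h1 h2 h3 h4 h5 e1 e2 e3 e1' e2' e3' s hs
      have hr : ∀ r ∈ Icc T s, _ := fun r hr =>
        have hr' : r ∈ Icc T T' := ⟨hr.1, hr.2.trans hs.2⟩
        have hr0 : 0 ≤ r := hT.trans hr.1
        abs_rhs_sub_le (β := 2 * M * (C * (r - T)) ^ n / n.factorial) hM0 (H.memF r hr0)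
          (H'.memF r hr0)
          (by have := sub_nonneg.mpr hr.1; positivity) (hslice hb r hr') (hslice hb' r hr')
          (hslice ih r hr') (hslice hgap r hr') (h3 r hr') (h1 r hr') (h2 r hr') (h4 r hr')
      exact
        ⟨(H.eq_y ξ).abs_sub_le (H'.eq_y ξ) hT hs.1 h5.y fun r h => (hr r h).1,
        (H.eq_U ξ).abs_sub_le (H'.eq_U ξ) hT hs.1 h5.U fun r h => (hr r h).2.1,
        e1.abs_sub_le e1' hT hs.1 h5.yξ fun r h => (hr r h).2.2.1,
        e2.abs_sub_le e2' hT hs.1 h5.Uξ fun r h => (hr r h).2.2.2.1,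
        e3.abs_sub_le e3' hT hs.1 h5.h fun r h => (hr r h).2.2.2.2⟩
  have hall := ae_all_iff.mpr hclose
  filter_upwards [hall, hgap] with ξ h1 h2 s hs
  have hlim : Tendsto (fun n : ℕ => 2 * M * (C * (s - T)) ^ n / n.factorial) atTop (𝓝 0) := by
    have := (FloorSemiring.tendsto_pow_div_factorial_atTop (C * (s - T))).const_mul (2 * M)
    rw [mul_zero] at this
    simpa only [mul_div_assoc] using this
  have hz : ∀ {a b : ℝ}, (∀ n : ℕ, |a - b| ≤ 2 * M * (C * (s - T)) ^ n / n.factorial) →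
      a = b := fun h => by
    have h3 := ge_of_tendsto' hlim h
    exact sub_eq_zero.mp (abs_eq_zero.mp (le_antisymm h3 (abs_nonneg _)))
  have hh := hz fun n => (h1 n s hs).h
  exact ⟨hz fun n => (h1 n s hs).y, hz fun n => (h1 n s hs).U, hz fun n => (h1 n s hs).yξ,
    hz fun n => (h1 n s hs).Uξ, hh, by linarith [h2 s hs]⟩

theorem eqAt_of_not_breaking (H : IsAlphaDissipativeLagrangian α Θ)
    (H' : IsAlphaDissipativeLagrangian α Θ') {T T' : ℝ} (hT : 0 ≤ T)
    (h0 : ∀ᵐ ξ, (Θ T).EqAt (Θ' T) ξ)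
    (hb : ∀ᵐ ξ, ∀ s ∈ Ioc T T', (Θ s).yξ ξ ≠ 0) (hb' : ∀ᵐ ξ, ∀ s ∈ Ioc T T', (Θ' s).yξ ξ ≠ 0) :
    ∀ᵐ ξ, ∀ s ∈ Icc T T', (Θ s).EqAt (Θ' s) ξ := by
  refine H.eqAt_of_gap_eq H' hT h0 ?_
  filter_upwards [h0, hb, hb', H.energy, H'.energy] with ξ e a a' r r' s hs
  rw [r.gap_const hT (fun s hs _ => a s hs) s hs, r'.gap_const hT (fun s hs _ => a' s hs) s hs,
    e.hbar, e.h]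

theorem exists_lipschitz_yξ (H : IsAlphaDissipativeLagrangian α Θ) (T : ℝ) :
    ∃ M, 1 ≤ M ∧ ∀ᵐ ξ, ∀ s t, 0 ≤ s → s ≤ t → t ≤ T →
      |(Θ t).yξ ξ - (Θ s).yξ ξ| ≤ M * (t - s) := by
  obtain ⟨M, hM, hb⟩ := H.exists_ae_bound_Icc T
  refine ⟨M, hM, ?_⟩
  filter_upwards [hb, H.eq_yξ] with ξ h1 h2 s t hs hst ht
  rw [h2.sub_eq hs (hs.trans hst), ← Real.norm_eq_abs]
  refine (intervalIntegral.norm_integral_le_of_norm_le_const (C := M) fun r hr => ?_).trans_eq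
    (by rw [abs_of_nonneg (sub_nonneg.mpr hst)])
  rw [uIoc_of_le hst] at hr
  exact (h1 r ⟨hs.trans hr.1.le, hr.2.trans ht⟩).Uξ

/-- Only Θ' is assumed to stay away from breaking. Once the two agree at a time, y_ξ of Θ is at
least c there and, being Lipschitz in time, positive for a further time δ. So Θ cannot break either,
agreement propagates, and the bound c is restored for the next step. -/
theorem eqAt_of_le_yξ (H : IsAlphaDissipativeLagrangian α Θ)
    (H' : IsAlphaDissipativeLagrangian α Θ') {T T' : ℝ} (hT : 0 ≤ T) (hTT' : T ≤ T')
    (h0 : ∀ᵐ ξ, (Θ T).EqAt (Θ' T) ξ) {c : ℝ} (hc : 0 < c)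
    (hb' : ∀ᵐ ξ, ∀ s ∈ Icc T T', c ≤ (Θ' s).yξ ξ) :
    ∀ᵐ ξ, ∀ s ∈ Icc T T', (Θ s).EqAt (Θ' s) ξ := by
  obtain ⟨M, hM, hlip⟩ := H.exists_lipschitz_yξ T'
  set δ := c / (2 * M) with hδ
  have hδ0 : 0 < δ := by positivity
  have key : ∀ n : ℕ, ∀ᵐ ξ, ∀ s ∈ Icc T (min (T + n * δ) T'), (Θ s).EqAt (Θ' s) ξ := by
    intro n
    induction n with
    | zero =>
      filter_upwards [h0] with ξ h s hs
      have h1 : s = T := by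
        refine le_antisymm (hs.2.trans ((min_le_left _ _).trans_eq (by simp))) hs.1
      rwa [h1]
    | succ n ih =>
      set S₀ := min (T + n * δ) T' with hS₀
      have hTS : T ≤ S₀ := le_min (by have : 0 ≤ n * δ := by positivity
                                      linarith) hTT'
      have hS₁ : min (T + (n + 1 : ℕ) * δ) T' ≤ S₀ + δ := by
        push_cast
        rcases min_cases (T + n * δ) T' with h | h
        · rw [hS₀, h.1]; exact (min_le_left _ _).trans (by linarith)
        · rw [hS₀, h.1]; exact (min_le_right _ _).trans (by linarith)
      have hstart : ∀ᵐ ξ, (Θ S₀).EqAt (Θ' S₀) ξ := ih.mono fun ξ h => h S₀ ⟨hTS, le_rfl⟩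
      have hnext := H.eqAt_of_not_breaking H' (hT.trans hTS)
        (T' := min (T + (n + 1 : ℕ) * δ) T') hstart ?_ ?_
      · filter_upwards [ih, hnext] with ξ h1 h2 s hs
        rcases le_total s S₀ with h | h
        · exact h1 s ⟨hs.1, h⟩
        · exact h2 s ⟨h, hs.2⟩
      · filter_upwards [hlip, hstart, hb'] with ξ h1 h2 h3 s hs
        have hsT' : s ≤ T' := hs.2.trans (min_le_right _ _)
        have h4 := h1 S₀ s (hT.trans hTS) hs.1.le hsT'
        have h5 := h3 S₀ ⟨hTS, min_le_right _ _⟩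
        rw [← h2.yξ] at h5
        have h6 : M * (s - S₀) ≤ c / 2 := by
          calc M * (s - S₀) ≤ M * δ := by
                have : s ≤ S₀ + δ := hs.2.trans hS₁
                gcongr; linarith
            _ = c / 2 := by rw [hδ]; field_simp
        have h7 := (abs_le.mp h4).1
        have : 0 < (Θ s).yξ ξ := by linarith
        exact this.ne'
      · filter_upwards [hb'] with ξ h s hs
        exact (hc.trans_le (h s ⟨hTS.trans hs.1.le, hs.2.trans (min_le_right _ _)⟩)).ne'
  obtain ⟨n, hn⟩ := exists_nat_ge ((T' - T) / δ)
  filter_upwards [key n] with ξ h s hs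
  refine h s ⟨hs.1, le_min ?_ hs.2⟩
  have : T' - T ≤ n * δ := by rwa [div_le_iff₀ hδ0] at hn
  linarith [hs.2]

/-- The components other than h̄ agree at T by continuity. For h̄, either the label breaks and both
values are 1 - α times the same left limit, or both gaps are constant just before T. -/
theorem eqAt_of_forall_lt (H : IsAlphaDissipativeLagrangian α Θ)
    (H' : IsAlphaDissipativeLagrangian α Θ') {T : ℝ} (hT : 0 < T)
    (h : ∀ᵐ ξ, ∀ s ∈ Ico 0 T, (Θ s).EqAt (Θ' s) ξ) : ∀ᵐ ξ, (Θ T).EqAt (Θ' T) ξ := by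
  have hev : ∀ᶠ s in 𝓝[<] T, s ∈ Ico 0 T := by
    filter_upwards [Ioo_mem_nhdsLT hT] with s hs using ⟨hs.1.le, hs.2⟩
  have hle : 𝓝[<] T ≤ 𝓝[Ici 0] T :=
    nhdsWithin_le_of_mem (mem_of_superset hev fun s hs => hs.1)
  have hlim : ∀ {f f' : ℝ → ℝ}, ContinuousOn f (Ici 0) → ContinuousOn f' (Ici 0) →
      (∀ s ∈ Ico 0 T, f s = f' s) → f T = f' T := by
    intro f f' hf hf' he
    refine tendsto_nhds_unique_of_eventuallyEq ((hf T hT.le).tendsto.mono_left hle)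
      ((hf' T hT.le).tendsto.mono_left hle) (hev.mono he)
  filter_upwards [h, H.ae_continuousOn, H'.ae_continuousOn, H.energy, H'.energy]
    with ξ h1 c c' r r'
  have ey := hlim (H.eq_y ξ).continuousOn (H'.eq_y ξ).continuousOn fun s hs => (h1 s hs).y
  have eU := hlim (H.eq_U ξ).continuousOn (H'.eq_U ξ).continuousOn fun s hs => (h1 s hs).U
  have eyξ := hlim c.1 c'.1 fun s hs => (h1 s hs).yξ
  have eUξ := hlim c.2.1 c'.2.1 fun s hs => (h1 s hs).Uξ
  have eh := hlim c.2.2 c'.2.2 fun s hs => (h1 s hs).h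
  refine ⟨ey, eU, eyξ, eUξ, eh, ?_⟩
  by_cases hz : (Θ T).yξ ξ = 0
  · obtain ⟨l, hl, hl'⟩ := (r T hT.le).2.2 hT hz
    obtain ⟨m, hm, hm'⟩ := (r' T hT.le).2.2 hT (eyξ.symm.trans hz)
    have : l = m := tendsto_nhds_unique_of_eventuallyEq hl hm (hev.mono fun s hs => (h1 s hs).hbar)
    exact hl'.trans (this ▸ hm'.symm)
  · have g1 := (r T hT.le).2.1 hT hz
    have g2 := (r' T hT.le).2.1 hT (fun h => hz (eyξ.trans h))
    obtain ⟨s, ⟨a1, a2⟩, a3⟩ := ((g1.and g2).and hev).exists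
    have b1 := (h1 s a3).hbar
    have b2 := (h1 s a3).h
    linarith

/-- A label with y_ξ ≥ c cannot reach 0 quickly. A label with y_ξ = 0 has U_ξ = 0 by the energy
relation, and its remaining energy h̄ ≥ c makes U_ξ grow at rate at least c/4, so y_ξ becomes
positive immediately. As c does not depend on the label, one δ serves for almost all of them. -/
theorem exists_not_breaking_after (H : IsAlphaDissipativeLagrangian α Θ) {T c : ℝ} (hT : 0 ≤ T)
    (hc : 0 < c)
    (hstart : ∀ᵐ ξ, c ≤ (Θ T).yξ ξ ∨ ((Θ T).yξ ξ = 0 ∧ c ≤ (Θ T).hbar ξ)) :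
    ∃ δ > 0, ∀ᵐ ξ, ∀ s ∈ Icc T (T + δ), (Θ s).hbar ξ - (Θ s).h ξ = (Θ T).hbar ξ - (Θ T).h ξ := by
  obtain ⟨M, hM, hb⟩ := H.exists_ae_bound_Icc (T + 1)
  obtain ⟨M', hM', hlip⟩ := H.exists_lipschitz_yξ (T + 1)
  set N := M ^ 2 + nonlocalBound M with hN
  have hM0 : 0 ≤ M := zero_le_one.trans hM
  have hN0 : 0 < N := add_pos_of_pos_of_nonneg (by positivity) (nonlocalBound_nonneg hM0)
  -- Chosen so that δ ≤ c/K makes each of 8NMδ, 8NM'δ and 8M'δ at most c.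
  set K := 8 * (N * M + N * M' + M') with hK
  have hK0 : 0 < K := by positivity
  set δ := min 1 (c / K) with hδ
  have hδ0 : 0 < δ := lt_min one_pos (by positivity)
  have hδ1 : δ ≤ 1 := min_le_left _ _
  have hδK : δ * K ≤ c := by
    have : δ ≤ c / K := min_le_right _ _
    rwa [le_div_iff₀ hK0] at this
  refine ⟨δ, hδ0, ?_⟩
  filter_upwards [hstart, hb, hlip, H.eq_yξ, H.eq_Uξ, H.eq_h, H.energy,
    (H.memF T hT).energy_rel] with ξ h1 h2 h3 e1 e2 e3 r h4
  have hP : ∀ s ∈ Icc T (T + δ), |(Θ s).U ξ ^ 2 - (Θ s).P ξ| ≤ N := by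
    intro s hs
    have hs' : s ∈ Icc 0 (T + 1) := ⟨hT.trans hs.1, hs.2.trans (by linarith)⟩
    have a1 := (H.memF s hs'.1).abs_P_le (hb.mono fun ξ h => h s hs') ξ
    refine (abs_sub _ _).trans (add_le_add ?_ a1)
    rw [abs_pow]; exact pow_le_pow_left₀ (abs_nonneg _) (h2 s hs').U 2
  refine r.gap_const hT fun s hs hgap => ?_
  have hs1 : s ≤ T + 1 := hs.2.trans (by linarith)
  have hsT : s - T ≤ δ := by linarith [hs.2]
  have hTs : 0 < s - T := sub_pos.mpr hs.1
  have hd1 : δ * (8 * (N * M)) ≤ c := hδK.trans' (by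
    rw [hK]; gcongr; linarith [mul_pos hN0 (zero_lt_one.trans_le hM')])
  have hd2 : δ * (8 * (N * M')) ≤ c := hδK.trans' (by
    rw [hK]; gcongr; linarith [mul_nonneg hN0.le hM0])
  have hd3 : δ * (8 * M') ≤ c := hδK.trans' (by
    rw [hK]; gcongr; linarith [mul_nonneg hN0.le hM0, mul_pos hN0 (zero_lt_one.trans_le hM')])
  rcases h1 with h1 | ⟨h1, h1'⟩
  · have a1 := (abs_le.mp (h3 T s hT hs.1.le hs1)).1
    have a2 : M' * (s - T) ≤ M' * δ := by gcongr
    have : 0 < (Θ s).yξ ξ := by linarith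
    exact this.ne'
  · have hU0 : (Θ T).Uξ ξ = 0 := by
      rw [h1, zero_mul] at h4
      exact pow_eq_zero_iff (two_ne_zero) |>.mp h4.symm
    -- While the gap is constant, h̄ changes exactly as h does, so h̄ ≥ c - 2NMδ ≥ 3c/4. The second
    -- summand costs at most NM'δ ≤ c/8, which leaves c/4.
    have hder : ∀ q ∈ Ico T s, c / 4 ≤
        1 / 2 * (Θ q).hbar ξ + ((Θ q).U ξ ^ 2 - (Θ q).P ξ) * (Θ q).yξ ξ := by
      intro q hq
      have hq' : q ∈ Icc T (T + δ) := ⟨hq.1, hq.2.le.trans hs.2⟩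
      have hq1 : q ≤ T + 1 := hq.2.le.trans hs1
      have hqδ : q - T ≤ δ := by linarith [hq'.2]
      have hqT : 0 ≤ q - T := sub_nonneg.mpr hq.1
      have b1 := h3 T q hT hq.1 hq1
      rw [h1, sub_zero] at b1
      have b2 : |((Θ q).U ξ ^ 2 - (Θ q).P ξ) * (Θ q).yξ ξ| ≤ N * (M' * δ) := by
        rw [abs_mul]
        refine mul_le_mul (hP q hq') (b1.trans ?_) (abs_nonneg _) hN0.le
        gcongr
      have b3 : |(Θ q).h ξ - (Θ T).h ξ| ≤ 2 * N * M * δ := by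
        rw [e3.sub_eq hT (hT.trans hq.1), ← Real.norm_eq_abs]
        refine (intervalIntegral.norm_integral_le_of_norm_le_const (C := 2 * N * M)
          fun p hp => ?_).trans ?_
        · rw [uIoc_of_le hq.1] at hp
          have hp' : p ∈ Icc T (T + δ) := ⟨hp.1.le, hp.2.trans hq'.2⟩
          rw [norm_mul, norm_mul, Real.norm_eq_abs, Real.norm_eq_abs, Real.norm_eq_abs, abs_two]
          refine mul_le_mul ?_ (h2 p ⟨hT.trans hp.1.le, hp.2.trans hq1⟩).Uξ (abs_nonneg _)
            (by positivity)
          linarith [hP p hp']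
        · rw [abs_of_nonneg hqT]; gcongr
      have b4 := hgap q hq
      have b5 := (abs_le.mp b2).1
      have b6 := (abs_le.mp b3).1
      nlinarith
    have hUpos : ∀ q ∈ Icc T s, c / 4 * (q - T) ≤ (Θ q).Uξ ξ := by
      intro q hq
      have b1 := e2.sub_eq hT (hT.trans hq.1)
      rw [hU0, sub_zero] at b1
      rw [b1]
      have b2 : ∫ _ in T..q, c / 4 = c / 4 * (q - T) := by simp; ring
      rw [← b2]
      exact intervalIntegral.integral_mono_on_of_le_Ioo hq.1 (by simp)
        (e2.intervalIntegrable hT (hT.trans hq.1))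
        fun p hp => hder p ⟨hp.1.le, hp.2.trans_le hq.2⟩
    have b1 := e1.sub_eq hT (hT.trans hs.1.le)
    rw [h1, sub_zero] at b1
    have b2 : 0 < ∫ q in T..s, (Θ q).Uξ ξ := by
      have hlow : 0 < ∫ q in T..s, c / 4 * (q - T) := by
        refine intervalIntegral.intervalIntegral_pos_of_pos_on
          (Continuous.intervalIntegrable (by fun_prop) _ _) (fun q hq => ?_) hs.1
        have := sub_pos.mpr hq.1
        positivity
      refine hlow.trans_le (intervalIntegral.integral_mono_on hs.1.le
        (Continuous.intervalIntegrable (by fun_prop) _ _)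
        (e1.intervalIntegrable hT (hT.trans hs.1.le)) hUpos)
    rw [← b1] at b2
    exact b2.ne'

/-- Two `α`-dissipative solutions with the same initial data agree, provided that one of them
breaks at a single time only, in a controlled way. -/
theorem eqAt_of_single_breaking (H : IsAlphaDissipativeLagrangian α Θ)
    (H' : IsAlphaDissipativeLagrangian α Θ') {t₀ : ℝ} (ht₀ : 0 < t₀)
    (h0 : ∀ᵐ ξ, (Θ 0).EqAt (Θ' 0) ξ)
    (hbefore : ∀ T, 0 ≤ T → T < t₀ → ∃ c > 0, ∀ᵐ ξ, ∀ s ∈ Icc 0 T, c ≤ (Θ' s).yξ ξ)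
    (hat : ∃ c > 0, ∀ᵐ ξ, c ≤ (Θ' t₀).yξ ξ ∨ ((Θ' t₀).yξ ξ = 0 ∧ c ≤ (Θ' t₀).hbar ξ))
    (hafter : ∀ S T, t₀ < S → S ≤ T → ∃ c > 0, ∀ᵐ ξ, ∀ s ∈ Icc S T, c ≤ (Θ' s).yξ ξ) :
    ∀ᵐ ξ, ∀ t, 0 ≤ t → (Θ t).EqAt (Θ' t) ξ := by
  have h1 : ∀ᵐ ξ, ∀ s ∈ Ico 0 t₀, (Θ s).EqAt (Θ' s) ξ := by
    -- The lower bound on y_ξ degenerates at t₀, so [0, t₀) is exhausted by countably many closed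
    -- intervals.
    have : ∀ n : ℕ, ∀ᵐ ξ, ∀ s ∈ Icc 0 (t₀ - t₀ / (n + 1)), (Θ s).EqAt (Θ' s) ξ := by
      intro n
      have hn : (0 : ℝ) < t₀ / (n + 1) := by positivity
      have hn' : t₀ / (n + 1) ≤ t₀ := div_le_self ht₀.le (by linarith [n.cast_nonneg (α := ℝ)])
      obtain ⟨c, hc, hb⟩ := hbefore (t₀ - t₀ / (n + 1)) (by linarith) (by linarith)
      exact H.eqAt_of_le_yξ H' le_rfl (by linarith) h0 hc hb
    filter_upwards [ae_all_iff.mpr this] with ξ h s hs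
    obtain ⟨n, hn⟩ := exists_nat_gt (t₀ / (t₀ - s))
    refine h n s ⟨hs.1, ?_⟩
    have hs' : 0 < t₀ - s := sub_pos.mpr hs.2
    rw [div_lt_iff₀ hs'] at hn
    have : t₀ / (n + 1) ≤ t₀ - s := by
      rw [div_le_iff₀ (by positivity)]; linarith
    linarith
  have h2 := H.eqAt_of_forall_lt H' ht₀ h1
  obtain ⟨c, hc, hat⟩ := hat
  obtain ⟨δ₁, hδ₁, hg₁⟩ := H.exists_not_breaking_after ht₀.le hc
    (by filter_upwards [hat, h2] with ξ a b; rwa [b.yξ, b.hbar])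
  obtain ⟨δ₂, hδ₂, hg₂⟩ := H'.exists_not_breaking_after ht₀.le hc hat
  set δ := min δ₁ δ₂
  have hδ : 0 < δ := lt_min hδ₁ hδ₂
  -- On this interval y_ξ has no positive lower bound, but neither gap changes. This bridges the
  -- times between t₀ and those covered by `hafter`.
  have h3 : ∀ᵐ ξ, ∀ s ∈ Icc t₀ (t₀ + δ), (Θ s).EqAt (Θ' s) ξ := by
    refine H.eqAt_of_gap_eq H' ht₀.le h2 ?_
    filter_upwards [h2, hg₁, hg₂] with ξ a b b' s hs
    rw [b s ⟨hs.1, hs.2.trans (by linarith [min_le_left δ₁ δ₂])⟩,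
      b' s ⟨hs.1, hs.2.trans (by linarith [min_le_right δ₁ δ₂])⟩, a.hbar, a.h]
  have h4 : ∀ n : ℕ, ∀ᵐ ξ, ∀ s ∈ Icc (t₀ + δ) (t₀ + δ + n), (Θ s).EqAt (Θ' s) ξ := by
    intro n
    have hn : (0 : ℝ) ≤ n := n.cast_nonneg
    obtain ⟨c, hc, hb⟩ := hafter (t₀ + δ) (t₀ + δ + n) (by linarith) (by linarith)
    exact H.eqAt_of_le_yξ H' (by linarith) (by linarith)
      (h3.mono fun ξ h => h _ ⟨by linarith, le_rfl⟩) hc hb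
  filter_upwards [h1, h3, ae_all_iff.mpr h4] with ξ a b d t ht
  rcases lt_or_ge t t₀ with e | e
  · exact a t ⟨ht, e⟩
  · rcases le_total t (t₀ + δ) with f | f
    · exact b t ⟨e, f⟩
    · obtain ⟨n, hn⟩ := exists_nat_ge (t - (t₀ + δ))
      exact d n t ⟨f, by linarith⟩

end IsAlphaDissipativeLagrangian

/-! ### The conservative two-peakon flow in Lagrangian coordinates

The labels are normalized so that at the collision time `T = 0` the characteristics with labels in
`[0, 2]` sit at the origin. -/

/-- A function given by different formulas on `(-∞, 0)`, `[0, 2]` and `(2, ∞)`. -/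
def pw (l m r : ℝ → ℝ) (X : ℝ) : ℝ := if X < 0 then l X else if X ≤ 2 then m X else r X

section pw

variable {l m r l' m' r' : ℝ → ℝ} {X : ℝ}

theorem pw_left (h : X < 0) : pw l m r X = l X := if_pos h

theorem pw_mid (h : X ∈ Icc (0 : ℝ) 2) : pw l m r X = m X := by
  rw [pw, if_neg (not_lt.mpr h.1), if_pos h.2]

theorem pw_right (h : 2 < X) : pw l m r X = r X := by
  rw [pw, if_neg (by linarith), if_neg (by linarith)]

theorem pw_cases (p : ℝ → Prop) (h1 : X < 0 → p (l X)) (h2 : X ∈ Icc (0 : ℝ) 2 → p (m X))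
    (h3 : 2 < X → p (r X)) : p (pw l m r X) := by
  rcases lt_or_ge X 0 with h | h
  · rw [pw_left h]; exact h1 h
  · rcases le_or_gt X 2 with h' | h'
    · rw [pw_mid ⟨h, h'⟩]; exact h2 ⟨h, h'⟩
    · rw [pw_right h']; exact h3 h'

theorem continuous_pw (hl : ContinuousOn l (Iic 0)) (hm : ContinuousOn m (Icc 0 2))
    (hr : ContinuousOn r (Ici 2)) (h0 : l 0 = m 0) (h2 : m 2 = r 2) : Continuous (pw l m r) := by
  have hfr : ∀ a ∈ frontier {X : ℝ | X < 0}, a = 0 := by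
    intro a ha
    have : frontier {X : ℝ | X < 0} = {0} := frontier_Iio
    simpa [this] using ha
  have hfr2 : ∀ a ∈ frontier {X : ℝ | X ≤ 2}, a = 2 := by
    intro a ha
    have : frontier {X : ℝ | X ≤ 2} = {2} := frontier_Iic
    simpa [this] using ha
  refine continuous_if (fun a ha => ?_) ?_ ?_
  · rw [hfr a ha]; simpa using h0
  · have : closure {X : ℝ | X < 0} = Iic 0 := closure_Iio' ⟨-1, by simp⟩
    rwa [this]
  · have : closure {X : ℝ | ¬ X < 0} = Ici 0 := by
      have : {X : ℝ | ¬ X < 0} = Ici 0 := by ext; simp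
      rw [this, closure_Ici]
    rw [this]
    refine ContinuousOn.if (fun a ha => ?_) ?_ ?_
    · rw [hfr2 a ha.2]; exact h2
    · have : closure {X : ℝ | X ≤ 2} = Iic 2 := closure_Iic 2
      rw [this]; exact hm
    · have : closure {X : ℝ | ¬ X ≤ 2} = Ici 2 := by
        have : {X : ℝ | ¬ X ≤ 2} = Ioi 2 := by ext; simp
        rw [this, closure_Ioi]
      rw [this]; exact hr.mono inter_subset_right

theorem measurable_pw (hl : Measurable l) (hm : Measurable m) (hr : Measurable r) :
    Measurable (pw l m r) :=
  Measurable.ite measurableSet_Iio hl (Measurable.ite measurableSet_Iic hm hr)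

theorem hasDerivAt_pw (hl : ∀ X < 0, HasDerivAt l (l' X) X)
    (hm : ∀ X ∈ Ioo (0 : ℝ) 2, HasDerivAt m (m' X) X) (hr : ∀ X > 2, HasDerivAt r (r' X) X) :
    ∀ X ∉ ({0, 2} : Set ℝ), HasDerivAt (pw l m r) (pw l' m' r' X) X := by
  intro X hX
  have h0 : X ≠ 0 := fun h => hX (by simp [h])
  have h2 : X ≠ 2 := fun h => hX (by simp [h])
  rcases lt_or_gt_of_ne h0 with h | h
  · rw [pw_left h]
    refine (hl X h).congr_of_eventuallyEq ?_
    filter_upwards [Iio_mem_nhds h] with x hx using pw_left hx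
  · rcases lt_or_gt_of_ne h2 with h' | h'
    · rw [pw_mid ⟨h.le, h'.le⟩]
      refine (hm X ⟨h, h'⟩).congr_of_eventuallyEq ?_
      filter_upwards [Ioo_mem_nhds h h'] with x hx using pw_mid ⟨hx.1.le, hx.2.le⟩
    · rw [pw_right h']
      refine (hr X h').congr_of_eventuallyEq ?_
      filter_upwards [Ioi_mem_nhds h'] with x hx using pw_right hx

end pw

/-! #### The outer regions -/

section outer

variable (a b T r : ℝ)

/-- The coefficient in the outer regions. -/
def outM : ℝ := (a * Real.exp (a * T) - b * Real.exp (b * T)) / (a - b) - 1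

/-- The time derivative of `outM`. -/
def outK : ℝ := (a ^ 2 * Real.exp (a * T) - b ^ 2 * Real.exp (b * T)) / (a - b)

/-- The second time derivative of `outM`. -/
def outJ : ℝ := (a ^ 3 * Real.exp (a * T) - b ^ 3 * Real.exp (b * T)) / (a - b)

/-- The common denominator in the outer regions. -/
def outD : ℝ := 1 + outM a b T * r

variable {a b T r}

theorem hasDerivAt_outM : HasDerivAt (outM a b) (outK a b T) T := by
  have h1 : HasDerivAt (fun T => Real.exp (a * T)) (Real.exp (a * T) * (a * 1)) T :=
    ((hasDerivAt_id T).const_mul a).exp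
  have h2 : HasDerivAt (fun T => Real.exp (b * T)) (Real.exp (b * T) * (b * 1)) T :=
    ((hasDerivAt_id T).const_mul b).exp
  refine ((((h1.const_mul a).sub (h2.const_mul b)).div_const (a - b)).sub_const 1).congr_deriv ?_
  unfold outK; ring

theorem hasDerivAt_outK : HasDerivAt (outK a b) (outJ a b T) T := by
  have h1 : HasDerivAt (fun T => Real.exp (a * T)) (Real.exp (a * T) * (a * 1)) T :=
    ((hasDerivAt_id T).const_mul a).exp
  have h2 : HasDerivAt (fun T => Real.exp (b * T)) (Real.exp (b * T) * (b * 1)) T :=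
    ((hasDerivAt_id T).const_mul b).exp
  refine (((h1.const_mul (a ^ 2)).sub (h2.const_mul (b ^ 2))).div_const (a - b)).congr_deriv ?_
  unfold outJ; ring

theorem continuous_outM : Continuous (outM a b) :=
  continuous_iff_continuousAt.mpr fun _ => hasDerivAt_outM.continuousAt

theorem continuous_outK : Continuous (outK a b) :=
  continuous_iff_continuousAt.mpr fun _ => hasDerivAt_outK.continuousAt

theorem outM_add_one_pos (ha : 0 < a) (hb : b < 0) : 0 < outM a b T + 1 := by
  unfold outM
  have h1 := Real.exp_pos (a * T)
  have h2 := Real.exp_pos (b * T)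
  rw [sub_add_cancel]
  exact div_pos (by nlinarith) (by linarith)

/-- A convex combination, with weight r, of 1 and the positive number `outM a b T + 1`. -/
theorem outD_pos (ha : 0 < a) (hb : b < 0) (hr : r ∈ Icc (0 : ℝ) 1) : 0 < outD a b T r := by
  have h := outM_add_one_pos (T := T) ha hb
  have : outD a b T r = (1 - r) + r * (outM a b T + 1) := by unfold outD; ring
  rw [this]
  rcases hr.1.eq_or_lt with h0 | h0
  · rw [← h0]; norm_num
  · have := mul_pos h0 h
    linarith [hr.2]

theorem hasDerivAt_outD_time : HasDerivAt (fun T => outD a b T r) (outK a b T * r) T :=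
  (hasDerivAt_outM.mul_const r).const_add 1

theorem hasDerivAt_outD_label : HasDerivAt (fun r => outD a b T r) (outM a b T) r :=
  (((hasDerivAt_id r).const_mul (outM a b T)).const_add 1).congr_deriv (by ring)

theorem continuous_outD : Continuous fun p : ℝ × ℝ => outD a b p.1 p.2 := by
  have := continuous_outM (a := a) (b := b)
  unfold outD; fun_prop

end outer

/-! #### The middle region -/

section mid

variable (a b T X : ℝ)

/-- The numerator of `e^y` in the middle region. -/
def midN : ℝ := (a * Real.exp (a * T) - b * Real.exp (b * T)) * X
  + (a - b) * (Real.exp (a * T) * Real.exp (b * T)) * (2 - X)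

/-- The denominator of `e^y` in the middle region. -/
def midA : ℝ := (a - b) * X + (a * Real.exp (b * T) - b * Real.exp (a * T)) * (2 - X)

/-- The time derivative of `midN`. -/
def midNt : ℝ := (a ^ 2 * Real.exp (a * T) - b ^ 2 * Real.exp (b * T)) * X
  + (a - b) * (a + b) * (Real.exp (a * T) * Real.exp (b * T)) * (2 - X)

/-- The time derivative of `midA`. -/
def midAt : ℝ := (a * b) * (Real.exp (b * T) - Real.exp (a * T)) * (2 - X)

/-- The velocity in the middle region. -/
def midU : ℝ := midNt a b T X / midN a b T X - midAt a b T X / midA a b T X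

/-- `y_ξ` in the middle region. -/
def midY : ℝ := -2 * a * b * (Real.exp (a * T) - Real.exp (b * T)) ^ 2
  / (midA a b T X * midN a b T X)

/-- The sum of squares occurring in the slope in the middle region. -/
def midW : ℝ := midN a b T X ^ 2 + Real.exp (a * T) * Real.exp (b * T) * midA a b T X ^ 2

/-- `U_ξ` in the middle region. -/
def midV : ℝ := -2 * a * b * (a - b) * (Real.exp (a * T) - Real.exp (b * T)) * midW a b T X
  / (midA a b T X * midN a b T X) ^ 2

/-- The energy density in the middle region. -/
def midH : ℝ := -2 * a * b * (a - b) ^ 2 * midW a b T X ^ 2 / (midA a b T X * midN a b T X) ^ 3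

variable {a b T X}

theorem hasDerivAt_exp_mul (c T : ℝ) :
    HasDerivAt (fun T => Real.exp (c * T)) (c * Real.exp (c * T)) T :=
  (((hasDerivAt_id T).const_mul c).exp).congr_deriv (by simp; ring)

theorem midN_pos (ha : 0 < a) (hb : b < 0) (hX : X ∈ Icc (0 : ℝ) 2) : 0 < midN a b T X := by
  unfold midN
  have h1 := Real.exp_pos (a * T)
  have h2 := Real.exp_pos (b * T)
  have h3 : 0 < a * Real.exp (a * T) - b * Real.exp (b * T) := by nlinarith
  have h4 : 0 < (a - b) * (Real.exp (a * T) * Real.exp (b * T)) :=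
    mul_pos (by linarith) (by positivity)
  rcases hX.1.eq_or_lt with h | h
  · rw [← h]; linarith
  · have := mul_pos h3 h
    have := mul_nonneg h4.le (sub_nonneg.mpr hX.2)
    linarith

theorem midA_pos (ha : 0 < a) (hb : b < 0) (hX : X ∈ Icc (0 : ℝ) 2) : 0 < midA a b T X := by
  unfold midA
  have h1 := Real.exp_pos (a * T)
  have h2 := Real.exp_pos (b * T)
  have h3 : 0 < a * Real.exp (b * T) - b * Real.exp (a * T) := by nlinarith
  have h4 : 0 < a - b := by linarith
  rcases hX.1.eq_or_lt with h | h
  · rw [← h]; linarith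
  · have := mul_pos h4 h
    have := mul_nonneg h3.le (sub_nonneg.mpr hX.2)
    linarith

theorem midW_pos (ha : 0 < a) (hb : b < 0) (hX : X ∈ Icc (0 : ℝ) 2) : 0 < midW a b T X := by
  have := midN_pos (T := T) ha hb hX
  unfold midW; positivity

theorem hasDerivAt_midN_time : HasDerivAt (fun T => midN a b T X) (midNt a b T X) T := by
  have h1 := hasDerivAt_exp_mul a T
  have h2 := hasDerivAt_exp_mul b T
  refine ((((h1.const_mul a).sub (h2.const_mul b)).mul_const X).add
    (((h1.mul h2).const_mul (a - b)).mul_const (2 - X))).congr_deriv ?_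
  unfold midNt; ring

theorem hasDerivAt_midA_time : HasDerivAt (fun T => midA a b T X) (midAt a b T X) T := by
  have h1 := hasDerivAt_exp_mul a T
  have h2 := hasDerivAt_exp_mul b T
  refine ((((h2.const_mul a).sub (h1.const_mul b)).mul_const (2 - X)).const_add
    ((a - b) * X)).congr_deriv ?_
  unfold midAt; ring

theorem hasDerivAt_affine (p q X : ℝ) : HasDerivAt (fun X => p * X + q * (2 - X)) (p - q) X := by
  refine (((hasDerivAt_id X).const_mul p).add
    (((hasDerivAt_id X).const_sub 2).const_mul q)).congr_deriv ?_
  ring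

theorem hasDerivAt_midN_label : HasDerivAt (fun X => midN a b T X)
    ((a * Real.exp (a * T) - b * Real.exp (b * T))
      - (a - b) * (Real.exp (a * T) * Real.exp (b * T))) X := hasDerivAt_affine _ _ X

theorem hasDerivAt_midA_label : HasDerivAt (fun X => midA a b T X)
    ((a - b) - (a * Real.exp (b * T) - b * Real.exp (a * T))) X := hasDerivAt_affine _ _ X

/-- The computation does not divide by e^{aT} - e^{bT} and therefore covers the collision time. -/
theorem hasDerivAt_midY_time (ha : 0 < a) (hb : b < 0) (hX : X ∈ Icc (0 : ℝ) 2) :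
    HasDerivAt (fun T => midY a b T X) (midV a b T X) T := by
  have h1 := hasDerivAt_exp_mul a T
  have h2 := hasDerivAt_exp_mul b T
  have hN := (midN_pos (T := T) ha hb hX).ne'
  have hA := (midA_pos (T := T) ha hb hX).ne'
  have h3 : HasDerivAt
      (fun T => -2 * a * b * (Real.exp (a * T) - Real.exp (b * T)) ^ 2)
      (-2 * a * b * (2 * (Real.exp (a * T) - Real.exp (b * T))
        * (a * Real.exp (a * T) - b * Real.exp (b * T)))) T :=
    (((h1.sub h2).pow 2).const_mul (-2 * a * b)).congr_deriv (by simp)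
  have h4 : HasDerivAt (fun T => midA a b T X * midN a b T X)
      (midAt a b T X * midN a b T X + midA a b T X * midNt a b T X) T :=
    hasDerivAt_midA_time.mul hasDerivAt_midN_time
  refine (h3.div h4 (mul_ne_zero hA hN)).congr_deriv ?_
  rw [midV, div_left_inj' (pow_ne_zero 2 (mul_ne_zero hA hN))]
  have key : 2 * (a * Real.exp (a * T) - b * Real.exp (b * T)) * (midA a b T X * midN a b T X)
      - (Real.exp (a * T) - Real.exp (b * T))
        * (midAt a b T X * midN a b T X + midA a b T X * midNt a b T X)
      = (a - b) * midW a b T X := by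
    simp only [midW, midNt, midAt, midN, midA]
    -- With the two exponentials as independent variables the claim is a polynomial identity.
    generalize Real.exp (a * T) = E
    generalize Real.exp (b * T) = F
    ring
  linear_combination (-2 * a * b * (Real.exp (a * T) - Real.exp (b * T))) * key

/-- Together with `hasDerivAt_midY_time` this expresses the symmetry of the mixed second derivatives
of y: `midV` is both the time derivative of y_ξ and the label derivative of U. -/
theorem hasDerivAt_midU_label (ha : 0 < a) (hb : b < 0) (hX : X ∈ Icc (0 : ℝ) 2) :
    HasDerivAt (fun X => midU a b T X) (midV a b T X) X := by
  have hN := (midN_pos (T := T) ha hb hX).ne'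
  have hA := (midA_pos (T := T) ha hb hX).ne'
  have e1 : HasDerivAt (fun X => midNt a b T X) _ X := hasDerivAt_affine _ _ X
  have e2 : HasDerivAt (fun X => midAt a b T X)
      (0 - (a * b) * (Real.exp (b * T) - Real.exp (a * T))) X :=
    (hasDerivAt_affine 0 ((a * b) * (Real.exp (b * T) - Real.exp (a * T))) X).congr_of_eventuallyEq
      (Eventually.of_forall fun X => by simp [midAt])
  refine ((e1.div hasDerivAt_midN_label hN).sub (e2.div hasDerivAt_midA_label hA)).congr_deriv ?_
  rw [div_sub_div _ _ (pow_ne_zero 2 hN) (pow_ne_zero 2 hA), midV, midW, ← mul_pow,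
    mul_comm (midN a b T X) (midA a b T X), div_left_inj' (by positivity)]
  have key1 : (a ^ 2 * Real.exp (a * T) - b ^ 2 * Real.exp (b * T)
        - (a - b) * (a + b) * (Real.exp (a * T) * Real.exp (b * T))) * midN a b T X
      - midNt a b T X * (a * Real.exp (a * T) - b * Real.exp (b * T)
        - (a - b) * (Real.exp (a * T) * Real.exp (b * T))) =
      -2 * a * b * (a - b) * (Real.exp (a * T) - Real.exp (b * T))
        * (Real.exp (a * T) * Real.exp (b * T)) := by
    simp only [midNt, midN]
    generalize Real.exp (a * T) = E
    generalize Real.exp (b * T) = F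
    ring
  have key2 : (0 - a * b * (Real.exp (b * T) - Real.exp (a * T))) * midA a b T X
      - midAt a b T X * (a - b - (a * Real.exp (b * T) - b * Real.exp (a * T))) =
      2 * a * b * (a - b) * (Real.exp (a * T) - Real.exp (b * T)) := by
    simp only [midAt, midA]
    generalize Real.exp (a * T) = E
    generalize Real.exp (b * T) = F
    ring
  rw [key1, key2]
  ring

theorem hasDerivAt_mid_label (ha : 0 < a) (hb : b < 0) (hX : X ∈ Icc (0 : ℝ) 2) :
    HasDerivAt (fun X => Real.log (midN a b T X) - Real.log (midA a b T X)) (midY a b T X) X := by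
  have hN := (midN_pos (T := T) ha hb hX).ne'
  have hA := (midA_pos (T := T) ha hb hX).ne'
  refine ((hasDerivAt_midN_label.log hN).sub (hasDerivAt_midA_label.log hA)).congr_deriv ?_
  rw [div_sub_div _ _ hN hA, midY, mul_comm (midN a b T X) (midA a b T X),
    div_left_inj' (mul_ne_zero hA hN)]
  simp only [midN, midA]
  generalize Real.exp (a * T) = E
  generalize Real.exp (b * T) = F
  ring

theorem hasDerivAt_mid_time (ha : 0 < a) (hb : b < 0) (hX : X ∈ Icc (0 : ℝ) 2) :
    HasDerivAt (fun T => Real.log (midN a b T X) - Real.log (midA a b T X)) (midU a b T X) T :=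
  (hasDerivAt_midN_time.log (midN_pos ha hb hX).ne').sub
    (hasDerivAt_midA_time.log (midA_pos ha hb hX).ne')

theorem exp_mul_ne (ha : 0 < a) (hb : b < 0) (hT : T ≠ 0) :
    Real.exp (a * T) - Real.exp (b * T) ≠ 0 := by
  intro h
  have : a * T = b * T := Real.exp_injective (sub_eq_zero.mp h)
  have h2 : (a - b) * T = 0 := by linarith
  rcases mul_eq_zero.mp h2 with h3 | h3
  · linarith
  · exact hT h3

/-- Since e^y is the quotient of `midN` and `midA`, this is the form A e^y + B e^{-y} of the
velocity. The coefficients have the denominator e^{aT} - e^{bT}, hence the exclusion of T = 0. -/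
theorem midU_eq (ha : 0 < a) (hb : b < 0) (hX : X ∈ Icc (0 : ℝ) 2) (hT : T ≠ 0) :
    midU a b T X = (a - b) * (midN a b T X ^ 2
      - Real.exp (a * T) * Real.exp (b * T) * midA a b T X ^ 2) /
        ((Real.exp (a * T) - Real.exp (b * T)) * (midA a b T X * midN a b T X)) := by
  have hN := (midN_pos (T := T) ha hb hX).ne'
  have hA := (midA_pos (T := T) ha hb hX).ne'
  have hE := exp_mul_ne ha hb hT
  have key : (Real.exp (a * T) - Real.exp (b * T))
      * (midNt a b T X * midA a b T X - midN a b T X * midAt a b T X) = (a - b) *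
      (midN a b T X ^ 2 - Real.exp (a * T) * Real.exp (b * T) * midA a b T X ^ 2) := by
    simp only [midNt, midAt, midN, midA]
    generalize Real.exp (a * T) = E
    generalize Real.exp (b * T) = F
    ring
  rw [midU, div_sub_div _ _ hN hA, ← key, mul_div_mul_left _ _ hE, mul_comm (midN a b T X)
    (midA a b T X)]

end mid

/-! #### The outer regions: velocity, slope and energy -/

section outerFunctions

variable (a b T r : ℝ)

/-- The velocity in the outer regions. -/
def outU : ℝ := outK a b T * r / outD a b T r

/-- The modulus of `U_ξ` in the outer regions. -/
def outV : ℝ := outK a b T * r / outD a b T r ^ 2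

/-- The energy density in the outer regions. -/
def outH : ℝ := outK a b T ^ 2 * r ^ 2 / outD a b T r ^ 3

variable {a b T r}

theorem hasDerivAt_log_outD_time (ha : 0 < a) (hb : b < 0) (hr : r ∈ Icc (0 : ℝ) 1) :
    HasDerivAt (fun T => Real.log (outD a b T r)) (outU a b T r) T :=
  hasDerivAt_outD_time.log (outD_pos ha hb hr).ne'

theorem hasDerivAt_inv_outD_time (ha : 0 < a) (hb : b < 0) (hr : r ∈ Icc (0 : ℝ) 1) :
    HasDerivAt (fun T => (outD a b T r)⁻¹) (-outV a b T r) T :=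
  (hasDerivAt_outD_time.inv (outD_pos ha hb hr).ne').congr_deriv (by unfold outV; ring)

theorem hasDerivAt_outU_label (ha : 0 < a) (hb : b < 0) (hr : r ∈ Icc (0 : ℝ) 1) :
    HasDerivAt (fun r => outU a b T r) (outK a b T / outD a b T r ^ 2) r := by
  have hD := (outD_pos (T := T) ha hb hr).ne'
  have := (((hasDerivAt_id r).const_mul (outK a b T)).div hasDerivAt_outD_label hD)
  refine this.congr_deriv ?_
  simp only [id, outD]; ring

end outerFunctions

theorem exp_mem_Icc_of_nonpos {x : ℝ} (hx : x ≤ 0) : Real.exp x ∈ Icc (0 : ℝ) 1 :=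
  ⟨(Real.exp_pos x).le, Real.exp_le_one_iff.mpr hx⟩

/-! #### The full flow -/

section flow

variable (a b T : ℝ)

/-- The characteristics. -/
def flowY : ℝ → ℝ := pw (fun X => X - Real.log (outD a b (-T) (Real.exp X)))
  (fun X => Real.log (midN a b T X) - Real.log (midA a b T X))
  (fun X => X - 2 + Real.log (outD a b T (Real.exp (2 - X))))

/-- The velocity. -/
def flowU : ℝ → ℝ := pw (fun X => outU a b (-T) (Real.exp X)) (fun X => midU a b T X)
  (fun X => outU a b T (Real.exp (2 - X)))

/-- The derivative of `flowY`. -/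
def flowYξ : ℝ → ℝ := pw (fun X => (outD a b (-T) (Real.exp X))⁻¹) (fun X => midY a b T X)
  (fun X => (outD a b T (Real.exp (2 - X)))⁻¹)

/-- The derivative of `flowU`. -/
def flowUξ : ℝ → ℝ := pw (fun X => outV a b (-T) (Real.exp X)) (fun X => midV a b T X)
  (fun X => -outV a b T (Real.exp (2 - X)))

/-- The energy density, where `k` is added in the middle region. -/
def flowH (k : ℝ) : ℝ → ℝ := pw (fun X => outH a b (-T) (Real.exp X)) (fun X => midH a b T X + k)
  (fun X => outH a b T (Real.exp (2 - X)))

/-- The Lagrangian state of the two-peakon flow; `k` is the amount of energy in `h` that is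
missing in `h̄` in the middle region. -/
def flowState (k : ℝ) : LagrangianState where
  y := flowY a b T
  U := flowU a b T
  yξ := flowYξ a b T
  Uξ := flowUξ a b T
  hbar := flowH a b T 0
  h := flowH a b T k

variable {a b T} {X : ℝ}

theorem hasDerivAt_comp_neg {f : ℝ → ℝ} {f' T : ℝ} (h : HasDerivAt f f' (-T)) :
    HasDerivAt (fun T => f (-T)) (-f') T :=
  (h.comp T (hasDerivAt_neg T)).congr_deriv (by ring)

theorem label_cases (X : ℝ) : X < 0 ∨ X ∈ Icc (0 : ℝ) 2 ∨ 2 < X := by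
  rcases lt_or_ge X 0 with h | h
  · exact .inl h
  · rcases le_or_gt X 2 with h' | h'
    · exact .inr (.inl ⟨h, h'⟩)
    · exact .inr (.inr h')

theorem exp_right_mem {X : ℝ} (h : 2 ≤ X) : Real.exp (2 - X) ∈ Icc (0 : ℝ) 1 :=
  exp_mem_Icc_of_nonpos (by linarith)

theorem hasDerivAt_flowY_time (ha : 0 < a) (hb : b < 0) :
    HasDerivAt (fun T => flowY a b T X) (flowU a b T X) T := by
  rcases label_cases X with h | h | h
  · simp only [flowY, flowU, pw_left h]
    exact ((hasDerivAt_comp_neg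
      (hasDerivAt_log_outD_time ha hb (exp_mem_Icc_of_nonpos h.le))).const_sub X).congr_deriv
      (by ring)
  · simp only [flowY, flowU, pw_mid h]
    exact hasDerivAt_mid_time ha hb h
  · simp only [flowY, flowU, pw_right h]
    exact (hasDerivAt_log_outD_time ha hb (exp_right_mem h.le)).const_add (X - 2)

theorem hasDerivAt_flowYξ_time (ha : 0 < a) (hb : b < 0) :
    HasDerivAt (fun T => flowYξ a b T X) (flowUξ a b T X) T := by
  rcases label_cases X with h | h | h
  · simp only [flowYξ, flowUξ, pw_left h]
    exact (hasDerivAt_comp_neg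
      (hasDerivAt_inv_outD_time ha hb (exp_mem_Icc_of_nonpos h.le))).congr_deriv (by ring)
  · simp only [flowYξ, flowUξ, pw_mid h]
    exact hasDerivAt_midY_time ha hb h
  · simp only [flowYξ, flowUξ, pw_right h]
    exact hasDerivAt_inv_outD_time ha hb (exp_right_mem h.le)

theorem hasDerivAt_exp_two_sub (X : ℝ) :
    HasDerivAt (fun X => Real.exp (2 - X)) (-Real.exp (2 - X)) X :=
  (((hasDerivAt_id X).const_sub 2).exp).congr_deriv (by simp)

theorem hasDerivAt_flowY_label (ha : 0 < a) (hb : b < 0) :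
    ∀ X ∉ ({0, 2} : Set ℝ), HasDerivAt (flowY a b T) (flowYξ a b T X) X := by
  refine hasDerivAt_pw (fun X h => ?_)
    (fun X h => hasDerivAt_mid_label ha hb (Ioo_subset_Icc_self h)) (fun X h => ?_)
  · have hD := (outD_pos (T := -T) ha hb (exp_mem_Icc_of_nonpos (le_of_lt h))).ne'
    have h1 : HasDerivAt (fun X => outD a b (-T) (Real.exp X)) _ X :=
      (hasDerivAt_outD_label (T := -T) (r := Real.exp X)).comp X (Real.hasDerivAt_exp X)
    refine ((hasDerivAt_id X).sub (h1.log hD)).congr_deriv ?_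
    rw [inv_eq_one_div, eq_div_iff hD, sub_mul, div_mul_cancel₀ _ hD]
    unfold outD; ring
  · have hD := (outD_pos (T := T) ha hb (exp_right_mem (le_of_lt h))).ne'
    have h1 : HasDerivAt (fun X => outD a b T (Real.exp (2 - X))) _ X :=
      HasDerivAt.comp (h₂ := outD a b T) (h := fun X => Real.exp (2 - X)) X
        hasDerivAt_outD_label (hasDerivAt_exp_two_sub X)
    refine (((hasDerivAt_id X).sub_const 2).add (h1.log hD)).congr_deriv ?_
    rw [inv_eq_one_div, eq_div_iff hD, add_mul, div_mul_cancel₀ _ hD]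
    unfold outD; ring

theorem hasDerivAt_flowU_label (ha : 0 < a) (hb : b < 0) :
    ∀ X ∉ ({0, 2} : Set ℝ), HasDerivAt (flowU a b T) (flowUξ a b T X) X := by
  refine hasDerivAt_pw (fun X h => ?_)
    (fun X h => hasDerivAt_midU_label ha hb (Ioo_subset_Icc_self h)) (fun X h => ?_)
  · exact ((hasDerivAt_outU_label (T := -T) ha hb (exp_mem_Icc_of_nonpos (le_of_lt h))).comp X
      (Real.hasDerivAt_exp X)).congr_deriv (by unfold outV; ring)
  · exact (HasDerivAt.comp (h₂ := outU a b T) (h := fun X => Real.exp (2 - X)) X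
      (hasDerivAt_outU_label (T := T) ha hb (exp_right_mem (le_of_lt h)))
      (hasDerivAt_exp_two_sub X)).congr_deriv (by simp only [outV]; ring)

theorem outD_neg_one : outD a b (-T) 1 = (a * Real.exp (b * T) - b * Real.exp (a * T)) /
    ((a - b) * (Real.exp (a * T) * Real.exp (b * T))) := by
  unfold outD outM
  rw [mul_neg, mul_neg, Real.exp_neg, Real.exp_neg]
  have h1 := (Real.exp_pos (a * T)).ne'
  have h2 := (Real.exp_pos (b * T)).ne'
  field_simp
  ring

theorem outD_one : outD a b T 1 = (a * Real.exp (a * T) - b * Real.exp (b * T)) / (a - b) := by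
  unfold outD outM; ring

theorem outK_neg : outK a b (-T) = (a ^ 2 * Real.exp (b * T) - b ^ 2 * Real.exp (a * T)) /
    ((a - b) * (Real.exp (a * T) * Real.exp (b * T))) := by
  unfold outK
  rw [mul_neg, mul_neg, Real.exp_neg, Real.exp_neg]
  have h1 := (Real.exp_pos (a * T)).ne'
  have h2 := (Real.exp_pos (b * T)).ne'
  field_simp

theorem outJ_neg : outJ a b (-T) = (a ^ 3 * Real.exp (b * T) - b ^ 3 * Real.exp (a * T)) /
    ((a - b) * (Real.exp (a * T) * Real.exp (b * T))) := by
  unfold outJ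
  rw [mul_neg, mul_neg, Real.exp_neg, Real.exp_neg]
  have h1 := (Real.exp_pos (a * T)).ne'
  have h2 := (Real.exp_pos (b * T)).ne'
  field_simp

theorem continuousOn_outD_left : Continuous fun X => outD a b (-T) (Real.exp X) := by
  unfold outD; fun_prop

theorem continuousOn_outD_right : Continuous fun X => outD a b T (Real.exp (2 - X)) := by
  unfold outD; fun_prop

theorem continuous_midN : Continuous fun X => midN a b T X := by unfold midN; fun_prop

theorem continuous_midA : Continuous fun X => midA a b T X := by unfold midA; fun_prop

theorem continuous_flowY (ha : 0 < a) (hb : b < 0) : Continuous (flowY a b T) := by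
  have hE := Real.exp_pos (a * T)
  have hF := Real.exp_pos (b * T)
  have hL : 0 < a - b := by linarith
  have h3 : 0 < a * Real.exp (b * T) - b * Real.exp (a * T) := by nlinarith
  have h4 : 0 < a * Real.exp (a * T) - b * Real.exp (b * T) := by nlinarith
  refine continuous_pw ?_ ?_ ?_ ?_ ?_
  · exact continuousOn_id.sub (continuousOn_outD_left.continuousOn.log fun X hX =>
      (outD_pos ha hb (exp_mem_Icc_of_nonpos hX)).ne')
  · exact (continuous_midN.continuousOn.log fun X hX => (midN_pos ha hb hX).ne').sub
      (continuous_midA.continuousOn.log fun X hX => (midA_pos ha hb hX).ne')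
  · exact (by fun_prop : Continuous fun X : ℝ => X - 2).continuousOn.add
      (continuousOn_outD_right.continuousOn.log fun X hX =>
      (outD_pos ha hb (exp_right_mem hX)).ne')
  · rw [Real.exp_zero, outD_neg_one, Real.log_div (by positivity) (by positivity)]
    have e1 : midN a b T 0 = ((a - b) * (Real.exp (a * T) * Real.exp (b * T))) * 2 := by
      unfold midN; ring
    have e2 : midA a b T 0 = (a * Real.exp (b * T) - b * Real.exp (a * T)) * 2 := by
      unfold midA; ring
    rw [e1, e2, Real.log_mul (by positivity) two_ne_zero, Real.log_mul (by positivity) two_ne_zero]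
    ring
  · rw [sub_self, Real.exp_zero, outD_one, Real.log_div (by positivity) (by positivity)]
    have e1 : midN a b T 2 = (a * Real.exp (a * T) - b * Real.exp (b * T)) * 2 := by
      unfold midN; ring
    have e2 : midA a b T 2 = (a - b) * 2 := by
      unfold midA; ring
    rw [e1, e2, Real.log_mul (by positivity) two_ne_zero, Real.log_mul (by positivity) two_ne_zero]
    ring

theorem continuous_flowU (ha : 0 < a) (hb : b < 0) : Continuous (flowU a b T) := by
  have hE := Real.exp_pos (a * T)
  have hF := Real.exp_pos (b * T)
  have hL : 0 < a - b := by linarith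
  have h3 : 0 < a * Real.exp (b * T) - b * Real.exp (a * T) := by nlinarith
  have h4 : 0 < a * Real.exp (a * T) - b * Real.exp (b * T) := by nlinarith
  refine continuous_pw ?_ ?_ ?_ ?_ ?_
  · exact (by fun_prop : Continuous fun X => outK a b (-T) * Real.exp X).continuousOn.div
      continuousOn_outD_left.continuousOn fun X hX =>
      (outD_pos ha hb (exp_mem_Icc_of_nonpos hX)).ne'
  · exact fun X hX => (hasDerivAt_midU_label ha hb hX).continuousAt.continuousWithinAt
  · exact (by fun_prop : Continuous fun X => outK a b T * Real.exp (2 - X)).continuousOn.div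
      continuousOn_outD_right.continuousOn fun X hX =>
      (outD_pos ha hb (exp_right_mem hX)).ne'
  · rw [Real.exp_zero, outU, outD_neg_one, outK_neg]
    simp only [midU, midNt, midAt, midN, midA]
    generalize Real.exp (a * T) = E at *
    generalize Real.exp (b * T) = F at *
    simp only [mul_zero, zero_add, sub_zero]
    field_simp
    ring
  · rw [sub_self, Real.exp_zero, outU, outD_one, outK]
    simp only [midU, midNt, midAt, midN, midA]
    generalize Real.exp (a * T) = E at *
    generalize Real.exp (b * T) = F at *
    simp only [sub_self, mul_zero, add_zero, zero_div, sub_zero]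
    field_simp

/-- The coefficient of `e^x` in `u`, as a function of the label. -/
def coefA (a b T : ℝ) : ℝ → ℝ := pw (fun _ => outK a b (-T))
  (fun _ => (a - b) / (Real.exp (a * T) - Real.exp (b * T))) (fun _ => 0)

/-- The coefficient of `e^{-x}` in `u`, as a function of the label. -/
def coefB (a b T : ℝ) : ℝ → ℝ := pw (fun _ => 0)
  (fun _ => -(a - b) * (Real.exp (a * T) * Real.exp (b * T))
    / (Real.exp (a * T) - Real.exp (b * T))) (fun _ => outK a b T)

/-- The time derivative of `coefA`. -/
def coefA' (a b T : ℝ) : ℝ → ℝ := pw (fun _ => -outJ a b (-T))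
  (fun _ => -(a - b) * (a * Real.exp (a * T) - b * Real.exp (b * T))
    / (Real.exp (a * T) - Real.exp (b * T)) ^ 2) (fun _ => 0)

/-- The time derivative of `coefB`. -/
def coefB' (a b T : ℝ) : ℝ → ℝ := pw (fun _ => 0)
  (fun _ => (a - b) * (Real.exp (a * T) * Real.exp (b * T))
    * (a * Real.exp (b * T) - b * Real.exp (a * T))
    / (Real.exp (a * T) - Real.exp (b * T)) ^ 2) (fun _ => outJ a b T)

theorem hasDerivAt_coefA (ha : 0 < a) (hb : b < 0) (hT : T ≠ 0) :
    HasDerivAt (fun T => coefA a b T X) (coefA' a b T X) T := by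
  have hne := exp_mul_ne ha hb hT
  rcases label_cases X with h | h | h
  · simp only [coefA, coefA', pw_left h]
    exact hasDerivAt_comp_neg hasDerivAt_outK
  on_goal 2 => simp only [coefA, coefA', pw_right h]; exact hasDerivAt_const T _
  simp only [coefA, coefA', pw_mid h]
  refine ((hasDerivAt_const T (a - b)).div
    ((hasDerivAt_exp_mul a T).sub (hasDerivAt_exp_mul b T)) hne).congr_deriv ?_
  simp only [Pi.sub_apply]; ring

theorem hasDerivAt_coefB (ha : 0 < a) (hb : b < 0) (hT : T ≠ 0) :
    HasDerivAt (fun T => coefB a b T X) (coefB' a b T X) T := by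
  have hne := exp_mul_ne ha hb hT
  rcases label_cases X with h | h | h
  · simp only [coefB, coefB', pw_left h]; exact hasDerivAt_const T _
  on_goal 2 => simp only [coefB, coefB', pw_right h]; exact hasDerivAt_outK
  simp only [coefB, coefB', pw_mid h]
  refine ((((hasDerivAt_exp_mul a T).mul (hasDerivAt_exp_mul b T)).const_mul (-(a - b))).div
    ((hasDerivAt_exp_mul a T).sub (hasDerivAt_exp_mul b T)) hne).congr_deriv ?_
  simp only [Pi.sub_apply, Pi.mul_apply]
  rw [div_left_inj' (pow_ne_zero 2 hne)]; ring

theorem exp_flowY_left (ha : 0 < a) (hb : b < 0) (h : X < 0) :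
    Real.exp (flowY a b T X) = Real.exp X / outD a b (-T) (Real.exp X) := by
  rw [flowY, pw_left h, Real.exp_sub, Real.exp_log (outD_pos ha hb (exp_mem_Icc_of_nonpos h.le))]

theorem exp_flowY_mid (ha : 0 < a) (hb : b < 0) (h : X ∈ Icc (0 : ℝ) 2) :
    Real.exp (flowY a b T X) = midN a b T X / midA a b T X := by
  rw [flowY, pw_mid h, Real.exp_sub, Real.exp_log (midN_pos ha hb h),
    Real.exp_log (midA_pos ha hb h)]

theorem exp_flowY_right (ha : 0 < a) (hb : b < 0) (h : 2 < X) :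
    Real.exp (flowY a b T X) = outD a b T (Real.exp (2 - X)) / Real.exp (2 - X) := by
  rw [flowY, pw_right h, Real.exp_add, Real.exp_log (outD_pos ha hb (exp_right_mem h.le)),
    mul_comm, div_eq_mul_inv, ← Real.exp_neg]
  ring_nf

/-- The slope `u_x ∘ y`. -/
def slope (a b T X : ℝ) : ℝ :=
  coefA a b T X * Real.exp (flowY a b T X) - coefB a b T X / Real.exp (flowY a b T X)

/-- Between the peaks u solves u = u_xx, so it is a combination of e^x and e^{-x} with coefficients
depending only on the region. The outer regions carry one exponential each, by decay. -/
theorem flowU_eq (ha : 0 < a) (hb : b < 0) (hT : T ≠ 0) : flowU a b T X =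
    coefA a b T X * Real.exp (flowY a b T X) + coefB a b T X / Real.exp (flowY a b T X) := by
  rcases label_cases X with h | hX | h'
  · rw [exp_flowY_left ha hb h, flowU, coefA, coefB, pw_left h, pw_left h, pw_left h, outU]; ring
  · have hN := (midN_pos (T := T) ha hb hX).ne'
    have hA := (midA_pos (T := T) ha hb hX).ne'
    have hne := exp_mul_ne ha hb hT
    rw [exp_flowY_mid ha hb hX, flowU, coefA, coefB, pw_mid hX, pw_mid hX, pw_mid hX,
      midU_eq ha hb hX hT]
    field_simp
    ring
  · rw [exp_flowY_right ha hb h', flowU, coefA, coefB, pw_right h', pw_right h', pw_right h',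
      outU]
    have hr := (Real.exp_pos (2 - X)).ne'
    field_simp
    ring

theorem flowUξ_eq (ha : 0 < a) (hb : b < 0) (hT : T ≠ 0) :
    flowUξ a b T X = slope a b T X * flowYξ a b T X := by
  unfold slope
  rcases label_cases X with h | hX | h'
  · rw [exp_flowY_left ha hb h, flowUξ, flowYξ, coefA, coefB, pw_left h, pw_left h, pw_left h,
      pw_left h, outV]; ring
  · have hN := (midN_pos (T := T) ha hb hX).ne'
    have hA := (midA_pos (T := T) ha hb hX).ne'
    have hne := exp_mul_ne ha hb hT
    rw [exp_flowY_mid ha hb hX, flowUξ, flowYξ, coefA, coefB, pw_mid hX, pw_mid hX, pw_mid hX,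
      pw_mid hX, midV, midY, midW]
    field_simp
    ring
  · rw [exp_flowY_right ha hb h', flowUξ, flowYξ, coefA, coefB, pw_right h', pw_right h',
      pw_right h', pw_right h', outV]
    have hr := (Real.exp_pos (2 - X)).ne'
    have hD := (outD_pos (T := T) ha hb (exp_right_mem h'.le)).ne'
    field_simp
    ring

/-- Away from the collision the energy is u_x² dx. At T = 0 this fails in the middle, where y_ξ = 0
but h̄ = -2ab. -/
theorem flowH_zero_eq (ha : 0 < a) (hb : b < 0) (hT : T ≠ 0) :
    flowH a b T 0 X = slope a b T X ^ 2 * flowYξ a b T X := by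
  unfold slope
  rcases label_cases X with h | hX | h'
  · rw [exp_flowY_left ha hb h, flowH, flowYξ, coefA, coefB, pw_left h, pw_left h, pw_left h,
      pw_left h, outH]
    have hD := (outD_pos (T := -T) ha hb (exp_mem_Icc_of_nonpos h.le)).ne'
    field_simp
    ring
  · have hN := (midN_pos (T := T) ha hb hX).ne'
    have hA := (midA_pos (T := T) ha hb hX).ne'
    have hne := exp_mul_ne ha hb hT
    rw [exp_flowY_mid ha hb hX, flowH, flowYξ, coefA, coefB, pw_mid hX, pw_mid hX, pw_mid hX,
      pw_mid hX, midH, midY, midW]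
    field_simp
    ring
  · rw [exp_flowY_right ha hb h', flowH, flowYξ, coefA, coefB, pw_right h', pw_right h',
      pw_right h', pw_right h', outH]
    have hr := (Real.exp_pos (2 - X)).ne'
    have hD := (outD_pos (T := T) ha hb (exp_right_mem h'.le)).ne'
    field_simp
    ring

/-- Unlike the expression of h̄ by the slope, this relation survives the collision, so it is checked
from the formulas directly. -/
theorem flowYξ_mul_flowH (ha : 0 < a) (hb : b < 0) :
    flowYξ a b T X * flowH a b T 0 X = flowUξ a b T X ^ 2 := by
  rcases label_cases X with h | hX | h'
  · rw [flowH, flowYξ, flowUξ, pw_left h, pw_left h, pw_left h, outH, outV]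
    have hD := (outD_pos (T := -T) ha hb (exp_mem_Icc_of_nonpos h.le)).ne'
    field_simp
  · have hN := (midN_pos (T := T) ha hb hX).ne'
    have hA := (midA_pos (T := T) ha hb hX).ne'
    rw [flowH, flowYξ, flowUξ, pw_mid hX, pw_mid hX, pw_mid hX, midH, midY, midV]
    field_simp
    ring
  · rw [flowH, flowYξ, flowUξ, pw_right h', pw_right h', pw_right h', outH, outV]
    have hD := (outD_pos (T := T) ha hb (exp_right_mem h'.le)).ne'
    field_simp

end flow

/-! #### Decay and continuity in time -/

/-- The weight measuring the decay of the flow in the label. -/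
def weight : ℝ → ℝ := pw Real.exp (fun _ => 1) (fun X => Real.exp (2 - X))

theorem weight_pos (X : ℝ) : 0 < weight X :=
  pw_cases (fun x => 0 < x) (fun _ => Real.exp_pos _) (fun _ => one_pos) (fun _ => Real.exp_pos _)

theorem weight_le_one (X : ℝ) : weight X ≤ 1 :=
  pw_cases (fun x => x ≤ 1) (fun h => Real.exp_le_one_iff.mpr h.le) (fun _ => le_rfl)
    (fun h => Real.exp_le_one_iff.mpr (by linarith))

theorem weight_le (X : ℝ) : weight X ≤ Real.exp 2 * Real.exp (-|X|) := by
  rw [← Real.exp_add]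
  refine pw_cases (fun x => x ≤ Real.exp (2 + -|X|)) (fun h => ?_) (fun h => ?_) (fun h => ?_)
  · rw [abs_of_neg h]; exact Real.exp_le_exp.mpr (by linarith)
  · rw [abs_of_nonneg h.1]; exact Real.one_le_exp (by linarith [h.2])
  · rw [abs_of_pos (by linarith)]; exact Real.exp_le_exp.mpr (by linarith)

theorem measurable_weight : Measurable weight :=
  measurable_pw (by fun_prop) (by fun_prop) (by fun_prop)

theorem integrable_weight : Integrable weight :=
  (integrable_exp_neg_abs.const_mul (Real.exp 2)).mono' measurable_weight.aestronglyMeasurable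
    (Eventually.of_forall fun X => by
      rw [Real.norm_eq_abs, abs_of_pos (weight_pos X)]; exact weight_le X)

theorem memLp_weight_top : MemLp weight ∞ volume :=
  memLp_top_of_bound measurable_weight.aestronglyMeasurable 1 (Eventually.of_forall fun X => by
    rw [Real.norm_eq_abs, abs_of_pos (weight_pos X)]; exact weight_le_one X)

theorem memLp_weight_two : MemLp weight 2 volume := by
  rw [memLp_two_iff_integrable_sq measurable_weight.aestronglyMeasurable]
  refine integrable_weight.mono' (measurable_weight.pow_const 2).aestronglyMeasurable
    (Eventually.of_forall fun X => ?_)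
  rw [Real.norm_eq_abs, abs_of_nonneg (sq_nonneg _)]
  nlinarith [weight_pos X, weight_le_one X]

theorem memLp_of_abs_le_weight {f : ℝ → ℝ} (hf : AEStronglyMeasurable f volume) {K : ℝ}
    (h : ∀ X, |f X| ≤ K * weight X) {p : ℝ≥0∞} (hp : MemLp weight p volume) : MemLp f p volume :=
  hp.of_le_mul hf (Eventually.of_forall fun X => by
    rw [Real.norm_eq_abs, Real.norm_eq_abs, abs_of_pos (weight_pos X)]; exact h X)

/-- Uniform continuity in time and boundedness in the label. -/
structure UniformFamily (g : ℝ → ℝ → ℝ) : Prop where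
  close : ∀ T, ∀ ε > 0, ∀ᶠ S in 𝓝 T, ∀ X, |g S X - g T X| ≤ ε
  bound : ∀ T, ∃ K, ∀ X, |g T X| ≤ K

/-- Continuity on a strip with compact cross-section gives continuity in T that is uniform in r. -/
theorem eventually_forall_abs_sub_le {φ : ℝ × ℝ → ℝ} {c d : ℝ} (hcd : c ≤ d)
    (hφ : ContinuousOn φ (univ ×ˢ Icc c d)) (T : ℝ) {ε : ℝ} (hε : 0 < ε) :
    ∀ᶠ S in 𝓝 T, ∀ r ∈ Icc c d, |φ (S, r) - φ (T, r)| ≤ ε := by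
  -- Projecting r to [c, d] extends φ continuously to the plane, so that two-sided neighbourhoods
  -- can be used at the ends.
  set ψ : ℝ × ℝ → ℝ := fun p => φ (p.1, projIcc c d hcd p.2) with hψ
  have hcont : Continuous ψ := by
    refine hφ.comp_continuous (continuous_fst.prodMk
      (continuous_subtype_val.comp (continuous_projIcc.comp continuous_snd))) fun p => ?_
    exact ⟨mem_univ _, (projIcc c d hcd p.2).2⟩
  have h1 : ∀ᶠ S in 𝓝 T, ∀ r ∈ Icc c d, |ψ (S, r) - ψ (T, r)| < ε := by
    refine isCompact_Icc.eventually_forall_of_forall_eventually fun r _ => ?_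
    have h2 : Continuous fun p : ℝ × ℝ => |ψ (p.1, p.2) - ψ (T, p.2)| := by fun_prop
    have h3 := h2.tendsto (T, r)
    simp only [sub_self, abs_zero] at h3
    exact h3.eventually (gt_mem_nhds hε)
  filter_upwards [h1] with S hS r hr
  have := hS r hr
  simp only [hψ, projIcc_of_mem hcd hr] at this
  exact this.le

theorem exists_abs_le_of_continuousOn {φ : ℝ × ℝ → ℝ} {c d : ℝ}
    (hφ : ContinuousOn φ (univ ×ˢ Icc c d)) (T : ℝ) : ∃ K, ∀ r ∈ Icc c d, |φ (T, r)| ≤ K := by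
  have h : ContinuousOn (fun r => φ (T, r)) (Icc c d) :=
    hφ.comp (by fun_prop) fun r hr => ⟨mem_univ _, hr⟩
  exact isCompact_Icc.exists_bound_of_continuousOn h

/-- The outer label regions become bounded in the variables e^X and e^{2-X}; adding the endpoint 0,
which stands for infinity, makes them compact. -/
theorem uniformFamily_pw {φl φm φr : ℝ × ℝ → ℝ} (hl : ContinuousOn φl (univ ×ˢ Icc 0 1))
    (hm : ContinuousOn φm (univ ×ˢ Icc 0 2)) (hr : ContinuousOn φr (univ ×ˢ Icc 0 1)) :
    UniformFamily fun T => pw (fun X => φl (T, Real.exp X)) (fun X => φm (T, X))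
      (fun X => φr (T, Real.exp (2 - X))) := by
  refine ⟨fun T ε hε => ?_, fun T => ?_⟩
  · filter_upwards [eventually_forall_abs_sub_le zero_le_one hl T hε,
      eventually_forall_abs_sub_le zero_le_two hm T hε,
      eventually_forall_abs_sub_le zero_le_one hr T hε] with S h1 h2 h3 X
    rcases label_cases X with h | h | h
    · simp only [pw_left h]; exact h1 _ (exp_mem_Icc_of_nonpos h.le)
    · simp only [pw_mid h]; exact h2 _ h
    · simp only [pw_right h]; exact h3 _ (exp_right_mem h.le)
  · obtain ⟨K₁, h1⟩ := exists_abs_le_of_continuousOn hl T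
    obtain ⟨K₂, h2⟩ := exists_abs_le_of_continuousOn hm T
    obtain ⟨K₃, h3⟩ := exists_abs_le_of_continuousOn hr T
    refine ⟨max K₁ (max K₂ K₃), fun X => ?_⟩
    rcases label_cases X with h | h | h
    · simp only [pw_left h]; exact (h1 _ (exp_mem_Icc_of_nonpos h.le)).trans (le_max_left _ _)
    · simp only [pw_mid h]
      exact (h2 _ h).trans ((le_max_left _ _).trans (le_max_right _ _))
    · simp only [pw_right h]
      exact (h3 _ (exp_right_mem h.le)).trans ((le_max_right _ _).trans (le_max_right _ _))

/-- Uniform continuity in time and decay in the label. -/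
def DecayingFamily (f : ℝ → ℝ → ℝ) : Prop :=
  ∃ g : ℝ → ℝ → ℝ, UniformFamily g ∧ ∀ T X, f T X = g T X * weight X

theorem DecayingFamily.close {f : ℝ → ℝ → ℝ} (hf : DecayingFamily f) (T : ℝ) {ε : ℝ} (hε : 0 < ε) :
    ∀ᶠ S in 𝓝 T, ∀ X, |f S X - f T X| ≤ ε * weight X := by
  obtain ⟨g, hg, h⟩ := hf
  filter_upwards [hg.close T ε hε] with S hS X
  rw [h, h, ← sub_mul, abs_mul, abs_of_pos (weight_pos X)]
  exact mul_le_mul_of_nonneg_right (hS X) (weight_pos X).le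

theorem DecayingFamily.bound {f : ℝ → ℝ → ℝ} (hf : DecayingFamily f) (T : ℝ) :
    ∃ K, ∀ X, |f T X| ≤ K * weight X := by
  obtain ⟨g, hg, h⟩ := hf
  obtain ⟨K, hK⟩ := hg.bound T
  refine ⟨K, fun X => ?_⟩
  rw [h, abs_mul, abs_of_pos (weight_pos X)]
  exact mul_le_mul_of_nonneg_right (hK X) (weight_pos X).le

theorem DecayingFamily.bound_nhds {f : ℝ → ℝ → ℝ} (hf : DecayingFamily f) (T : ℝ) :
    ∃ K, 0 ≤ K ∧ ∀ᶠ S in 𝓝 T, ∀ X, |f S X| ≤ K * weight X := by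
  obtain ⟨K, hK⟩ := hf.bound T
  refine ⟨|K| + 1, by positivity, (hf.close T one_pos).mono fun S hS X => ?_⟩
  have h1 := hS X
  have h2 := hK X
  have h3 : |f S X| ≤ |f S X - f T X| + |f T X| := by
    simpa using abs_add_le (f S X - f T X) (f T X)
  nlinarith [weight_pos X, le_abs_self K]

theorem DecayingFamily.memLp {f : ℝ → ℝ → ℝ} (hf : DecayingFamily f) {T : ℝ}
    (hm : AEStronglyMeasurable (f T) volume) {p : ℝ≥0∞} (hp : MemLp weight p volume) :
    MemLp (f T) p volume := by
  obtain ⟨K, hK⟩ := hf.bound T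
  exact memLp_of_abs_le_weight hm hK hp

/-- A pointwise bound by ε times a fixed L^p weight gives convergence in L^p for every relevant p at
once. -/
theorem DecayingFamily.tendsto_eLpNorm {f : ℝ → ℝ → ℝ} (hf : DecayingFamily f) (T : ℝ)
    {p : ℝ≥0∞} (hp : MemLp weight p volume) :
    Tendsto (fun S => eLpNorm (fun X => f S X - f T X) p volume) (𝓝 T) (𝓝 0) := by
  rw [ENNReal.tendsto_nhds_zero]
  intro ε hε
  have h1 : Tendsto (fun δ : ℝ => ENNReal.ofReal δ * eLpNorm weight p volume) (𝓝[>] 0) (𝓝 0) := by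
    have h2 : Tendsto (fun δ : ℝ => ENNReal.ofReal δ) (𝓝[>] 0) (𝓝 0) := by
      have := (ENNReal.continuous_ofReal.tendsto (0 : ℝ)).mono_left
        (nhdsWithin_le_nhds (s := Ioi 0))
      rwa [ENNReal.ofReal_zero] at this
    have := ENNReal.Tendsto.mul_const h2 (Or.inr hp.2.ne)
    rwa [zero_mul] at this
  obtain ⟨δ, hδ, hδ0⟩ := ((h1.eventually (ge_mem_nhds hε)).and self_mem_nhdsWithin).exists
  filter_upwards [hf.close T (mem_Ioi.mp hδ0)] with S hS
  refine le_trans (eLpNorm_le_mul_eLpNorm_of_ae_le_mul (Eventually.of_forall fun X => ?_) p) hδ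
  rw [Real.norm_eq_abs, Real.norm_eq_abs, abs_of_pos (weight_pos X)]
  exact hS X

theorem decayingFamily_pw {f : ℝ → ℝ → ℝ} {φl φm φr : ℝ × ℝ → ℝ}
    (hl : ContinuousOn φl (univ ×ˢ Icc 0 1)) (hm : ContinuousOn φm (univ ×ˢ Icc 0 2))
    (hr : ContinuousOn φr (univ ×ˢ Icc 0 1))
    (h1 : ∀ T, ∀ X < 0, f T X = φl (T, Real.exp X) * Real.exp X)
    (h2 : ∀ T, ∀ X ∈ Icc (0 : ℝ) 2, f T X = φm (T, X))
    (h3 : ∀ T, ∀ X > 2, f T X = φr (T, Real.exp (2 - X)) * Real.exp (2 - X)) :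
    DecayingFamily f := by
  refine ⟨_, uniformFamily_pw hl hm hr, fun T X => ?_⟩
  rcases label_cases X with h | h | h
  · simp only [pw_left h, weight]; exact h1 T X h
  · simp only [pw_mid h, weight, mul_one]; exact h2 T X h
  · simp only [pw_right h, weight]; exact h3 T X h

section flow

variable {a b T k X : ℝ}

theorem continuous_outD_neg : Continuous fun p : ℝ × ℝ => outD a b (-p.1) p.2 :=
  continuous_outD.comp (by fun_prop : Continuous fun p : ℝ × ℝ => (-p.1, p.2))

theorem outD_ne (ha : 0 < a) (hb : b < 0) :
    ∀ p ∈ (univ : Set ℝ) ×ˢ Icc (0 : ℝ) 1, outD a b p.1 p.2 ≠ 0 :=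
  fun _ hp => (outD_pos ha hb hp.2).ne'

theorem outD_neg_ne (ha : 0 < a) (hb : b < 0) :
    ∀ p ∈ (univ : Set ℝ) ×ˢ Icc (0 : ℝ) 1, outD a b (-p.1) p.2 ≠ 0 :=
  fun _ hp => (outD_pos ha hb hp.2).ne'

theorem continuous_midN_prod : Continuous fun p : ℝ × ℝ => midN a b p.1 p.2 := by
  unfold midN; fun_prop

theorem continuous_midA_prod : Continuous fun p : ℝ × ℝ => midA a b p.1 p.2 := by
  unfold midA; fun_prop

theorem continuous_midW_prod : Continuous fun p : ℝ × ℝ => midW a b p.1 p.2 := by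
  have := continuous_midN_prod (a := a) (b := b)
  have := continuous_midA_prod (a := a) (b := b)
  unfold midW; fun_prop

theorem midA_ne (ha : 0 < a) (hb : b < 0) :
    ∀ p ∈ (univ : Set ℝ) ×ˢ Icc (0 : ℝ) 2, midA a b p.1 p.2 ≠ 0 :=
  fun _ hp => (midA_pos ha hb hp.2).ne'

theorem midN_ne (ha : 0 < a) (hb : b < 0) :
    ∀ p ∈ (univ : Set ℝ) ×ˢ Icc (0 : ℝ) 2, midN a b p.1 p.2 ≠ 0 :=
  fun _ hp => (midN_pos ha hb hp.2).ne'

theorem midAN_pow_ne (ha : 0 < a) (hb : b < 0) (n : ℕ) :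
    ∀ p ∈ (univ : Set ℝ) ×ˢ Icc (0 : ℝ) 2, (midA a b p.1 p.2 * midN a b p.1 p.2) ^ n ≠ 0 :=
  fun p hp => pow_ne_zero n (mul_ne_zero (midA_ne ha hb p hp) (midN_ne ha hb p hp))

theorem continuousOn_midY (ha : 0 < a) (hb : b < 0) :
    ContinuousOn (fun p : ℝ × ℝ => midY a b p.1 p.2) (univ ×ˢ Icc 0 2) := by
  have := continuous_midN_prod (a := a) (b := b)
  have := continuous_midA_prod (a := a) (b := b)
  exact ContinuousOn.div (by fun_prop) (by fun_prop) fun p hp => by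
    simpa using midAN_pow_ne ha hb 1 p hp

theorem continuousOn_midU (ha : 0 < a) (hb : b < 0) :
    ContinuousOn (fun p : ℝ × ℝ => midU a b p.1 p.2) (univ ×ˢ Icc 0 2) := by
  have := continuous_midN_prod (a := a) (b := b)
  have := continuous_midA_prod (a := a) (b := b)
  exact (ContinuousOn.div (by unfold midNt; fun_prop) (by fun_prop) (midN_ne ha hb)).sub
    (ContinuousOn.div (by unfold midAt; fun_prop) (by fun_prop) (midA_ne ha hb))

theorem continuousOn_midV (ha : 0 < a) (hb : b < 0) :
    ContinuousOn (fun p : ℝ × ℝ => midV a b p.1 p.2) (univ ×ˢ Icc 0 2) := by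
  have := continuous_midN_prod (a := a) (b := b)
  have := continuous_midA_prod (a := a) (b := b)
  have := continuous_midW_prod (a := a) (b := b)
  exact ContinuousOn.div (by fun_prop) (by fun_prop) (midAN_pow_ne ha hb 2)

theorem continuousOn_midH (ha : 0 < a) (hb : b < 0) :
    ContinuousOn (fun p : ℝ × ℝ => midH a b p.1 p.2) (univ ×ˢ Icc 0 2) := by
  have := continuous_midN_prod (a := a) (b := b)
  have := continuous_midA_prod (a := a) (b := b)
  have := continuous_midW_prod (a := a) (b := b)
  exact ContinuousOn.div (by fun_prop) (by fun_prop) (midAN_pow_ne ha hb 3)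

theorem decayingFamily_flowYξ (ha : 0 < a) (hb : b < 0) :
    DecayingFamily fun T X => flowYξ a b T X - 1 := by
  have c1 := continuous_outD_neg (a := a) (b := b)
  have c2 := continuous_outD (a := a) (b := b)
  have c3 := continuous_outM (a := a) (b := b)
  -- From 1/D - 1 = -(M/D) r with D = 1 + M r: the factor r is the weight.
  refine decayingFamily_pw (φl := fun p => -outM a b (-p.1) / outD a b (-p.1) p.2)
    (φm := fun p => midY a b p.1 p.2 - 1) (φr := fun p => -outM a b p.1 / outD a b p.1 p.2)
    (ContinuousOn.div (by fun_prop) (by fun_prop) (outD_neg_ne ha hb))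
    ((continuousOn_midY ha hb).sub continuousOn_const)
    (ContinuousOn.div (by fun_prop) (by fun_prop) (outD_ne ha hb)) ?_ ?_ ?_
  · intro T X h
    have hD := (outD_pos (T := -T) ha hb (exp_mem_Icc_of_nonpos h.le)).ne'
    simp only [flowYξ, pw_left h]
    field_simp
    unfold outD; ring
  · intro T X h
    simp only [flowYξ, pw_mid h]
  · intro T X h
    have hD := (outD_pos (T := T) ha hb (exp_right_mem h.le)).ne'
    simp only [flowYξ, pw_right h]
    field_simp
    unfold outD; ring

theorem decayingFamily_flowU (ha : 0 < a) (hb : b < 0) :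
    DecayingFamily fun T X => flowU a b T X := by
  have c1 := continuous_outD_neg (a := a) (b := b)
  have c2 := continuous_outD (a := a) (b := b)
  have c3 := continuous_outK (a := a) (b := b)
  refine decayingFamily_pw (φl := fun p => outK a b (-p.1) / outD a b (-p.1) p.2)
    (φm := fun p => midU a b p.1 p.2) (φr := fun p => outK a b p.1 / outD a b p.1 p.2)
    (ContinuousOn.div (by fun_prop) (by fun_prop) (outD_neg_ne ha hb)) (continuousOn_midU ha hb)
    (ContinuousOn.div (by fun_prop) (by fun_prop) (outD_ne ha hb)) ?_ ?_ ?_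
  · intro T X h
    simp only [flowU, pw_left h, outU]; ring
  · intro T X h
    simp only [flowU, pw_mid h]
  · intro T X h
    simp only [flowU, pw_right h, outU]; ring

theorem decayingFamily_flowUξ (ha : 0 < a) (hb : b < 0) :
    DecayingFamily fun T X => flowUξ a b T X := by
  have c1 := continuous_outD_neg (a := a) (b := b)
  have c2 := continuous_outD (a := a) (b := b)
  have c3 := continuous_outK (a := a) (b := b)
  refine decayingFamily_pw (φl := fun p => outK a b (-p.1) / outD a b (-p.1) p.2 ^ 2)
    (φm := fun p => midV a b p.1 p.2) (φr := fun p => -outK a b p.1 / outD a b p.1 p.2 ^ 2)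
    (ContinuousOn.div (by fun_prop) (by fun_prop)
      fun p hp => pow_ne_zero 2 (outD_neg_ne ha hb p hp)) (continuousOn_midV ha hb)
    (ContinuousOn.div (by fun_prop) (by fun_prop)
      fun p hp => pow_ne_zero 2 (outD_ne ha hb p hp)) ?_ ?_ ?_
  · intro T X h
    simp only [flowUξ, pw_left h, outV]; ring
  · intro T X h
    simp only [flowUξ, pw_mid h]
  · intro T X h
    simp only [flowUξ, pw_right h, outV]; ring

theorem decayingFamily_flowH (ha : 0 < a) (hb : b < 0) (k : ℝ) :
    DecayingFamily fun T X => flowH a b T k X := by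
  have c1 := continuous_outD_neg (a := a) (b := b)
  have c2 := continuous_outD (a := a) (b := b)
  have c3 := continuous_outK (a := a) (b := b)
  refine decayingFamily_pw
    (φl := fun p => outK a b (-p.1) ^ 2 * p.2 / outD a b (-p.1) p.2 ^ 3)
    (φm := fun p => midH a b p.1 p.2 + k)
    (φr := fun p => outK a b p.1 ^ 2 * p.2 / outD a b p.1 p.2 ^ 3)
    (ContinuousOn.div (by fun_prop) (by fun_prop)
      fun p hp => pow_ne_zero 3 (outD_neg_ne ha hb p hp))
    ((continuousOn_midH ha hb).add continuousOn_const)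
    (ContinuousOn.div (by fun_prop) (by fun_prop)
      fun p hp => pow_ne_zero 3 (outD_ne ha hb p hp)) ?_ ?_ ?_
  · intro T X h
    simp only [flowH, pw_left h, outH]; ring
  · intro T X h
    simp only [flowH, pw_mid h]
  · intro T X h
    simp only [flowH, pw_right h, outH]; ring

theorem uniformFamily_flowY (ha : 0 < a) (hb : b < 0) :
    UniformFamily fun T X => flowY a b T X - X := by
  have c1 := continuous_outD_neg (a := a) (b := b)
  have c2 := continuous_outD (a := a) (b := b)
  have c3 := continuous_midN_prod (a := a) (b := b)
  have c4 := continuous_midA_prod (a := a) (b := b)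
  have := uniformFamily_pw (φl := fun p => -Real.log (outD a b (-p.1) p.2))
    (φm := fun p => Real.log (midN a b p.1 p.2) - Real.log (midA a b p.1 p.2) - p.2)
    (φr := fun p => -2 + Real.log (outD a b p.1 p.2))
    (c1.continuousOn.log (outD_neg_ne ha hb)).neg
    (((c3.continuousOn.log (midN_ne ha hb)).sub (c4.continuousOn.log (midA_ne ha hb))).sub
      continuous_snd.continuousOn)
    (continuousOn_const.add (c2.continuousOn.log (outD_ne ha hb)))
  convert this using 3 with T X
  rcases label_cases X with h | h | h
  · simp only [flowY, pw_left h]; ring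
  · simp only [flowY, pw_mid h]
  · simp only [flowY, pw_right h]; ring

theorem measurable_flowYξ : Measurable (flowYξ a b T) := by
  refine measurable_pw ?_ ?_ ?_
  · unfold outD; fun_prop
  · unfold midY midA midN; fun_prop
  · unfold outD; fun_prop

theorem measurable_flowUξ : Measurable (flowUξ a b T) := by
  refine measurable_pw ?_ ?_ ?_
  · unfold outV outD; fun_prop
  · unfold midV midW midA midN; fun_prop
  · unfold outV outD; fun_prop

theorem measurable_flowH : Measurable (flowH a b T k) := by
  refine measurable_pw ?_ ?_ ?_
  · unfold outH outD; fun_prop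
  · unfold midH midW midA midN; fun_prop
  · unfold outH outD; fun_prop

theorem midY_nonneg (ha : 0 < a) (hb : b < 0) (h : X ∈ Icc (0 : ℝ) 2) : 0 ≤ midY a b T X := by
  have h1 := midN_pos (T := T) ha hb h
  have h2 := midA_pos (T := T) ha hb h
  have h3 : 0 < -2 * a * b := by nlinarith
  unfold midY; positivity

theorem midY_pos (ha : 0 < a) (hb : b < 0) (h : X ∈ Icc (0 : ℝ) 2) (hT : T ≠ 0) :
    0 < midY a b T X := by
  have h1 := midN_pos (T := T) ha hb h
  have h2 := midA_pos (T := T) ha hb h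
  have h3 : 0 < -2 * a * b := by nlinarith
  have h4 := exp_mul_ne ha hb hT
  unfold midY; positivity

theorem midH_pos (ha : 0 < a) (hb : b < 0) (h : X ∈ Icc (0 : ℝ) 2) : 0 < midH a b T X := by
  have h1 := midN_pos (T := T) ha hb h
  have h2 := midA_pos (T := T) ha hb h
  have h3 : 0 < -2 * a * b := by nlinarith
  have h4 := midW_pos (T := T) ha hb h
  have h5 : 0 < a - b := by linarith
  unfold midH; positivity

theorem flowYξ_nonneg (ha : 0 < a) (hb : b < 0) (X : ℝ) : 0 ≤ flowYξ a b T X :=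
  pw_cases (fun x => 0 ≤ x)
    (fun h => (inv_pos.mpr (outD_pos ha hb (exp_mem_Icc_of_nonpos h.le))).le)
    (fun h => midY_nonneg ha hb h)
    (fun h => (inv_pos.mpr (outD_pos ha hb (exp_right_mem h.le))).le)

theorem flowYξ_pos (ha : 0 < a) (hb : b < 0) (hT : T ≠ 0) (X : ℝ) : 0 < flowYξ a b T X :=
  pw_cases (fun x => 0 < x)
    (fun h => inv_pos.mpr (outD_pos ha hb (exp_mem_Icc_of_nonpos h.le)))
    (fun h => midY_pos ha hb h hT)
    (fun h => inv_pos.mpr (outD_pos ha hb (exp_right_mem h.le)))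

theorem flowH_nonneg (ha : 0 < a) (hb : b < 0) (hk : 0 ≤ k) (X : ℝ) : 0 ≤ flowH a b T k X :=
  pw_cases (fun x => 0 ≤ x)
    (fun h => by
      have := outD_pos (T := -T) ha hb (exp_mem_Icc_of_nonpos h.le)
      unfold outH; positivity)
    (fun h => add_nonneg (midH_pos ha hb h).le hk)
    (fun h => by
      have := outD_pos (T := T) ha hb (exp_right_mem h.le)
      unfold outH; positivity)

theorem flowH_sub (X : ℝ) : flowH a b T k X = flowH a b T 0 X + pw 0 (fun _ => k) 0 X := by
  rcases label_cases X with h | h | h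
  · simp only [flowH, pw_left h]; simp
  · simp only [flowH, pw_mid h]; ring
  · simp only [flowH, pw_right h]; simp

theorem inv_outD_ge (ha : 0 < a) (hb : b < 0) {r : ℝ} (hr : r ∈ Icc (0 : ℝ) 1) :
    (1 + |outM a b T|)⁻¹ ≤ (outD a b T r)⁻¹ := by
  refine inv_anti₀ (outD_pos ha hb hr) ?_
  unfold outD
  nlinarith [le_abs_self (outM a b T), hr.1, hr.2, abs_nonneg (outM a b T)]

/-- Valid at the collision too: outside [0, 2] the slope y_ξ stays away from 0, and on [0, 2] the
positive continuous function h̄ does. So y_ξ + h̄, and not merely y_ξ + h, is bounded below. -/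
theorem exists_lower_flow (ha : 0 < a) (hb : b < 0) :
    ∃ c : ℝ, 0 < c ∧ ∀ X, (X ∉ Icc (0 : ℝ) 2 → c ≤ flowYξ a b T X) ∧
      (X ∈ Icc (0 : ℝ) 2 → c ≤ flowH a b T 0 X) := by
  have hc : ContinuousOn (fun X => midH a b T X) (Icc 0 2) :=
    ContinuousOn.comp (g := fun p : ℝ × ℝ => midH a b p.1 p.2) (f := fun X => (T, X))
      (continuousOn_midH ha hb) (by fun_prop) fun X hX => ⟨mem_univ _, hX⟩
  obtain ⟨X₀, hX₀, hmin⟩ := isCompact_Icc.exists_isMinOn ⟨0, by simp⟩ hc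
  have h1 : 0 < (1 + |outM a b (-T)|)⁻¹ := by positivity
  have h2 : 0 < (1 + |outM a b T|)⁻¹ := by positivity
  have h3 := midH_pos (T := T) ha hb hX₀
  obtain ⟨c, hc, hc1, hc2, hc3⟩ : ∃ c : ℝ, 0 < c ∧ c ≤ (1 + |outM a b (-T)|)⁻¹ ∧
      c ≤ (1 + |outM a b T|)⁻¹ ∧ c ≤ midH a b T X₀ :=
    ⟨_, lt_min h1 (lt_min h2 h3), min_le_left _ _, (min_le_right _ _).trans (min_le_left _ _),
      (min_le_right _ _).trans (min_le_right _ _)⟩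
  refine ⟨c, hc, fun X => ⟨fun h => ?_, fun h => ?_⟩⟩
  · rcases label_cases X with h' | h' | h'
    · simp only [flowYξ, pw_left h']
      exact hc1.trans (inv_outD_ge ha hb (exp_mem_Icc_of_nonpos h'.le))
    · exact absurd h' h
    · simp only [flowYξ, pw_right h']
      exact hc2.trans (inv_outD_ge ha hb (exp_right_mem h'.le))
  · simp only [flowH, pw_mid h, add_zero]
    have h4 : midH a b T X₀ ≤ midH a b T X := hmin h
    exact hc3.trans h4

theorem tendsto_flowY_sub :
    Tendsto (fun X => flowY a b T X - X) atBot (𝓝 0) := by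
  have h1 : Tendsto (fun X => -Real.log (outD a b (-T) (Real.exp X))) atBot (𝓝 0) := by
    have h2 : Tendsto (fun X => outD a b (-T) (Real.exp X)) atBot (𝓝 1) := by
      have := (Real.tendsto_exp_atBot.const_mul (outM a b (-T))).const_add 1
      simpa [outD] using this
    have := ((Real.continuousAt_log one_ne_zero).tendsto.comp h2).neg
    simpa using this
  refine h1.congr' ?_
  filter_upwards [eventually_lt_atBot 0] with X h
  simp only [flowY, pw_left h]; ring

theorem locallyIntegrable_of_decay {f : ℝ → ℝ → ℝ} (hf : DecayingFamily f)
    (hm : Measurable (f T)) : LocallyIntegrable (f T) volume :=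
  (hf.memLp hm.aestronglyMeasurable memLp_weight_top).locallyIntegrable le_top

theorem isWeakDeriv_flowY (ha : 0 < a) (hb : b < 0) :
    IsWeakDeriv (flowY a b T) (flowYξ a b T) := by
  refine .of_hasDerivAt_off_countable (s := {0, 2}) (by simp)
    (continuous_flowY ha hb) (hasDerivAt_flowY_label ha hb) ?_
  have h1 := (locallyIntegrable_of_decay (T := T) (decayingFamily_flowYξ ha hb)
    (measurable_flowYξ.sub_const 1)).add (locallyIntegrable_const (1 : ℝ))
  have h2 : (flowYξ a b T) = (fun X => flowYξ a b T X - 1) + fun _ => (1 : ℝ) := by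
    ext X; simp
  rw [h2]
  exact h1

theorem isWeakDeriv_flowU (ha : 0 < a) (hb : b < 0) :
    IsWeakDeriv (flowU a b T) (flowUξ a b T) :=
  .of_hasDerivAt_off_countable (s := {0, 2}) (by simp)
    (continuous_flowU ha hb) (hasDerivAt_flowU_label ha hb)
    (locallyIntegrable_of_decay (decayingFamily_flowUξ ha hb) measurable_flowUξ)

theorem memLp_flowH (ha : 0 < a) (hb : b < 0) {p : ℝ≥0∞} (hp : MemLp weight p volume) :
    MemLp (flowH a b T k) p volume :=
  (decayingFamily_flowH ha hb k).memLp measurable_flowH.aestronglyMeasurable hp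

theorem integrable_flowH (ha : 0 < a) (hb : b < 0) : Integrable (flowH a b T k) :=
  memLp_one_iff_integrable.mp
    (memLp_flowH ha hb (memLp_one_iff_integrable.mpr integrable_weight))

theorem memF_flowState (ha : 0 < a) (hb : b < 0) (hk : 0 ≤ k) : (flowState a b T k).MemF := by
  have hζ : MemLp (fun X => flowY a b T X - X) ∞ volume := by
    obtain ⟨K, hK⟩ := (uniformFamily_flowY ha hb).bound T
    exact memLp_top_of_bound ((continuous_flowY ha hb).sub continuous_id).aestronglyMeasurable K
      (Eventually.of_forall hK)
  have hζξ : ∀ {p : ℝ≥0∞}, MemLp weight p volume → MemLp (fun X => flowYξ a b T X - 1) p volume :=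
    fun hp => (decayingFamily_flowYξ ha hb).memLp
      (measurable_flowYξ.sub_const 1).aestronglyMeasurable hp
  have hU : ∀ {p : ℝ≥0∞}, MemLp weight p volume → MemLp (flowU a b T) p volume :=
    fun hp => (decayingFamily_flowU ha hb).memLp (continuous_flowU ha hb).aestronglyMeasurable hp
  have hUξ : ∀ {p : ℝ≥0∞}, MemLp weight p volume → MemLp (flowUξ a b T) p volume :=
    fun hp => (decayingFamily_flowUξ ha hb).memLp measurable_flowUξ.aestronglyMeasurable hp
  have hle : ∀ X, flowH a b T 0 X ≤ flowH a b T k X := fun X => by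
    rw [flowH_sub (k := k)]
    have : 0 ≤ pw 0 (fun _ => k) 0 X :=
      pw_cases (fun x => 0 ≤ x) (fun _ => le_rfl) (fun _ => hk) (fun _ => le_rfl)
    linarith
  have hlow : ∃ c : ℝ, 0 < c ∧ ∀ᵐ X, c ≤ flowYξ a b T X + flowH a b T k X := by
    obtain ⟨c, hc, h⟩ := exists_lower_flow (T := T) ha hb
    refine ⟨c, hc, Eventually.of_forall fun X => ?_⟩
    have h1 := flowYξ_nonneg (T := T) ha hb X
    have h2 := flowH_nonneg (T := T) ha hb le_rfl X
    have h3 := hle X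
    by_cases hX : X ∈ Icc (0 : ℝ) 2
    · linarith [(h X).2 hX]
    · linarith [(h X).1 hX]
  exact
  { deriv_y := isWeakDeriv_flowY ha hb
    deriv_U := isWeakDeriv_flowU ha hb
    ζ_bdd := hζ
    U_two := hU memLp_weight_two
    U_bdd := hU memLp_weight_top
    ζξ_two := hζξ memLp_weight_two
    ζξ_bdd := hζξ memLp_weight_top
    Uξ_two := hUξ memLp_weight_two
    Uξ_bdd := hUξ memLp_weight_top
    h_two := memLp_flowH ha hb memLp_weight_two
    h_bdd := memLp_flowH ha hb memLp_weight_top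
    h_int := integrable_flowH ha hb
    hbar_meas := measurable_flowH.aestronglyMeasurable
    yξ_nonneg := Eventually.of_forall (flowYξ_nonneg ha hb)
    h_nonneg := Eventually.of_forall (flowH_nonneg ha hb hk)
    hbar_nonneg := Eventually.of_forall (flowH_nonneg ha hb le_rfl)
    ζ_lim := tendsto_flowY_sub
    lower := hlow
    energy_rel := Eventually.of_forall fun X => flowYξ_mul_flowH ha hb
    hbar_le := Eventually.of_forall hle
    relabel := add_integral_mem_relabelingGroup (isWeakDeriv_flowY ha hb) hζ
      (hζξ memLp_weight_two) (hζξ memLp_weight_top) (integrable_flowH ha hb)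
      (memLp_flowH ha hb memLp_weight_two) (memLp_flowH ha hb memLp_weight_top)
      (Eventually.of_forall (flowH_nonneg ha hb hk)) hlow }

theorem tendsto_lagrangianDist_flowState (ha : 0 < a) (hb : b < 0) (k T : ℝ) :
    Tendsto (fun S => lagrangianDist (flowState a b S k) (flowState a b T k)) (𝓝 T) (𝓝 0) := by
  have hy : Tendsto (fun S => eLpNorm (fun X => flowY a b S X - flowY a b T X) ∞ volume)
      (𝓝 T) (𝓝 0) := by
    rw [ENNReal.tendsto_nhds_zero]
    intro ε hε
    have h2 : Tendsto (fun δ : ℝ => ENNReal.ofReal δ) (𝓝[>] 0) (𝓝 0) := by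
      have := (ENNReal.continuous_ofReal.tendsto (0 : ℝ)).mono_left
        (nhdsWithin_le_nhds (s := Ioi 0))
      rwa [ENNReal.ofReal_zero] at this
    obtain ⟨δ, hδ, hδ0⟩ := ((h2.eventually (ge_mem_nhds hε)).and self_mem_nhdsWithin).exists
    filter_upwards [(uniformFamily_flowY ha hb).close T δ hδ0] with S hS
    refine le_trans ?_ hδ
    rw [eLpNorm_exponent_top]
    refine eLpNormEssSup_le_of_ae_bound (Eventually.of_forall fun X => ?_)
    have := hS X
    rwa [sub_sub_sub_cancel_right] at this
  have hYξ : ∀ {p : ℝ≥0∞}, MemLp weight p volume →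
      Tendsto (fun S => eLpNorm (fun X => flowYξ a b S X - flowYξ a b T X) p volume)
        (𝓝 T) (𝓝 0) := fun hp => by
    have := (decayingFamily_flowYξ (a := a) (b := b) ha hb).tendsto_eLpNorm T hp
    simpa only [sub_sub_sub_cancel_right] using this
  have hU := fun {p} hp => (decayingFamily_flowU (a := a) (b := b) ha hb).tendsto_eLpNorm T
    (p := p) hp
  have hUξ := fun {p} hp => (decayingFamily_flowUξ (a := a) (b := b) ha hb).tendsto_eLpNorm T
    (p := p) hp
  have hH := fun {p} hp => (decayingFamily_flowH (a := a) (b := b) ha hb k).tendsto_eLpNorm T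
    (p := p) hp
  have := ((((((((hy.add (hU memLp_weight_two)).add (hU memLp_weight_top)).add
    (hYξ memLp_weight_two)).add (hYξ memLp_weight_top)).add (hUξ memLp_weight_two)).add
    (hUξ memLp_weight_top)).add (hH memLp_weight_two)).add (hH memLp_weight_top))
  simp only [add_zero] at this
  exact this

end flow

/-! #### The nonlocal terms -/

theorem LagrangianState.MemF.integrable_kernel_density {Θ : LagrangianState} (hΘ : Θ.MemF)
    {σ : ℝ → ℝ} (hσ : Measurable σ) (hσ1 : ∀ η, |σ η| ≤ 1) {M : ℝ}
    (hM : ∀ᵐ ξ, Θ.BoundedBy M ξ) (ξ : ℝ) :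
    Integrable (fun η => σ η * Real.exp (-|Θ.y ξ - Θ.y η|) * Θ.density η) ∧
      |∫ η, σ η * Real.exp (-|Θ.y ξ - Θ.y η|) * Θ.density η| ≤ nonlocalBound M :=
  integrable_kernel hσ hσ1 hΘ.deriv_y.continuous hΘ.density_meas (hΘ.abs_density_le hM)
    (hΘ.abs_y_sub_le hM) (hΘ.abs_y_sub_le hM ξ)

theorem LagrangianState.MemF.abs_Q_le {Θ : LagrangianState} (hΘ : Θ.MemF) {M : ℝ}
    (hM : ∀ᵐ ξ, Θ.BoundedBy M ξ) (ξ : ℝ) : |Θ.Q ξ| ≤ nonlocalBound M := by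
  rw [Θ.Q_eq, neg_mul, abs_neg]
  exact abs_quarter_mul_le
    (hΘ.integrable_kernel_density (measurable_sign_sub ξ) (fun _ => abs_sign_le _) hM ξ).2

/-- For nondecreasing characteristics the nonlocal terms are given by one-sided integrals. -/
theorem LagrangianState.MemF.nonlocal_eq {Θ : LagrangianState} (hΘ : Θ.MemF) (hy : Monotone Θ.y)
    (ξ : ℝ) :
    IntegrableOn (fun η => Real.exp (Θ.y η) * Θ.density η) (Iic ξ) ∧
    IntegrableOn (fun η => Real.exp (-Θ.y η) * Θ.density η) (Ioi ξ) ∧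
    Θ.P ξ = 1 / 4 * (Real.exp (-Θ.y ξ) * (∫ η in Iic ξ, Real.exp (Θ.y η) * Θ.density η) +
      Real.exp (Θ.y ξ) * ∫ η in Ioi ξ, Real.exp (-Θ.y η) * Θ.density η) ∧
    Θ.Q ξ = -(1 / 4) * (Real.exp (-Θ.y ξ) * (∫ η in Iic ξ, Real.exp (Θ.y η) * Θ.density η) -
      Real.exp (Θ.y ξ) * ∫ η in Ioi ξ, Real.exp (-Θ.y η) * Θ.density η) := by
  obtain ⟨M, hM⟩ := hΘ.exists_bound
  have h1 := (hΘ.integrable_kernel_density (σ := fun _ => 1) measurable_const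
    (fun _ => by simp) hM ξ).1
  have h2 := (hΘ.integrable_kernel_density (measurable_sign_sub ξ) (fun _ => abs_sign_le _) hM ξ).1
  have e1 : ∀ η ∈ Iic ξ, 1 * Real.exp (-|Θ.y ξ - Θ.y η|) * Θ.density η
      = Real.exp (-Θ.y ξ) * (Real.exp (Θ.y η) * Θ.density η) := fun η hη => by
    rw [abs_of_nonneg (sub_nonneg.mpr (hy hη)), ← mul_assoc, ← Real.exp_add]; ring_nf
  have e2 : ∀ η ∈ Ioi ξ, 1 * Real.exp (-|Θ.y ξ - Θ.y η|) * Θ.density η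
      = Real.exp (Θ.y ξ) * (Real.exp (-Θ.y η) * Θ.density η) := fun η hη => by
    rw [abs_of_nonpos (sub_nonpos.mpr (hy (le_of_lt hη))), ← mul_assoc, ← Real.exp_add]; ring_nf
  -- Only almost everywhere, because the sign vanishes at η = ξ.
  have e3 : ∀ᵐ η, η ∈ Iic ξ → Real.sign (ξ - η) * Real.exp (-|Θ.y ξ - Θ.y η|) * Θ.density η
      = Real.exp (-Θ.y ξ) * (Real.exp (Θ.y η) * Θ.density η) := by
    filter_upwards [Measure.ae_ne volume ξ] with η hne hη
    rw [← e1 η hη, Real.sign_of_pos (sub_pos.mpr (lt_of_le_of_ne hη hne))]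
  have e4 : ∀ η ∈ Ioi ξ, Real.sign (ξ - η) * Real.exp (-|Θ.y ξ - Θ.y η|) * Θ.density η
      = -(Real.exp (Θ.y ξ) * (Real.exp (-Θ.y η) * Θ.density η)) := fun η hη => by
    rw [← e2 η hη, Real.sign_of_neg (sub_neg.mpr hη)]; ring
  have i1 : IntegrableOn (fun η => Real.exp (Θ.y η) * Θ.density η) (Iic ξ) := by
    have := (integrableOn_congr_fun e1 measurableSet_Iic).mp h1.integrableOn
    exact (integrable_const_mul_iff (Real.exp_pos _).ne'.isUnit _).mp this
  have i2 : IntegrableOn (fun η => Real.exp (-Θ.y η) * Θ.density η) (Ioi ξ) := by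
    have := (integrableOn_congr_fun e2 measurableSet_Ioi).mp h1.integrableOn
    exact (integrable_const_mul_iff (Real.exp_pos _).ne'.isUnit _).mp this
  refine ⟨i1, i2, ?_, ?_⟩
  · rw [Θ.P_eq, ← intervalIntegral.integral_Iic_add_Ioi h1.integrableOn h1.integrableOn,
      setIntegral_congr_fun measurableSet_Iic e1, setIntegral_congr_fun measurableSet_Ioi e2,
      integral_const_mul, integral_const_mul]
  · rw [Θ.Q_eq, ← intervalIntegral.integral_Iic_add_Ioi h2.integrableOn h2.integrableOn,
      setIntegral_congr_ae measurableSet_Iic e3, setIntegral_congr_fun measurableSet_Ioi e4,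
      integral_neg, integral_const_mul, integral_const_mul, sub_eq_add_neg]

/-- The antiderivative of `e^y (2 U² y_ξ + h̄)`. -/
def potL (a b T X : ℝ) : ℝ := 4 * coefB' a b T X
  + coefA a b T X ^ 2 * Real.exp (flowY a b T X) ^ 3
  - 3 * coefB a b T X ^ 2 / Real.exp (flowY a b T X)
  + 2 * coefA a b T X * coefB a b T X * Real.exp (flowY a b T X)

/-- The antiderivative of `-e^{-y} (2 U² y_ξ + h̄)`. -/
def potR (a b T X : ℝ) : ℝ := -4 * coefA' a b T X
  - 3 * coefA a b T X ^ 2 * Real.exp (flowY a b T X)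
  + coefB a b T X ^ 2 / Real.exp (flowY a b T X) ^ 3
  + 2 * coefA a b T X * coefB a b T X / Real.exp (flowY a b T X)

section nonlocal

variable {a b T X : ℝ}

theorem exp_flowY_zero (ha : 0 < a) (hb : b < 0) : Real.exp (flowY a b T 0) =
    (a - b) * (Real.exp (a * T) * Real.exp (b * T)) /
      (a * Real.exp (b * T) - b * Real.exp (a * T)) := by
  rw [exp_flowY_mid ha hb ⟨le_rfl, zero_le_two⟩, midN, midA]
  simp only [mul_zero, zero_add, sub_zero]
  exact mul_div_mul_right _ _ two_ne_zero

theorem exp_flowY_two (ha : 0 < a) (hb : b < 0) : Real.exp (flowY a b T 2) =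
    (a * Real.exp (a * T) - b * Real.exp (b * T)) / (a - b) := by
  rw [exp_flowY_mid ha hb ⟨zero_le_two, le_rfl⟩, midN, midA]
  simp only [sub_self, mul_zero, add_zero]
  exact mul_div_mul_right _ _ two_ne_zero

/-- On each region any constant may be added to the antiderivative. The constants 4B', with B' the
time derivative of the coefficient of e^{-x}, are those that make the pieces match at both peaks and
the limit at -∞ vanish. -/
theorem continuous_potL (ha : 0 < a) (hb : b < 0) (hT : T ≠ 0) : Continuous (potL a b T) := by
  have hy := continuous_flowY (T := T) ha hb
  have hE := Real.exp_pos (a * T)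
  have hF := Real.exp_pos (b * T)
  have hL : a - b ≠ 0 := by linarith
  have h3 : a * Real.exp (b * T) - b * Real.exp (a * T) ≠ 0 := by nlinarith
  have h4 : a * Real.exp (a * T) - b * Real.exp (b * T) ≠ 0 := by nlinarith
  have hne := exp_mul_ne ha hb hT
  have e : potL a b T = pw (fun X => outK a b (-T) ^ 2 * Real.exp (flowY a b T X) ^ 3)
      (fun X => 4 * ((a - b) * (Real.exp (a * T) * Real.exp (b * T))
        * (a * Real.exp (b * T) - b * Real.exp (a * T))
        / (Real.exp (a * T) - Real.exp (b * T)) ^ 2)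
        + ((a - b) / (Real.exp (a * T) - Real.exp (b * T))) ^ 2 * Real.exp (flowY a b T X) ^ 3
        - 3 * (-(a - b) * (Real.exp (a * T) * Real.exp (b * T))
          / (Real.exp (a * T) - Real.exp (b * T))) ^ 2 / Real.exp (flowY a b T X)
        + 2 * ((a - b) / (Real.exp (a * T) - Real.exp (b * T)))
          * (-(a - b) * (Real.exp (a * T) * Real.exp (b * T))
          / (Real.exp (a * T) - Real.exp (b * T))) * Real.exp (flowY a b T X))
      (fun X => 4 * outJ a b T - 3 * outK a b T ^ 2 / Real.exp (flowY a b T X)) := by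
    ext X
    rcases label_cases X with h | h | h
    · simp only [potL, coefA, coefB, coefB', pw_left h]; ring
    · simp only [potL, coefA, coefB, coefB', pw_mid h]
    · simp only [potL, coefA, coefB, coefB', pw_right h]; ring
  have hexp : ∀ X, Real.exp (flowY a b T X) ≠ 0 := fun X => (Real.exp_pos _).ne'
  rw [e]
  refine continuous_pw (by fun_prop) (Continuous.continuousOn (by fun_prop (disch := exact hexp)))
    (Continuous.continuousOn (by fun_prop (disch := exact hexp))) ?_ ?_
  · rw [exp_flowY_zero ha hb, outK_neg]
    generalize Real.exp (a * T) = E at *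
    generalize Real.exp (b * T) = F at *
    field_simp
    ring
  · rw [exp_flowY_two ha hb, outK, outJ]
    generalize Real.exp (a * T) = E at *
    generalize Real.exp (b * T) = F at *
    field_simp
    ring

/-- The mirror image of `continuous_potL`: here the constants are -4A', and the limit at +∞
vanishes. -/
theorem continuous_potR (ha : 0 < a) (hb : b < 0) (hT : T ≠ 0) : Continuous (potR a b T) := by
  have hy := continuous_flowY (T := T) ha hb
  have hE := Real.exp_pos (a * T)
  have hF := Real.exp_pos (b * T)
  have hL : a - b ≠ 0 := by linarith
  have h3 : a * Real.exp (b * T) - b * Real.exp (a * T) ≠ 0 := by nlinarith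
  have h4 : a * Real.exp (a * T) - b * Real.exp (b * T) ≠ 0 := by nlinarith
  have hne := exp_mul_ne ha hb hT
  have e : potR a b T = pw
      (fun X => 4 * outJ a b (-T) - 3 * outK a b (-T) ^ 2 * Real.exp (flowY a b T X))
      (fun X => -4 * (-(a - b) * (a * Real.exp (a * T) - b * Real.exp (b * T))
        / (Real.exp (a * T) - Real.exp (b * T)) ^ 2)
        - 3 * ((a - b) / (Real.exp (a * T) - Real.exp (b * T))) ^ 2 * Real.exp (flowY a b T X)
        + (-(a - b) * (Real.exp (a * T) * Real.exp (b * T))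
          / (Real.exp (a * T) - Real.exp (b * T))) ^ 2 / Real.exp (flowY a b T X) ^ 3
        + 2 * ((a - b) / (Real.exp (a * T) - Real.exp (b * T)))
          * (-(a - b) * (Real.exp (a * T) * Real.exp (b * T))
          / (Real.exp (a * T) - Real.exp (b * T))) / Real.exp (flowY a b T X))
      (fun X => outK a b T ^ 2 / Real.exp (flowY a b T X) ^ 3) := by
    ext X
    rcases label_cases X with h | h | h
    · simp only [potR, coefA, coefB, coefA', pw_left h]; ring
    · simp only [potR, coefA, coefB, coefA', pw_mid h]
    · simp only [potR, coefA, coefB, coefA', pw_right h]; ring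
  have hexp : ∀ X, Real.exp (flowY a b T X) ≠ 0 := fun X => (Real.exp_pos _).ne'
  have hexp3 : ∀ X, Real.exp (flowY a b T X) ^ 3 ≠ 0 := fun X => pow_ne_zero 3 (hexp X)
  rw [e]
  refine continuous_pw (by fun_prop)
    (Continuous.continuousOn (by fun_prop (disch := first | exact hexp | exact hexp3)))
    (Continuous.continuousOn (by fun_prop (disch := exact hexp3))) ?_ ?_
  · rw [exp_flowY_zero ha hb, outK_neg, outJ_neg]
    generalize Real.exp (a * T) = E at *
    generalize Real.exp (b * T) = F at *
    field_simp
    ring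
  · rw [exp_flowY_two ha hb, outK]
    generalize Real.exp (a * T) = E at *
    generalize Real.exp (b * T) = F at *
    field_simp
    ring

theorem pw_const_eventuallyEq {l m r X : ℝ} (hX : X ∉ ({0, 2} : Set ℝ)) :
    ∀ᶠ x in 𝓝 X, pw (fun _ => l) (fun _ => m) (fun _ => r) x
      = pw (fun _ => l) (fun _ => m) (fun _ => r) X := by
  have h0 : X ≠ 0 := fun h => hX (by simp [h])
  have h2 : X ≠ 2 := fun h => hX (by simp [h])
  rcases lt_or_gt_of_ne h0 with h | h
  · filter_upwards [Iio_mem_nhds h] with x hx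
    rw [pw_left h, pw_left hx]
  · rcases lt_or_gt_of_ne h2 with h' | h'
    · filter_upwards [Ioo_mem_nhds h h'] with x hx
      rw [pw_mid ⟨h.le, h'.le⟩, pw_mid ⟨hx.1.le, hx.2.le⟩]
    · filter_upwards [Ioi_mem_nhds h'] with x hx
      rw [pw_right h', pw_right hx]

/-- The density contains h̄ but not h, so the energy k stored in h does not act on the motion. -/
theorem density_flowState (ha : 0 < a) (hb : b < 0) (hT : T ≠ 0) {k : ℝ} :
    (flowState a b T k).density X = (3 * coefA a b T X ^ 2 * Real.exp (flowY a b T X) ^ 2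
      + 2 * coefA a b T X * coefB a b T X
      + 3 * coefB a b T X ^ 2 / Real.exp (flowY a b T X) ^ 2) * flowYξ a b T X := by
  have hz := (Real.exp_pos (flowY a b T X)).ne'
  simp only [LagrangianState.density, flowState]
  rw [flowU_eq ha hb hT, flowH_zero_eq ha hb hT, slope]
  field_simp
  ring

theorem hasDerivAt_potL (ha : 0 < a) (hb : b < 0) (hT : T ≠ 0) (k : ℝ) :
    ∀ X ∉ ({0, 2} : Set ℝ), HasDerivAt (potL a b T)
      (Real.exp (flowY a b T X) * (flowState a b T k).density X) X := by
  intro X hX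
  have hz := (Real.exp_pos (flowY a b T X)).ne'
  have hy := (hasDerivAt_flowY_label (T := T) ha hb X hX).exp
  have h1 := ((((hy.pow 3).const_mul (coefA a b T X ^ 2)).const_add (4 * coefB' a b T X)).sub
    ((hasDerivAt_const X (3 * coefB a b T X ^ 2)).div hy hz)).add
      (hy.const_mul (2 * coefA a b T X * coefB a b T X))
  refine (h1.congr_of_eventuallyEq ?_).congr_deriv ?_
  · filter_upwards [pw_const_eventuallyEq hX, pw_const_eventuallyEq hX,
      pw_const_eventuallyEq hX] with x e1 e2 e3
    simp only [potL, coefA, coefB, coefB'] at *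
    rw [e1, e2, e3]
    rfl
  · rw [density_flowState ha hb hT]
    field_simp
    ring

theorem hasDerivAt_potR (ha : 0 < a) (hb : b < 0) (hT : T ≠ 0) (k : ℝ) :
    ∀ X ∉ ({0, 2} : Set ℝ), HasDerivAt (potR a b T)
      (-(Real.exp (-flowY a b T X) * (flowState a b T k).density X)) X := by
  intro X hX
  have hz := (Real.exp_pos (flowY a b T X)).ne'
  have hy := (hasDerivAt_flowY_label (T := T) ha hb X hX).exp
  have h1 := (((hy.const_mul (3 * coefA a b T X ^ 2)).const_sub (-4 * coefA' a b T X)).add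
    ((hasDerivAt_const X (coefB a b T X ^ 2)).div (hy.pow 3) (pow_ne_zero 3 hz))).add
      ((hasDerivAt_const X (2 * coefA a b T X * coefB a b T X)).div hy hz)
  refine (h1.congr_of_eventuallyEq ?_).congr_deriv ?_
  · filter_upwards [pw_const_eventuallyEq hX, pw_const_eventuallyEq hX,
      pw_const_eventuallyEq hX] with x e1 e2 e3
    simp only [potR, coefA, coefB, coefA'] at *
    rw [e1, e2, e3]
    rfl
  · rw [density_flowState ha hb hT, Real.exp_neg, Pi.pow_apply]
    field_simp
    ring

theorem tendsto_flowY_atBot : Tendsto (flowY a b T) atBot atBot := by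
  have := (tendsto_flowY_sub (a := a) (b := b) (T := T)).add_atBot tendsto_id
  simpa using this

theorem tendsto_flowY_atTop (ha : 0 < a) (hb : b < 0) : Tendsto (flowY a b T) atTop atTop := by
  obtain ⟨K, hK⟩ := (uniformFamily_flowY ha hb).bound T
  refine tendsto_atTop_mono (fun X => ?_) (tendsto_atTop_add_const_right atTop (-K) tendsto_id)
  have := abs_le.mp (hK X)
  simp only [id]; linarith

theorem tendsto_potL_atBot : Tendsto (potL a b T) atBot (𝓝 0) := by
  have h1 : Tendsto (fun X => outK a b (-T) ^ 2 * Real.exp (flowY a b T X) ^ 3) atBot (𝓝 0) := by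
    have := ((Real.tendsto_exp_atBot.comp (tendsto_flowY_atBot (a := a) (b := b) (T := T))).pow
      3).const_mul (outK a b (-T) ^ 2)
    simpa using this
  refine h1.congr' ?_
  filter_upwards [eventually_lt_atBot 0] with X h
  simp only [potL, coefA, coefB, coefB', pw_left h]; ring

theorem tendsto_potR_atTop (ha : 0 < a) (hb : b < 0) : Tendsto (potR a b T) atTop (𝓝 0) := by
  have h1 : Tendsto (fun X => outK a b T ^ 2 * Real.exp (-flowY a b T X) ^ 3) atTop (𝓝 0) := by
    have := ((Real.tendsto_exp_atBot.comp (tendsto_neg_atTop_atBot.comp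
      (tendsto_flowY_atTop (T := T) ha hb))).pow 3).const_mul (outK a b T ^ 2)
    simpa using this
  refine h1.congr' ?_
  filter_upwards [eventually_gt_atTop 2] with X h
  simp only [potR, coefA, coefB, coefA', pw_right h, Real.exp_neg]; ring

theorem strictMono_flowY (ha : 0 < a) (hb : b < 0) (hT : T ≠ 0) : StrictMono (flowY a b T) := by
  have hpiece : ∀ {D : Set ℝ}, Convex ℝ D → (∀ X ∈ interior D, X ∉ ({0, 2} : Set ℝ)) →
      StrictMonoOn (flowY a b T) D := fun hD h =>
    strictMonoOn_of_deriv_pos hD (continuous_flowY ha hb).continuousOn fun X hX => by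
      rw [(hasDerivAt_flowY_label ha hb X (h X hX)).deriv]
      exact flowYξ_pos ha hb hT X
  have h1 : StrictMonoOn (flowY a b T) (Iic 0) := hpiece (convex_Iic 0) fun X hX => by
    rw [interior_Iic] at hX
    rintro (h | h) <;> simp only [mem_Iio] at hX <;> [skip; rw [mem_singleton_iff] at h] <;> linarith
  have h2 : StrictMonoOn (flowY a b T) (Icc 0 2) := hpiece (convex_Icc 0 2) fun X hX => by
    rw [interior_Icc] at hX
    rintro (h | h)
    · exact hX.1.ne' h
    · exact hX.2.ne h
  have h3 : StrictMonoOn (flowY a b T) (Ici 2) := hpiece (convex_Ici 2) fun X hX => by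
    rw [interior_Ici] at hX
    rintro (h | h) <;> simp only [mem_Ioi] at hX <;> [skip; rw [mem_singleton_iff] at h] <;> linarith
  have h4 := (h2.union h3 (isGreatest_Icc zero_le_two) isLeast_Ici)
  rw [Icc_union_Ici_eq_Ici zero_le_two] at h4
  have h5 := h1.union h4 isGreatest_Iic isLeast_Ici
  rwa [Iic_union_Ici, strictMonoOn_univ] at h5

/-- In this form Q is minus the material derivative of A e^x + B e^{-x}: the terms A'e^y + B'e^{-y}
come from the moving coefficients and U u_x from the transport. -/
theorem nonlocal_flowState (ha : 0 < a) (hb : b < 0) (hT : T ≠ 0) {k : ℝ} (hk : 0 ≤ k) :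
    (flowState a b T k).P X = coefB' a b T X / Real.exp (flowY a b T X)
      - coefA' a b T X * Real.exp (flowY a b T X) - slope a b T X ^ 2 / 2 ∧
    (flowState a b T k).Q X = -(coefA' a b T X * Real.exp (flowY a b T X)
      + coefB' a b T X / Real.exp (flowY a b T X)) - flowU a b T X * slope a b T X := by
  obtain ⟨i1, i2, hP, hQ⟩ := (memF_flowState (T := T) ha hb hk).nonlocal_eq
    (strictMono_flowY ha hb hT).monotone X
  have hz := (Real.exp_pos (flowY a b T X)).ne'
  have e1 : ∫ η in Iic X, Real.exp (flowY a b T η) * (flowState a b T k).density η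
      = potL a b T X := by
    rw [integral_Iic_of_hasDerivAt_off_countable (s := {0, 2}) (by simp)
      (continuous_potL ha hb hT) (hasDerivAt_potL ha hb hT k) i1 tendsto_potL_atBot, sub_zero]
  have e2 : ∫ η in Ioi X, Real.exp (-flowY a b T η) * (flowState a b T k).density η
      = potR a b T X := by
    have := integral_Ioi_of_hasDerivAt_off_countable (s := {0, 2}) (by simp)
      (continuous_potR ha hb hT) (hasDerivAt_potR ha hb hT k) i2.neg (tendsto_potR_atTop ha hb)
    rw [integral_neg] at this
    linarith
  rw [hP, hQ]
  have e3 : (flowState a b T k).y = flowY a b T := rfl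
  rw [e3, e1, e2, potL, potR, flowU_eq ha hb hT, slope, Real.exp_neg]
  generalize Real.exp (flowY a b T X) = z at *
  constructor <;> field_simp <;> ring

end nonlocal

/-! #### Evolution in time -/

/-- No regularity of g is assumed: g is measurable because it agrees a.e. with a derivative, and
local boundedness makes it integrable. This suits P and Q, which are computed only for T ≠ 0. -/
theorem IsWeakDeriv.of_hasDerivAt_of_bdd {f g : ℝ → ℝ} {s : Set ℝ} (hs : s.Countable)
    (hf : Continuous f) (hd : ∀ x ∉ s, HasDerivAt f (g x) x)
    (hb : ∀ x, ∃ C, ∀ᶠ z in 𝓝 x, |g z| ≤ C) : IsWeakDeriv f g := by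
  have hae : deriv f =ᵐ[volume] g := by
    filter_upwards [hs.ae_notMem volume] with x hx using (hd x hx).deriv
  have hm : AEStronglyMeasurable g volume :=
    (measurable_deriv f).aestronglyMeasurable.congr hae
  refine .of_hasDerivAt_off_countable hs hf hd fun x => ?_
  obtain ⟨C, hC⟩ := hb x
  exact Measure.FiniteAtFilter.integrableAtFilter ⟨univ, univ_mem, by simpa using hm⟩
    (volume.finiteAt_nhds x) (isBoundedUnder_of_eventually_le (a := C) hC)

theorem DecayingFamily.continuous {f : ℝ → ℝ → ℝ} (hf : DecayingFamily f) (X : ℝ) :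
    Continuous fun T => f T X := by
  refine continuous_iff_continuousAt.mpr fun T => Metric.tendsto_nhds.mpr fun ε hε => ?_
  filter_upwards [hf.close T (half_pos hε)] with S hS
  have := hS X
  rw [Real.dist_eq]
  nlinarith [weight_le_one X, weight_pos X]

theorem DecayingFamily.exists_bound {f : ℝ → ℝ → ℝ} (hf : DecayingFamily f) (T X : ℝ) :
    ∃ C, ∀ᶠ S in 𝓝 T, |f S X| ≤ C := by
  obtain ⟨K, _, h⟩ := hf.bound_nhds T
  exact ⟨_, h.mono fun S hS => hS X⟩

section evolution

variable {a b T k : ℝ}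

/-- The bound comes from membership in ℱ and continuity of the state in time, and therefore covers T
= 0, where no formula for P and Q has been established. -/
theorem exists_bound_nonlocal (ha : 0 < a) (hb : b < 0) (hk : 0 ≤ k) (T : ℝ) :
    ∃ C, ∀ᶠ S in 𝓝 T, ∀ X, |(flowState a b S k).P X| ≤ C ∧ |(flowState a b S k).Q X| ≤ C := by
  obtain ⟨M, hM⟩ := (memF_flowState (T := T) ha hb hk).exists_bound
  refine ⟨nonlocalBound (M + 1), ?_⟩
  filter_upwards [(tendsto_lagrangianDist_flowState ha hb k T).eventually
    (gt_mem_nhds zero_lt_one)] with S hS X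
  have h1 := ae_boundedBy_of_lagrangianDist_lt hM hS
  have h2 := memF_flowState (T := S) ha hb hk
  exact ⟨h2.abs_P_le h1 X, h2.abs_Q_le h1 X⟩

variable (X : ℝ)

theorem isWeakDeriv_flowY_time (ha : 0 < a) (hb : b < 0) :
    IsWeakDeriv (fun T => flowY a b T X) fun T => flowU a b T X :=
  .of_hasDerivAt_of_bdd (s := ∅) countable_empty
    (continuous_iff_continuousAt.mpr fun _ => (hasDerivAt_flowY_time ha hb).continuousAt)
    (fun _ _ => hasDerivAt_flowY_time ha hb) fun T => (decayingFamily_flowU ha hb).exists_bound T X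

theorem isWeakDeriv_flowYξ_time (ha : 0 < a) (hb : b < 0) :
    IsWeakDeriv (fun T => flowYξ a b T X) fun T => flowUξ a b T X :=
  .of_hasDerivAt_of_bdd (s := ∅) countable_empty
    (continuous_iff_continuousAt.mpr fun _ => (hasDerivAt_flowYξ_time ha hb).continuousAt)
    (fun _ _ => hasDerivAt_flowYξ_time ha hb)
    fun T => (decayingFamily_flowUξ ha hb).exists_bound T X

variable {X}

theorem hasDerivAt_slope_time (ha : 0 < a) (hb : b < 0) (hT : T ≠ 0) :
    HasDerivAt (fun T => slope a b T X) (coefA' a b T X * Real.exp (flowY a b T X)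
      - coefB' a b T X / Real.exp (flowY a b T X) + flowU a b T X ^ 2) T := by
  have hz := (Real.exp_pos (flowY a b T X)).ne'
  have hy := (hasDerivAt_flowY_time (X := X) (T := T) ha hb).exp
  refine (((hasDerivAt_coefA (X := X) ha hb hT).mul hy).sub
    ((hasDerivAt_coefB (X := X) ha hb hT).div hy hz)).congr_deriv ?_
  rw [flowU_eq ha hb hT]
  field_simp
  ring

theorem hasDerivAt_flowU_time (ha : 0 < a) (hb : b < 0) (hk : 0 ≤ k) (hT : T ≠ 0) :
    HasDerivAt (fun T => flowU a b T X) (-(flowState a b T k).Q X) T := by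
  have hz := (Real.exp_pos (flowY a b T X)).ne'
  have hy := (hasDerivAt_flowY_time (X := X) (T := T) ha hb).exp
  refine ((((hasDerivAt_coefA (X := X) ha hb hT).mul hy).add
    ((hasDerivAt_coefB (X := X) ha hb hT).div hy hz)).congr_of_eventuallyEq ?_).congr_deriv ?_
  · filter_upwards [eventually_ne_nhds hT] with S hS using flowU_eq ha hb hS
  · rw [(nonlocal_flowState ha hb hT hk).2, slope]
    field_simp
    ring

theorem hasDerivAt_flowUξ_time (ha : 0 < a) (hb : b < 0) (hk : 0 ≤ k) (hT : T ≠ 0) :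
    HasDerivAt (fun T => flowUξ a b T X) (1 / 2 * flowH a b T 0 X
      + (flowU a b T X ^ 2 - (flowState a b T k).P X) * flowYξ a b T X) T := by
  refine (((hasDerivAt_slope_time (X := X) ha hb hT).mul
    (hasDerivAt_flowYξ_time (X := X) ha hb)).congr_of_eventuallyEq ?_).congr_deriv ?_
  · filter_upwards [eventually_ne_nhds hT] with S hS using flowUξ_eq ha hb hS
  · rw [(nonlocal_flowState ha hb hT hk).1, flowH_zero_eq ha hb hT, flowUξ_eq ha hb hT]
    ring

theorem hasDerivAt_flowH_time (ha : 0 < a) (hb : b < 0) (hk : 0 ≤ k) (hT : T ≠ 0) :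
    HasDerivAt (fun T => flowH a b T k X)
      (2 * (flowU a b T X ^ 2 - (flowState a b T k).P X) * flowUξ a b T X) T := by
  refine (((((hasDerivAt_slope_time (X := X) ha hb hT).pow 2).mul
    (hasDerivAt_flowYξ_time (X := X) ha hb)).add_const (pw 0 (fun _ => k) 0 X)).congr_of_eventuallyEq
      ?_).congr_deriv ?_
  · filter_upwards [eventually_ne_nhds hT] with S hS
    rw [flowH_sub, flowH_zero_eq ha hb hS]
    rfl
  · rw [(nonlocal_flowState ha hb hT hk).1, flowUξ_eq ha hb hT, Pi.pow_apply]
    ring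

variable (X)

/-- The collision is one exceptional time; continuity of U across it and local boundedness of Q
suffice. The two following statements use the same device. -/
theorem isWeakDeriv_flowU_time (ha : 0 < a) (hb : b < 0) (hk : 0 ≤ k) :
    IsWeakDeriv (fun T => flowU a b T X) fun T => -(flowState a b T k).Q X :=
  .of_hasDerivAt_of_bdd (countable_singleton 0) ((decayingFamily_flowU ha hb).continuous X)
    (fun _ hT => hasDerivAt_flowU_time ha hb hk hT) fun T => by
      obtain ⟨C, hC⟩ := exists_bound_nonlocal ha hb hk T
      exact ⟨C, hC.mono fun S hS => by rw [abs_neg]; exact (hS X).2⟩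

theorem isWeakDeriv_flowUξ_time (ha : 0 < a) (hb : b < 0) (hk : 0 ≤ k) :
    IsWeakDeriv (fun T => flowUξ a b T X) fun T => 1 / 2 * flowH a b T 0 X
      + (flowU a b T X ^ 2 - (flowState a b T k).P X) * flowYξ a b T X :=
  .of_hasDerivAt_of_bdd (countable_singleton 0) ((decayingFamily_flowUξ ha hb).continuous X)
    (fun _ hT => hasDerivAt_flowUξ_time ha hb hk hT) fun T => by
      obtain ⟨C, hC⟩ := exists_bound_nonlocal ha hb hk T
      obtain ⟨C₁, h1⟩ := (decayingFamily_flowH ha hb 0).exists_bound T X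
      obtain ⟨C₂, h2⟩ := (decayingFamily_flowU ha hb).exists_bound T X
      obtain ⟨C₃, h3⟩ := (decayingFamily_flowYξ ha hb).exists_bound T X
      refine ⟨1 / 2 * C₁ + (C₂ ^ 2 + C) * (C₃ + 1), ?_⟩
      filter_upwards [hC, h1, h2, h3] with S g0 g1 g2 g3
      have k3 : |flowYξ a b S X| ≤ C₃ + 1 := by
        have := abs_add_le (flowYξ a b S X - 1) 1
        rw [sub_add_cancel, abs_one] at this
        linarith
      have k2 : |flowU a b S X ^ 2| ≤ C₂ ^ 2 := by
        rw [abs_pow]; exact pow_le_pow_left₀ (abs_nonneg _) g2 2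
      refine (abs_add_le _ _).trans (add_le_add ?_ ?_)
      · rw [abs_mul, abs_of_pos (by norm_num : (0 : ℝ) < 1 / 2)]; linarith
      · rw [abs_mul]
        have k4 : |flowU a b S X ^ 2 - (flowState a b S k).P X| ≤ C₂ ^ 2 + C :=
          (abs_sub _ _).trans (add_le_add k2 (g0 X).1)
        exact mul_le_mul k4 k3 (abs_nonneg _) ((abs_nonneg _).trans k4)

theorem isWeakDeriv_flowH_time (ha : 0 < a) (hb : b < 0) (hk : 0 ≤ k) :
    IsWeakDeriv (fun T => flowH a b T k X) fun T =>
      2 * (flowU a b T X ^ 2 - (flowState a b T k).P X) * flowUξ a b T X :=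
  .of_hasDerivAt_of_bdd (countable_singleton 0) ((decayingFamily_flowH ha hb k).continuous X)
    (fun _ hT => hasDerivAt_flowH_time ha hb hk hT) fun T => by
      obtain ⟨C, hC⟩ := exists_bound_nonlocal ha hb hk T
      obtain ⟨C₂, h2⟩ := (decayingFamily_flowU ha hb).exists_bound T X
      obtain ⟨C₃, h3⟩ := (decayingFamily_flowUξ ha hb).exists_bound T X
      refine ⟨2 * (C₂ ^ 2 + C) * C₃, ?_⟩
      filter_upwards [hC, h2, h3] with S g0 g2 g3
      have k2 : |flowU a b S X ^ 2| ≤ C₂ ^ 2 := by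
        rw [abs_pow]; exact pow_le_pow_left₀ (abs_nonneg _) g2 2
      have k4 : |flowU a b S X ^ 2 - (flowState a b S k).P X| ≤ C₂ ^ 2 + C :=
        (abs_sub _ _).trans (add_le_add k2 (g0 X).1)
      rw [abs_mul, abs_mul, abs_two]
      exact mul_le_mul (by linarith) g3 (abs_nonneg _)
        (by linarith [(abs_nonneg _).trans k4])

end evolution

/-! ### The flow through wave breaking -/

/-- The parameters before and after wave breaking. -/
structure BreakingData (α a b a' b' : ℝ) : Prop where
  pos : 0 < a
  neg : b < 0
  pos' : 0 < a'
  neg' : b' < 0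
  nonneg : 0 ≤ α
  add_eq : a' + b' = a + b
  mul_eq : a' * b' = (1 - α) * (a * b)

/-- Joins the flows before and after breaking. Only the functions have to match at 0; the
derivatives may jump. -/
theorem IsWeakDeriv.glue {f₁ g₁ f₂ g₂ : ℝ → ℝ} (h1 : IsWeakDeriv f₁ g₁) (h2 : IsWeakDeriv f₂ g₂)
    (h0 : f₁ 0 = f₂ 0) :
    IsWeakDeriv (fun T => if T < 0 then f₁ T else f₂ T)
      (fun T => if T < 0 then g₁ T else g₂ T) := by
  have hloc : LocallyIntegrable (fun T => if T < 0 then g₁ T else g₂ T) volume := by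
    have e : (fun T => if T < 0 then g₁ T else g₂ T) =
        (Iio 0).indicator g₁ + (Iio 0)ᶜ.indicator g₂ := by
      ext T
      by_cases h : T < 0 <;> simp [h, not_lt.mp]
    rw [e]
    exact (h1.1.indicator measurableSet_Iio).add (h2.1.indicator measurableSet_Iio.compl)
  have key : ∀ c : ℝ, (if c < 0 then f₁ c else f₂ c) - f₂ 0
      = ∫ T in (0 : ℝ)..c, if T < 0 then g₁ T else g₂ T := by
    intro c
    rcases lt_or_ge c 0 with h | h
    · rw [if_pos h, ← h0, h1.2 0 c]
      refine intervalIntegral.integral_congr_ae ?_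
      filter_upwards [Measure.ae_ne volume 0] with x hne hx
      rw [uIoc_of_ge h.le] at hx
      rw [if_pos (lt_of_le_of_ne hx.2 hne)]
    · rw [if_neg (not_lt.mpr h), h2.2 0 c]
      refine intervalIntegral.integral_congr_ae (Eventually.of_forall fun x hx => ?_)
      rw [uIoc_of_le h] at hx
      rw [if_neg (not_lt.mpr hx.1.le)]
  refine ⟨hloc, fun c d => ?_⟩
  have hi : ∀ c d, IntervalIntegrable (fun T => if T < 0 then g₁ T else g₂ T) volume c d :=
    fun c d => (hloc.integrableOn_isCompact isCompact_uIcc).intervalIntegrable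
  rw [← intervalIntegral.integral_interval_sub_left (hi 0 d) (hi 0 c), ← key, ← key]
  ring

theorem IsWeakDeriv.evolves_shift {f g : ℝ → ℝ} (h : IsWeakDeriv f g) (t₀ : ℝ) :
    Evolves (fun t => f (t - t₀)) (fun t => g (t - t₀)) := fun t _ => by
  refine ⟨?_, ?_⟩
  · have := (h.intervalIntegrable (0 - t₀) (t - t₀)).comp_sub_right t₀
    simpa using this
  · rw [intervalIntegral.integral_comp_sub_right g t₀, ← h.2]
    ring

/-! ### The state at the collision time. -/

section zeroTime

variable {a b X : ℝ}

theorem outD_zero (hab : a - b ≠ 0) (r : ℝ) : outD a b 0 r = 1 := by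
  simp only [outD, outM, mul_zero, Real.exp_zero, mul_one, div_self hab, sub_self, zero_mul,
    add_zero]

theorem outK_zero (hab : a - b ≠ 0) : outK a b 0 = a + b := by
  simp only [outK, mul_zero, Real.exp_zero, mul_one]
  field_simp
  ring

theorem flowY_zero_time (hab : a - b ≠ 0) :
    flowY a b 0 = pw (fun X => X) (fun _ => 0) (fun X => X - 2) := by
  ext X
  rcases label_cases X with h | h | h
  · simp [flowY, pw_left h, outD_zero hab]
  · simp only [flowY, pw_mid h, midN, midA, mul_zero, Real.exp_zero, mul_one, sub_self]
  · simp [flowY, pw_right h, outD_zero hab]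

theorem flowU_zero_time (hab : a - b ≠ 0) : flowU a b 0 =
    pw (fun X => (a + b) * Real.exp X) (fun _ => a + b) (fun X => (a + b) * Real.exp (2 - X)) := by
  ext X
  rcases label_cases X with h | h | h
  · simp [flowU, pw_left h, outU, outD_zero hab, outK_zero hab]
  · simp only [flowU, pw_mid h, midU, midNt, midAt, midN, midA, mul_zero, Real.exp_zero, mul_one,
      sub_self, zero_mul, zero_div, sub_zero]
    rw [← mul_add, div_eq_iff (by rw [add_sub_cancel]; exact mul_ne_zero hab two_ne_zero)]
    ring
  · simp [flowU, pw_right h, outU, outD_zero hab, outK_zero hab]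

theorem flowYξ_zero_time (hab : a - b ≠ 0) :
    flowYξ a b 0 = pw (fun _ => 1) (fun _ => 0) (fun _ => 1) := by
  ext X
  rcases label_cases X with h | h | h
  · simp [flowYξ, pw_left h, outD_zero hab]
  · simp [flowYξ, pw_mid h, midY]
  · simp [flowYξ, pw_right h, outD_zero hab]

theorem flowUξ_zero_time (hab : a - b ≠ 0) : flowUξ a b 0 =
    pw (fun X => (a + b) * Real.exp X) (fun _ => 0) (fun X => -((a + b) * Real.exp (2 - X))) := by
  ext X
  rcases label_cases X with h | h | h
  · simp [flowUξ, pw_left h, outV, outD_zero hab, outK_zero hab]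
  · simp [flowUξ, pw_mid h, midV]
  · simp [flowUξ, pw_right h, outV, outD_zero hab, outK_zero hab]

/-- The only component at T = 0 that depends on more than a + b: the collision energy is spread
evenly over the labels [0, 2] with density -2ab. -/
theorem flowH_zero_time (hab : a - b ≠ 0) (k : ℝ) : flowH a b 0 k =
    pw (fun X => ((a + b) * Real.exp X) ^ 2) (fun _ => -2 * (a * b) + k)
      (fun X => ((a + b) * Real.exp (2 - X)) ^ 2) := by
  ext X
  rcases label_cases X with h | h | h
  · simp only [flowH, pw_left h, outH, neg_zero, outD_zero hab, outK_zero hab]; ring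
  · have e1 : midN a b 0 X = (a - b) * 2 := by
      simp only [midN, mul_zero, Real.exp_zero, mul_one]; ring
    have e2 : midA a b 0 X = (a - b) * 2 := by
      simp only [midA, mul_zero, Real.exp_zero, mul_one]; ring
    simp only [flowH, pw_mid h, midH, midW, e1, e2, mul_zero, Real.exp_zero, mul_one, one_mul]
    field_simp
    ring
  · simp only [flowH, pw_right h, outH, outD_zero hab, outK_zero hab]; ring

end zeroTime

/-- The two-peakon flow with parameters `a, b` before and `a', b'` after wave breaking. -/
def peakonFlow (α a b a' b' T : ℝ) : LagrangianState :=
  if T < 0 then flowState a b T 0 else flowState a' b' T (-2 * α * (a * b))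

section peakonFlow

variable {α a b a' b' T : ℝ}

theorem peakonFlow_neg (h : T < 0) : peakonFlow α a b a' b' T = flowState a b T 0 := if_pos h

theorem peakonFlow_nonneg (h : 0 ≤ T) :
    peakonFlow α a b a' b' T = flowState a' b' T (-2 * α * (a * b)) := if_neg (not_lt.mpr h)

namespace BreakingData

theorem gap_nonneg (B : BreakingData α a b a' b') : 0 ≤ -2 * α * (a * b) := by
  have h1 := mul_pos B.pos (neg_pos.mpr B.neg)
  nlinarith [B.nonneg]

theorem sub_ne (B : BreakingData α a b a' b') : a - b ≠ 0 := by linarith [B.pos, B.neg]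

theorem sub_ne' (B : BreakingData α a b a' b') : a' - b' ≠ 0 := by linarith [B.pos', B.neg']

theorem memF (B : BreakingData α a b a' b') (T : ℝ) : (peakonFlow α a b a' b' T).MemF := by
  rcases lt_or_ge T 0 with h | h
  · rw [peakonFlow_neg h]; exact memF_flowState B.pos B.neg le_rfl
  · rw [peakonFlow_nonneg h]; exact memF_flowState B.pos' B.neg' B.gap_nonneg

theorem flowY_eq (B : BreakingData α a b a' b') : flowY a b 0 = flowY a' b' 0 := by
  rw [flowY_zero_time B.sub_ne, flowY_zero_time B.sub_ne']

theorem flowU_eq (B : BreakingData α a b a' b') : flowU a b 0 = flowU a' b' 0 := by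
  rw [flowU_zero_time B.sub_ne, flowU_zero_time B.sub_ne', B.add_eq]

theorem flowYξ_eq (B : BreakingData α a b a' b') : flowYξ a b 0 = flowYξ a' b' 0 := by
  rw [flowYξ_zero_time B.sub_ne, flowYξ_zero_time B.sub_ne']

theorem flowUξ_eq (B : BreakingData α a b a' b') : flowUξ a b 0 = flowUξ a' b' 0 := by
  rw [flowUξ_zero_time B.sub_ne, flowUξ_zero_time B.sub_ne', B.add_eq]

/-- What h̄ loses is exactly what is added to h: -2a'b' - 2αab = -2ab. -/
theorem flowH_eq (B : BreakingData α a b a' b') :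
    flowH a b 0 0 = flowH a' b' 0 (-2 * α * (a * b)) := by
  rw [flowH_zero_time B.sub_ne, flowH_zero_time B.sub_ne', B.add_eq, B.mul_eq]
  congr 1
  ext; ring

theorem tendsto_lagrangianDist (B : BreakingData α a b a' b') (T : ℝ) :
    Tendsto (fun S => lagrangianDist (peakonFlow α a b a' b' S) (peakonFlow α a b a' b' T))
      (𝓝 T) (𝓝 0) := by
  have h1 := tendsto_lagrangianDist_flowState B.pos B.neg 0 T
  have h2 := tendsto_lagrangianDist_flowState B.pos' B.neg' (-2 * α * (a * b)) T
  rcases lt_trichotomy T 0 with h | h | h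
  · rw [peakonFlow_neg h]
    refine h1.congr' ?_
    filter_upwards [Iio_mem_nhds h] with S hS
    rw [peakonFlow_neg hS]
  · subst h
    rw [peakonFlow_nonneg le_rfl]
    -- The distance does not involve h̄, the only component in which the two states at T = 0 may
    -- differ.
    have e : (fun S => lagrangianDist (flowState a b S 0) (flowState a b 0 0)) =
        fun S => lagrangianDist (flowState a b S 0) (flowState a' b' 0 (-2 * α * (a * b))) := by
      ext S
      simp only [lagrangianDist, flowState, B.flowY_eq, B.flowU_eq, B.flowYξ_eq, B.flowUξ_eq,
        B.flowH_eq]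
    rw [e] at h1
    refine (h1.if' (p := fun S => S < 0) h2).congr fun S => ?_
    unfold peakonFlow
    split_ifs <;> rfl
  · rw [peakonFlow_nonneg h.le]
    refine h2.congr' ?_
    filter_upwards [Ioi_mem_nhds h] with S hS
    rw [peakonFlow_nonneg (le_of_lt hS)]

/-- The gap is 0 before the collision and a fixed function of the label afterwards, supported in [0,
2]. These are precisely the labels with y_ξ = 0 at T = 0, and there the loss is the relation a'b' =
(1 - α)ab. -/
theorem energyRule (B : BreakingData α a b a' b') (t₀ X : ℝ) : AlphaEnergyRule α
    (fun t => (peakonFlow α a b a' b' (t - t₀)).yξ X)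
    (fun t => (peakonFlow α a b a' b' (t - t₀)).h X)
    (fun t => (peakonFlow α a b a' b' (t - t₀)).hbar X) := by
  have g1 : ∀ {T}, T < 0 →
      (peakonFlow α a b a' b' T).hbar X - (peakonFlow α a b a' b' T).h X = 0 := fun h => by
    rw [peakonFlow_neg h]; exact sub_self _
  have g2 : ∀ {T}, 0 ≤ T →
      (peakonFlow α a b a' b' T).hbar X - (peakonFlow α a b a' b' T).h X
        = -pw 0 (fun _ => -2 * α * (a * b)) 0 X := fun {T} h => by
    rw [peakonFlow_nonneg h]
    simp only [flowState]
    rw [flowH_sub (k := -2 * α * (a * b))]; ring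
  intro t _
  refine ⟨?_, fun _ hne => ?_, fun _ h0 => ?_⟩
  · rcases lt_or_ge t t₀ with h | h
    · filter_upwards [mem_nhdsWithin_of_mem_nhds (Iio_mem_nhds h)] with s hs
      rw [g1 (sub_neg.mpr hs), g1 (sub_neg.mpr h)]
    · filter_upwards [self_mem_nhdsWithin] with s hs
      rw [g2 (sub_nonneg.mpr (h.trans (le_of_lt hs))), g2 (sub_nonneg.mpr h)]
  · rcases lt_trichotomy t t₀ with h | h | h
    · filter_upwards [mem_nhdsWithin_of_mem_nhds (Iio_mem_nhds h)] with s hs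
      rw [g1 (sub_neg.mpr hs), g1 (sub_neg.mpr h)]
    · subst h
      have hX : X ∉ Icc (0 : ℝ) 2 := fun hX => hne (by
        simp only [sub_self]
        rw [peakonFlow_nonneg le_rfl]
        simp only [flowState]
        rw [flowYξ_zero_time B.sub_ne', pw_mid hX])
      have hpw : pw 0 (fun _ => -2 * α * (a * b)) 0 X = 0 := by
        rcases label_cases X with h | h | h
        · rw [pw_left h]; rfl
        · exact absurd h hX
        · rw [pw_right h]; rfl
      filter_upwards [self_mem_nhdsWithin] with s hs
      rw [g1 (sub_neg.mpr hs), g2 (sub_nonneg.mpr le_rfl), hpw, neg_zero]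
    · filter_upwards [mem_nhdsWithin_of_mem_nhds (Ioi_mem_nhds h)] with s hs
      rw [g2 (sub_nonneg.mpr (le_of_lt hs)), g2 (sub_nonneg.mpr h.le)]
  · rcases lt_trichotomy t t₀ with h | h | h
    · simp only [peakonFlow_neg (sub_neg.mpr h), flowState] at h0
      exact absurd h0 (flowYξ_pos B.pos B.neg (by linarith) X).ne'
    · subst h
      simp only [sub_self, peakonFlow_nonneg le_rfl, flowState] at h0 ⊢
      have hX : X ∈ Icc (0 : ℝ) 2 := by
        by_contra hX
        rw [flowYξ_zero_time B.sub_ne'] at h0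
        rcases label_cases X with h | h | h
        · rw [pw_left h] at h0; exact one_ne_zero h0
        · exact hX h
        · rw [pw_right h] at h0; exact one_ne_zero h0
      refine ⟨flowH a b 0 0 X, ?_, ?_⟩
      · have h1 : Tendsto (fun s => flowH a b (s - t) 0 X) (𝓝[<] t) (𝓝 (flowH a b (t - t) 0 X)) :=
          ((((decayingFamily_flowH B.pos B.neg 0).continuous X).comp
            (continuous_sub_right t)).tendsto t).mono_left nhdsWithin_le_nhds
        rw [sub_self] at h1
        refine h1.congr' ?_
        filter_upwards [self_mem_nhdsWithin] with s hs
        rw [peakonFlow_neg (sub_neg.mpr hs)]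
        rfl
      · rw [flowH_zero_time B.sub_ne, flowH_zero_time B.sub_ne', pw_mid hX, pw_mid hX, B.mul_eq]
        ring
    · simp only [peakonFlow_nonneg (sub_nonneg.mpr h.le), flowState] at h0
      exact absurd h0 (flowYξ_pos B.pos' B.neg' (by linarith) X).ne'

theorem isAlphaDissipativeLagrangian (B : BreakingData α a b a' b') (t₀ : ℝ) :
    IsAlphaDissipativeLagrangian α fun t => peakonFlow α a b a' b' (t - t₀) where
  memF t _ := B.memF _
  cont t _ := ((B.tendsto_lagrangianDist (t - t₀)).comp
    ((continuous_sub_right t₀).tendsto t)).mono_left nhdsWithin_le_nhds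
  eq_y X := by
    have h := ((isWeakDeriv_flowY_time X B.pos B.neg).glue
      (isWeakDeriv_flowY_time X B.pos' B.neg') (congrFun B.flowY_eq X)).evolves_shift t₀
    convert h using 2 <;> (unfold peakonFlow; split_ifs <;> rfl)
  eq_U X := by
    have h := ((isWeakDeriv_flowU_time X B.pos B.neg le_rfl).glue
      (isWeakDeriv_flowU_time X B.pos' B.neg' B.gap_nonneg)
      (congrFun B.flowU_eq X)).evolves_shift t₀
    convert h using 2 <;> (unfold peakonFlow; split_ifs <;> rfl)
  eq_yξ := Eventually.of_forall fun X => by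
    have h := ((isWeakDeriv_flowYξ_time X B.pos B.neg).glue
      (isWeakDeriv_flowYξ_time X B.pos' B.neg') (congrFun B.flowYξ_eq X)).evolves_shift t₀
    convert h using 2 <;> (unfold peakonFlow; split_ifs <;> rfl)
  eq_Uξ := Eventually.of_forall fun X => by
    have h := ((isWeakDeriv_flowUξ_time X B.pos B.neg le_rfl).glue
      (isWeakDeriv_flowUξ_time X B.pos' B.neg' B.gap_nonneg)
      (congrFun B.flowUξ_eq X)).evolves_shift t₀
    convert h using 2 <;> (unfold peakonFlow; split_ifs <;> rfl)
  eq_h := Eventually.of_forall fun X => by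
    have h := ((isWeakDeriv_flowH_time X B.pos B.neg le_rfl).glue
      (isWeakDeriv_flowH_time X B.pos' B.neg' B.gap_nonneg)
      (congrFun B.flowH_eq X)).evolves_shift t₀
    convert h using 2 <;> (unfold peakonFlow; split_ifs <;> rfl)
  energy := Eventually.of_forall fun X => B.energyRule t₀ X

end BreakingData

end peakonFlow

/-! #### Uniqueness of the flow through wave breaking -/

section lower

variable {a b : ℝ}

theorem exists_lower_flowYξ_at (ha : 0 < a) (hb : b < 0) {T : ℝ} (hT : T ≠ 0) :
    ∃ c : ℝ, 0 < c ∧ ∀ X, c ≤ flowYξ a b T X := by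
  have hc : ContinuousOn (fun X => midY a b T X) (Icc 0 2) :=
    ContinuousOn.comp (g := fun p : ℝ × ℝ => midY a b p.1 p.2) (f := fun X => (T, X))
      (continuousOn_midY ha hb) (by fun_prop) fun X hX => ⟨mem_univ _, hX⟩
  obtain ⟨X₀, hX₀, hmin⟩ := isCompact_Icc.exists_isMinOn ⟨0, by simp⟩ hc
  obtain ⟨c, hc, h⟩ := exists_lower_flow (T := T) ha hb
  refine ⟨min c (midY a b T X₀), lt_min hc (midY_pos ha hb hX₀ hT), fun X => ?_⟩
  by_cases hX : X ∈ Icc (0 : ℝ) 2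
  · have h1 : midY a b T X₀ ≤ midY a b T X := hmin hX
    rw [flowYξ, pw_mid hX]
    exact (min_le_right _ _).trans h1
  · exact (min_le_left _ _).trans ((h X).1 hX)

/-- The bound at a single time persists nearby because y_ξ is continuous in time uniformly in the
label; compactness gives the interval. -/
theorem exists_lower_flowYξ (ha : 0 < a) (hb : b < 0) {S T : ℝ} (h0 : (0 : ℝ) ∉ Icc S T) :
    ∃ c : ℝ, 0 < c ∧ ∀ τ ∈ Icc S T, ∀ X, c ≤ flowYξ a b τ X := by
  refine isCompact_Icc.induction_on
    (p := fun K => ∃ c : ℝ, 0 < c ∧ ∀ τ ∈ K, ∀ X, c ≤ flowYξ a b τ X)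
    ⟨1, one_pos, by simp⟩ (fun K K' hK h => h.imp fun c h => ⟨h.1, fun s hs => h.2 s (hK hs)⟩) ?_ ?_
  · rintro K K' ⟨c, hc, h⟩ ⟨c', hc', h'⟩
    refine ⟨min c c', lt_min hc hc', ?_⟩
    rintro s (hs | hs) X
    · exact (min_le_left _ _).trans (h s hs X)
    · exact (min_le_right _ _).trans (h' s hs X)
  · intro τ hτ
    obtain ⟨c, hc, h⟩ := exists_lower_flowYξ_at (T := τ) ha hb fun h => h0 (h ▸ hτ)
    refine ⟨_, mem_nhdsWithin_of_mem_nhds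
      ((decayingFamily_flowYξ ha hb).close τ (half_pos hc)), c / 2, half_pos hc, fun s hs X => ?_⟩
    have h1 : |flowYξ a b s X - 1 - (flowYξ a b τ X - 1)| ≤ c / 2 * weight X := hs X
    have h2 := h X
    have h3 := (abs_le.mp h1).1
    nlinarith [weight_le_one X]

end lower

section uniqueness

variable {α a b a' b' t₀ : ℝ} {g g' : ℝ → ℝ}

/-- An `α`-dissipative solution which initially agrees with a relabeling of the two-peakon flow
agrees with it for all times. -/
theorem BreakingData.eqAt (B : BreakingData α a b a' b') (ht₀ : 0 < t₀) (hg : IsRelabeling g g')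
    {Θ : ℝ → LagrangianState} (H : IsAlphaDissipativeLagrangian α Θ)
    (h0 : ∀ᵐ ξ, (Θ 0).EqAt ((peakonFlow α a b a' b' (0 - t₀)).relabel g g') ξ) :
    ∀ᵐ ξ, ∀ t, 0 ≤ t → (Θ t).EqAt ((peakonFlow α a b a' b' (t - t₀)).relabel g g') ξ := by
  obtain ⟨m, _, hm, hb⟩ := hg.bounds
  have hm' : ∀ ξ, m ≤ g' ξ := fun ξ => (hb ξ).1
  have H' := (B.isAlphaDissipativeLagrangian t₀).relabel hg
  refine H.eqAt_of_single_breaking H' ht₀ h0 (fun T _ hT => ?_) ?_ (fun S T hS _ => ?_)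
  · obtain ⟨c, hc, h⟩ := exists_lower_flowYξ B.pos B.neg (S := 0 - t₀) (T := T - t₀)
      fun h => by linarith [h.2]
    refine ⟨c * m, by positivity, Eventually.of_forall fun ξ s hs => ?_⟩
    rw [peakonFlow_neg (by linarith [hs.2])]
    exact mul_le_mul (h _ ⟨by linarith [hs.1], by linarith [hs.2]⟩ _) (hm' ξ) hm.le
      (hc.le.trans (h _ ⟨by linarith [hs.1], by linarith [hs.2]⟩ _))
  -- The value of h̄ on the middle labels just after the loss.
  · have hpos : 0 < -2 * (a' * b') := by nlinarith [mul_pos B.pos' (neg_pos.mpr B.neg')]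
    obtain ⟨c, hc, hc1, hc2⟩ : ∃ c : ℝ, 0 < c ∧ c ≤ 1 ∧ c ≤ -2 * (a' * b') :=
      ⟨_, lt_min one_pos hpos, min_le_left _ _, min_le_right _ _⟩
    refine ⟨c * m, by positivity, Eventually.of_forall fun ξ => ?_⟩
    simp only [sub_self, peakonFlow_nonneg le_rfl, LagrangianState.relabel, flowState,
      flowYξ_zero_time B.sub_ne', flowH_zero_time B.sub_ne', add_zero]
    rcases label_cases (g ξ) with h | h | h
    · left
      rw [pw_left h]
      exact mul_le_mul hc1 (hm' ξ) hm.le zero_le_one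
    · right
      rw [pw_mid h, pw_mid h, zero_mul]
      exact ⟨rfl, mul_le_mul hc2 (hm' ξ) hm.le hpos.le⟩
    · left
      rw [pw_right h]
      exact mul_le_mul hc1 (hm' ξ) hm.le zero_le_one
  · obtain ⟨c, hc, h⟩ := exists_lower_flowYξ B.pos' B.neg' (S := S - t₀) (T := T - t₀)
      fun h => by linarith [h.1]
    refine ⟨c * m, by positivity, Eventually.of_forall fun ξ s hs => ?_⟩
    rw [peakonFlow_nonneg (by linarith [hs.1])]
    exact mul_le_mul (h _ ⟨by linarith [hs.1], by linarith [hs.2]⟩ _) (hm' ξ) hm.le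
      (hc.le.trans (h _ ⟨by linarith [hs.1], by linarith [hs.2]⟩ _))

end uniqueness

/-! ### Two-peakon profiles -/

theorem hasDerivAt_exp_neg_abs_sub {x Q : ℝ} (h : x ≠ Q) :
    HasDerivAt (fun x => Real.exp (-|x - Q|)) (-Real.sign (x - Q) * Real.exp (-|x - Q|)) x := by
  rcases lt_or_gt_of_ne h with h | h
  · have h1 : HasDerivAt (fun x => Real.exp (x - Q)) (Real.exp (x - Q) * 1) x :=
      ((hasDerivAt_id x).sub_const Q).exp
    refine (h1.congr_of_eventuallyEq ?_).congr_deriv ?_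
    · filter_upwards [Iio_mem_nhds h] with z hz
      rw [abs_of_neg (sub_neg.mpr hz), neg_neg]
    · rw [abs_of_neg (sub_neg.mpr h), neg_neg, Real.sign_of_neg (sub_neg.mpr h)]; ring
  · have h1 : HasDerivAt (fun x => Real.exp (-(x - Q))) (Real.exp (-(x - Q)) * -1) x :=
      ((hasDerivAt_id x).sub_const Q).neg.exp
    refine (h1.congr_of_eventuallyEq ?_).congr_deriv ?_
    · filter_upwards [Ioi_mem_nhds h] with z hz
      rw [abs_of_pos (sub_pos.mpr hz)]
    · rw [abs_of_pos (sub_pos.mpr h), Real.sign_of_pos (sub_pos.mpr h)]; ring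

theorem memLp_exp_neg_abs_sub (Q : ℝ) : MemLp (fun x => Real.exp (-|x - Q|)) 2 volume := by
  have hc : Continuous fun x => Real.exp (-|x - Q|) := by fun_prop
  rw [memLp_two_iff_integrable_sq hc.aestronglyMeasurable]
  refine (integrable_exp_neg_abs.comp_sub_right Q).mono' (hc.pow 2).aestronglyMeasurable
    (Eventually.of_forall fun x => ?_)
  rw [Real.norm_eq_abs, abs_of_nonneg (sq_nonneg _)]
  have h1 := Real.exp_pos (-|x - Q|)
  have h2 : Real.exp (-|x - Q|) ≤ 1 := Real.exp_le_one_iff.mpr (neg_nonpos.mpr (abs_nonneg _))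
  nlinarith

section twoPeakon

variable {P₁ P₂ Q₁ Q₂ x : ℝ}

theorem continuous_twoPeakon : Continuous (twoPeakon P₁ P₂ Q₁ Q₂) := by
  unfold twoPeakon; fun_prop

theorem hasDerivAt_twoPeakon (h1 : x ≠ Q₁) (h2 : x ≠ Q₂) : HasDerivAt (twoPeakon P₁ P₂ Q₁ Q₂)
    (P₁ * (-Real.sign (x - Q₁) * Real.exp (-|x - Q₁|))
      + P₂ * (-Real.sign (x - Q₂) * Real.exp (-|x - Q₂|))) x :=
  ((hasDerivAt_exp_neg_abs_sub h1).const_mul P₁).add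
    ((hasDerivAt_exp_neg_abs_sub h2).const_mul P₂)

theorem memLp_twoPeakon : MemLp (twoPeakon P₁ P₂ Q₁ Q₂) 2 volume :=
  ((memLp_exp_neg_abs_sub Q₁).const_mul P₁).add ((memLp_exp_neg_abs_sub Q₂).const_mul P₂)

theorem memLp_deriv_twoPeakon : MemLp (deriv (twoPeakon P₁ P₂ Q₁ Q₂)) 2 volume := by
  have h : MemLp (fun x => |P₁| * Real.exp (-|x - Q₁|) + |P₂| * Real.exp (-|x - Q₂|)) 2 volume :=
    ((memLp_exp_neg_abs_sub Q₁).const_mul |P₁|).add ((memLp_exp_neg_abs_sub Q₂).const_mul |P₂|)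
  refine h.mono (measurable_deriv _).aestronglyMeasurable ?_
  filter_upwards [Measure.ae_ne volume Q₁, Measure.ae_ne volume Q₂] with x h1 h2
  rw [(hasDerivAt_twoPeakon h1 h2).deriv, Real.norm_eq_abs, Real.norm_eq_abs]
  refine le_trans ?_ (le_abs_self _)
  have key : ∀ P Q : ℝ, |P * (-Real.sign (x - Q) * Real.exp (-|x - Q|))|
      ≤ |P| * Real.exp (-|x - Q|) := fun P Q => by
    rw [abs_mul, abs_mul, abs_neg, abs_of_pos (Real.exp_pos _)]
    refine mul_le_mul_of_nonneg_left ?_ (abs_nonneg P)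
    exact mul_le_of_le_one_left (Real.exp_pos _).le (abs_sign_le _)
  exact (abs_add_le _ _).trans (add_le_add (key _ _) (key _ _))

theorem isWeakDeriv_twoPeakon :
    IsWeakDeriv (twoPeakon P₁ P₂ Q₁ Q₂) (deriv (twoPeakon P₁ P₂ Q₁ Q₂)) := by
  refine .of_hasDerivAt_off_countable (s := {Q₁, Q₂}) (by simp) continuous_twoPeakon
    (fun x hx => ?_) (memLp_deriv_twoPeakon.locallyIntegrable one_le_two)
  have h1 : x ≠ Q₁ := fun h => hx (by simp [h])
  have h2 : x ≠ Q₂ := fun h => hx (by simp [h])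
  exact (hasDerivAt_twoPeakon h1 h2).differentiableAt.hasDerivAt

theorem integrable_twoPeakon_energy :
    Integrable fun x => twoPeakon P₁ P₂ Q₁ Q₂ x ^ 2 + deriv (twoPeakon P₁ P₂ Q₁ Q₂) x ^ 2 :=
  memLp_twoPeakon.integrable_sq.add memLp_deriv_twoPeakon.integrable_sq

theorem twoPeakon_left (h1 : x ≤ Q₁) (h2 : x ≤ Q₂) : twoPeakon P₁ P₂ Q₁ Q₂ x
    = (P₁ / Real.exp Q₁ + P₂ / Real.exp Q₂) * Real.exp x := by
  rw [twoPeakon, abs_of_nonpos (sub_nonpos.mpr h1), abs_of_nonpos (sub_nonpos.mpr h2), neg_neg,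
    neg_neg, Real.exp_sub, Real.exp_sub]
  ring

theorem twoPeakon_mid (h1 : Q₁ ≤ x) (h2 : x ≤ Q₂) : twoPeakon P₁ P₂ Q₁ Q₂ x
    = P₂ / Real.exp Q₂ * Real.exp x + P₁ * Real.exp Q₁ / Real.exp x := by
  rw [twoPeakon, abs_of_nonneg (sub_nonneg.mpr h1), abs_of_nonpos (sub_nonpos.mpr h2), neg_neg,
    neg_sub, Real.exp_sub, Real.exp_sub]
  ring

theorem twoPeakon_right (h1 : Q₁ ≤ x) (h2 : Q₂ ≤ x) : twoPeakon P₁ P₂ Q₁ Q₂ x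
    = (P₁ * Real.exp Q₁ + P₂ * Real.exp Q₂) / Real.exp x := by
  rw [twoPeakon, abs_of_nonneg (sub_nonneg.mpr h1), abs_of_nonneg (sub_nonneg.mpr h2), neg_sub,
    neg_sub, Real.exp_sub, Real.exp_sub]
  ring

theorem deriv_twoPeakon_left (h1 : x < Q₁) (h2 : x < Q₂) : deriv (twoPeakon P₁ P₂ Q₁ Q₂) x
    = (P₁ / Real.exp Q₁ + P₂ / Real.exp Q₂) * Real.exp x := by
  rw [(hasDerivAt_twoPeakon h1.ne h2.ne).deriv, abs_of_neg (sub_neg.mpr h1),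
    abs_of_neg (sub_neg.mpr h2), Real.sign_of_neg (sub_neg.mpr h1),
    Real.sign_of_neg (sub_neg.mpr h2)]
  simp only [neg_neg, neg_sub, Real.exp_sub]
  ring

theorem deriv_twoPeakon_mid (h1 : Q₁ < x) (h2 : x < Q₂) : deriv (twoPeakon P₁ P₂ Q₁ Q₂) x
    = P₂ / Real.exp Q₂ * Real.exp x - P₁ * Real.exp Q₁ / Real.exp x := by
  rw [(hasDerivAt_twoPeakon h1.ne' h2.ne).deriv, abs_of_pos (sub_pos.mpr h1),
    abs_of_neg (sub_neg.mpr h2), Real.sign_of_pos (sub_pos.mpr h1),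
    Real.sign_of_neg (sub_neg.mpr h2)]
  simp only [neg_neg, neg_sub, Real.exp_sub]
  ring

theorem deriv_twoPeakon_right (h1 : Q₁ < x) (h2 : Q₂ < x) : deriv (twoPeakon P₁ P₂ Q₁ Q₂) x
    = -((P₁ * Real.exp Q₁ + P₂ * Real.exp Q₂) / Real.exp x) := by
  rw [(hasDerivAt_twoPeakon h1.ne' h2.ne').deriv, abs_of_pos (sub_pos.mpr h1),
    abs_of_pos (sub_pos.mpr h2), Real.sign_of_pos (sub_pos.mpr h1),
    Real.sign_of_pos (sub_pos.mpr h2)]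
  simp only [neg_sub, Real.exp_sub]
  ring

theorem deriv_twoPeakon_sq (hQ : Q₁ ≤ Q₂) (h1 : x ≠ Q₁) (h2 : x ≠ Q₂) :
    deriv (twoPeakon P₁ P₂ Q₁ Q₂) x ^ 2 = twoPeakonSlopeSq P₁ P₂ Q₁ Q₂ x := by
  unfold twoPeakonSlopeSq
  have e1 : Real.exp (2 * x) = Real.exp x ^ 2 := by
    rw [← Real.exp_nat_mul]; norm_num
  have e2 : Real.exp (-2 * x) = (Real.exp x ^ 2)⁻¹ := by
    rw [← e1, ← Real.exp_neg, neg_mul]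
  rcases lt_or_gt_of_ne h1 with h | h
  · rw [if_pos h, deriv_twoPeakon_left h (h.trans_le hQ), e1, Real.exp_neg, Real.exp_neg]
    ring
  · rw [if_neg (not_lt.mpr h.le)]
    rcases lt_or_gt_of_ne h2 with h' | h'
    · rw [if_pos h', deriv_twoPeakon_mid h h', Real.exp_sub, Real.exp_sub]
      ring
    · rw [if_neg (not_lt.mpr h'.le), deriv_twoPeakon_right h h', e2]
      ring

end twoPeakon

/-! #### The profile of the two-peakon flow -/

section profile

variable (a b T : ℝ)

/-- The momentum of the left peakon. -/
def peakP₁ : ℝ := (b * Real.exp (a * T) - a * Real.exp (b * T)) /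
  (Real.exp (a * T) - Real.exp (b * T))

/-- The momentum of the right peakon. -/
def peakP₂ : ℝ := (a * Real.exp (a * T) - b * Real.exp (b * T)) /
  (Real.exp (a * T) - Real.exp (b * T))

/-- The velocity profile; the peaks travel along the characteristics with labels `0` and `2`. -/
def peakU : ℝ → ℝ := twoPeakon (peakP₁ a b T) (peakP₂ a b T) (flowY a b T 0) (flowY a b T 2)

variable {a b T}

/-- This and the next three identities match the coefficients of e^x and e^{-x} in the peakon
profile with `coefA` and `coefB` on the three regions. -/
theorem peakP₂_div (ha : 0 < a) (hb : b < 0) (hT : T ≠ 0) :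
    peakP₂ a b T / Real.exp (flowY a b T 2) = (a - b) / (Real.exp (a * T) - Real.exp (b * T)) := by
  have hL : a - b ≠ 0 := by linarith
  have h4 : a * Real.exp (a * T) - b * Real.exp (b * T) ≠ 0 := by
    nlinarith [Real.exp_pos (a * T), Real.exp_pos (b * T)]
  have hne := exp_mul_ne ha hb hT
  rw [exp_flowY_two ha hb, peakP₂]
  generalize Real.exp (a * T) = E at *
  generalize Real.exp (b * T) = F at *
  field_simp

theorem peakP₁_mul (ha : 0 < a) (hb : b < 0) (hT : T ≠ 0) :
    peakP₁ a b T * Real.exp (flowY a b T 0) = -(a - b) * (Real.exp (a * T) * Real.exp (b * T))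
      / (Real.exp (a * T) - Real.exp (b * T)) := by
  have h3 : a * Real.exp (b * T) - b * Real.exp (a * T) ≠ 0 := by
    nlinarith [Real.exp_pos (a * T), Real.exp_pos (b * T)]
  have hne := exp_mul_ne ha hb hT
  rw [exp_flowY_zero ha hb, peakP₁]
  generalize Real.exp (a * T) = E at *
  generalize Real.exp (b * T) = F at *
  field_simp
  ring

theorem peakP_left (ha : 0 < a) (hb : b < 0) (hT : T ≠ 0) :
    peakP₁ a b T / Real.exp (flowY a b T 0) + peakP₂ a b T / Real.exp (flowY a b T 2)
      = outK a b (-T) := by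
  have hL : a - b ≠ 0 := by linarith
  have h3 : a * Real.exp (b * T) - b * Real.exp (a * T) ≠ 0 := by
    nlinarith [Real.exp_pos (a * T), Real.exp_pos (b * T)]
  have hE := Real.exp_pos (a * T)
  have hF := Real.exp_pos (b * T)
  have hne := exp_mul_ne ha hb hT
  rw [peakP₂_div ha hb hT, exp_flowY_zero ha hb, peakP₁, outK_neg]
  generalize Real.exp (a * T) = E at *
  generalize Real.exp (b * T) = F at *
  field_simp
  ring

theorem peakP_right (ha : 0 < a) (hb : b < 0) (hT : T ≠ 0) :
    peakP₁ a b T * Real.exp (flowY a b T 0) + peakP₂ a b T * Real.exp (flowY a b T 2)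
      = outK a b T := by
  have hL : a - b ≠ 0 := by linarith
  have hne := exp_mul_ne ha hb hT
  rw [peakP₁_mul ha hb hT, exp_flowY_two ha hb, peakP₂, outK]
  generalize Real.exp (a * T) = E at *
  generalize Real.exp (b * T) = F at *
  field_simp
  ring

theorem peakU_flowY (ha : 0 < a) (hb : b < 0) (hT : T ≠ 0) (X : ℝ) :
    peakU a b T (flowY a b T X) = flowU a b T X := by
  have hm := (strictMono_flowY ha hb hT).monotone
  rw [flowU_eq ha hb hT, peakU]
  rcases label_cases X with h | h | h
  · rw [twoPeakon_left (hm h.le) (hm (by linarith)), peakP_left ha hb hT, coefA, coefB,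
      pw_left h, pw_left h]
    ring
  · rw [twoPeakon_mid (hm h.1) (hm h.2), peakP₂_div ha hb hT, peakP₁_mul ha hb hT, coefA, coefB,
      pw_mid h, pw_mid h]
  · rw [twoPeakon_right (hm (by linarith)) (hm h.le), peakP_right ha hb hT, coefA, coefB,
      pw_right h, pw_right h]
    ring

theorem deriv_peakU_flowY (ha : 0 < a) (hb : b < 0) (hT : T ≠ 0) {X : ℝ}
    (hX : X ∉ ({0, 2} : Set ℝ)) : deriv (peakU a b T) (flowY a b T X) = slope a b T X := by
  have hm := strictMono_flowY ha hb hT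
  have h0 : X ≠ 0 := fun h => hX (by simp [h])
  have h2 : X ≠ 2 := fun h => hX (by simp [h])
  rw [slope, peakU]
  rcases label_cases X with h | h | h
  · rw [deriv_twoPeakon_left (hm h) (hm (by linarith)), peakP_left ha hb hT, coefA, coefB,
      pw_left h, pw_left h]
    ring
  · rw [deriv_twoPeakon_mid (hm (lt_of_le_of_ne h.1 h0.symm)) (hm (lt_of_le_of_ne h.2 h2)),
      peakP₂_div ha hb hT, peakP₁_mul ha hb hT, coefA, coefB, pw_mid h, pw_mid h]
  · rw [deriv_twoPeakon_right (hm (by linarith)) (hm h), peakP_right ha hb hT, coefA, coefB,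
      pw_right h, pw_right h]
    ring

/-- Away from the collision the characteristics themselves form an admissible change of variables.
Push-forwards, energy integrals and the labels with y(0, ξ) = ξ all follow from this. -/
theorem isRelabeling_flowY (ha : 0 < a) (hb : b < 0) (hT : T ≠ 0) :
    IsRelabeling (flowY a b T) (flowYξ a b T) where
  cont := continuous_flowY ha hb
  exists_countable := ⟨{0, 2}, by simp, hasDerivAt_flowY_label ha hb⟩
  meas := measurable_flowYξ
  bounds := by
    obtain ⟨c, hc, h⟩ := exists_lower_flowYξ_at ha hb hT
    obtain ⟨K, hK⟩ := (decayingFamily_flowYξ ha hb).bound T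
    refine ⟨c, |K| + 1, hc, fun X => ⟨h X, ?_⟩⟩
    have h1 := (abs_le.mp (hK X)).2
    nlinarith [le_abs_self K, abs_nonneg K, weight_pos X, weight_le_one X]
  bdd := (uniformFamily_flowY ha hb).bound T
  lim := tendsto_flowY_sub
  two := (decayingFamily_flowYξ ha hb).memLp (measurable_flowYξ.sub_const 1).aestronglyMeasurable
    memLp_weight_two

theorem flowY_mem_Icc_iff (ha : 0 < a) (hb : b < 0) (hT : T ≠ 0) {X : ℝ} :
    flowY a b T X ∈ Icc (flowY a b T 0) (flowY a b T 2) ↔ X ∈ Icc (0 : ℝ) 2 :=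
  and_congr (strictMono_flowY ha hb hT).le_iff_le (strictMono_flowY ha hb hT).le_iff_le

theorem image_flowY_Icc (ha : 0 < a) (hb : b < 0) (hT : T ≠ 0) :
    flowY a b T '' Icc 0 2 = Icc (flowY a b T 0) (flowY a b T 2) := by
  ext x
  obtain ⟨X, rfl⟩ := (isRelabeling_flowY ha hb hT).surjective x
  rw [flowY_mem_Icc_iff ha hb hT, (strictMono_flowY ha hb hT).injective.mem_set_image]

/-- The stored energy has constant density k in the labels; ρ is the Eulerian density whose
pull-back is this constant. -/
theorem map_flowH (ha : 0 < a) (hb : b < 0) (hT : T ≠ 0) {k : ℝ} (hk : 0 ≤ k) {ρ : ℝ → ℝ}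
    (hρk : ∀ X ∈ Icc (0 : ℝ) 2, flowYξ a b T X * ρ (flowY a b T X) = k) :
    (volume.withDensity (fun X => ENNReal.ofReal (flowH a b T k X))).map (flowY a b T)
      = slopeSqMeasure (peakU a b T)
        + (volume.restrict (Icc (flowY a b T 0) (flowY a b T 2))).withDensity
          (fun x => ENNReal.ofReal (ρ x)) := by
  have h1 := (isRelabeling_flowY ha hb hT).map_withDensity fun x =>
    ENNReal.ofReal (deriv (peakU a b T) x ^ 2)
      + (Icc (flowY a b T 0) (flowY a b T 2)).indicator (fun x => ENNReal.ofReal (ρ x)) x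
  have h2 : volume.withDensity (fun X => ENNReal.ofReal (flowH a b T k X)) =
      volume.withDensity (fun X => ENNReal.ofReal (flowYξ a b T X) *
        (ENNReal.ofReal (deriv (peakU a b T) (flowY a b T X) ^ 2)
          + (Icc (flowY a b T 0) (flowY a b T 2)).indicator (fun x => ENNReal.ofReal (ρ x))
            (flowY a b T X))) := by
    refine withDensity_congr_ae ?_
    filter_upwards [(show ({0, 2} : Set ℝ).Countable by simp).ae_notMem volume] with X hX
    have hy := (flowYξ_pos ha hb hT X).le
    rw [flowH_sub, flowH_zero_eq ha hb hT, deriv_peakU_flowY ha hb hT hX, mul_add,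
      ← ENNReal.ofReal_mul hy, mul_comm (flowYξ a b T X)]
    by_cases h : X ∈ Icc (0 : ℝ) 2
    · rw [pw_mid h, indicator_of_mem ((flowY_mem_Icc_iff ha hb hT).mpr h), ← ENNReal.ofReal_mul hy,
        hρk X h, ENNReal.ofReal_add (by positivity) hk]
    · rw [indicator_of_notMem (fun h' => h ((flowY_mem_Icc_iff ha hb hT).mp h')), mul_zero,
        add_zero]
      rcases label_cases X with h' | h' | h'
      · rw [pw_left h', Pi.zero_apply, add_zero]
      · exact absurd h' h
      · rw [pw_right h', Pi.zero_apply, add_zero]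
  rw [h2, h1]
  have h3 := withDensity_add_left (μ := volume)
    (((measurable_deriv (peakU a b T)).pow_const 2).ennreal_ofReal)
    ((Icc (flowY a b T 0) (flowY a b T 2)).indicator fun x => ENNReal.ofReal (ρ x))
  rw [withDensity_indicator measurableSet_Icc] at h3
  exact h3

theorem map_flowH_zero (ha : 0 < a) (hb : b < 0) (hT : T ≠ 0) :
    (volume.withDensity (fun X => ENNReal.ofReal (flowH a b T 0 X))).map (flowY a b T)
      = slopeSqMeasure (peakU a b T) := by
  rw [map_flowH ha hb hT le_rfl (ρ := fun _ => 0) (fun X _ => mul_zero _)]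
  simp

/-- An antiderivative of the energy density `(U² + u_x(y)²) y_ξ`. -/
def potE (a b T X : ℝ) : ℝ :=
  coefA a b T X ^ 2 * Real.exp (flowY a b T X) ^ 2 - coefB a b T X ^ 2 / Real.exp (flowY a b T X) ^ 2
    + pw (fun _ => 0) (fun _ => 2 * (b ^ 2 * Real.exp (a * T) - a ^ 2 * Real.exp (b * T))
      / (Real.exp (a * T) - Real.exp (b * T))) (fun _ => 2 * a ^ 2 + 2 * b ^ 2) X

/-- The constants on the three regions are fixed by continuity at the peaks, starting from 0 on the
left. The last one is then the total energy, since the exponential terms vanish at both ends. -/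
theorem continuous_potE (ha : 0 < a) (hb : b < 0) (hT : T ≠ 0) : Continuous (potE a b T) := by
  have hy := continuous_flowY (T := T) ha hb
  have hE := Real.exp_pos (a * T)
  have hF := Real.exp_pos (b * T)
  have hL : a - b ≠ 0 := by linarith
  have h3 : a * Real.exp (b * T) - b * Real.exp (a * T) ≠ 0 := by nlinarith
  have h4 : a * Real.exp (a * T) - b * Real.exp (b * T) ≠ 0 := by nlinarith
  have hne := exp_mul_ne ha hb hT
  have e : potE a b T = pw (fun X => outK a b (-T) ^ 2 * Real.exp (flowY a b T X) ^ 2)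
      (fun X => ((a - b) / (Real.exp (a * T) - Real.exp (b * T))) ^ 2 * Real.exp (flowY a b T X) ^ 2
        - (-(a - b) * (Real.exp (a * T) * Real.exp (b * T))
          / (Real.exp (a * T) - Real.exp (b * T))) ^ 2 / Real.exp (flowY a b T X) ^ 2
        + 2 * (b ^ 2 * Real.exp (a * T) - a ^ 2 * Real.exp (b * T))
          / (Real.exp (a * T) - Real.exp (b * T)))
      (fun X => -(outK a b T ^ 2 / Real.exp (flowY a b T X) ^ 2) + (2 * a ^ 2 + 2 * b ^ 2)) := by
    ext X
    rcases label_cases X with h | h | h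
    · simp only [potE, coefA, coefB, pw_left h]; ring
    · simp only [potE, coefA, coefB, pw_mid h]
    · simp only [potE, coefA, coefB, pw_right h]; ring
  have hexp : ∀ X, Real.exp (flowY a b T X) ^ 2 ≠ 0 := fun X => (by positivity)
  rw [e]
  refine continuous_pw (by fun_prop) (Continuous.continuousOn (by fun_prop (disch := exact hexp)))
    (Continuous.continuousOn (by fun_prop (disch := exact hexp))) ?_ ?_
  · rw [exp_flowY_zero ha hb, outK_neg]
    generalize Real.exp (a * T) = E at *
    generalize Real.exp (b * T) = F at *
    field_simp
    ring
  · rw [exp_flowY_two ha hb, outK]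
    generalize Real.exp (a * T) = E at *
    generalize Real.exp (b * T) = F at *
    field_simp
    ring

theorem hasDerivAt_potE (ha : 0 < a) (hb : b < 0) (hT : T ≠ 0) :
    ∀ X ∉ ({0, 2} : Set ℝ), HasDerivAt (potE a b T)
      ((peakU a b T (flowY a b T X) ^ 2 + deriv (peakU a b T) (flowY a b T X) ^ 2)
        * flowYξ a b T X) X := by
  intro X hX
  have hz := (Real.exp_pos (flowY a b T X)).ne'
  have hy := (hasDerivAt_flowY_label (T := T) ha hb X hX).exp
  have h1 := (((hy.pow 2).const_mul (coefA a b T X ^ 2)).sub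
    ((hasDerivAt_const X (coefB a b T X ^ 2)).div (hy.pow 2) (pow_ne_zero 2 hz))).add_const
      (pw (fun _ => 0) (fun _ => 2 * (b ^ 2 * Real.exp (a * T) - a ^ 2 * Real.exp (b * T))
      / (Real.exp (a * T) - Real.exp (b * T))) (fun _ => 2 * a ^ 2 + 2 * b ^ 2) X)
  refine (h1.congr_of_eventuallyEq ?_).congr_deriv ?_
  · filter_upwards [pw_const_eventuallyEq hX, pw_const_eventuallyEq hX,
      pw_const_eventuallyEq hX] with x e1 e2 e3
    simp only [potE, coefA, coefB] at *
    rw [e1, e2, e3]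
    rfl
  · rw [peakU_flowY ha hb hT, flowU_eq ha hb hT, deriv_peakU_flowY ha hb hT hX, slope, Pi.pow_apply]
    field_simp
    ring

theorem integral_peakU_energy (ha : 0 < a) (hb : b < 0) (hT : T ≠ 0) :
    ∫ x, (peakU a b T x ^ 2 + deriv (peakU a b T) x ^ 2) = 2 * a ^ 2 + 2 * b ^ 2 := by
  have hr := isRelabeling_flowY ha hb hT
  rw [← hr.integral_comp fun x => peakU a b T x ^ 2 + deriv (peakU a b T) x ^ 2]
  have h1 : Tendsto (potE a b T) atBot (𝓝 0) := by
    have h1 : Tendsto (fun X => outK a b (-T) ^ 2 * Real.exp (flowY a b T X) ^ 2) atBot (𝓝 0) := by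
      have := ((Real.tendsto_exp_atBot.comp (tendsto_flowY_atBot (a := a) (b := b) (T := T))).pow
        2).const_mul (outK a b (-T) ^ 2)
      simpa using this
    refine h1.congr' ?_
    filter_upwards [eventually_lt_atBot 0] with X h
    simp only [potE, coefA, coefB, pw_left h]; ring
  have h2 : Tendsto (potE a b T) atTop (𝓝 (2 * a ^ 2 + 2 * b ^ 2)) := by
    have h1 : Tendsto (fun X => -(outK a b T ^ 2 * Real.exp (-flowY a b T X) ^ 2)
        + (2 * a ^ 2 + 2 * b ^ 2)) atTop (𝓝 (2 * a ^ 2 + 2 * b ^ 2)) := by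
      have := (((Real.tendsto_exp_atBot.comp (tendsto_neg_atTop_atBot.comp
        (tendsto_flowY_atTop (T := T) ha hb))).pow 2).const_mul (outK a b T ^ 2)).neg.add_const
          (2 * a ^ 2 + 2 * b ^ 2)
      simpa using this
    refine h1.congr' ?_
    filter_upwards [eventually_gt_atTop 2] with X h
    simp only [potE, coefA, coefB, pw_right h, Real.exp_neg]; ring
  rw [integral_of_hasDerivAt_off_countable (s := {0, 2}) (by simp) (continuous_potE ha hb hT)
    (hasDerivAt_potE ha hb hT) (hr.integrable_comp integrable_twoPeakon_energy) h1 h2, sub_zero]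

end profile

/-! ### The explicit solution -/

section identification

variable {a b t₀ t : ℝ}

theorem exp_sub_mul (a b T : ℝ) :
    Real.exp ((a - b) * T) = Real.exp (a * T) / Real.exp (b * T) := by
  rw [← Real.exp_sub]; ring_nf

theorem exp_neg_sub_mul (a b T : ℝ) :
    Real.exp (-(a - b) * T) = Real.exp (b * T) / Real.exp (a * T) := by
  rw [← Real.exp_sub]; ring_nf

/-- The formulas before and after breaking are the same functions of T, a and b. They differ in
which of e^{aT}, e^{bT} has been divided out, so each identification multiplies numerator and
denominator by the missing exponential, up to sign. -/
theorem p₁_eq : p₁ a b t₀ t = peakP₁ a b (t - t₀) := by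
  rw [p₁, peakP₁, exp_sub_mul]
  have hF := (Real.exp_pos (b * (t - t₀))).ne'
  generalize Real.exp (a * (t - t₀)) = E at *
  generalize Real.exp (b * (t - t₀)) = F at *
  rw [← mul_div_mul_right _ _ (neg_ne_zero.mpr hF)]
  congr 1 <;> (field_simp; ring)

theorem p₂_eq : p₂ a b t₀ t = peakP₂ a b (t - t₀) := by
  rw [p₂, peakP₂, exp_sub_mul]
  have hF := (Real.exp_pos (b * (t - t₀))).ne'
  generalize Real.exp (a * (t - t₀)) = E at *
  generalize Real.exp (b * (t - t₀)) = F at *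
  rw [← mul_div_mul_right _ _ (neg_ne_zero.mpr hF)]
  congr 1 <;> (field_simp; ring)

theorem pt₁_eq : pt₁ a b t₀ t = peakP₁ a b (t - t₀) := by
  rw [pt₁, peakP₁, exp_neg_sub_mul]
  have hE := (Real.exp_pos (a * (t - t₀))).ne'
  generalize Real.exp (a * (t - t₀)) = E at *
  generalize Real.exp (b * (t - t₀)) = F at *
  rw [← mul_div_mul_right _ _ hE]
  congr 1 <;> field_simp

theorem pt₂_eq : pt₂ a b t₀ t = peakP₂ a b (t - t₀) := by
  rw [pt₂, peakP₂, exp_neg_sub_mul]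
  have hE := (Real.exp_pos (a * (t - t₀))).ne'
  generalize Real.exp (a * (t - t₀)) = E at *
  generalize Real.exp (b * (t - t₀)) = F at *
  rw [← mul_div_mul_right _ _ hE]
  congr 1 <;> field_simp

theorem q₁_eq (ha : 0 < a) (hb : b < 0) : q₁ a b t₀ t = flowY a b (t - t₀) 0 := by
  have hE := Real.exp_pos (a * (t - t₀))
  have hF := Real.exp_pos (b * (t - t₀))
  have hL : 0 < a - b := by linarith
  have h1 : 0 < a - b * (Real.exp (a * (t - t₀)) / Real.exp (b * (t - t₀))) := by
    have := mul_pos (neg_pos.mpr hb) (div_pos hE hF)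
    linarith
  refine Real.exp_injective ?_
  rw [exp_flowY_zero ha hb, q₁, exp_sub_mul, Real.exp_sub, Real.exp_add, Real.exp_log hL,
    Real.exp_log h1]
  generalize Real.exp (a * (t - t₀)) = E at *
  generalize Real.exp (b * (t - t₀)) = F at *
  rw [← mul_div_mul_right _ _ hF.ne']
  congr 1 <;> (field_simp)

theorem q₂_eq (ha : 0 < a) (hb : b < 0) : q₂ a b t₀ t = flowY a b (t - t₀) 2 := by
  have hE := Real.exp_pos (a * (t - t₀))
  have hF := Real.exp_pos (b * (t - t₀))
  have hL : 0 < a - b := by linarith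
  have h1 : 0 < a * (Real.exp (a * (t - t₀)) / Real.exp (b * (t - t₀))) - b := by
    have := mul_pos ha (div_pos hE hF)
    linarith
  refine Real.exp_injective ?_
  rw [exp_flowY_two ha hb, q₂, exp_sub_mul, Real.exp_add, Real.exp_add, Real.exp_neg,
    Real.exp_log hL, Real.exp_log h1]
  generalize Real.exp (a * (t - t₀)) = E at *
  generalize Real.exp (b * (t - t₀)) = F at *
  field_simp

theorem qt₁_eq (ha : 0 < a) (hb : b < 0) : qt₁ a b t₀ t = flowY a b (t - t₀) 0 := by
  have hE := Real.exp_pos (a * (t - t₀))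
  have hF := Real.exp_pos (b * (t - t₀))
  have hL : 0 < a - b := by linarith
  have h1 : 0 < a * (Real.exp (b * (t - t₀)) / Real.exp (a * (t - t₀))) - b := by
    have := mul_pos ha (div_pos hF hE)
    linarith
  refine Real.exp_injective ?_
  rw [exp_flowY_zero ha hb, qt₁, exp_neg_sub_mul, Real.exp_sub, Real.exp_add, Real.exp_log hL,
    Real.exp_log h1]
  generalize Real.exp (a * (t - t₀)) = E at *
  generalize Real.exp (b * (t - t₀)) = F at *
  rw [← mul_div_mul_right _ _ hE.ne']
  congr 1 <;> (field_simp)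

theorem qt₂_eq (ha : 0 < a) (hb : b < 0) : qt₂ a b t₀ t = flowY a b (t - t₀) 2 := by
  have hE := Real.exp_pos (a * (t - t₀))
  have hF := Real.exp_pos (b * (t - t₀))
  have hL : 0 < a - b := by linarith
  have h1 : 0 < a - b * (Real.exp (b * (t - t₀)) / Real.exp (a * (t - t₀))) := by
    have := mul_pos (neg_pos.mpr hb) (div_pos hF hE)
    linarith
  refine Real.exp_injective ?_
  rw [exp_flowY_two ha hb, qt₂, exp_neg_sub_mul, Real.exp_add, Real.exp_add, Real.exp_neg,
    Real.exp_log hL, Real.exp_log h1]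
  generalize Real.exp (a * (t - t₀)) = E at *
  generalize Real.exp (b * (t - t₀)) = F at *
  field_simp

end identification

/-! ### The parameters after breaking. -/

section parameters

variable {c₁ c₂ α : ℝ}

theorem d₁_add_d₂ : d₁ c₁ c₂ α + d₂ c₁ c₂ α = c₁ + c₂ := by unfold d₁ d₂; ring

/-- Strictness comes from -(1 - α)c₁c₂ > 0. It makes the square root exceed |c₁ + c₂|/2, which
determines the signs of d₁ and d₂. -/
theorem discriminant_pos (h₁ : 0 < c₁) (h₂ : c₂ < 0) (hα : α < 1) :
    (1 / 2 * (c₁ + c₂)) ^ 2 < 1 / 4 * (c₁ + c₂) ^ 2 - (1 - α) * c₁ * c₂ := by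
  have := mul_pos (mul_pos (sub_pos.mpr hα) h₁) (neg_pos.mpr h₂)
  nlinarith

theorem d₁_mul_d₂ (h₁ : 0 < c₁) (h₂ : c₂ < 0) (hα : α < 1) :
    d₁ c₁ c₂ α * d₂ c₁ c₂ α = (1 - α) * (c₁ * c₂) := by
  have h := discriminant_pos h₁ h₂ hα
  have hs := Real.sq_sqrt ((sq_nonneg _).trans h.le)
  unfold d₁ d₂
  linear_combination -hs

theorem d₁_pos (h₁ : 0 < c₁) (h₂ : c₂ < 0) (hα : α < 1) : 0 < d₁ c₁ c₂ α := by
  have h := Real.sqrt_lt_sqrt (sq_nonneg _) (discriminant_pos h₁ h₂ hα)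
  rw [Real.sqrt_sq_eq_abs] at h
  unfold d₁
  linarith [neg_abs_le (1 / 2 * (c₁ + c₂))]

theorem d₂_neg (h₁ : 0 < c₁) (h₂ : c₂ < 0) (hα : α < 1) : d₂ c₁ c₂ α < 0 := by
  have h := Real.sqrt_lt_sqrt (sq_nonneg _) (discriminant_pos h₁ h₂ hα)
  rw [Real.sqrt_sq_eq_abs] at h
  unfold d₂
  linarith [le_abs_self (1 / 2 * (c₁ + c₂))]

theorem breakingData (h₁ : 0 < c₁) (h₂ : c₂ < 0) (hα₀ : 0 ≤ α) (hα : α < 1) :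
    BreakingData α c₁ c₂ (d₁ c₁ c₂ α) (d₂ c₁ c₂ α) where
  pos := h₁
  neg := h₂
  pos' := d₁_pos h₁ h₂ hα
  neg' := d₂_neg h₁ h₂ hα
  nonneg := hα₀
  add_eq := d₁_add_d₂
  mul_eq := d₁_mul_d₂ h₁ h₂ hα

end parameters

/-! ### The explicit triple as the Eulerian image of the flow. -/

section explicit

variable {c₁ c₂ t₀ α t : ℝ}

theorem uSol_before (h₁ : 0 < c₁) (h₂ : c₂ < 0) (h : t < t₀) :
    uSol c₁ c₂ t₀ α t = peakU c₁ c₂ (t - t₀) := by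
  rw [uSol, if_pos h, p₁_eq, p₂_eq, q₁_eq h₁ h₂, q₂_eq h₁ h₂, peakU]

theorem uSol_after (h₁ : 0 < c₁) (h₂ : c₂ < 0) (hα : α < 1) (h : t₀ < t) :
    uSol c₁ c₂ t₀ α t = peakU (d₁ c₁ c₂ α) (d₂ c₁ c₂ α) (t - t₀) := by
  rw [uSol, if_neg h.not_gt, if_neg h.ne', pt₁_eq, pt₂_eq,
    qt₁_eq (d₁_pos h₁ h₂ hα) (d₂_neg h₁ h₂ hα), qt₂_eq (d₁_pos h₁ h₂ hα) (d₂_neg h₁ h₂ hα), peakU]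

theorem uSol_at : uSol c₁ c₂ t₀ α t₀ = twoPeakon (c₁ + c₂) 0 0 0 := by
  ext x
  rw [uSol, if_neg (lt_irrefl _), if_pos rfl, twoPeakon, sub_zero, zero_mul, add_zero]

theorem uSol_eq_twoPeakon (t : ℝ) : ∃ P₁ P₂ Q₁ Q₂, uSol c₁ c₂ t₀ α t = twoPeakon P₁ P₂ Q₁ Q₂ := by
  rcases lt_trichotomy t t₀ with h | h | h
  · exact ⟨_, _, _, _, by rw [uSol, if_pos h]⟩
  · subst h; exact ⟨_, _, _, _, uSol_at⟩
  · exact ⟨_, _, _, _, by rw [uSol, if_neg h.not_gt, if_neg h.ne']⟩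

theorem initialData_eq (h₁ : 0 < c₁) (h₂ : c₂ < 0) : initialData c₁ c₂ t₀ =
    ⟨peakU c₁ c₂ (0 - t₀), slopeSqMeasure (peakU c₁ c₂ (0 - t₀)),
      slopeSqMeasure (peakU c₁ c₂ (0 - t₀))⟩ := by
  rw [initialData, p₁_eq, p₂_eq, q₁_eq h₁ h₂, q₂_eq h₁ h₂, peakU]

theorem explicitSolution_before (h₁ : 0 < c₁) (h₂ : c₂ < 0) (h : t < t₀) :
    explicitSolution c₁ c₂ t₀ α t = ⟨peakU c₁ c₂ (t - t₀), slopeSqMeasure (peakU c₁ c₂ (t - t₀)),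
      slopeSqMeasure (peakU c₁ c₂ (t - t₀))⟩ := by
  rw [explicitSolution, if_neg h.ne, if_pos h, add_zero, uSol_before h₁ h₂ h]

theorem explicitSolution_zero (h₁ : 0 < c₁) (h₂ : c₂ < 0) (h : 0 < t₀) :
    explicitSolution c₁ c₂ t₀ α 0 = initialData c₁ c₂ t₀ := by
  rw [explicitSolution_before h₁ h₂ h, initialData_eq h₁ h₂]

theorem isEulerianImage_before (h₁ : 0 < c₁) (h₂ : c₂ < 0) (h : t < t₀) :
    IsEulerianImage (flowState c₁ c₂ (t - t₀) 0) (explicitSolution c₁ c₂ t₀ α t) := by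
  have hT : t - t₀ ≠ 0 := by linarith
  rw [explicitSolution_before h₁ h₂ h]
  exact ⟨fun X => peakU_flowY h₁ h₂ hT X, (map_flowH_zero h₁ h₂ hT).symm,
    (map_flowH_zero h₁ h₂ hT).symm⟩

theorem midInterval_eq (h₁ : 0 < c₁) (h₂ : c₂ < 0) (hα : α < 1) : midInterval c₁ c₂ t₀ α t =
    Icc (flowY (d₁ c₁ c₂ α) (d₂ c₁ c₂ α) (t - t₀) 0)
      (flowY (d₁ c₁ c₂ α) (d₂ c₁ c₂ α) (t - t₀) 2) := by
  rw [midInterval, qt₁_eq (d₁_pos h₁ h₂ hα) (d₂_neg h₁ h₂ hα),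
    qt₂_eq (d₁_pos h₁ h₂ hα) (d₂_neg h₁ h₂ hα)]

/-- This is the origin of ν_m: it is the image under y of the energy -2αc₁c₂ per unit label which
was removed from h̄ but kept in h. -/
theorem flowYξ_mul_nuMDensity {a b X : ℝ} (ha : 0 < a) (hb : b < 0) (hα : α < 1)
    (hab : a * b = (1 - α) * (c₁ * c₂)) (ht : t ≠ t₀) (hX : X ∈ Icc (0 : ℝ) 2) :
    flowYξ a b (t - t₀) X * nuMDensity c₁ c₂ α a b t₀ t (flowY a b (t - t₀) X)
      = -2 * α * (c₁ * c₂) := by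
  have hN := (midN_pos (T := t - t₀) ha hb hX).ne'
  have hA := (midA_pos (T := t - t₀) ha hb hX).ne'
  have hE := (Real.exp_pos (a * (t - t₀))).ne'
  have hne := exp_mul_ne ha hb (sub_ne_zero.mpr ht)
  have hα' : 1 - α ≠ 0 := by linarith
  have hab' : a * b ≠ 0 := mul_ne_zero ha.ne' hb.ne
  have hc : c₁ * c₂ = a * b / (1 - α) := by rw [hab]; field_simp
  -- At x = y(X) the bracket that is squared in ν_m simplifies to a constant over `midA`. Then e^x
  -- divided by its square is a constant times `midA * midN`, which cancels against y_ξ.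
  have key : Real.exp (flowY a b (t - t₀) X - a * (t - t₀)) * (a - b
      + b * Real.exp (a * (t - t₀)) - a * Real.exp (b * (t - t₀)))
      - (a - b * Real.exp (-(a - b) * (t - t₀)) - (a - b) * Real.exp (b * (t - t₀)))
      = 2 * (a * b) * (Real.exp (a * (t - t₀)) - Real.exp (b * (t - t₀))) ^ 2
        / (midA a b (t - t₀) X * Real.exp (a * (t - t₀))) := by
    rw [Real.exp_sub, exp_flowY_mid ha hb hX, exp_neg_sub_mul]
    generalize hA' : midA a b (t - t₀) X = A at *
    generalize hN' : midN a b (t - t₀) X = N at *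
    rw [midA] at hA'
    rw [midN] at hN'
    generalize Real.exp (a * (t - t₀)) = E at *
    generalize Real.exp (b * (t - t₀)) = F at *
    field_simp
    rw [← hA', ← hN']
    ring
  rw [nuMDensity, key, flowYξ, pw_mid hX, midY, exp_flowY_mid ha hb hX, exp_neg_sub_mul]
  have e : 4 * α * (1 - α) * c₁ ^ 2 * c₂ ^ 2 = 4 * α * (1 - α) * (c₁ * c₂) ^ 2 := by ring
  rw [e, hc]
  generalize Real.exp (a * (t - t₀)) = E at *
  generalize Real.exp (b * (t - t₀)) = F at *
  generalize midA a b (t - t₀) X = A at *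
  generalize midN a b (t - t₀) X = N at *
  have ha' := ha.ne'
  have hb' := hb.ne
  field_simp
  ring

theorem isEulerianImage_after (h₁ : 0 < c₁) (h₂ : c₂ < 0) (hα₀ : 0 ≤ α) (hα : α < 1)
    (h : t₀ < t) :
    IsEulerianImage (flowState (d₁ c₁ c₂ α) (d₂ c₁ c₂ α) (t - t₀) (-2 * α * (c₁ * c₂)))
      (explicitSolution c₁ c₂ t₀ α t) := by
  have ha := d₁_pos h₁ h₂ hα
  have hb := d₂_neg h₁ h₂ hα
  have hT : t - t₀ ≠ 0 := by linarith
  refine ⟨fun X => ?_, ?_, ?_⟩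
  · simp only [explicitSolution, uSol_after h₁ h₂ hα h]
    exact peakU_flowY ha hb hT X
  · simp only [explicitSolution, uSol_after h₁ h₂ hα h]
    rw [if_neg h.ne', add_zero]
    exact (map_flowH_zero ha hb hT).symm
  · simp only [explicitSolution, uSol_after h₁ h₂ hα h]
    rw [if_neg h.not_gt, if_neg h.ne', midInterval_eq h₁ h₂ hα]
    exact (map_flowH ha hb hT (breakingData h₁ h₂ hα₀ hα).gap_nonneg
      fun X hX => flowYξ_mul_nuMDensity ha hb hα (d₁_mul_d₂ h₁ h₂ hα) h.ne' hX).symm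

/-- Outside [0, 2] the map y is a translation on each side, injective with image the line without 0.
The labels [0, 2], of length 2 and constant density -2ab + k, all go to 0 and form the point mass.
-/
theorem map_flowH_collision {a b : ℝ} (hab : a - b ≠ 0) (k : ℝ) :
    (volume.withDensity (fun X => ENNReal.ofReal (flowH a b 0 k X))).map (flowY a b 0)
      = slopeSqMeasure (twoPeakon (a + b) 0 0 0)
        + ENNReal.ofReal (-4 * (a * b) + 2 * k) • Measure.dirac 0 := by
  have hy : Measurable (flowY a b 0) := by
    rw [flowY_zero_time hab]
    exact measurable_pw measurable_id measurable_const (measurable_id.sub_const 2)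
  have hd : ∀ x : ℝ, x ≠ 0 → deriv (twoPeakon (a + b) 0 0 0) x ^ 2
      = ((a + b) * Real.exp (-|x|)) ^ 2 := fun x hx => by
    rw [(hasDerivAt_twoPeakon hx hx).deriv, zero_mul, add_zero, sub_zero]
    rcases lt_or_gt_of_ne hx with h | h
    · rw [Real.sign_of_neg h]; ring
    · rw [Real.sign_of_pos h]; ring
  set ρ : ℝ → ℝ≥0∞ := fun x => ENNReal.ofReal (deriv (twoPeakon (a + b) 0 0 0) x ^ 2) with hρ
  set A : Set ℝ := (Icc 0 2)ᶜ with hA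
  have hmA : MeasurableSet A := measurableSet_Icc.compl
  have hyl : ∀ X < 0, flowY a b 0 X = X := fun X h => by rw [flowY_zero_time hab, pw_left h]
  have hyr : ∀ X > 2, flowY a b 0 X = X - 2 := fun X h => by rw [flowY_zero_time hab, pw_right h]
  have hcases : ∀ X ∈ A, X < 0 ∨ 2 < X := fun X hX => by
    rcases label_cases X with h | h | h
    · exact .inl h
    · exact absurd h hX
    · exact .inr h
  have hinj : InjOn (flowY a b 0) A := fun X hX Z hZ h => by
    rcases hcases X hX with h1 | h1 <;> rcases hcases Z hZ with h2 | h2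
    · rwa [hyl X h1, hyl Z h2] at h
    · rw [hyl X h1, hyr Z h2] at h; linarith
    · rw [hyr X h1, hyl Z h2] at h; linarith
    · rw [hyr X h1, hyr Z h2] at h; linarith
  have himg : flowY a b 0 '' A = {0}ᶜ := by
    ext x
    constructor
    · rintro ⟨X, hX, rfl⟩
      rcases hcases X hX with h1 | h1
      · rw [hyl X h1]; exact h1.ne
      · rw [hyr X h1]; exact (sub_pos.mpr h1).ne'
    · intro hx
      rcases lt_or_gt_of_ne (show x ≠ 0 from hx) with h | h
      · exact ⟨x, fun h' => absurd h'.1 h.not_ge, hyl x h⟩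
      · exact ⟨x + 2, fun h' => by linarith [h'.2], by rw [hyr _ (by linarith)]; ring⟩
  have hder : ∀ X ∈ A, HasDerivWithinAt (flowY a b 0) 1 A X := fun X hX => by
    have hX' : X ∉ ({0, 2} : Set ℝ) := fun h => by
      rcases h with h | h
      · exact hX (by rw [h]; simp)
      · exact hX (by rw [mem_singleton_iff.mp h]; simp)
    rw [flowY_zero_time hab]
    have h1 := hasDerivAt_pw (l := fun X => X) (m := fun _ => 0) (r := fun X => X - 2)
      (l' := fun _ => 1) (m' := fun _ => 0) (r' := fun _ => 1) (fun X _ => hasDerivAt_id X)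
      (fun X _ => hasDerivAt_const X 0) (fun X _ => (hasDerivAt_id X).sub_const 2) X hX'
    refine (h1.congr_deriv ?_).hasDerivWithinAt
    rcases hcases X hX with h | h
    · rw [pw_left h]
    · rw [pw_right h]
  have e1 := map_withDensity_of_hasDerivWithinAt hmA hy hinj hder (fun _ _ => zero_le_one) ρ
  have e2 : (volume.restrict A).withDensity
      (fun X => ENNReal.ofReal 1 * ρ (flowY a b 0 X)) =
      (volume.restrict A).withDensity (fun X => ENNReal.ofReal (flowH a b 0 k X)) := by
    refine withDensity_congr_ae ((ae_restrict_iff' hmA).mpr (Eventually.of_forall fun X hX => ?_))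
    rw [ENNReal.ofReal_one]
    simp only [one_mul, hρ, flowH_zero_time hab]
    rcases hcases X hX with h | h
    · simp only [hyl X h, pw_left h, hd X h.ne, abs_of_neg h, neg_neg]
    · simp only [hyr X h, pw_right h, hd (X - 2) (sub_pos.mpr h).ne', abs_of_pos (sub_pos.mpr h),
        neg_sub]
  have e3 : ((volume.restrict Aᶜ).withDensity (fun X => ENNReal.ofReal (flowH a b 0 k X))).map
      (flowY a b 0) = ENNReal.ofReal (-4 * (a * b) + 2 * k) • Measure.dirac 0 := by
    have e4 : (volume.restrict Aᶜ).withDensity (fun X => ENNReal.ofReal (flowH a b 0 k X)) =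
        (volume.restrict Aᶜ).withDensity (fun _ => ENNReal.ofReal (-2 * (a * b) + k)) := by
      refine withDensity_congr_ae ((ae_restrict_iff' hmA.compl).mpr
        (Eventually.of_forall fun X hX => ?_))
      simp only [hA, compl_compl] at hX
      simp only [flowH_zero_time hab, pw_mid hX]
    have e5 : flowY a b 0 =ᵐ[(volume.restrict Aᶜ).withDensity
        (fun _ => ENNReal.ofReal (-2 * (a * b) + k))] fun _ => (0 : ℝ) := by
      refine (withDensity_absolutelyContinuous _ _).ae_le ((ae_restrict_iff' hmA.compl).mpr
        (Eventually.of_forall fun X hX => ?_))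
      simp only [hA, compl_compl] at hX
      rw [flowY_zero_time hab, pw_mid hX]
    rw [e4, Measure.map_congr e5, Measure.map_const, withDensity_const, Measure.smul_apply,
      Measure.restrict_apply_univ, hA, compl_compl, Real.volume_Icc, smul_eq_mul, mul_comm,
      ← ENNReal.ofReal_mul (by norm_num)]
    congr 2
    ring
  have e6 : volume.withDensity (fun X => ENNReal.ofReal (flowH a b 0 k X)) =
      (volume.restrict A).withDensity (fun X => ENNReal.ofReal (flowH a b 0 k X)) +
      (volume.restrict Aᶜ).withDensity (fun X => ENNReal.ofReal (flowH a b 0 k X)) := by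
    rw [← withDensity_add_measure, Measure.restrict_add_restrict_compl hmA]
  rw [e6, Measure.map_add _ _ hy, e3, ← e2, e1, himg]
  congr 2
  rw [restrict_compl_singleton]

theorem isEulerianImage_at (h₁ : 0 < c₁) (h₂ : c₂ < 0) (hα : α < 1) :
    IsEulerianImage (flowState (d₁ c₁ c₂ α) (d₂ c₁ c₂ α) 0 (-2 * α * (c₁ * c₂)))
      (explicitSolution c₁ c₂ t₀ α t₀) := by
  have ha := d₁_pos h₁ h₂ hα
  have hb := d₂_neg h₁ h₂ hα
  have hab : d₁ c₁ c₂ α - d₂ c₁ c₂ α ≠ 0 := by linarith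
  refine ⟨fun X => ?_, ?_, ?_⟩
  · simp only [explicitSolution, uSol_at, flowState]
    rw [flowY_zero_time hab, flowU_zero_time hab, d₁_add_d₂, twoPeakon, zero_mul, add_zero, sub_zero]
    rcases label_cases X with h | h | h
    · rw [pw_left h, pw_left h, abs_of_neg h, neg_neg]
    · rw [pw_mid h, pw_mid h, abs_zero, neg_zero, Real.exp_zero, mul_one]
    · rw [pw_right h, pw_right h, abs_of_pos (sub_pos.mpr h), neg_sub]
  · simp only [explicitSolution, uSol_at, flowState, if_true]
    rw [map_flowH_collision hab, d₁_add_d₂, d₁_mul_d₂ h₁ h₂ hα]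
    congr 3
    ring
  · simp only [explicitSolution, uSol_at, flowState, if_true, lt_irrefl, if_false]
    rw [map_flowH_collision hab, d₁_add_d₂, d₁_mul_d₂ h₁ h₂ hα]
    congr 3
    ring

theorem isEulerianImage_peakonFlow (h₁ : 0 < c₁) (h₂ : c₂ < 0) (hα₀ : 0 ≤ α) (hα : α < 1) (t : ℝ) :
    IsEulerianImage (peakonFlow α c₁ c₂ (d₁ c₁ c₂ α) (d₂ c₁ c₂ α) (t - t₀))
      (explicitSolution c₁ c₂ t₀ α t) := by
  rcases lt_trichotomy t t₀ with h | h | h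
  · rw [peakonFlow_neg (sub_neg.mpr h)]; exact isEulerianImage_before h₁ h₂ h
  · subst h; rw [sub_self, peakonFlow_nonneg le_rfl]; exact isEulerianImage_at h₁ h₂ hα
  · rw [peakonFlow_nonneg (sub_nonneg.mpr h.le)]; exact isEulerianImage_after h₁ h₂ hα₀ hα h

end explicit

/-! #### Membership in `𝒟` and uniqueness of Eulerian images -/

/-- A Radon–Nikodym derivative, bounded by 1 a.e. because μ ≤ ν. -/
theorem exists_density_of_le {μ ν : Measure ℝ} [IsFiniteMeasure μ] [IsFiniteMeasure ν]
    (h : μ ≤ ν) : ∃ f : ℝ → ℝ, Measurable f ∧ (∀ x, 0 ≤ f x ∧ f x ≤ 1) ∧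
      μ = ν.withDensity (fun x => ENNReal.ofReal (f x)) := by
  -- The minimum enforces the bound at every point, not only almost everywhere.
  refine ⟨fun x => min 1 (μ.rnDeriv ν x).toReal,
    measurable_const.min (Measure.measurable_rnDeriv μ ν).ennreal_toReal,
    fun x => ⟨le_min zero_le_one ENNReal.toReal_nonneg, min_le_left _ _⟩, ?_⟩
  rw [← Measure.withDensity_rnDeriv_eq μ ν (Measure.absolutelyContinuous_of_le h)]
  refine withDensity_congr_ae ?_
  rw [Measure.withDensity_rnDeriv_eq μ ν (Measure.absolutelyContinuous_of_le h)]
  filter_upwards [Measure.rnDeriv_le_one_of_le h] with x hx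
  have h1 : μ.rnDeriv ν x ≤ 1 := hx
  have h2 : (μ.rnDeriv ν x).toReal ≤ 1 := by
    simpa using ENNReal.toReal_mono ENNReal.one_ne_top h1
  rw [min_eq_right h2, ENNReal.ofReal_toReal (h1.trans_lt ENNReal.one_lt_top).ne]

namespace LagrangianState.MemF

variable {Θ Θ' : LagrangianState} {D D' : EulerianState}

theorem integrable_hbar (hΘ : Θ.MemF) : Integrable Θ.hbar := by
  refine hΘ.h_int.mono hΘ.hbar_meas ?_
  filter_upwards [hΘ.hbar_nonneg, hΘ.hbar_le] with ξ h0 h1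
  rw [Real.norm_eq_abs, Real.norm_eq_abs, abs_of_nonneg h0, abs_of_nonneg (h0.trans h1)]
  exact h1

theorem surjective_y (hΘ : Θ.MemF) : Function.Surjective Θ.y := by
  obtain ⟨M, hM⟩ := exists_bound_of_memLp_top (hΘ.deriv_y.continuous.sub continuous_id) hΘ.ζ_bdd
  exact surjective_of_continuous_of_sub_id_bounded hΘ.deriv_y.continuous hM

/-- The density f exists because h̄ ≤ h implies μ ≤ ν for the images. Only the regularity of u and
the decomposition of μ have to be supplied. -/
theorem memD (hΘ : Θ.MemF) (h : IsEulerianImage Θ D)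
    (hD : ∃ ux : ℝ → ℝ, IsWeakDeriv D.u ux ∧ MemLp D.u 2 volume ∧ MemLp ux 2 volume ∧
      ∃ μs : Measure ℝ, μs ⟂ₘ volume ∧
        D.μ = volume.withDensity (fun x => ENNReal.ofReal (ux x ^ 2)) + μs) : D.MemD := by
  have hμ : IsFiniteMeasure D.μ := by
    have := isFiniteMeasure_withDensity_ofReal hΘ.integrable_hbar.2
    rw [h.μ_eq]; infer_instance
  have hν : IsFiniteMeasure D.ν := by
    have := isFiniteMeasure_withDensity_ofReal hΘ.h_int.2
    rw [h.ν_eq]; infer_instance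
  refine ⟨hμ, hν, hD, exists_density_of_le ?_⟩
  rw [h.μ_eq, h.ν_eq]
  exact Measure.map_mono (withDensity_mono (hΘ.hbar_le.mono fun ξ hξ => ENNReal.ofReal_le_ofReal hξ))
    hΘ.deriv_y.continuous.measurable

theorem eq_of_ae_eqAt (hΘ : Θ.MemF) (hΘ' : Θ'.MemF) (h : ∀ᵐ ξ, Θ.EqAt Θ' ξ) :
    Θ.y = Θ'.y ∧ Θ.U = Θ'.U :=
  ⟨(hΘ.deriv_y.continuous.ae_eq_iff_eq volume hΘ'.deriv_y.continuous).mp (h.mono fun _ h => h.y),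
    (hΘ.deriv_U.continuous.ae_eq_iff_eq volume hΘ'.deriv_U.continuous).mp (h.mono fun _ h => h.U)⟩

theorem isEulerianImage_congr (hΘ : Θ.MemF) (hΘ' : Θ'.MemF) (h : ∀ᵐ ξ, Θ.EqAt Θ' ξ)
    (hD : IsEulerianImage Θ' D) : IsEulerianImage Θ D := by
  obtain ⟨hy, hU⟩ := hΘ.eq_of_ae_eqAt hΘ' h
  refine ⟨fun ξ => by rw [hy, hU, hD.u_eq], ?_, ?_⟩
  · rw [hD.μ_eq, hy]
    congr 1
    exact withDensity_congr_ae (h.mono fun ξ h => by simp only [h.hbar])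
  · rw [hD.ν_eq, hy]
    congr 1
    exact withDensity_congr_ae (h.mono fun ξ h => by simp only [h.h])

/-- Since y is onto, U determines u at every point, not only almost everywhere. -/
theorem eulerianImage_unique (hΘ : Θ.MemF) (h : IsEulerianImage Θ D) (h' : IsEulerianImage Θ D') :
    D = D' := by
  refine EulerianState.ext ?_ (h.μ_eq.trans h'.μ_eq.symm) (h.ν_eq.trans h'.ν_eq.symm)
  ext x
  obtain ⟨ξ, rfl⟩ := hΘ.surjective_y x
  rw [h.u_eq, h'.u_eq]

end LagrangianState.MemF

section explicit

variable {c₁ c₂ t₀ α t : ℝ}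

theorem memD_explicitSolution (h₁ : 0 < c₁) (h₂ : c₂ < 0) (hα₀ : 0 ≤ α) (hα : α < 1) (t : ℝ) :
    (explicitSolution c₁ c₂ t₀ α t).MemD := by
  refine ((breakingData h₁ h₂ hα₀ hα).memF (t - t₀)).memD
    (isEulerianImage_peakonFlow h₁ h₂ hα₀ hα t) ⟨deriv (uSol c₁ c₂ t₀ α t), ?_, ?_, ?_,
      if t = t₀ then ENNReal.ofReal (-4 * (1 - α) * c₁ * c₂) • Measure.dirac 0 else 0, ?_, rfl⟩
  · obtain ⟨P₁, P₂, Q₁, Q₂, h⟩ := uSol_eq_twoPeakon (c₁ := c₁) (c₂ := c₂) (t₀ := t₀) (α := α) t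
    simp only [explicitSolution, h]
    exact isWeakDeriv_twoPeakon
  · obtain ⟨P₁, P₂, Q₁, Q₂, h⟩ := uSol_eq_twoPeakon (c₁ := c₁) (c₂ := c₂) (t₀ := t₀) (α := α) t
    simp only [explicitSolution, h]
    exact memLp_twoPeakon
  · obtain ⟨P₁, P₂, Q₁, Q₂, h⟩ := uSol_eq_twoPeakon (c₁ := c₁) (c₂ := c₂) (t₀ := t₀) (α := α) t
    rw [h]
    exact memLp_deriv_twoPeakon
  · split_ifs
    · exact (mutuallySingular_dirac (0 : ℝ) (volume : Measure ℝ)).smul _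
    · exact Measure.MutuallySingular.zero_left

theorem qt₁_lt_qt₂ (h₁ : 0 < c₁) (h₂ : c₂ < 0) (hα : α < 1) (h : t₀ < t) :
    qt₁ (d₁ c₁ c₂ α) (d₂ c₁ c₂ α) t₀ t < qt₂ (d₁ c₁ c₂ α) (d₂ c₁ c₂ α) t₀ t := by
  rw [qt₁_eq (d₁_pos h₁ h₂ hα) (d₂_neg h₁ h₂ hα), qt₂_eq (d₁_pos h₁ h₂ hα) (d₂_neg h₁ h₂ hα)]
  exact strictMono_flowY (d₁_pos h₁ h₂ hα) (d₂_neg h₁ h₂ hα) (by linarith) two_pos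

theorem energy_before (h₁ : 0 < c₁) (h₂ : c₂ < 0) (h : t < t₀) :
    Integrable (fun x => uSol c₁ c₂ t₀ α t x ^ 2 + deriv (uSol c₁ c₂ t₀ α t) x ^ 2) volume ∧
      ∫ x, (uSol c₁ c₂ t₀ α t x ^ 2 + deriv (uSol c₁ c₂ t₀ α t) x ^ 2)
        = 2 * c₁ ^ 2 + 2 * c₂ ^ 2 := by
  rw [uSol_before h₁ h₂ h]
  exact ⟨integrable_twoPeakon_energy, integral_peakU_energy h₁ h₂ (by linarith)⟩

theorem energy_after (h₁ : 0 < c₁) (h₂ : c₂ < 0) (hα : α < 1) (h : t₀ < t) :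
    Integrable (fun x => uSol c₁ c₂ t₀ α t x ^ 2 + deriv (uSol c₁ c₂ t₀ α t) x ^ 2) volume ∧
      ∫ x, (uSol c₁ c₂ t₀ α t x ^ 2 + deriv (uSol c₁ c₂ t₀ α t) x ^ 2)
        = 2 * d₁ c₁ c₂ α ^ 2 + 2 * d₂ c₁ c₂ α ^ 2 := by
  rw [uSol_after h₁ h₂ hα h]
  exact ⟨integrable_twoPeakon_energy,
    integral_peakU_energy (d₁_pos h₁ h₂ hα) (d₂_neg h₁ h₂ hα) (by linarith)⟩

theorem energy_loss (h₁ : 0 < c₁) (h₂ : c₂ < 0) (hα : α < 1) :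
    2 * d₁ c₁ c₂ α ^ 2 + 2 * d₂ c₁ c₂ α ^ 2 = 2 * c₁ ^ 2 + 2 * c₂ ^ 2 + 4 * α * c₁ * c₂ := by
  have e1 := d₁_add_d₂ (c₁ := c₁) (c₂ := c₂) (α := α)
  have e2 := d₁_mul_d₂ h₁ h₂ hα
  linear_combination 2 * (d₁ c₁ c₂ α + d₂ c₁ c₂ α + (c₁ + c₂)) * e1 - 4 * e2

theorem slope_after (h₁ : 0 < c₁) (h₂ : c₂ < 0) (hα : α < 1) (h : t₀ < t) {x : ℝ}
    (hx₁ : x ≠ qt₁ (d₁ c₁ c₂ α) (d₂ c₁ c₂ α) t₀ t) (hx₂ : x ≠ qt₂ (d₁ c₁ c₂ α) (d₂ c₁ c₂ α) t₀ t) :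
    DifferentiableAt ℝ (uSol c₁ c₂ t₀ α t) x ∧
      deriv (uSol c₁ c₂ t₀ α t) x ^ 2 = twoPeakonSlopeSq
        (pt₁ (d₁ c₁ c₂ α) (d₂ c₁ c₂ α) t₀ t) (pt₂ (d₁ c₁ c₂ α) (d₂ c₁ c₂ α) t₀ t)
        (qt₁ (d₁ c₁ c₂ α) (d₂ c₁ c₂ α) t₀ t) (qt₂ (d₁ c₁ c₂ α) (d₂ c₁ c₂ α) t₀ t) x := by
  rw [uSol, if_neg h.not_gt, if_neg h.ne']
  exact ⟨(hasDerivAt_twoPeakon hx₁ hx₂).differentiableAt,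
    deriv_twoPeakon_sq (qt₁_lt_qt₂ h₁ h₂ hα h).le hx₁ hx₂⟩

/-- Pulled back by y, the density is the constant -2αc₁c₂ on [0, 2], so its integral is twice that.
-/
theorem nuMDensity_spec (h₁ : 0 < c₁) (h₂ : c₂ < 0) (hα₀ : 0 ≤ α) (hα : α < 1) (h : t₀ < t) :
    (∀ x ∈ midInterval c₁ c₂ t₀ α t, 0 ≤ nuMDensity c₁ c₂ α (d₁ c₁ c₂ α) (d₂ c₁ c₂ α) t₀ t x) ∧
      IntegrableOn (nuMDensity c₁ c₂ α (d₁ c₁ c₂ α) (d₂ c₁ c₂ α) t₀ t)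
        (midInterval c₁ c₂ t₀ α t) volume ∧
      ∫ x in midInterval c₁ c₂ t₀ α t, nuMDensity c₁ c₂ α (d₁ c₁ c₂ α) (d₂ c₁ c₂ α) t₀ t x
        = -4 * α * c₁ * c₂ := by
  have ha := d₁_pos h₁ h₂ hα
  have hb := d₂_neg h₁ h₂ hα
  have hT : t - t₀ ≠ 0 := by linarith
  have hr := isRelabeling_flowY ha hb hT
  have e : ∀ X ∈ Icc (0 : ℝ) 2, nuMDensity c₁ c₂ α (d₁ c₁ c₂ α) (d₂ c₁ c₂ α) t₀ t
      (flowY (d₁ c₁ c₂ α) (d₂ c₁ c₂ α) (t - t₀) X) * flowYξ (d₁ c₁ c₂ α) (d₂ c₁ c₂ α) (t - t₀) X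
      = -2 * α * (c₁ * c₂) := fun X hX => by
    rw [mul_comm]; exact flowYξ_mul_nuMDensity ha hb hα (d₁_mul_d₂ h₁ h₂ hα) h.ne' hX
  rw [midInterval_eq h₁ h₂ hα, ← image_flowY_Icc ha hb hT]
  refine ⟨fun x _ => ?_, ?_, ?_⟩
  · have : 0 ≤ 1 - α := by linarith
    unfold nuMDensity; positivity
  · rw [← hr.integrableOn_comp measurableSet_Icc, integrableOn_congr_fun e measurableSet_Icc]
    exact integrableOn_const (by simp)
  · rw [← hr.setIntegral_comp measurableSet_Icc, setIntegral_congr_fun measurableSet_Icc e,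
      setIntegral_const, Measure.real, Real.volume_Icc, smul_eq_mul,
      ENNReal.toReal_ofReal (by norm_num)]
    ring

end explicit

/-! #### Labels adapted to the initial data -/

theorem IsWeakDeriv.hasDerivAt {f g : ℝ → ℝ} (h : IsWeakDeriv f g) {x : ℝ} (hx : ContinuousAt g x) :
    HasDerivAt f (g x) x := by
  have h1 := intervalIntegral.integral_hasDerivAt_right (a := 0) (b := x)
    (h.intervalIntegrable 0 x) ⟨univ, univ_mem, by simpa using LocallyIntegrable.aestronglyMeasurable h.1⟩ hx
  refine (h1.const_add (f 0)).congr_of_eventuallyEq (Eventually.of_forall fun t => ?_)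
  simp only [← h.2]; ring

theorem continuousAt_pw {l m r : ℝ → ℝ} (hl : ContinuousOn l (Iio 0))
    (hm : ContinuousOn m (Ioo 0 2)) (hr : ContinuousOn r (Ioi 2)) {X : ℝ}
    (hX : X ∉ ({0, 2} : Set ℝ)) : ContinuousAt (pw l m r) X := by
  have h0 : X ≠ 0 := fun h => hX (by simp [h])
  have h2 : X ≠ 2 := fun h => hX (by simp [h])
  rcases lt_or_gt_of_ne h0 with h | h
  · refine (hl.continuousAt (Iio_mem_nhds h)).congr ?_
    filter_upwards [Iio_mem_nhds h] with x hx using (pw_left hx).symm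
  · rcases lt_or_gt_of_ne h2 with h' | h'
    · refine (hm.continuousAt (Ioo_mem_nhds h h')).congr ?_
      filter_upwards [Ioo_mem_nhds h h'] with x hx using (pw_mid ⟨hx.1.le, hx.2.le⟩).symm
    · refine (hr.continuousAt (Ioi_mem_nhds h')).congr ?_
      filter_upwards [Ioi_mem_nhds h'] with x hx using (pw_right hx).symm

theorem tendsto_setIntegral_Iic_atBot {h : ℝ → ℝ} (hh : Integrable h) :
    Tendsto (fun ξ => ∫ η in Iic ξ, h η) atBot (𝓝 0) := by
  have h1 := (intervalIntegral_tendsto_integral_Iic 0 hh.integrableOn tendsto_id).const_sub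
    (∫ η in Iic 0, h η)
  rw [sub_self] at h1
  refine h1.congr fun ξ => ?_
  rw [id, ← intervalIntegral.integral_Iic_sub_Iic hh.integrableOn hh.integrableOn]; ring

section labels

variable {a b T : ℝ}

theorem continuousAt_flowH (ha : 0 < a) (hb : b < 0) {X : ℝ} (hX : X ∉ ({0, 2} : Set ℝ)) :
    ContinuousAt (flowH a b T 0) X := by
  have c1 : Continuous fun r => outD a b T r := by unfold outD; fun_prop
  have c2 : Continuous fun r => outD a b (-T) r := by unfold outD; fun_prop
  refine continuousAt_pw ?_ ?_ ?_ hX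
  · exact ContinuousOn.div (by fun_prop) (by fun_prop)
      fun x hx => pow_ne_zero 3 (outD_pos ha hb (exp_mem_Icc_of_nonpos (le_of_lt hx))).ne'
  · refine ContinuousOn.add ?_ continuousOn_const
    exact ContinuousOn.comp (g := fun p : ℝ × ℝ => midH a b p.1 p.2) (f := fun X => (T, X))
      (continuousOn_midH ha hb) (by fun_prop) fun X hX => ⟨mem_univ _, hX.1.le, hX.2.le⟩
  · exact ContinuousOn.div (by fun_prop) (by fun_prop) fun x hx =>
      pow_ne_zero 3 (outD_pos ha hb (exp_mem_Icc_of_nonpos (sub_nonpos.mpr (le_of_lt hx)))).ne'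

/-- The map L chooses labels with y + ∫h equal to the identity; the inverse of this relabeling
produces them. Continuity of h off the two kinks makes the integral differentiable there. -/
theorem isRelabeling_flowY_add_flowH (ha : 0 < a) (hb : b < 0) (hT : T ≠ 0) :
    IsRelabeling (fun X => flowY a b T X + ∫ η in Iic X, flowH a b T 0 η)
      (fun X => flowYξ a b T X + flowH a b T 0 X) where
  cont := (continuous_flowY ha hb).add (isWeakDeriv_integral_Iic (integrable_flowH ha hb)).continuous
  exists_countable := ⟨{0, 2}, by simp, fun X hX => (hasDerivAt_flowY_label ha hb X hX).add
    ((isWeakDeriv_integral_Iic (integrable_flowH ha hb)).hasDerivAt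
      (continuousAt_flowH ha hb hX))⟩
  meas := measurable_flowYξ.add measurable_flowH
  bounds := by
    obtain ⟨c, hc, h⟩ := exists_lower_flowYξ_at ha hb hT
    obtain ⟨K, hK⟩ := (decayingFamily_flowYξ ha hb).bound T
    obtain ⟨K', hK'⟩ := (decayingFamily_flowH ha hb 0).bound T
    refine ⟨c, |K| + |K'| + 1, hc, fun X => ⟨?_, ?_⟩⟩
    · linarith [h X, flowH_nonneg (T := T) ha hb le_rfl X]
    · have h1 := (abs_le.mp (hK X)).2
      have h2 := (abs_le.mp (hK' X)).2
      nlinarith [le_abs_self K, abs_nonneg K, le_abs_self K', abs_nonneg K', weight_pos X,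
        weight_le_one X]
  bdd := by
    obtain ⟨K, hK⟩ := (uniformFamily_flowY ha hb).bound T
    refine ⟨K + ∫ η, flowH a b T 0 η, fun X => ?_⟩
    have h1 := setIntegral_le_integral (s := Iic X) (integrable_flowH (T := T) (k := 0) ha hb)
      (Eventually.of_forall (flowH_nonneg ha hb le_rfl))
    have h2 := setIntegral_nonneg (s := Iic X) (μ := volume) measurableSet_Iic
      fun η _ => flowH_nonneg (T := T) ha hb le_rfl η
    have h3 := abs_le.mp (hK X)
    rw [abs_le]
    constructor <;> linarith
  lim := by
    have := (tendsto_flowY_sub (a := a) (b := b) (T := T)).add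
      (tendsto_setIntegral_Iic_atBot (integrable_flowH (T := T) (k := 0) ha hb))
    rw [add_zero] at this
    exact this.congr fun X => by ring
  two := by
    have h1 := (decayingFamily_flowYξ ha hb).memLp (T := T)
      (measurable_flowYξ.sub_const 1).aestronglyMeasurable memLp_weight_two
    have h2 := memLp_flowH (T := T) (k := 0) ha hb memLp_weight_two
    convert h1.add h2 using 1
    ext X
    simp only [Pi.add_apply]; ring

/-- The labels for which the initial characteristic is the identity. -/
theorem exists_labels_id (ha : 0 < a) (hb : b < 0) (hT : T ≠ 0) :
    ∃ g g' : ℝ → ℝ, IsRelabeling g g' ∧ (∀ ξ, flowY a b T (g ξ) = ξ) ∧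
      ∀ ξ, flowYξ a b T (g ξ) * g' ξ = 1 := by
  have h := isRelabeling_flowY ha hb hT
  exact ⟨_, _, h.symm, fun ξ => h.homeo.apply_symm_apply ξ,
    fun ξ => mul_inv_cancel₀ (h.pos _).ne'⟩

/-- The labels for which `y + H` is initially the identity. -/
theorem exists_labels_lift (ha : 0 < a) (hb : b < 0) (hT : T ≠ 0) :
    ∃ g g' : ℝ → ℝ, IsRelabeling g g' ∧
      (∀ ξ, flowY a b T (g ξ) + ∫ η in Iic (g ξ), flowH a b T 0 η = ξ) ∧
      ∀ ξ, (flowYξ a b T (g ξ) + flowH a b T 0 (g ξ)) * g' ξ = 1 := by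
  have h := isRelabeling_flowY_add_flowH ha hb hT
  exact ⟨_, _, h.symm, fun ξ => h.homeo.apply_symm_apply ξ,
    fun ξ => mul_inv_cancel₀ (h.pos _).ne'⟩

end labels

/-! #### Identification of the initial Lagrangian states -/

namespace LagrangianState.MemF

variable {Θ Φ : LagrangianState}

/-- The functions y and U fix their derivatives, and y_ξ h̄ = U_ξ² fixes h̄ wherever y_ξ ≠ 0. The
component h is left to a hypothesis because it is found differently in the two applications: as 1 -
y_ξ for the lift, and as h̄ when y is the identity and μ = ν. -/
theorem ae_eqAt (hΘ : Θ.MemF) (hΦ : Φ.MemF) (hy : Θ.y = Φ.y) (hU : Θ.U = Φ.U)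
    (hpos : ∀ᵐ ξ, Φ.yξ ξ ≠ 0)
    (hh : ∀ᵐ ξ, Θ.yξ ξ = Φ.yξ ξ → Θ.hbar ξ = Φ.hbar ξ → Θ.h ξ = Φ.h ξ) :
    ∀ᵐ ξ, Θ.EqAt Φ ξ := by
  have h1 := IsWeakDeriv.ae_unique hΘ.deriv_y (hy ▸ hΦ.deriv_y)
  have h2 := IsWeakDeriv.ae_unique hΘ.deriv_U (hU ▸ hΦ.deriv_U)
  filter_upwards [h1, h2, hpos, hh, hΘ.energy_rel, hΦ.energy_rel] with ξ e1 e2 e3 e4 e5 e6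
  have e7 : Θ.hbar ξ = Φ.hbar ξ := by
    rw [e1, e2, ← e6] at e5
    exact mul_left_cancel₀ e3 e5
  exact ⟨congrFun hy ξ, congrFun hU ξ, e1, e2, e4 e1 e7, e7⟩

/-- When y is the identity the push-forward changes nothing, so equal measures have equal densities.
-/
theorem ae_h_eq_hbar (hΘ : Θ.MemF) (hy : ∀ ξ, Θ.y ξ = ξ) {D : EulerianState}
    (hD : IsEulerianImage Θ D) (h : D.μ = D.ν) : ∀ᵐ ξ, Θ.h ξ = Θ.hbar ξ := by
  rw [hD.μ_eq, hD.ν_eq, show Θ.y = id from funext hy, Measure.map_id, Measure.map_id] at h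
  have h1 := (withDensity_eq_iff_of_sigmaFinite hΘ.hbar_meas.aemeasurable.ennreal_ofReal
    hΘ.h_int.aemeasurable.ennreal_ofReal).mp h
  filter_upwards [h1, hΘ.hbar_nonneg, hΘ.h_nonneg] with ξ e1 e2 e3
  exact ((ENNReal.ofReal_eq_ofReal_iff e2 e3).mp e1).symm

end LagrangianState.MemF

theorem IsEulerianImage.U_eq {Θ Φ : LagrangianState} {D : EulerianState} (h : IsEulerianImage Θ D)
    (h' : IsEulerianImage Φ D) (hy : Θ.y = Φ.y) : Θ.U = Φ.U := by
  ext ξ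
  rw [← h.u_eq, ← h'.u_eq, hy]

section initial

variable {a b T : ℝ} {g g' : ℝ → ℝ}

/-- Write z = y(Z). Then ν((-∞, z)) is the integral of h up to Z, and the condition compares the
increasing function y + ∫h at Z and X. This evaluates the supremum in the definition of L. -/
theorem setOf_measure_Iio_add_lt (ha : 0 < a) (hb : b < 0) (hT : T ≠ 0) (X : ℝ) :
    {z : ℝ | (slopeSqMeasure (peakU a b T) (Iio z)).toReal + z
      < flowY a b T X + ∫ η in Iic X, flowH a b T 0 η} = Iio (flowY a b T X) := by
  have hφ := (isRelabeling_flowY_add_flowH ha hb hT).strictMono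
  have hy := strictMono_flowY ha hb hT
  ext z
  obtain ⟨Z, rfl⟩ := (isRelabeling_flowY ha hb hT).surjective z
  have h1 : (slopeSqMeasure (peakU a b T) (Iio (flowY a b T Z))).toReal
      = ∫ η in Iic Z, flowH a b T 0 η := by
    have h2 : flowY a b T ⁻¹' Iio (flowY a b T Z) = Iio Z := by
      ext W; exact hy.lt_iff_lt
    rw [← map_flowH_zero ha hb hT,
      Measure.map_apply (continuous_flowY ha hb).measurable measurableSet_Iio, h2,
      withDensity_apply _ measurableSet_Iio, integral_Iic_eq_integral_Iio,
      integral_eq_lintegral_of_nonneg_ae (Eventually.of_forall (flowH_nonneg ha hb le_rfl))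
        measurable_flowH.aestronglyMeasurable]
  rw [mem_ofPred_eq, h1, add_comm, mem_Iio, hy.lt_iff_lt]
  exact hφ.lt_iff_lt (a := Z) (b := X)

theorem isLagrangianLift_flowState (ha : 0 < a) (hb : b < 0) (hT : T ≠ 0) (hg : IsRelabeling g g')
    (h1 : ∀ ξ, flowY a b T (g ξ) + ∫ η in Iic (g ξ), flowH a b T 0 η = ξ)
    (h2 : ∀ ξ, (flowYξ a b T (g ξ) + flowH a b T 0 (g ξ)) * g' ξ = 1) :
    IsLagrangianLift ⟨peakU a b T, slopeSqMeasure (peakU a b T), slopeSqMeasure (peakU a b T)⟩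
      ((flowState a b T 0).relabel g g') := by
  have hF := hg.memF (memF_flowState (T := T) (k := 0) ha hb le_rfl)
  refine ⟨fun ξ => ?_, hF.deriv_y, Eventually.of_forall fun ξ => ?_, fun ξ => ?_, hF.deriv_U,
    fun _ => 1, measurable_const, fun _ => ⟨zero_le_one, le_rfl⟩, ?_, Eventually.of_forall fun ξ => ?_⟩
  · have h3 := setOf_measure_Iio_add_lt ha hb hT (g ξ)
    rw [h1] at h3
    exact (h3 ▸ csSup_Iio).symm
  · have := h2 ξ
    simp only [LagrangianState.relabel, flowState]
    linarith
  · exact (peakU_flowY ha hb hT (g ξ)).symm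
  · simp only [ENNReal.ofReal_one]
    exact withDensity_one.symm
  · simp only [LagrangianState.relabel, flowState, one_mul]

theorem IsLagrangianLift.ae_eqAt {D : EulerianState} {Θ Φ : LagrangianState} (hΘ : Θ.MemF)
    (hΦ : Φ.MemF) (h : IsLagrangianLift D Θ) (h' : IsLagrangianLift D Φ)
    (hpos : ∀ᵐ ξ, Φ.yξ ξ ≠ 0) : ∀ᵐ ξ, Θ.EqAt Φ ξ := by
  have hy : Θ.y = Φ.y := funext fun ξ => by rw [h.y_eq, h'.y_eq]
  refine hΘ.ae_eqAt hΦ hy (funext fun ξ => by rw [h.U_eq, h'.U_eq, hy]) hpos ?_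
  filter_upwards [h.h_eq, h'.h_eq] with ξ e1 e2 e3 _
  rw [e1, e2, e3]

end initial

/-! #### The Eulerian solution -/

section eulerian

variable {c₁ c₂ t₀ α : ℝ} {g g' : ℝ → ℝ}

/-- The two-peakon flow started at time `0`, which breaks at time `t₀`. -/
def peakonSolution (c₁ c₂ t₀ α : ℝ) (g g' : ℝ → ℝ) (t : ℝ) : LagrangianState :=
  (peakonFlow α c₁ c₂ (d₁ c₁ c₂ α) (d₂ c₁ c₂ α) (t - t₀)).relabel g g'

theorem isAlphaDissipativeLagrangian_peakonSolution (h₁ : 0 < c₁) (h₂ : c₂ < 0) (hα₀ : 0 ≤ α)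
    (hα : α < 1) (hg : IsRelabeling g g') :
    IsAlphaDissipativeLagrangian α (peakonSolution c₁ c₂ t₀ α g g') :=
  ((breakingData h₁ h₂ hα₀ hα).isAlphaDissipativeLagrangian t₀).relabel hg

theorem isEulerianImage_peakonSolution (h₁ : 0 < c₁) (h₂ : c₂ < 0) (hα₀ : 0 ≤ α)
    (hα : α < 1) (hg : IsRelabeling g g') (t : ℝ) :
    IsEulerianImage (peakonSolution c₁ c₂ t₀ α g g' t) (explicitSolution c₁ c₂ t₀ α t) :=
  hg.isEulerianImage ((breakingData h₁ h₂ hα₀ hα).memF _).deriv_y.continuous.measurable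
    (isEulerianImage_peakonFlow h₁ h₂ hα₀ hα t)

theorem peakonSolution_zero (ht₀ : 0 < t₀) :
    peakonSolution c₁ c₂ t₀ α g g' 0 = (flowState c₁ c₂ (0 - t₀) 0).relabel g g' := by
  rw [peakonSolution, peakonFlow_neg (by linarith)]

theorem peakonSolution_zero_yξ_ne (h₁ : 0 < c₁) (h₂ : c₂ < 0) (ht₀ : 0 < t₀)
    (hg : IsRelabeling g g') (ξ : ℝ) : (peakonSolution c₁ c₂ t₀ α g g' 0).yξ ξ ≠ 0 := by
  rw [peakonSolution_zero ht₀]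
  exact (mul_pos (flowYξ_pos h₁ h₂ (by linarith) _) (hg.pos ξ)).ne'

/-- The initial triple determines Θ(0) through L, Lagrangian uniqueness determines Θ(t) for a.e.
label, and the image determines the triple. Conversely, the relabeled flow is a solution with the
required lift. -/
theorem isAlphaDissipativeSolution_iff (h₁ : 0 < c₁) (h₂ : c₂ < 0) (ht₀ : 0 < t₀) (hα₀ : 0 ≤ α)
    (hα : α < 1) (D : ℝ → EulerianState) :
    (IsAlphaDissipativeSolution α D ∧ D 0 = initialData c₁ c₂ t₀) ↔
      ∀ t, 0 ≤ t → D t = explicitSolution c₁ c₂ t₀ α t := by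
  have hT : (0 : ℝ) - t₀ ≠ 0 := by linarith
  obtain ⟨g, g', hg, hg₁, hg₂⟩ := exists_labels_lift h₁ h₂ hT
  have HΦ := isAlphaDissipativeLagrangian_peakonSolution (t₀ := t₀) h₁ h₂ hα₀ hα hg
  have hlift : IsLagrangianLift (initialData c₁ c₂ t₀) (peakonSolution c₁ c₂ t₀ α g g' 0) := by
    rw [initialData_eq h₁ h₂, peakonSolution_zero ht₀]
    exact isLagrangianLift_flowState h₁ h₂ hT hg hg₁ hg₂
  constructor
  · rintro ⟨⟨Θ, H, hL, hD⟩, h0⟩ t ht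
    rw [h0] at hL
    have h := (breakingData h₁ h₂ hα₀ hα).eqAt ht₀ hg H
      (hL.ae_eqAt (H.memF 0 le_rfl) (HΦ.memF 0 le_rfl) hlift
        (Eventually.of_forall (peakonSolution_zero_yξ_ne h₁ h₂ ht₀ hg)))
    exact (H.memF t ht).eulerianImage_unique (hD t ht).2
      ((H.memF t ht).isEulerianImage_congr (HΦ.memF t ht) (h.mono fun ξ hξ => hξ t ht)
        (isEulerianImage_peakonSolution h₁ h₂ hα₀ hα hg t))
  · intro hD
    have h0 : D 0 = initialData c₁ c₂ t₀ := by
      rw [hD 0 le_rfl, explicitSolution_zero h₁ h₂ ht₀]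
    refine ⟨⟨_, HΦ, h0 ▸ hlift, fun t ht => ?_⟩, h0⟩
    rw [hD t ht]
    exact ⟨memD_explicitSolution h₁ h₂ hα₀ hα t,
      isEulerianImage_peakonSolution h₁ h₂ hα₀ hα hg t⟩

end eulerian

/-! #### The Lagrangian solution with initial characteristic `y(0, ξ) = ξ` -/

section identity

variable {c₁ c₂ t₀ α : ℝ} {g g' : ℝ → ℝ} {Θ : ℝ → LagrangianState}

theorem ae_eqAt_peakonSolution (h₁ : 0 < c₁) (h₂ : c₂ < 0) (ht₀ : 0 < t₀) (hα₀ : 0 ≤ α)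
    (hα : α < 1) (hg : IsRelabeling g g') (hg₁ : ∀ ξ, flowY c₁ c₂ (0 - t₀) (g ξ) = ξ)
    (H : IsAlphaDissipativeLagrangian α Θ) (hy : ∀ ξ, (Θ 0).y ξ = ξ)
    (hD : IsEulerianImage (Θ 0) (initialData c₁ c₂ t₀)) :
    ∀ᵐ ξ, ∀ t, 0 ≤ t → (Θ t).EqAt (peakonSolution c₁ c₂ t₀ α g g' t) ξ := by
  have HΦ := isAlphaDissipativeLagrangian_peakonSolution (t₀ := t₀) h₁ h₂ hα₀ hα hg
  have hI := isEulerianImage_peakonSolution (t₀ := t₀) h₁ h₂ hα₀ hα hg 0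
  rw [explicitSolution_zero h₁ h₂ ht₀] at hI
  have hy' : (Θ 0).y = (peakonSolution c₁ c₂ t₀ α g g' 0).y := by
    ext ξ
    rw [hy, peakonSolution_zero ht₀]
    exact (hg₁ ξ).symm
  refine (breakingData h₁ h₂ hα₀ hα).eqAt ht₀ hg H
    ((H.memF 0 le_rfl).ae_eqAt (HΦ.memF 0 le_rfl) hy' (hD.U_eq hI hy')
      (Eventually.of_forall (peakonSolution_zero_yξ_ne h₁ h₂ ht₀ hg)) ?_)
  filter_upwards [(H.memF 0 le_rfl).ae_h_eq_hbar hy hD rfl] with ξ e1 _ e2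
  change _ = (peakonSolution c₁ c₂ t₀ α g g' 0).h ξ
  change _ = (peakonSolution c₁ c₂ t₀ α g g' 0).hbar ξ at e2
  rw [e1, e2, peakonSolution_zero ht₀]
  rfl

theorem exists_identity_solution (h₁ : 0 < c₁) (h₂ : c₂ < 0) (ht₀ : 0 < t₀) (hα₀ : 0 ≤ α)
    (hα : α < 1) : ∃ Θ : ℝ → LagrangianState, IsAlphaDissipativeLagrangian α Θ ∧
      (∀ ξ, (Θ 0).y ξ = ξ) ∧ IsEulerianImage (Θ 0) (initialData c₁ c₂ t₀) := by
  obtain ⟨g, g', hg, hg₁, -⟩ := exists_labels_id h₁ h₂ (T := 0 - t₀) (by linarith)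
  refine ⟨_, isAlphaDissipativeLagrangian_peakonSolution (t₀ := t₀) h₁ h₂ hα₀ hα hg, fun ξ => ?_,
    ?_⟩
  · rw [peakonSolution_zero ht₀]
    exact hg₁ ξ
  · rw [← explicitSolution_zero (α := α) h₁ h₂ ht₀]
    exact isEulerianImage_peakonSolution h₁ h₂ hα₀ hα hg 0

theorem label_mem_Icc_iff (h₁ : 0 < c₁) (h₂ : c₂ < 0) (ht₀ : 0 < t₀)
    (hg₁ : ∀ ξ, flowY c₁ c₂ (0 - t₀) (g ξ) = ξ) (ξ : ℝ) :
    g ξ ∈ Icc (0 : ℝ) 2 ↔ ξ ∈ Icc (q₁ c₁ c₂ t₀ 0) (q₂ c₁ c₂ t₀ 0) := by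
  rw [q₁_eq h₁ h₂, q₂_eq h₁ h₂, ← flowY_mem_Icc_iff h₁ h₂ (T := 0 - t₀) (by linarith), hg₁]

theorem flowYξ_eq_zero_iff {a b T : ℝ} (ha : 0 < a) (hb : b < 0) {X : ℝ} :
    flowYξ a b T X = 0 ↔ T = 0 ∧ X ∈ Icc (0 : ℝ) 2 := by
  rcases eq_or_ne T 0 with rfl | hT
  · rw [flowYξ_zero_time (by linarith)]
    rcases label_cases X with h | h | h
    · rw [pw_left h]; simp [h.not_ge]
    · rw [pw_mid h]; simpa using h
    · rw [pw_right h]; simp [h.not_ge]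
  · simp [hT, (flowYξ_pos ha hb hT X).ne']

theorem flowY_zero_time_eq_zero_iff {a b : ℝ} (ha : 0 < a) (hb : b < 0) {X : ℝ} :
    flowY a b 0 X = 0 ↔ X ∈ Icc (0 : ℝ) 2 := by
  rw [flowY_zero_time (by linarith)]
  rcases label_cases X with h | h | h
  · rw [pw_left h]; simp [h.not_ge, h.ne]
  · rw [pw_mid h]; simpa using h
  · rw [pw_right h]; simp [h.not_ge, (sub_pos.mpr h).ne']

theorem peakonSolution_yξ_eq_zero_iff (h₁ : 0 < c₁) (h₂ : c₂ < 0) (hα : α < 1)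
    (hg : IsRelabeling g g') {t ξ : ℝ} :
    (peakonSolution c₁ c₂ t₀ α g g' t).yξ ξ = 0 ↔ t = t₀ ∧ g ξ ∈ Icc (0 : ℝ) 2 := by
  rw [← sub_eq_zero (b := t₀)]
  rcases lt_or_ge (t - t₀) 0 with h | h
  · rw [peakonSolution, peakonFlow_neg h, ← flowYξ_eq_zero_iff h₁ h₂]
    exact mul_eq_zero_iff_right (hg.pos ξ).ne'
  · rw [peakonSolution, peakonFlow_nonneg h,
      ← flowYξ_eq_zero_iff (d₁_pos h₁ h₂ hα) (d₂_neg h₁ h₂ hα)]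
    exact mul_eq_zero_iff_right (hg.pos ξ).ne'

theorem identity_solution_spec (h₁ : 0 < c₁) (h₂ : c₂ < 0) (ht₀ : 0 < t₀) (hα₀ : 0 ≤ α)
    (hα : α < 1) (hg : IsRelabeling g g') (hg₁ : ∀ ξ, flowY c₁ c₂ (0 - t₀) (g ξ) = ξ)
    (H : IsAlphaDissipativeLagrangian α Θ)
    (h : ∀ᵐ ξ, ∀ t, 0 ≤ t → (Θ t).EqAt (peakonSolution c₁ c₂ t₀ α g g' t) ξ) :
    (∀ t, 0 ≤ t → IsEulerianImage (Θ t) (explicitSolution c₁ c₂ t₀ α t)) ∧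
    (∀ᵐ ξ, ∀ t, 0 ≤ t →
      ((Θ t).yξ ξ = 0 ↔ t = t₀ ∧ ξ ∈ Set.Icc (q₁ c₁ c₂ t₀ 0) (q₂ c₁ c₂ t₀ 0))) ∧
    (∀ ξ, (Θ t₀).y ξ = 0 ↔ ξ ∈ Set.Icc (q₁ c₁ c₂ t₀ 0) (q₂ c₁ c₂ t₀ 0)) ∧
    (fun ξ => (Θ t₀).y ξ + ∫ η in Set.Iic ξ, (Θ t₀).hbar η) ∈ relabelingGroup := by
  have HΦ := isAlphaDissipativeLagrangian_peakonSolution (t₀ := t₀) h₁ h₂ hα₀ hα hg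
  have ha := d₁_pos h₁ h₂ hα
  have hb := d₂_neg h₁ h₂ hα
  have hF := H.memF t₀ ht₀.le
  have hF' := HΦ.memF t₀ ht₀.le
  have heq : ∀ᵐ ξ, (Θ t₀).EqAt (peakonSolution c₁ c₂ t₀ α g g' t₀) ξ :=
    h.mono fun ξ hξ => hξ t₀ ht₀.le
  have hs : peakonSolution c₁ c₂ t₀ α g g' t₀
      = (flowState (d₁ c₁ c₂ α) (d₂ c₁ c₂ α) 0 (-2 * α * (c₁ * c₂))).relabel g g' := by
    rw [peakonSolution, sub_self, peakonFlow_nonneg le_rfl]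
  refine ⟨fun t ht => (H.memF t ht).isEulerianImage_congr (HΦ.memF t ht)
      (h.mono fun ξ hξ => hξ t ht) (isEulerianImage_peakonSolution h₁ h₂ hα₀ hα hg t), ?_, ?_, ?_⟩
  · filter_upwards [h] with ξ hξ t ht
    rw [(hξ t ht).yξ, peakonSolution_yξ_eq_zero_iff h₁ h₂ hα hg,
      label_mem_Icc_iff h₁ h₂ ht₀ hg₁]
  · intro ξ
    rw [(hF.eq_of_ae_eqAt hF' heq).1, hs, ← label_mem_Icc_iff h₁ h₂ ht₀ hg₁,
      ← flowY_zero_time_eq_zero_iff ha hb]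
    rfl
  · have hbd : ∀ᵐ ξ, ‖(Θ t₀).hbar ξ‖ ≤ ‖(Θ t₀).h ξ‖ := by
      filter_upwards [hF.hbar_nonneg, hF.hbar_le] with ξ e1 e2
      rw [Real.norm_eq_abs, Real.norm_eq_abs, abs_of_nonneg e1, abs_of_nonneg (e1.trans e2)]
      exact e2
    refine add_integral_mem_relabelingGroup hF.deriv_y hF.ζ_bdd hF.ζξ_two hF.ζξ_bdd
      hF.integrable_hbar (hF.h_two.mono hF.hbar_meas hbd) (hF.h_bdd.mono hF.hbar_meas hbd)
      hF.hbar_nonneg ?_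
    -- The lower bound of the flow is in terms of h̄ after the loss, which is why the claim holds
    -- with h̄ instead of h.
    obtain ⟨c, hc, hlow⟩ := exists_lower_flow (T := 0) ha hb
    obtain ⟨m, _, hm, hb'⟩ := hg.bounds
    refine ⟨c * m, mul_pos hc hm, heq.mono fun ξ hξ => ?_⟩
    rw [hξ.yξ, hξ.hbar, hs]
    simp only [LagrangianState.relabel, flowState, ← add_mul]
    refine mul_le_mul ?_ (hb' ξ).1 hm.le
      (add_nonneg (flowYξ_nonneg ha hb _) (flowH_nonneg ha hb le_rfl _))
    by_cases hX : g ξ ∈ Icc (0 : ℝ) 2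
    · linarith [(hlow (g ξ)).2 hX, flowYξ_nonneg (T := 0) ha hb (g ξ)]
    · linarith [(hlow (g ξ)).1 hX, flowH_nonneg (T := 0) ha hb le_rfl (g ξ)]

end identity

/-! #### The explicit formulas after breaking -/

/-! ### Outer regions: from the labels X to ξ = y(0). -/

section outerFormulas

variable {c₁ c₂ t₀ a b t ξ r : ℝ}

/-- In the left region ξ = X - log D at the initial time, so e^ξ = r/D with r = e^X. Under this
substitution the denominator becomes the quotient of `outD` for the new and the old parameters. -/
theorem denL_eq (hc : c₁ - c₂ ≠ 0) (hab : a - b ≠ 0) (hD : outD c₁ c₂ t₀ r ≠ 0)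
    (h : Real.exp ξ = r / outD c₁ c₂ t₀ r) : denL c₁ c₂ t₀ a b t ξ
      = (c₁ - c₂) * (a - b) * outD a b (-(t - t₀)) r / outD c₁ c₂ t₀ r := by
  rw [denL, h, eq_div_iff hD]
  have e1 : -a * (t - t₀) = a * -(t - t₀) := by ring
  have e2 : -b * (t - t₀) = b * -(t - t₀) := by ring
  have e3 : (-c₁ * Real.exp (c₁ * t₀) + c₂ * Real.exp (c₂ * t₀))
      = -(c₁ - c₂) * (outM c₁ c₂ t₀ + 1) := by
    rw [outM]; field_simp; ring
  have e4 : a * Real.exp (a * -(t - t₀)) - b * Real.exp (b * -(t - t₀))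
      = (a - b) * (outM a b (-(t - t₀)) + 1) := by
    rw [outM]; field_simp; ring
  rw [e1, e2, e3, e4]
  unfold outD at hD ⊢
  field_simp
  ring

theorem denR_eq (hc : c₁ - c₂ ≠ 0) (hab : a - b ≠ 0) (hD : outD c₁ c₂ (-t₀) r ≠ 0)
    (h : Real.exp (-ξ) = r / outD c₁ c₂ (-t₀) r) : denR c₁ c₂ t₀ a b t ξ
      = (c₁ - c₂) * (a - b) * outD a b (t - t₀) r / outD c₁ c₂ (-t₀) r := by
  rw [denR, h, eq_div_iff hD]
  have e1 : -c₁ * t₀ = c₁ * -t₀ := by ring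
  have e2 : -c₂ * t₀ = c₂ * -t₀ := by ring
  have e3 : (-c₁ * Real.exp (c₁ * -t₀) + c₂ * Real.exp (c₂ * -t₀))
      = -(c₁ - c₂) * (outM c₁ c₂ (-t₀) + 1) := by
    rw [outM]; field_simp; ring
  have e4 : a * Real.exp (a * (t - t₀)) - b * Real.exp (b * (t - t₀))
      = (a - b) * (outM a b (t - t₀) + 1) := by
    rw [outM]; field_simp; ring
  rw [e1, e2, e3, e4]
  unfold outD at hD ⊢
  field_simp
  ring

theorem left_formulas (hc : 0 < c₁ - c₂) (hab : 0 < a - b) (hD : 0 < outD c₁ c₂ t₀ r)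
    (hD' : 0 < outD a b (-(t - t₀)) r) (h : Real.exp ξ = r / outD c₁ c₂ t₀ r) :
    yL c₁ c₂ t₀ a b t ξ
      = ξ + Real.log (outD c₁ c₂ t₀ r) - Real.log (outD a b (-(t - t₀)) r) ∧
    UL c₁ c₂ t₀ a b t ξ = outU a b (-(t - t₀)) r ∧
    yξL c₁ c₂ t₀ a b t ξ = (outD a b (-(t - t₀)) r)⁻¹ * outD c₁ c₂ t₀ r ∧
    hbarL c₁ c₂ t₀ a b t ξ = outH a b (-(t - t₀)) r * outD c₁ c₂ t₀ r := by
  have e1 : -a * (t - t₀) = a * -(t - t₀) := by ring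
  have e2 : -b * (t - t₀) = b * -(t - t₀) := by ring
  have e4 : a ^ 2 * Real.exp (a * -(t - t₀)) - b ^ 2 * Real.exp (b * -(t - t₀))
      = (a - b) * outK a b (-(t - t₀)) := by
    rw [outK]; field_simp
  have e5 : Real.exp (2 * ξ) = Real.exp ξ ^ 2 := by rw [← Real.exp_nat_mul]; norm_num
  have h1 := denL_eq (t := t) hc.ne' hab.ne' hD.ne' h
  refine ⟨?_, ?_, ?_, ?_⟩
  · rw [yL, h1, Real.log_div (by positivity) hD.ne', Real.log_mul (by positivity) hD'.ne']
    ring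
  · rw [UL, h1, e1, e2, e4, h, outU]
    field_simp
  · rw [yξL, h1]
    field_simp
  · rw [hbarL, h1, e1, e2, e4, e5, h, outH]
    field_simp

theorem right_formulas (hc : 0 < c₁ - c₂) (hab : 0 < a - b) (hD : 0 < outD c₁ c₂ (-t₀) r)
    (hD' : 0 < outD a b (t - t₀) r) (h : Real.exp (-ξ) = r / outD c₁ c₂ (-t₀) r) :
    yR c₁ c₂ t₀ a b t ξ
      = ξ - Real.log (outD c₁ c₂ (-t₀) r) + Real.log (outD a b (t - t₀) r) ∧
    UR c₁ c₂ t₀ a b t ξ = outU a b (t - t₀) r ∧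
    yξR c₁ c₂ t₀ a b t ξ = (outD a b (t - t₀) r)⁻¹ * outD c₁ c₂ (-t₀) r ∧
    hbarR c₁ c₂ t₀ a b t ξ = outH a b (t - t₀) r * outD c₁ c₂ (-t₀) r := by
  have e4 : a ^ 2 * Real.exp (a * (t - t₀)) - b ^ 2 * Real.exp (b * (t - t₀))
      = (a - b) * outK a b (t - t₀) := by
    rw [outK]; field_simp
  have e5 : Real.exp (-2 * ξ) = Real.exp (-ξ) ^ 2 := by
    rw [← Real.exp_nat_mul]; congr 1; push_cast; ring
  have h1 := denR_eq (t := t) hc.ne' hab.ne' hD.ne' h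
  refine ⟨?_, ?_, ?_, ?_⟩
  · rw [yR, h1, Real.log_div (by positivity) hD.ne', Real.log_mul (by positivity) hD'.ne']
    ring
  · rw [UR, h1, e4, h, outU]
    field_simp
  · rw [yξR, h1]
    field_simp
  · rw [hbarR, h1, e4, e5, h, outH]
    field_simp

end outerFormulas

/-! ### Middle region: S as the shifted label. -/

section midFormulas

variable {c₁ c₂ t₀ a b t ξ X : ℝ}

/-- By e^x > 1 + x for both exponentials; the terms linear in t₀ cancel. It shows that the first
factor in the denominator of S is not zero. -/
theorem slope_gap_pos (h₁ : 0 < c₁) (h₂ : c₂ < 0) (ht₀ : 0 < t₀) :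
    0 < c₁ * Real.exp (c₂ * -t₀) - c₂ * Real.exp (c₁ * -t₀) - (c₁ - c₂) := by
  have e1 := Real.add_one_lt_exp (x := c₂ * -t₀) (by nlinarith)
  have e2 := Real.add_one_lt_exp (x := c₁ * -t₀) (by nlinarith)
  nlinarith

/-- The initial map from X to e^ξ is the fractional linear map `midN / midA`. Expressed in X, a
function affine in e^ξ has the denominator `midA`, and for LC + D the numerator is constant. -/
theorem Cfun_Dfun_eq (h : Real.exp ξ = midN c₁ c₂ (-t₀) X / midA c₁ c₂ (-t₀) X)
    (hA : midA c₁ c₂ (-t₀) X ≠ 0) :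
    (c₁ - c₂) * Cfun c₁ c₂ t₀ ξ + Dfun c₁ c₂ t₀ ξ = 2 * (c₁ - c₂) * (c₁ * c₂)
      * (Real.exp (c₁ * -t₀) - Real.exp (c₂ * -t₀)) ^ 2
      / (Real.exp (c₂ * -t₀) * midA c₁ c₂ (-t₀) X) := by
  have e1 : Real.exp (-(c₁ - c₂) * t₀) = Real.exp (c₁ * -t₀) / Real.exp (c₂ * -t₀) := by
    rw [← Real.exp_sub]; congr 1; ring
  have e2 : Real.exp (ξ + c₂ * t₀) = Real.exp ξ / Real.exp (c₂ * -t₀) := by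
    rw [← Real.exp_sub]; congr 1; ring
  have e3 : Real.exp (ξ - (c₁ - c₂) * t₀)
      = Real.exp ξ * Real.exp (c₁ * -t₀) / Real.exp (c₂ * -t₀) := by
    rw [← Real.exp_add, ← Real.exp_sub]; congr 1; ring
  have e4 : Real.exp (-c₁ * t₀) = Real.exp (c₁ * -t₀) := by congr 1; ring
  have hf := (Real.exp_pos (c₂ * -t₀)).ne'
  rw [Cfun, Dfun, e1, e2, e3, e4, h]
  unfold midN midA at *
  generalize Real.exp (c₁ * -t₀) = e at *
  generalize Real.exp (c₂ * -t₀) = f at *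
  generalize hA' : (c₁ - c₂) * X + (c₁ * f - c₂ * e) * (2 - X) = A at *
  field_simp
  rw [← hA']
  ring

/-- S inverts the initial characteristic: it is the normalised label, centred at 0, as a function of
ξ. Hence S + 1 and S - 1 in the formulas stand for X and X - 2. -/
theorem Sfun_eq (h₁ : 0 < c₁) (h₂ : c₂ < 0) (ht₀ : 0 < t₀)
    (h : Real.exp ξ = midN c₁ c₂ (-t₀) X / midA c₁ c₂ (-t₀) X)
    (hA : midA c₁ c₂ (-t₀) X ≠ 0) : Sfun c₁ c₂ t₀ ξ = X - 1 := by
  have e1 : Real.exp (-(c₁ - c₂) * t₀) = Real.exp (c₁ * -t₀) / Real.exp (c₂ * -t₀) := by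
    rw [← Real.exp_sub]; congr 1; ring
  have e2 : Real.exp (c₂ * t₀) = 1 / Real.exp (c₂ * -t₀) := by
    rw [one_div, ← Real.exp_neg]; congr 1; ring
  have hf := (Real.exp_pos (c₂ * -t₀)).ne'
  have hgap := (slope_gap_pos h₁ h₂ ht₀).ne'
  have hef : Real.exp (c₁ * -t₀) - Real.exp (c₂ * -t₀) ≠ 0 :=
    sub_ne_zero.mpr fun h => by have := Real.exp_injective h; nlinarith
  have hL : c₁ - c₂ ≠ 0 := by linarith
  have h₁' := h₁.ne'
  have h₂' := h₂.ne
  rw [Sfun, Cfun_Dfun_eq h hA, e1, e2]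
  unfold midA at *
  generalize Real.exp (c₁ * -t₀) = e at *
  generalize Real.exp (c₂ * -t₀) = f at *
  have hden : -c₁ + c₂ * (e / f) + (c₁ - c₂) * (1 / f) ≠ 0 := by
    have : -c₁ + c₂ * (e / f) + (c₁ - c₂) * (1 / f) = -(c₁ * f - c₂ * e - (c₁ - c₂)) / f := by
      field_simp; ring
    rw [this]
    exact div_ne_zero (neg_ne_zero.mpr hgap) hf
  generalize hA' : (c₁ - c₂) * X + (c₁ * f - c₂ * e) * (2 - X) = A at *
  rw [div_eq_iff (mul_ne_zero hden (by positivity))]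
  field_simp
  rw [← hA']
  ring

/-- The derivative of the inverse function: ξ ↦ X inverts y at T = -t₀, whose slope is `midY`. -/
theorem dSfun_eq (h₁ : 0 < c₁) (h₂ : c₂ < 0) (ht₀ : 0 < t₀)
    (h : Real.exp ξ = midN c₁ c₂ (-t₀) X / midA c₁ c₂ (-t₀) X)
    (hA : midA c₁ c₂ (-t₀) X ≠ 0) : dSfun c₁ c₂ t₀ ξ = (midY c₁ c₂ (-t₀) X)⁻¹ := by
  have e1 : Real.exp (-(c₁ - c₂) * t₀) = Real.exp (c₁ * -t₀) / Real.exp (c₂ * -t₀) := by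
    rw [← Real.exp_sub]; congr 1; ring
  have hf := (Real.exp_pos (c₂ * -t₀)).ne'
  have hef : Real.exp (c₁ * -t₀) - Real.exp (c₂ * -t₀) ≠ 0 :=
    sub_ne_zero.mpr fun h => by have := Real.exp_injective h; nlinarith
  have hL : c₁ - c₂ ≠ 0 := by linarith
  have h₁' := h₁.ne'
  have h₂' := h₂.ne
  rw [dSfun, Cfun_Dfun_eq h hA, e1, h, midY]
  generalize Real.exp (c₁ * -t₀) = e at *
  generalize Real.exp (c₂ * -t₀) = f at *
  generalize midA c₁ c₂ (-t₀) X = A at *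
  generalize midN c₁ c₂ (-t₀) X = N at *
  field_simp
  ring

theorem denM₁_eq (h : Sfun c₁ c₂ t₀ ξ = X - 1) :
    denM₁ c₁ c₂ t₀ a b t ξ = midA a b (t - t₀) X := by
  rw [denM₁, h, midA]; ring

theorem exp_neg_gap_mul : Real.exp (-(a - b) * (t - t₀))
    = Real.exp (b * (t - t₀)) / Real.exp (a * (t - t₀)) := by
  rw [← Real.exp_sub]; congr 1; ring

theorem denM₂_eq (h : Sfun c₁ c₂ t₀ ξ = X - 1) :
    denM₂ c₁ c₂ t₀ a b t ξ = midN a b (t - t₀) X / Real.exp (a * (t - t₀)) := by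
  rw [denM₂, h, midN, exp_neg_gap_mul]
  have := Real.exp_pos (a * (t - t₀))
  generalize Real.exp (a * (t - t₀)) = E at *
  generalize Real.exp (b * (t - t₀)) = F at *
  field_simp
  ring

theorem yM_eq (ha : 0 < a) (hb : b < 0) (hX : X ∈ Icc (0 : ℝ) 2) (h : Sfun c₁ c₂ t₀ ξ = X - 1) :
    yM c₁ c₂ t₀ a b t ξ
      = Real.log (midN a b (t - t₀) X) - Real.log (midA a b (t - t₀) X) := by
  rw [← Real.log_div (midN_pos ha hb hX).ne' (midA_pos ha hb hX).ne', yM, denM₁_eq h]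
  congr 1
  have e1 : (a - b) * Real.exp (b * (t - t₀)) * (Sfun c₁ c₂ t₀ ξ - 1)
      + (-a + b * Real.exp (-(a - b) * (t - t₀))) * (Sfun c₁ c₂ t₀ ξ + 1)
        = -denM₂ c₁ c₂ t₀ a b t ξ := by rw [denM₂]; ring
  rw [e1, denM₂_eq h]
  have := Real.exp_pos (a * (t - t₀))
  generalize Real.exp (a * (t - t₀)) = E at *
  field_simp

theorem yξM_eq (h : Sfun c₁ c₂ t₀ ξ = X - 1) :
    yξM c₁ c₂ t₀ a b t ξ = midY a b (t - t₀) X * dSfun c₁ c₂ t₀ ξ := by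
  rw [yξM, denM₁_eq h, denM₂_eq h, midY, exp_neg_gap_mul]
  have := Real.exp_pos (a * (t - t₀))
  generalize Real.exp (a * (t - t₀)) = E at *
  generalize Real.exp (b * (t - t₀)) = F at *
  field_simp

theorem UM_eq (ha : 0 < a) (hb : b < 0) (hX : X ∈ Icc (0 : ℝ) 2) (h : Sfun c₁ c₂ t₀ ξ = X - 1) :
    UM c₁ c₂ t₀ a b t ξ = midU a b (t - t₀) X := by
  have hN := (midN_pos (T := t - t₀) ha hb hX).ne'
  have hA := (midA_pos (T := t - t₀) ha hb hX).ne'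
  rw [UM, denM₁_eq h, denM₂_eq h, midU, h, exp_neg_gap_mul, midNt, midAt]
  have := Real.exp_pos (a * (t - t₀))
  unfold midN midA at *
  generalize Real.exp (a * (t - t₀)) = E at *
  generalize Real.exp (b * (t - t₀)) = F at *
  generalize hA' : (a - b) * X + (a * F - b * E) * (2 - X) = A at *
  generalize hN' : (a * E - b * F) * X + (a - b) * (E * F) * (2 - X) = N at *
  field_simp
  rw [← hA', ← hN']
  ring

theorem pt₁_mul_pt₂_mul_exp (ha : 0 < a) (hb : b < 0) (hT : t - t₀ ≠ 0) :
    pt₁ a b t₀ t * pt₂ a b t₀ t * Real.exp (qt₁ a b t₀ t - qt₂ a b t₀ t)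
      = -((a - b) ^ 2 * (Real.exp (a * (t - t₀)) * Real.exp (b * (t - t₀)))
        / (Real.exp (a * (t - t₀)) - Real.exp (b * (t - t₀))) ^ 2) := by
  have hE := Real.exp_pos (a * (t - t₀))
  have hF := Real.exp_pos (b * (t - t₀))
  have hef : Real.exp (a * (t - t₀)) - Real.exp (b * (t - t₀)) ≠ 0 :=
    sub_ne_zero.mpr fun h => hT (by
      have := Real.exp_injective h
      exact (mul_eq_zero.mp (by linarith : (a - b) * (t - t₀) = 0)).resolve_left (by linarith))
  have h1 : 0 < a - b := by linarith
  have hr : 0 < Real.exp (b * (t - t₀)) / Real.exp (a * (t - t₀)) := by positivity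
  have h2 : 0 < a * (Real.exp (b * (t - t₀)) / Real.exp (a * (t - t₀))) - b := by nlinarith
  have h3 : 0 < a - b * (Real.exp (b * (t - t₀)) / Real.exp (a * (t - t₀))) := by nlinarith
  have e1 : Real.exp (qt₁ a b t₀ t - qt₂ a b t₀ t)
      = (a - b) ^ 2 * Real.exp (b * (t - t₀)) / (Real.exp (a * (t - t₀))
        * (a * (Real.exp (b * (t - t₀)) / Real.exp (a * (t - t₀))) - b)
        * (a - b * (Real.exp (b * (t - t₀)) / Real.exp (a * (t - t₀))))) := by
    rw [qt₁, qt₂, exp_neg_gap_mul, Real.exp_sub, Real.exp_sub, Real.exp_add, Real.exp_add,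
      Real.exp_add, Real.exp_neg, Real.exp_log h1, Real.exp_log h2, Real.exp_log h3]
    generalize Real.exp (a * (t - t₀)) = E at *
    generalize Real.exp (b * (t - t₀)) = F at *
    field_simp
  rw [e1, pt₁, pt₂, exp_neg_gap_mul]
  generalize Real.exp (a * (t - t₀)) = E at *
  generalize Real.exp (b * (t - t₀)) = F at *
  have h4 : 1 - F / E ≠ 0 := by
    rw [one_sub_div hE.ne']; exact div_ne_zero hef hE.ne'
  have h5 := h2.ne'
  have h6 := h3.ne'
  have e5 : 1 - F / E = (E - F) / E := by field_simp
  have e6 : b - a * (F / E) = -(a * (F / E) - b) := by ring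
  rw [e6, e5]
  generalize a * (F / E) - b = p at *
  generalize a - b * (F / E) = q at *
  field_simp

/-- Between the peaks u_x² = u² - 4AB for u = A e^x + B e^{-x}, and AB is p̃₁ p̃₂ e^{q̃₁ - q̃₂}. -/
theorem hbarM_eq (ha : 0 < a) (hb : b < 0) (hX : X ∈ Icc (0 : ℝ) 2) (hT : t - t₀ ≠ 0)
    (h : Sfun c₁ c₂ t₀ ξ = X - 1) :
    hbarM c₁ c₂ t₀ a b t ξ = flowH a b (t - t₀) 0 X * dSfun c₁ c₂ t₀ ξ := by
  have h1 : flowYξ a b (t - t₀) X = midY a b (t - t₀) X := pw_mid hX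
  have h2 : flowU a b (t - t₀) X = midU a b (t - t₀) X := pw_mid hX
  rw [hbarM, UM_eq ha hb hX h, yξM_eq h, flowH_zero_eq ha hb hT, h1, slope, ← h2,
    flowU_eq ha hb hT, coefA, coefB, pw_mid hX, pw_mid hX, mul_assoc 4, mul_assoc 4,
    pt₁_mul_pt₂_mul_exp ha hb hT]
  have hy := (Real.exp_pos (flowY a b (t - t₀) X)).ne'
  have hef : Real.exp (a * (t - t₀)) - Real.exp (b * (t - t₀)) ≠ 0 :=
    sub_ne_zero.mpr fun h => hT (by
      have := Real.exp_injective h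
      exact (mul_eq_zero.mp (by linarith : (a - b) * (t - t₀) = 0)).resolve_left (by linarith))
  generalize Real.exp (a * (t - t₀)) = E at *
  generalize Real.exp (b * (t - t₀)) = F at *
  generalize Real.exp (flowY a b (t - t₀) X) = w at *
  field_simp
  ring

end midFormulas

section explicitFormulas

variable {c₁ c₂ t₀ α t : ℝ} {g g' : ℝ → ℝ}

theorem relabel_left (h₁ : 0 < c₁) (h₂ : c₂ < 0) (ht₀ : 0 < t₀) {a b : ℝ} (ha : 0 < a) (hb : b < 0)
    (hg₁ : ∀ ξ, flowY c₁ c₂ (-t₀) (g ξ) = ξ) (hg₂ : ∀ ξ, flowYξ c₁ c₂ (-t₀) (g ξ) * g' ξ = 1)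
    {ξ : ℝ} (hξ : ξ < q₁ c₁ c₂ t₀ 0) :
    flowY a b (t - t₀) (g ξ) = yL c₁ c₂ t₀ a b t ξ ∧
    flowU a b (t - t₀) (g ξ) = UL c₁ c₂ t₀ a b t ξ ∧
    flowYξ a b (t - t₀) (g ξ) * g' ξ = yξL c₁ c₂ t₀ a b t ξ ∧
    ∀ k, flowH a b (t - t₀) k (g ξ) * g' ξ = hbarL c₁ c₂ t₀ a b t ξ := by
  have hX : g ξ < 0 := by
    rw [q₁_eq h₁ h₂, zero_sub] at hξ
    rw [← (strictMono_flowY h₁ h₂ (neg_ne_zero.mpr ht₀.ne')).lt_iff_lt, hg₁]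
    exact hξ
  have hD := outD_pos (T := t₀) h₁ h₂ (exp_mem_Icc_of_nonpos hX.le)
  have hD' := outD_pos (T := -(t - t₀)) ha hb (exp_mem_Icc_of_nonpos hX.le)
  have he : Real.exp ξ = Real.exp (g ξ) / outD c₁ c₂ t₀ (Real.exp (g ξ)) := by
    conv_lhs => rw [← hg₁ ξ, exp_flowY_left h₁ h₂ hX, neg_neg]
  have hx : ξ = g ξ - Real.log (outD c₁ c₂ t₀ (Real.exp (g ξ))) := by
    conv_lhs => rw [← hg₁ ξ, flowY, pw_left hX, neg_neg]
  have hg' : g' ξ = outD c₁ c₂ t₀ (Real.exp (g ξ)) := by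
    have := hg₂ ξ
    rw [flowYξ, pw_left hX, neg_neg] at this
    exact (inv_mul_eq_one₀ hD.ne').mp this |>.symm
  obtain ⟨f1, f2, f3, f4⟩ := left_formulas (t := t) (by linarith) (by linarith) hD hD' he
  refine ⟨?_, ?_, ?_, fun k => ?_⟩
  · rw [f1, flowY, pw_left hX]; linarith
  · rw [f2, flowU, pw_left hX]
  · rw [f3, flowYξ, pw_left hX, hg']
  · rw [f4, flowH, pw_left hX, hg']

theorem relabel_right (h₁ : 0 < c₁) (h₂ : c₂ < 0) (ht₀ : 0 < t₀) {a b : ℝ} (ha : 0 < a)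
    (hb : b < 0) (hg₁ : ∀ ξ, flowY c₁ c₂ (-t₀) (g ξ) = ξ)
    (hg₂ : ∀ ξ, flowYξ c₁ c₂ (-t₀) (g ξ) * g' ξ = 1) {ξ : ℝ} (hξ : q₂ c₁ c₂ t₀ 0 < ξ) :
    flowY a b (t - t₀) (g ξ) = yR c₁ c₂ t₀ a b t ξ ∧
    flowU a b (t - t₀) (g ξ) = UR c₁ c₂ t₀ a b t ξ ∧
    flowYξ a b (t - t₀) (g ξ) * g' ξ = yξR c₁ c₂ t₀ a b t ξ ∧
    ∀ k, flowH a b (t - t₀) k (g ξ) * g' ξ = hbarR c₁ c₂ t₀ a b t ξ := by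
  have hX : 2 < g ξ := by
    rw [q₂_eq h₁ h₂, zero_sub] at hξ
    rw [← (strictMono_flowY h₁ h₂ (neg_ne_zero.mpr ht₀.ne')).lt_iff_lt, hg₁]
    exact hξ
  have hr := exp_mem_Icc_of_nonpos (sub_nonpos.mpr hX.le)
  have hD := outD_pos (T := -t₀) h₁ h₂ hr
  have hD' := outD_pos (T := t - t₀) ha hb hr
  have he : Real.exp (-ξ) = Real.exp (2 - g ξ) / outD c₁ c₂ (-t₀) (Real.exp (2 - g ξ)) := by
    conv_lhs => rw [← hg₁ ξ, Real.exp_neg, exp_flowY_right h₁ h₂ hX, inv_div]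
  have hx : ξ = g ξ - 2 + Real.log (outD c₁ c₂ (-t₀) (Real.exp (2 - g ξ))) := by
    conv_lhs => rw [← hg₁ ξ, flowY, pw_right hX]
  have hg' : g' ξ = outD c₁ c₂ (-t₀) (Real.exp (2 - g ξ)) := by
    have := hg₂ ξ
    rw [flowYξ, pw_right hX] at this
    exact (inv_mul_eq_one₀ hD.ne').mp this |>.symm
  obtain ⟨f1, f2, f3, f4⟩ := right_formulas (t := t) (by linarith) (by linarith) hD hD' he
  refine ⟨?_, ?_, ?_, fun k => ?_⟩
  · rw [f1, flowY, pw_right hX]; linarith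
  · rw [f2, flowU, pw_right hX]
  · rw [f3, flowYξ, pw_right hX, hg']
  · rw [f4, flowH, pw_right hX, hg']

theorem relabel_mid (h₁ : 0 < c₁) (h₂ : c₂ < 0) (ht₀ : 0 < t₀) (ht : t₀ < t) {a b : ℝ} (ha : 0 < a)
    (hb : b < 0) (hg₁ : ∀ ξ, flowY c₁ c₂ (-t₀) (g ξ) = ξ)
    (hg₂ : ∀ ξ, flowYξ c₁ c₂ (-t₀) (g ξ) * g' ξ = 1) {ξ : ℝ} (hξ₁ : q₁ c₁ c₂ t₀ 0 < ξ)
    (hξ₂ : ξ < q₂ c₁ c₂ t₀ 0) :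
    flowY a b (t - t₀) (g ξ) = yM c₁ c₂ t₀ a b t ξ ∧
    flowU a b (t - t₀) (g ξ) = UM c₁ c₂ t₀ a b t ξ ∧
    flowYξ a b (t - t₀) (g ξ) * g' ξ = yξM c₁ c₂ t₀ a b t ξ ∧
    ∀ k, flowH a b (t - t₀) k (g ξ) * g' ξ
      = hbarM c₁ c₂ t₀ a b t ξ + k * dSfun c₁ c₂ t₀ ξ := by
  have hX : g ξ ∈ Icc (0 : ℝ) 2 := by
    rw [← flowY_mem_Icc_iff h₁ h₂ (neg_ne_zero.mpr ht₀.ne'), hg₁]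
    rw [q₁_eq h₁ h₂, zero_sub] at hξ₁
    rw [q₂_eq h₁ h₂, zero_sub] at hξ₂
    exact ⟨hξ₁.le, hξ₂.le⟩
  have hA := (midA_pos (T := -t₀) h₁ h₂ hX).ne'
  have he : Real.exp ξ = midN c₁ c₂ (-t₀) (g ξ) / midA c₁ c₂ (-t₀) (g ξ) := by
    conv_lhs => rw [← hg₁ ξ, exp_flowY_mid h₁ h₂ hX]
  have hS := Sfun_eq h₁ h₂ ht₀ he hA
  have hg' : g' ξ = dSfun c₁ c₂ t₀ ξ := by
    have := hg₂ ξ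
    rw [flowYξ, pw_mid hX] at this
    rw [dSfun_eq h₁ h₂ ht₀ he hA]
    exact eq_inv_of_mul_eq_one_right this
  refine ⟨?_, ?_, ?_, fun k => ?_⟩
  · rw [yM_eq ha hb hX hS, flowY, pw_mid hX]
  · rw [UM_eq ha hb hX hS, flowU, pw_mid hX]
  · rw [yξM_eq hS, flowYξ, pw_mid hX, hg']
  · rw [hbarM_eq ha hb hX (by linarith) hS, flowH_sub, pw_mid hX, hg']; ring

theorem hasExplicitFormulas (h₁ : 0 < c₁) (h₂ : c₂ < 0) (ht₀ : 0 < t₀) (hα : α < 1) (ht : t₀ < t)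
    (hg₁ : ∀ ξ, flowY c₁ c₂ (0 - t₀) (g ξ) = ξ)
    (hg₂ : ∀ ξ, flowYξ c₁ c₂ (0 - t₀) (g ξ) * g' ξ = 1) {Θ : LagrangianState}
    (hy : Θ.y = (peakonSolution c₁ c₂ t₀ α g g' t).y)
    (hU : Θ.U = (peakonSolution c₁ c₂ t₀ α g g' t).U)
    (h : ∀ᵐ ξ, Θ.EqAt (peakonSolution c₁ c₂ t₀ α g g' t) ξ) :
    HasExplicitFormulas c₁ c₂ t₀ α t Θ := by
  have ha := d₁_pos h₁ h₂ hα
  have hb := d₂_neg h₁ h₂ hα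
  simp only [zero_sub] at hg₁ hg₂
  have hs : peakonSolution c₁ c₂ t₀ α g g' t = (flowState (d₁ c₁ c₂ α) (d₂ c₁ c₂ α) (t - t₀)
      (-2 * α * (c₁ * c₂))).relabel g g' := by
    rw [peakonSolution, peakonFlow_nonneg (sub_nonneg.mpr ht.le)]
  rw [hs] at hy hU
  simp only [hs] at h
  have hl : ∀ {ξ}, ξ < q₁ c₁ c₂ t₀ 0 → _ := fun hξ => relabel_left (t := t) h₁ h₂ ht₀ ha hb hg₁ hg₂ hξ
  have hr : ∀ {ξ}, q₂ c₁ c₂ t₀ 0 < ξ → _ :=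
    fun hξ => relabel_right (t := t) h₁ h₂ ht₀ ha hb hg₁ hg₂ hξ
  have hm : ∀ {ξ}, q₁ c₁ c₂ t₀ 0 < ξ → ξ < q₂ c₁ c₂ t₀ 0 → _ :=
    fun hξ hξ' => relabel_mid h₁ h₂ ht₀ ht ha hb hg₁ hg₂ hξ hξ'
  refine ⟨fun ξ hξ => ?_, fun ξ hξ hξ' => ?_, fun ξ hξ => ?_, ?_, ?_, ?_⟩
  · rw [hy, hU]
    exact ⟨(hl hξ).1, (hl hξ).2.1⟩
  · rw [hy, hU]
    exact ⟨(hm hξ hξ').1, (hm hξ hξ').2.1⟩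
  · rw [hy, hU]
    exact ⟨(hr hξ).1, (hr hξ).2.1⟩
  · filter_upwards [h] with ξ e hξ
    rw [e.yξ, e.hbar, e.h]
    exact ⟨(hl hξ).2.2.1, (hl hξ).2.2.2 _, (hl hξ).2.2.2 _⟩
  · filter_upwards [h] with ξ e hξ hξ'
    obtain ⟨-, -, f3, f4⟩ := hm hξ hξ'
    rw [e.yξ, e.hbar, e.h]
    refine ⟨f3, (f4 0).trans (by ring), (f4 _).trans (by ring)⟩
  · filter_upwards [h] with ξ e hξ
    rw [e.yξ, e.hbar, e.h]
    exact ⟨(hr hξ).2.2.1, (hr hξ).2.2.2 _, (hr hξ).2.2.2 _⟩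

end explicitFormulas

end CamassaHolm

end

theorem mainTheorem1 (c₁ c₂ t₀ α : ℝ) (hc₁ : 0 < c₁) (hc₂ : c₂ < 0) (ht₀ : 0 < t₀)
    (hα₀ : 0 ≤ α) (hα₁ : α < 1) :
    -- the Eulerian α-dissipative solution exists, is unique, and is the explicit one
    (∀ D : ℝ → EulerianState,
      (IsAlphaDissipativeSolution α D ∧ D 0 = initialData c₁ c₂ t₀) ↔
        (∀ t, 0 ≤ t → D t = explicitSolution c₁ c₂ t₀ α t)) ∧
    -- the parameters after breaking
    d₂ c₁ c₂ α < 0 ∧ 0 < d₁ c₁ c₂ α ∧ d₁ c₁ c₂ α + d₂ c₁ c₂ α = c₁ + c₂ ∧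
    (∀ t, t₀ < t → qt₁ (d₁ c₁ c₂ α) (d₂ c₁ c₂ α) t₀ t < qt₂ (d₁ c₁ c₂ α) (d₂ c₁ c₂ α) t₀ t) ∧
    -- the energy before and after breaking
    (∀ t, t < t₀ →
      Integrable (fun x => uSol c₁ c₂ t₀ α t x ^ 2 + deriv (uSol c₁ c₂ t₀ α t) x ^ 2) volume ∧
      ∫ x, (uSol c₁ c₂ t₀ α t x ^ 2 + deriv (uSol c₁ c₂ t₀ α t) x ^ 2)
        = 2 * c₁ ^ 2 + 2 * c₂ ^ 2) ∧
    (∀ t, t₀ < t →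
      Integrable (fun x => uSol c₁ c₂ t₀ α t x ^ 2 + deriv (uSol c₁ c₂ t₀ α t) x ^ 2) volume ∧
      ∫ x, (uSol c₁ c₂ t₀ α t x ^ 2 + deriv (uSol c₁ c₂ t₀ α t) x ^ 2)
        = 2 * d₁ c₁ c₂ α ^ 2 + 2 * d₂ c₁ c₂ α ^ 2) ∧
    2 * d₁ c₁ c₂ α ^ 2 + 2 * d₂ c₁ c₂ α ^ 2 = 2 * c₁ ^ 2 + 2 * c₂ ^ 2 + 4 * α * c₁ * c₂ ∧
    -- the slope of `u` after breaking
    (∀ t, t₀ < t → ∀ x, x ≠ qt₁ (d₁ c₁ c₂ α) (d₂ c₁ c₂ α) t₀ t →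
      x ≠ qt₂ (d₁ c₁ c₂ α) (d₂ c₁ c₂ α) t₀ t →
      DifferentiableAt ℝ (uSol c₁ c₂ t₀ α t) x ∧
      deriv (uSol c₁ c₂ t₀ α t) x ^ 2 = twoPeakonSlopeSq
        (pt₁ (d₁ c₁ c₂ α) (d₂ c₁ c₂ α) t₀ t) (pt₂ (d₁ c₁ c₂ α) (d₂ c₁ c₂ α) t₀ t)
        (qt₁ (d₁ c₁ c₂ α) (d₂ c₁ c₂ α) t₀ t) (qt₂ (d₁ c₁ c₂ α) (d₂ c₁ c₂ α) t₀ t) x) ∧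
    -- the extra density of `ν` after breaking
    (∀ t, t₀ < t →
      (∀ x ∈ midInterval c₁ c₂ t₀ α t,
        0 ≤ nuMDensity c₁ c₂ α (d₁ c₁ c₂ α) (d₂ c₁ c₂ α) t₀ t x) ∧
      IntegrableOn (nuMDensity c₁ c₂ α (d₁ c₁ c₂ α) (d₂ c₁ c₂ α) t₀ t)
        (midInterval c₁ c₂ t₀ α t) volume ∧
      ∫ x in midInterval c₁ c₂ t₀ α t, nuMDensity c₁ c₂ α (d₁ c₁ c₂ α) (d₂ c₁ c₂ α) t₀ t x
        = -4 * α * c₁ * c₂) ∧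
    -- the Lagrangian solution with initial characteristic `y(0, ξ) = ξ`
    (∃ Θ : ℝ → LagrangianState, IsAlphaDissipativeLagrangian α Θ ∧
      (∀ ξ, (Θ 0).y ξ = ξ) ∧ IsEulerianImage (Θ 0) (initialData c₁ c₂ t₀)) ∧
    (∀ Θ : ℝ → LagrangianState, IsAlphaDissipativeLagrangian α Θ →
      (∀ ξ, (Θ 0).y ξ = ξ) → IsEulerianImage (Θ 0) (initialData c₁ c₂ t₀) →
      (∀ t, 0 ≤ t → IsEulerianImage (Θ t) (explicitSolution c₁ c₂ t₀ α t)) ∧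
      -- wave breaking takes place exactly once, at time `t₀` and at the origin
      (∀ᵐ ξ, ∀ t, 0 ≤ t →
        ((Θ t).yξ ξ = 0 ↔ t = t₀ ∧ ξ ∈ Set.Icc (q₁ c₁ c₂ t₀ 0) (q₂ c₁ c₂ t₀ 0))) ∧
      (∀ ξ, (Θ t₀).y ξ = 0 ↔ ξ ∈ Set.Icc (q₁ c₁ c₂ t₀ 0) (q₂ c₁ c₂ t₀ 0)) ∧
      -- at breaking time `y + H̄` is a relabeling function
      (fun ξ => (Θ t₀).y ξ + ∫ η in Set.Iic ξ, (Θ t₀).hbar η) ∈ relabelingGroup ∧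
      (∀ t, t₀ < t → HasExplicitFormulas c₁ c₂ t₀ α t (Θ t))) := by
  refine ⟨isAlphaDissipativeSolution_iff hc₁ hc₂ ht₀ hα₀ hα₁, d₂_neg hc₁ hc₂ hα₁, d₁_pos hc₁ hc₂ hα₁,
    d₁_add_d₂, fun t ht => qt₁_lt_qt₂ hc₁ hc₂ hα₁ ht, fun t ht => energy_before hc₁ hc₂ ht,
    fun t ht => energy_after hc₁ hc₂ hα₁ ht, energy_loss hc₁ hc₂ hα₁,
    fun t ht x hx₁ hx₂ => slope_after hc₁ hc₂ hα₁ ht hx₁ hx₂,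
    fun t ht => nuMDensity_spec hc₁ hc₂ hα₀ hα₁ ht,
    exists_identity_solution hc₁ hc₂ ht₀ hα₀ hα₁, fun Θ H hy hD => ?_⟩
  -- The relabeling is the inverse of the initial characteristics; one choice of it serves all the
  -- remaining claims.
  obtain ⟨g, g', hg, hg₁, hg₂⟩ := exists_labels_id hc₁ hc₂ (T := 0 - t₀) (by linarith)
  have h := ae_eqAt_peakonSolution hc₁ hc₂ ht₀ hα₀ hα₁ hg hg₁ H hy hD
  have HΦ := isAlphaDissipativeLagrangian_peakonSolution (t₀ := t₀) hc₁ hc₂ hα₀ hα₁ hg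
  obtain ⟨s1, s2, s3, s4⟩ := identity_solution_spec hc₁ hc₂ ht₀ hα₀ hα₁ hg hg₁ H h
  refine ⟨s1, s2, s3, s4, fun t ht => ?_⟩
  have ht' : 0 ≤ t := (ht₀.trans ht).le
  have heq : ∀ᵐ ξ, (Θ t).EqAt (peakonSolution c₁ c₂ t₀ α g g' t) ξ :=
    h.mono fun ξ hξ => hξ t ht'
  obtain ⟨hy', hU'⟩ := (H.memF t ht').eq_of_ae_eqAt (HΦ.memF t ht') heq
  exact hasExplicitFormulas hc₁ hc₂ ht₀ hα₁ ht hg₁ hg₂ hy' hU' heq
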